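/- Let $n\ge 1$ and write points of $\mathbb{R}^{n+1}$ as $Z=(z,t)$ with $z\in\mathbb{R}^n$, $t\in\mathbb{R}$, dual variables $(\zeta,\tau)$, $D_{z_j}=-i\partial_{z_j}$, $D_t=-i\partial_t$, $\langle Z\rangle=(1+|z|^2+t^2)^{1/2}$. For $s,r\in\mathbb{R}$ let $E_{s,r}=\langle Z\rangle^{r}\,\mathrm{Op}\big((1+|\zeta|^4+\tau^2)^{s/4}\big)$, where $\mathrm{Op}$ denotes the Fourier multiplier, and let $$H^{s,r}_{\mathrm{par}}=\{u\in\mathcal S'(\mathbb{R}^{n+1}) : E_{s,r}u\in L^2(\mathbb{R}^{n+1})\},\qquad \|u\|_{H^{s,r}_{\mathrm{par}}}=\|E_{s,r}u\|_{L^2}.$$ For $c\in\mathbb{R}$ consider the generators $$\mathrm{Id},\quad D_{z_j},\quad D_t,\quad z_iD_{z_j}-z_jD_{z_i},\quad tD_{z_j}-\tfrac{c}{2}z_j,\quad 2tD_t+z\cdot D_z ,$$ and let $D_t$ and $2tD_t+z\cdot D_z$ have (parabolic) order $2$, $\mathrm{Id}$ order $0$, and the other generators order $1$. With $A_1,\dots,A_N$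 the generators other than $\mathrm{Id}$ in a fixed order, the order of the monomial $\mathbf A^\alpha=A_1^{\alpha_1}\cdots A_N^{\alpha_N}$ is the sum of the orders of its factors. For $k\in\mathbb{N}$ let $H^{s,r;k}_{c}$ be the space of all tempered distributions $u$ such that $\mathbf A^\alpha u\in H^{s,r}_{\mathrm{par}}$ for all monomials of order at most $k$, with $$\|u\|_{H^{s,r;k}_c}^2=\sum_{\mathrm{ord}(\mathbf A^\alpha)\le k}\|\mathbf A^\alpha u\|_{H^{s,r}_{\mathrm{par}}}^2 .$$ Let $k\in\mathbb{N}$ with $k>\max(n/2+2,3)$. (1) Let $s\ge 0$, $r_1,r_2\in\mathbb{R}$ and $c_1,c_2\in\mathbb{R}\setminus\{0\}$. There is a constant $C$ such that for all $u_1\in H^{s,r_1;k}_{c_1}$ and $u_2\in H^{s,r_2;k}_{c_2}$ the distributions $u_1,u_2$ are locally integrable functions, their pointwise product is a tempered distribution in $H^{s,r_1+r_2+(n+1)/2;k}_{c_1+c_2}$, and $$\|u_1u_2\|_{H^{s,r_1+r_2+(n+1)/2;k}_{c_1+c_2}}\le C\,\|u_1\|_{H^{s,r_1;k}_{c_1}}\|u_2\|_{H^{s,r_2;k}_{c_2}}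 .$$ (2) Let $p\ge1$ be an odd integer and $\varepsilon\in\mathbb{R}$ (of either sign). There is a constant $C$ such that for every $u\in H^{1/2,-1/2+\varepsilon;k}_{1}$ the function $|u|^{p-1}u$ is a tempered distribution in $H^{1/2,-1/2+(p-1)n/2+p\varepsilon;k}_{1}$, and $$\big\||u|^{p-1}u\big\|_{H^{1/2,-1/2+(p-1)n/2+p\varepsilon;k}_{1}}\le C\,\|u\|_{H^{1/2,-1/2+\varepsilon;k}_{1}}^{p}.$$ (3) Let $p\ge1$ be an odd integer and $\varepsilon\ge-n/2$. Let $N$ be a polynomial with complex coefficients in $u$, $\bar u$ and the spatial derivatives $D_{z_j}u$, $D_{z_j}\bar u$ ($1\le j\le n$), all of whose monomials have degree at least $p$, and which satisfies $N[e^{i\theta}u]=e^{i\theta}N[u]$ for all $\theta\in\mathbb{R}$. Then for every $u\in H^{3/2,-1/2+\varepsilon;k}_{1}$ the distributions $u$ and $D_{z_j}u$ are functions, and $N[u]$ is a tempered distribution in $H^{1/2,-1/2+(p-1)n/2+p\varepsilon;k}_{1}$. -/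

import Mathlib

open MeasureTheory LineDeriv TemperedDistribution Function
open scoped SchwartzMap ENNReal NNReal ComplexConjugate

noncomputable section

namespace NLSMult

/-- Spacetime `ℝ^{n+1}` with its Euclidean norm and Lebesgue measure. The first `n` coordinates are
the space variables `z`, the last one is the time variable `t`. The same space is used for the dual
variables `(ζ, τ)`. -/
abbrev Spacetime (n : ℕ) : Type := EuclideanSpace ℝ (Fin (n + 1))

/-- Complex-valued tempered distributions on spacetime. -/
abbrev Dist (n : ℕ) : Type := 𝓢'(Spacetime n, ℂ)

/-! ### Elementary operators on tempered distributions -/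

/-- The operator `D_a = -i ∂_a` in the coordinate direction `a`. -/
def opD {n : ℕ} (a : Fin (n + 1)) : Dist n →L[ℂ] Dist n :=
  (-Complex.I) • lineDerivOpCLM ℂ (Dist n) (EuclideanSpace.single a (1 : ℝ))

/-- Multiplication by the coordinate function `Z ↦ Z_a`. -/
def opX {n : ℕ} (a : Fin (n + 1)) : Dist n →L[ℂ] Dist n :=
  smulLeftCLM ℂ (fun Z : Spacetime n => ((Z a : ℝ) : ℂ))

/-- `D_{z_j}`. -/
abbrev opDz {n : ℕ} (j : Fin n) : Dist n →L[ℂ] Dist n := opD j.castSucc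

/-- `D_t`. -/
abbrev opDt {n : ℕ} : Dist n →L[ℂ] Dist n := opD (Fin.last n)

/-- Multiplication by `z_j`. -/
abbrev opZ {n : ℕ} (j : Fin n) : Dist n →L[ℂ] Dist n := opX j.castSucc

/-- Multiplication by `t`. -/
abbrev opT {n : ℕ} : Dist n →L[ℂ] Dist n := opX (Fin.last n)

/-! ### Parabolic weighted Sobolev spaces -/

/-- `1 + |ζ|⁴ + τ²`, evaluated at `(ζ, τ) = 2π ξ`. Mathlib's Fourier transform has the kernel
`exp (-2π i ⟨x, ξ⟩)`, so that `D_a` becomes multiplication by `2π ξ_a`. -/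
def parabolicBracket {n : ℕ} (ξ : Spacetime n) : ℝ :=
  1 + (∑ j : Fin n, (2 * Real.pi * ξ j.castSucc) ^ 2) ^ 2 + (2 * Real.pi * ξ (Fin.last n)) ^ 2

/-- The real powers of `1 + |ζ|⁴ + τ²` are smooth with polynomially bounded derivatives, so that
they are legitimate Fourier multipliers. -/
theorem hasTemperateGrowth_parabolicBracket {n : ℕ} (r : ℝ) :
    (fun ξ : Spacetime n => ((parabolicBracket ξ ^ r : ℝ) : ℂ)).HasTemperateGrowth := by
  have hc : ∀ a : Fin (n + 1), (fun ξ : Spacetime n => ξ a).HasTemperateGrowth := fun a =>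
    (EuclideanSpace.proj (𝕜 := ℝ) a : Spacetime n →L[ℝ] ℝ).hasTemperateGrowth
  have h1 : (fun ξ : Spacetime n =>
      ∑ j : Fin n, (2 * Real.pi * ξ j.castSucc) ^ 2).HasTemperateGrowth := by
    refine HasTemperateGrowth.sum (f := fun (j : Fin n) (ξ : Spacetime n) =>
      (2 * Real.pi * ξ j.castSucc) ^ 2) (fun j _ => ?_)
    exact ((HasTemperateGrowth.const (2 * Real.pi)).mul (hc j.castSucc)).pow 2
  have h2 : (fun ξ : Spacetime n => 2 * Real.pi * ξ (Fin.last n)).HasTemperateGrowth :=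
    (HasTemperateGrowth.const (2 * Real.pi)).mul (hc (Fin.last n))
  have h3 : (fun ξ : Spacetime n =>
      (∑ j : Fin n, (2 * Real.pi * ξ j.castSucc) ^ 2) • EuclideanSpace.single (0 : Fin 2) (1 : ℝ)
        + (2 * Real.pi * ξ (Fin.last n)) •
          EuclideanSpace.single (1 : Fin 2) (1 : ℝ)).HasTemperateGrowth :=
    (h1.smul (HasTemperateGrowth.const _)).add (h2.smul (HasTemperateGrowth.const _))
  have h4 := (hasTemperateGrowth_one_add_norm_sq_rpow (EuclideanSpace ℝ (Fin 2)) r).comp h3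
  have h5 := Complex.hasTemperateGrowth_ofReal.comp h4
  have h6 : (fun ξ : Spacetime n => ((parabolicBracket ξ ^ r : ℝ) : ℂ)) =
      Complex.ofReal ∘ (fun x : EuclideanSpace ℝ (Fin 2) => (1 + ‖x‖ ^ 2) ^ r) ∘
        fun ξ : Spacetime n =>
          (∑ j : Fin n, (2 * Real.pi * ξ j.castSucc) ^ 2) •
              EuclideanSpace.single (0 : Fin 2) (1 : ℝ)
            + (2 * Real.pi * ξ (Fin.last n)) • EuclideanSpace.single (1 : Fin 2) (1 : ℝ) := by
    funext ξ
    simp [parabolicBracket, EuclideanSpace.norm_sq_eq, Fin.sum_univ_two, add_assoc]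
  rw [h6]
  exact h5

/-- The operator `⟨Z⟩^l Op((1 + |ζ|⁴ + τ²)^{s/4})`, an invertible elliptic operator of parabolic
regularity order `s` and spacetime order `l`, where `⟨Z⟩ = (1 + |z|² + t²)^{1/2}`. -/
def parOp {n : ℕ} (s l : ℝ) : Dist n →L[ℂ] Dist n :=
  smulLeftCLM ℂ (fun Z : Spacetime n => (((1 + ‖Z‖ ^ 2) ^ (l / 2) : ℝ) : ℂ)) ∘L
    fourierMultiplierCLM ℂ (fun ξ : Spacetime n => ((parabolicBracket ξ ^ (s / 4) : ℝ) : ℂ))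

/-- Membership in the weighted parabolic Sobolev space `H_par^{s,l}(ℝ^{n+1})`. -/
def MemPar {n : ℕ} (s l : ℝ) (u : Dist n) : Prop :=
  ∃ g : Lp ℂ 2 (volume : Measure (Spacetime n)), parOp s l u = (g : Dist n)

/-- The norm of `H_par^{s,l}`: the `L²` norm of `parOp s l u`, and `∞` outside of the space. -/
def parNorm {n : ℕ} (s l : ℝ) (u : Dist n) : ℝ≥0∞ :=
  ⨅ (g : Lp ℂ 2 (volume : Measure (Spacetime n))) (_ : parOp s l u = (g : Dist n)), ‖g‖ₑ

/-! ### Module regularity -/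

/-- Labels of the generators, other than the identity. -/
inductive Gen (n : ℕ) : Type
  | Dz (j : Fin n)
  | Dt
  | rot (i j : Fin n)
  | gal (j : Fin n)
  | scal

/-- The generators of the module with parameter `c`:
`D_{z_j}`, `D_t`, `z_i D_{z_j} - z_j D_{z_i}`, `t D_{z_j} - c z_j / 2`, `2 t D_t + z · D_z`. -/
def genOp {n : ℕ} (c : ℝ) : Gen n → (Dist n →L[ℂ] Dist n)
  | .Dz j => opDz j
  | .Dt => opDt
  | .rot i j => opZ i ∘L opDz j - opZ j ∘L opDz i
  | .gal j => opT ∘L opDz j - ((c / 2 : ℝ) : ℂ) • opZ j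
  | .scal => (2 : ℂ) • (opT ∘L opDt) + ∑ j : Fin n, opZ j ∘L opDz j

/-- The parabolic regularity order of a generator. -/
def Gen.order {n : ℕ} : Gen n → ℕ
  | .Dz _ => 1
  | .Dt => 2
  | .rot _ _ => 1
  | .gal _ => 1
  | .scal => 2

/-- All generators other than the identity, in a fixed order. -/
def gens (n : ℕ) : List (Gen n) :=
  (List.finRange n).map Gen.Dz ++ [Gen.Dt] ++
    (List.finRange n ×ˢ List.finRange n).map (fun x => Gen.rot x.1 x.2) ++
    (List.finRange n).map Gen.gal ++ [Gen.scal]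

/-- A multi-index: one exponent for every entry of the list of generators. -/
abbrev MultiIndex (n : ℕ) : Type := Fin (gens n).length → ℕ

/-- The parabolic regularity order of the monomial with exponent `α`. -/
def MultiIndex.order {n : ℕ} (α : MultiIndex n) : ℕ :=
  ∑ i, α i * ((gens n).get i).order

/-- The ordered monomial `A_1^{α_1} ⋯ A_N^{α_N}` in the generators with parameter `c`. -/
def monomialOp {n : ℕ} (c : ℝ) (α : MultiIndex n) : Dist n →L[ℂ] Dist n :=
  (List.ofFn fun i => genOp c ((gens n).get i) ^ α i).prod

/-- The multi-indices of monomials of parabolic regularity order at most `k`. As every generator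
has regularity order at least `1` and spacetime order at most `1`, these are exactly the monomials
with `|α| ≤ k` whose orders are at most `(k, k)`. -/
def admissible (n k : ℕ) : Finset (MultiIndex n) :=
  (Fintype.piFinset fun _ => Finset.range (k + 1)).filter fun α => α.order ≤ k

/-- Every multi-index of order at most `k` belongs to `admissible n k`. -/
theorem mem_admissible {n k : ℕ} (α : MultiIndex n) : α ∈ admissible n k ↔ α.order ≤ k := by
  simp only [admissible, Finset.mem_filter, Fintype.mem_piFinset, Finset.mem_range,
    and_iff_right_iff_imp]
  intro h i
  have h1 : α i * ((gens n).get i).order ≤ α.order :=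
    Finset.single_le_sum (f := fun i => α i * ((gens n).get i).order)
      (fun _ _ => Nat.zero_le _) (Finset.mem_univ i)
  have h2 : 1 ≤ ((gens n).get i).order := by
    cases (gens n).get i <;> simp [Gen.order]
  nlinarith

/-- Membership in the module regularity space of order `k` over `H_par^{s,l}`, with respect to the
module with parameter `c`. -/
def MemMod {n : ℕ} (s l : ℝ) (k : ℕ) (c : ℝ) (u : Dist n) : Prop :=
  ∀ α ∈ admissible n k, MemPar s l (monomialOp c α u)

/-- The norm of the module regularity space (`∞` outside of the space). -/
def modNorm {n : ℕ} (s l : ℝ) (k : ℕ) (c : ℝ) (u : Dist n) : ℝ≥0∞ :=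
  (∑ α ∈ admissible n k, parNorm s l (monomialOp c α u) ^ 2) ^ (1 / 2 : ℝ)

/-! ### Products and nonlinear expressions -/

/-- The tempered distribution `u` is the function `f`: all the integrals `∫ φ f` converge
absolutely and `u φ = ∫ φ f`. Such an `f` is locally integrable, and unique up to null sets. -/
def IsFun {n : ℕ} (u : Dist n) (f : Spacetime n → ℂ) : Prop :=
  ∀ φ : 𝓢(Spacetime n, ℂ), Integrable (fun Z => φ Z * f Z) ∧ u φ = ∫ Z, φ Z * f Z

/-- `w = u₁ u₂`: the distributions `u₁`, `u₂` and `w` are functions, and `w` is the pointwise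
product of `u₁` and `u₂`. -/
def IsMul {n : ℕ} (u₁ u₂ w : Dist n) : Prop :=
  ∃ f₁ f₂ : Spacetime n → ℂ, IsFun u₁ f₁ ∧ IsFun u₂ f₂ ∧ IsFun w (fun Z => f₁ Z * f₂ Z)

/-- `w = |u|^{p-1} u`, for functions `u` and `w`. -/
def IsPower {n : ℕ} (p : ℕ) (u w : Dist n) : Prop :=
  ∃ f : Spacetime n → ℂ, IsFun u f ∧ IsFun w (fun Z => ((‖f Z‖ ^ (p - 1) : ℝ) : ℂ) * f Z)

/-- Polynomials in `u`, `D_{z_j} u`, `ū`, `D_{z_j} ū`. The variables `inl none`, `inl (some j)`,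
`inr none` and `inr (some j)` stand for `u`, `D_{z_j} u`, `ū` and `D_{z_j} ū`. -/
abbrev Nonlinearity (n : ℕ) : Type := MvPolynomial (Option (Fin n) ⊕ Option (Fin n)) ℂ

/-- The values of the variables at a point where `u` has the value `a none` and `D_{z_j} u` has the
value `a (some j)`; the sign comes from `D_{z_j} ū = -conj (D_{z_j} u)`. -/
def jetVal {n : ℕ} (a : Option (Fin n) → ℂ) : Option (Fin n) ⊕ Option (Fin n) → ℂ
  | .inl o => a o
  | .inr none => conj (a none)
  | .inr (some j) => -conj (a (some j))

/-- The value of the nonlinearity `N` at a point where `u` and `D_{z_j} u` have the values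
`a none` and `a (some j)`. -/
def Nonlinearity.val {n : ℕ} (N : Nonlinearity n) (a : Option (Fin n) → ℂ) : ℂ :=
  MvPolynomial.eval (jetVal a) N

/-- `N[e^{iθ} u] = e^{iθ} N[u]`. As `u` and its first derivatives can have arbitrary values at a
point, this is a condition on the values of `N`. -/
def Nonlinearity.PhaseInvariant {n : ℕ} (N : Nonlinearity n) : Prop :=
  ∀ (θ : ℝ) (a : Option (Fin n) → ℂ),
    N.val (fun o => Complex.exp (θ * Complex.I) * a o) = Complex.exp (θ * Complex.I) * N.val a

/-- `w = N[u]`: the distributions `u`, `D_{z_j} u` and `w` are functions, and `w` is obtained by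
inserting these functions into `N` pointwise. -/
def Nonlinearity.IsValue {n : ℕ} (N : Nonlinearity n) (u w : Dist n) : Prop :=
  ∃ a : Option (Fin n) → Spacetime n → ℂ,
    IsFun u (a none) ∧ (∀ j, IsFun (opDz j u) (a (some j))) ∧
      IsFun w (fun Z => N.val (fun o => a o Z))

end NLSMult

end

/-!
The product estimate rests on the fact that the generators describe, after a change of variables,
conormal regularity on small anisotropic boxes. The quadratic oscillation attached to the parameter
`c` is removed, and functions are written in the lens coordinates `(y, τ) ↦ (y cosh τ, sinh τ)`
(`lens`, `lensF`). There the derivatives in `y` are combinations of translations and Galilei boosts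
(`fderiv_lensF_space`), and since `c ≠ 0` also multiplication by `y` costs only one order
(`coord_mul_lensF`, `jb_mul_maj_le`). The parameters add under multiplication, so products obey a
Leibniz rule (`Gs_mulS`, `Ws_mulS_mem`). Around each point there is a box of scale `δ = 1 / ⟨y⟩`,
which is contracted by `δ²` in the direction of `y` and in time (`boxL`, `det_boxL`), such that
derivatives of order `l` in the variables of the box are words in the generators of order at most
`l`, with a gain (`BoxCl.fderiv`, `BoxCl.norm_le`). As `k > max (n / 2 + 2, 3)`, an anisotropic
Sobolev estimate bounds products in each box by words of total order `k` in the factors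
(`wn_mulS_le_sob`). The volume element `(cosh τ)^{n + 1}` of the lens
coordinates accounts for the additional decay `(n + 1) / 2` in `cosh τ`; the gain accounts for that
in `⟨y⟩`, and compensates the volumes of the boxes (`lw_mul_dl_le`, `wn_mulS_le`).

For the regularity `s`, the estimate is tested against a third function, with the symbol
`p = 1 + |ζ|⁴ + τ²` raised to the power `M z` on the product and `-M z` on the factors. On the lines
`Re z = 0` and `Re z = 1` Leibniz' rule for the differential operator `p^M` reduces it to `s = 0`
(`line_bound`). The form is the integral of `(p(ξ) / (p(η) p(ξ - η)))^{M z}` against an integrable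
function, where the quotient is bounded, and the three lines theorem gives the powers in between
(`norm_expInt_le_of_lines`, `wn_Mu_mulS_le`, `wordBd_mulS`). This uses that multipliers of order
zero are bounded on weighted `L²` spaces, which follows for integer weights from commutators, and
for the others by duality and real interpolation (`PB.muBdd`).

The norms involve ordered monomials only. They control all words by the argument of the
Poincaré-Birkhoff-Witt theorem, because the commutators of the generators have lower order
(`weyl_dist`, `word_mem_span`). The estimates are extended from Schwartz functions to distributions
by a regularization that preserves module regularity, and weak limits (`exists_approx`,
`exists_wordBd_mul`).

Conjugation changes the sign of `c` (`genIn_cjD`). A product of `b + 1` factors with parameter `1`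
and `b` factors with parameter `-1` is estimated by multiplying the factors in this order, so that
the parameters of the partial products never vanish (`rep_charged_prod`); this contains `|u|^{2b} u`.
For a phase invariant nonlinearity, averaging over the phase leaves only monomials of this kind
(`Nonlinearity.PhaseInvariant.val_eq`), and for `ε ≥ -n/2` the monomials of higher degree decay at
least as much as those of degree `p`.
-/

noncomputable section

open scoped ContDiff

namespace NLSMult

open FourierTransform

/-! ### Weighted `L²` norms -/

/-- Complex-valued Schwartz functions on spacetime. -/
abbrev Sch (n : ℕ) : Type := 𝓢(Spacetime n, ℂ)

/-- The weight `⟨Z⟩^r`, as a complex-valued function. -/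
def bracket {n : ℕ} (r : ℝ) (Z : Spacetime n) : ℂ := (((1 + ‖Z‖ ^ 2) ^ (r / 2) : ℝ) : ℂ)

variable {n : ℕ}

theorem hasTemperateGrowth_bracket (r : ℝ) :
    (bracket r : Spacetime n → ℂ).HasTemperateGrowth :=
  Complex.hasTemperateGrowth_ofReal.comp
    (hasTemperateGrowth_one_add_norm_sq_rpow (Spacetime n) (r / 2))

theorem bracket_mul (r r' : ℝ) (Z : Spacetime n) :
    bracket r Z * bracket r' Z = bracket (r + r') Z := by
  simp only [bracket]
  rw [← Complex.ofReal_mul, ← Real.rpow_add (by positivity)]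
  congr 2
  ring

theorem bracket_zero (Z : Spacetime n) : bracket 0 Z = 1 := by simp [bracket]

theorem norm_bracket (r : ℝ) (Z : Spacetime n) : ‖bracket r Z‖ = (1 + ‖Z‖ ^ 2) ^ (r / 2) := by
  rw [bracket, Complex.norm_real, Real.norm_of_nonneg (by positivity)]

theorem norm_bracket_sq (r : ℝ) (Z : Spacetime n) : ‖bracket r Z‖ ^ 2 = (1 + ‖Z‖ ^ 2) ^ r := by
  rw [norm_bracket, ← Real.rpow_natCast, ← Real.rpow_mul (by positivity)]
  congr 1
  push_cast
  ring

theorem conj_bracket (r : ℝ) (Z : Spacetime n) : conj (bracket r Z) = bracket r Z := by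
  simp [bracket]

/-- Multiplication of Schwartz functions by `⟨Z⟩^r`. -/
def wt (r : ℝ) : Sch n →L[ℂ] Sch n := SchwartzMap.smulLeftCLM ℂ (bracket r)

theorem wt_apply (r : ℝ) (f : Sch n) (Z : Spacetime n) : wt r f Z = bracket r Z * f Z := by
  simp [wt, SchwartzMap.smulLeftCLM_apply_apply (hasTemperateGrowth_bracket r)]

@[simp]
theorem wt_wt (r r' : ℝ) (f : Sch n) : wt r (wt r' f) = wt (r + r') f := by
  ext Z
  rw [wt_apply, wt_apply, wt_apply, ← mul_assoc, bracket_mul]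

@[simp]
theorem wt_zero (f : Sch n) : wt 0 f = f := by
  ext Z
  rw [wt_apply, bracket_zero, one_mul]

/-- The norm of `⟨Z⟩^r f` in `L²`. -/
def wn (r : ℝ) (f : Sch n) : ℝ := ‖(wt r f).toLp 2 volume‖

theorem wn_nonneg (r : ℝ) (f : Sch n) : 0 ≤ wn r f := norm_nonneg _

theorem wn_eq (r : ℝ) (f : Sch n) : wn r f = ‖SchwartzMap.toLpCLM ℂ ℂ 2 volume (wt r f)‖ := rfl

theorem wn_add_le (r : ℝ) (f g : Sch n) : wn r (f + g) ≤ wn r f + wn r g := by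
  simp only [wn_eq, map_add]
  exact norm_add_le _ _

theorem wn_smul (r : ℝ) (c : ℂ) (f : Sch n) : wn r (c • f) = ‖c‖ * wn r f := by
  simp only [wn_eq, map_smul, norm_smul]

theorem wn_zero (r : ℝ) : wn r (0 : Sch n) = 0 := by rw [wn_eq, map_zero, map_zero, norm_zero]

theorem wn_wt (r r' : ℝ) (f : Sch n) : wn r (wt r' f) = wn (r + r') f := by
  simp [wn]

theorem norm_toLp_sq (f : Sch n) : ‖f.toLp 2 volume‖ ^ 2 = ∫ x, ‖f x‖ ^ 2 := by
  have h := SchwartzMap.inner_toL2_toL2_eq f f volume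
  rw [inner_self_eq_norm_sq_to_K] at h
  have h2 : ∀ x, inner ℂ (f x) (f x) = ((‖f x‖ ^ 2 : ℝ) : ℂ) := fun x => by
    rw [inner_self_eq_norm_sq_to_K]; simp
  simp only [h2, integral_complex_ofReal] at h
  apply Complex.ofReal_injective
  rw [← h]
  push_cast
  rfl

theorem integrable_norm_sq (f : Sch n) : Integrable (fun x => ‖f x‖ ^ 2) :=
  (f.memLp 2 volume).integrable_norm_pow (by norm_num)

theorem wn_sq (r : ℝ) (f : Sch n) : wn r f ^ 2 = ∫ x, (1 + ‖x‖ ^ 2) ^ r * ‖f x‖ ^ 2 := by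
  rw [wn, norm_toLp_sq]
  congr 1
  ext x
  rw [wt_apply, norm_mul, mul_pow, norm_bracket_sq]

theorem integrable_wn (r : ℝ) (f : Sch n) :
    Integrable (fun x : Spacetime n => (1 + ‖x‖ ^ 2) ^ r * ‖f x‖ ^ 2) := by
  refine (integrable_norm_sq (wt r f)).congr (Filter.Eventually.of_forall fun x => ?_)
  simp only
  rw [wt_apply, norm_mul, mul_pow, norm_bracket_sq]

/-- Pointwise domination controls the weighted norms. -/
theorem wn_le_of_norm_le {r r' : ℝ} {f g : Sch n} {C : ℝ} (hC : 0 ≤ C)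
    (h : ∀ x, ‖bracket r x * g x‖ ≤ C * ‖bracket r' x * f x‖) : wn r g ≤ C * wn r' f := by
  refine abs_le_of_sq_le_sq' ?_ (mul_nonneg hC (wn_nonneg _ _)) |>.2
  rw [mul_pow, wn, wn, norm_toLp_sq, norm_toLp_sq, ← integral_const_mul]
  refine integral_mono (integrable_norm_sq _) ((integrable_norm_sq _).const_mul _) fun x => ?_
  have := h x
  rw [wt_apply, wt_apply, ← mul_pow]
  gcongr

theorem wn_mono {r r' : ℝ} (h : r ≤ r') (f : Sch n) : wn r f ≤ wn r' f := by
  have := wn_le_of_norm_le (r := r) (r' := r') (f := f) (g := f) zero_le_one fun x => ?_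
  · simpa using this
  · rw [one_mul, norm_mul, norm_mul, norm_bracket, norm_bracket]
    gcongr
    nlinarith [sq_nonneg ‖x‖]

theorem wn_le_of_forall_norm_le {r : ℝ} {f g : Sch n} {C : ℝ} (hC : 0 ≤ C)
    (h : ∀ x, ‖g x‖ ≤ C * ‖f x‖) : wn r g ≤ C * wn r f := by
  refine wn_le_of_norm_le hC fun x => ?_
  rw [norm_mul, norm_mul, mul_left_comm]
  gcongr
  exact h x

/-- Complex conjugation of Schwartz functions. -/
def cj : Sch n →L[ℝ] Sch n := SchwartzMap.postcompCLM (𝕜 := ℝ) Complex.conjCLE.toContinuousLinearMap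

@[simp]
theorem cj_apply (f : Sch n) (x : Spacetime n) : cj f x = conj (f x) := by
  simp [cj, SchwartzMap.postcompCLM_apply]

theorem wn_cj (r : ℝ) (f : Sch n) : wn r (cj f) = wn r f := by
  apply le_antisymm
  · simpa using wn_le_of_forall_norm_le (r := r) (f := f) (g := cj f) zero_le_one fun x => by simp
  · simpa using wn_le_of_forall_norm_le (r := r) (f := cj f) (g := f) zero_le_one fun x => by simp

/-- The product of two Schwartz functions. -/
def mulS (f g : Sch n) : Sch n := SchwartzMap.pairing (ContinuousLinearMap.mul ℂ ℂ) f g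

@[simp]
theorem mulS_apply (f g : Sch n) (x : Spacetime n) : mulS f g x = f x * g x := by
  simp [mulS, SchwartzMap.pairing_apply_apply]

theorem integral_mul_eq_inner (f g : Sch n) :
    ∫ x, f x * g x = inner ℂ ((cj f).toLp 2 volume) (g.toLp 2 volume) := by
  refine Eq.trans ?_ (SchwartzMap.inner_toL2_toL2_eq (cj f) g volume).symm
  congr 1
  ext x
  simp [mul_comm]

/-- Cauchy–Schwarz for the duality between the weights `r` and `-r`. -/
theorem norm_integral_mul_le (r : ℝ) (f g : Sch n) :
    ‖∫ x, f x * g x‖ ≤ wn r f * wn (-r) g := by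
  have : ∫ x, f x * g x = ∫ x, wt r f x * wt (-r) g x := by
    congr 1; ext x
    rw [wt_apply, wt_apply, mul_mul_mul_comm, bracket_mul, add_neg_cancel, bracket_zero, one_mul]
  rw [this, integral_mul_eq_inner]
  refine (norm_inner_le_norm _ _).trans ?_
  have h := wn_cj 0 (wt r f)
  simp only [wn, wt_zero] at h
  rw [h, wn, wn]

theorem wn_le_of_dual {r K : ℝ} (hK : 0 ≤ K) {f : Sch n}
    (h : ∀ φ : Sch n, ‖∫ x, φ x * f x‖ ≤ K * wn (-r) φ) : wn r f ≤ K := by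
  -- The extremal test function is `⟨x⟩^{2r}` times the conjugate of `f`.
  have h1 := h (cj (wt (2 * r) f))
  have h2 : ∫ x, cj (wt (2 * r) f) x * f x = ((wn r f ^ 2 : ℝ) : ℂ) := by
    rw [wn_sq, ← integral_complex_ofReal]
    congr 1; ext x
    rw [cj_apply, wt_apply, map_mul, conj_bracket, mul_assoc, ← Complex.normSq_eq_conj_mul_self,
      Complex.normSq_eq_norm_sq, bracket]
    push_cast
    congr 3
    ring
  rw [h2, wn_cj, wn_wt, Complex.norm_real, Real.norm_of_nonneg (by positivity),
    show -r + 2 * r = r by ring, sq] at h1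
  rcases (wn_nonneg r f).eq_or_lt with h0 | h0
  · rw [← h0]; exact hK
  · exact le_of_mul_le_mul_right h1 h0

/-! ### Weighted `L²` bounds of distributions -/

/-- The distribution `u` has norm at most `K` in `⟨Z⟩^{-r} L²`, expressed by duality. -/
def Bd (r : ℝ) (u : Dist n) (K : ℝ) : Prop := 0 ≤ K ∧ ∀ φ : Sch n, ‖u φ‖ ≤ K * wn (-r) φ

/-- Schwartz functions as tempered distributions. -/
abbrev toD : Sch n →L[ℂ] Dist n := SchwartzMap.toTemperedDistributionCLM (Spacetime n) ℂ volume

theorem toD_apply (f φ : Sch n) : toD f φ = ∫ x, φ x * f x := by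
  simp [toD, SchwartzMap.toTemperedDistributionCLM_apply_apply]

theorem bd_toD_iff {r K : ℝ} {f : Sch n} : Bd r (toD f) K ↔ wn r f ≤ K := by
  constructor
  · rintro ⟨h0, h⟩
    exact wn_le_of_dual h0 fun φ => by simpa [toD_apply] using h φ
  · intro h
    refine ⟨(wn_nonneg _ _).trans h, fun φ => ?_⟩
    rw [toD_apply]
    refine (norm_integral_mul_le (-r) φ f).trans ?_
    rw [neg_neg, mul_comm]
    exact mul_le_mul_of_nonneg_right h (wn_nonneg _ _)

theorem Bd.mono {r K K' : ℝ} {u : Dist n} (h : Bd r u K) (hK : K ≤ K') : Bd r u K' :=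
  ⟨h.1.trans hK, fun φ => (h.2 φ).trans (mul_le_mul_of_nonneg_right hK (wn_nonneg _ _))⟩

theorem Bd.weight_mono {r r' K : ℝ} {u : Dist n} (h : Bd r u K) (hr : r' ≤ r) : Bd r' u K :=
  ⟨h.1, fun φ => (h.2 φ).trans (mul_le_mul_of_nonneg_left (wn_mono (by linarith) φ) h.1)⟩

theorem Bd.add {r K K' : ℝ} {u v : Dist n} (h : Bd r u K) (h' : Bd r v K') :
    Bd r (u + v) (K + K') := by
  refine ⟨add_nonneg h.1 h'.1, fun φ => ?_⟩
  change ‖u φ + v φ‖ ≤ _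
  rw [add_mul]
  exact (norm_add_le _ _).trans (add_le_add (h.2 φ) (h'.2 φ))

theorem Bd.smul {r K : ℝ} {u : Dist n} (h : Bd r u K) (c : ℂ) : Bd r (c • u) (‖c‖ * K) := by
  refine ⟨mul_nonneg (norm_nonneg _) h.1, fun φ => ?_⟩
  change ‖c • u φ‖ ≤ _
  rw [norm_smul, mul_assoc]
  exact mul_le_mul_of_nonneg_left (h.2 φ) (norm_nonneg _)

theorem Bd.zero (r : ℝ) : Bd r (0 : Dist n) 0 :=
  ⟨le_rfl, fun φ => by change ‖(0 : ℂ)‖ ≤ _; simp⟩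

/-- An operator whose transpose is `T` inherits the bounds of `T` on Schwartz functions. -/
theorem Bd.of_transpose {r K C : ℝ} {u v : Dist n} {T : Sch n → Sch n} (hC : 0 ≤ C)
    (hv : ∀ φ, v φ = u (T φ)) (hT : ∀ φ, wn (-r) (T φ) ≤ C * wn (-r) φ) (h : Bd r u K) :
    Bd r v (C * K) := by
  refine ⟨mul_nonneg hC h.1, fun φ => ?_⟩
  rw [hv, mul_comm C, mul_assoc]
  exact (h.2 _).trans (mul_le_mul_of_nonneg_left (hT φ) h.1)

/-- The bound is stable under weak limits. -/
theorem Bd.of_tendsto {ι : Type*} {l : Filter ι} [l.NeBot] {r K : ℝ} {u : Dist n}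
    {v : ι → Dist n} (hv : ∀ i, Bd r (v i) K)
    (h : ∀ φ, Filter.Tendsto (fun i => v i φ) l (nhds (u φ))) : Bd r u K := by
  obtain ⟨i⟩ := l.nonempty_of_neBot
  exact ⟨(hv i).1, fun φ => le_of_tendsto (h φ).norm (Filter.Eventually.of_forall fun j =>
    (hv j).2 φ)⟩

/-- Riesz representation: a bounded distribution is a weighted `L²` function. -/
theorem Bd.exists_Lp {r K : ℝ} {u : Dist n} (h : Bd r u K) :
    ∃ g : Lp ℂ 2 (volume : Measure (Spacetime n)), ‖g‖ ≤ K ∧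
      u = smulLeftCLM ℂ (bracket (-r)) (g : Dist n) := by
  have hd : DenseRange (SchwartzMap.toLpCLM ℂ ℂ 2 (volume : Measure (Spacetime n))).toLinearMap :=
    SchwartzMap.denseRange_toLpCLM (E := Spacetime n) (F := ℂ) (p := 2) (by norm_num)
  -- The functional `φ ↦ u (⟨x⟩^r φ)` is bounded for the `L²` norm and extends by density.
  let L : Sch n →ₗ[ℂ] ℂ :=
    { toFun := fun φ => u (wt r φ)
      map_add' := fun a b => by simp
      map_smul' := fun a b => by simp }
  have hL : ∀ φ, ‖L φ‖ ≤ K * ‖(SchwartzMap.toLpCLM ℂ ℂ 2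
      (volume : Measure (Spacetime n))).toLinearMap φ‖ := fun φ => by
    have := h.2 (wt r φ)
    rw [wn_wt, neg_add_cancel, wn, wt_zero] at this
    exact this
  let M := L.extendOfNorm
    (SchwartzMap.toLpCLM ℂ ℂ 2 (volume : Measure (Spacetime n))).toLinearMap
  have hM : ∀ φ, M (φ.toLp 2 volume) = L φ := LinearMap.extendOfNorm_eq hd ⟨K, hL⟩
  have hMn : ‖M‖ ≤ K := LinearMap.opNorm_extendOfNorm_le hd h.1 hL
  let g₀ : Lp ℂ 2 (volume : Measure (Spacetime n)) := (InnerProductSpace.toDual ℂ _).symm M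
  have hg₀ : ‖g₀‖ = ‖M‖ := LinearIsometryEquiv.norm_map _ _
  -- Distributions act bilinearly, so the representing function is the conjugate of `g₀`.
  have hstar : MemLp (fun x => conj (g₀ x)) 2 (volume : Measure (Spacetime n)) :=
    (Lp.memLp g₀).star
  refine ⟨hstar.toLp _, ?_, ?_⟩
  · have : eLpNorm (fun x => conj (g₀ x)) 2 volume = eLpNorm g₀ 2 volume :=
      eLpNorm_conj (g₀ : Spacetime n → ℂ) 2 volume
    rw [Lp.norm_toLp, this, ← Lp.norm_def, hg₀]
    exact hMn
  · ext φ
    have h1 : u φ = M ((wt (-r) φ).toLp 2 volume) := by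
      rw [hM]
      simp [L]
    have h2 : M ((wt (-r) φ).toLp 2 volume) = inner ℂ g₀ ((wt (-r) φ).toLp 2 volume) := by
      rw [InnerProductSpace.toDual_symm_apply]
    rw [h1, h2, L2.inner_def, smulLeftCLM_apply_apply, Lp.toTemperedDistribution_apply]
    refine integral_congr_ae ?_
    filter_upwards [hstar.coeFn_toLp, (wt (-r) φ).coeFn_toLp 2 volume] with x hx hx'
    rw [hx, hx']
    simp [wt]

/-! ### Fourier multipliers on Schwartz functions -/

/-- The Fourier multiplier with symbol `m` on Schwartz functions. -/
def Mu (m : Spacetime n → ℂ) : Sch n →L[ℂ] Sch n := SchwartzMap.fourierMultiplierCLM ℂ m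

/-- Multiplication of Schwartz functions by the coordinate `a`. -/
def XS (a : Fin (n + 1)) : Sch n →L[ℂ] Sch n :=
  SchwartzMap.smulLeftCLM ℂ (fun Z : Spacetime n => ((Z a : ℝ) : ℂ))

/-- The coordinate unit vector `a`. -/
abbrev ev (a : Fin (n + 1)) : Spacetime n := EuclideanSpace.single a (1 : ℝ)

theorem inner_ev (a : Fin (n + 1)) (Z : Spacetime n) : inner ℝ Z (ev a) = Z a := by
  rw [PiLp.inner_apply]
  simp [ev]

theorem hasTemperateGrowth_coord (a : Fin (n + 1)) :
    (fun Z : Spacetime n => ((Z a : ℝ) : ℂ)).HasTemperateGrowth :=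
  Complex.hasTemperateGrowth_ofReal.comp
    (EuclideanSpace.proj (𝕜 := ℝ) a : Spacetime n →L[ℝ] ℝ).hasTemperateGrowth

theorem XS_apply (a : Fin (n + 1)) (f : Sch n) (Z : Spacetime n) : XS a f Z = (Z a : ℂ) * f Z := by
  simp [XS, SchwartzMap.smulLeftCLM_apply_apply (hasTemperateGrowth_coord a)]

theorem Mu_eq (m : Spacetime n → ℂ) (f : Sch n) :
    Mu m f = 𝓕⁻ (SchwartzMap.smulLeftCLM ℂ m (𝓕 f)) := by
  rw [Mu, SchwartzMap.fourierMultiplierCLM_apply]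

theorem fourier_Mu {m : Spacetime n → ℂ} (hm : m.HasTemperateGrowth) (f : Sch n)
    (ξ : Spacetime n) : (𝓕 (Mu m f) : Sch n) ξ = m ξ * (𝓕 f : Sch n) ξ := by
  rw [Mu_eq, fourier_fourierInv_eq (E := Sch n), SchwartzMap.smulLeftCLM_apply_apply hm, smul_eq_mul]

theorem sch_ext_fourier {f g : Sch n} (h : ∀ ξ, (𝓕 f : Sch n) ξ = (𝓕 g : Sch n) ξ) : f = g := by
  have : (𝓕 f : Sch n) = 𝓕 g := SchwartzMap.ext h
  rw [← fourierInv_fourier_eq (F := Sch n) f, this, fourierInv_fourier_eq]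

theorem Mu_Mu {m m' : Spacetime n → ℂ} (hm : m.HasTemperateGrowth) (hm' : m'.HasTemperateGrowth)
    (f : Sch n) : Mu m (Mu m' f) = Mu (fun ξ => m ξ * m' ξ) f := by
  refine sch_ext_fourier fun ξ => ?_
  rw [fourier_Mu hm, fourier_Mu hm', fourier_Mu (m := fun ξ => m ξ * m' ξ) (hm.mul hm'), mul_assoc]

theorem Mu_one (f : Sch n) : Mu (fun _ => 1) f = f := by
  refine sch_ext_fourier fun ξ => ?_
  rw [fourier_Mu (by fun_prop), one_mul]

theorem hasTemperateGrowth_comp_neg {m : Spacetime n → ℂ} (hm : m.HasTemperateGrowth) :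
    (fun ξ => m (-ξ)).HasTemperateGrowth :=
  hm.comp (LinearIsometryEquiv.neg ℝ (E := Spacetime n)).toContinuousLinearEquiv.hasTemperateGrowth

/-- The transpose of a Fourier multiplier is the multiplier with the reflected symbol. -/
theorem fourier_smul_fourierInv {m : Spacetime n → ℂ} (hm : m.HasTemperateGrowth) (φ : Sch n) :
    𝓕 (SchwartzMap.smulLeftCLM ℂ m (𝓕⁻ φ)) = Mu (fun ξ => m (-ξ)) φ := by
  have key : ∀ (g : Sch n) (x : Spacetime n), (𝓕⁻ g : Sch n) x = (𝓕 g : Sch n) (-x) := by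
    intro g x
    rw [SchwartzMap.fourierInv_apply_eq]
    simp
  have h1 : ⇑(SchwartzMap.smulLeftCLM ℂ m (𝓕⁻ φ)) = (SchwartzMap.smulLeftCLM ℂ
      (fun ξ => m (-ξ)) (𝓕 φ) : Sch n) ∘ LinearIsometryEquiv.neg ℝ (E := Spacetime n) := by
    ext y
    rw [SchwartzMap.smulLeftCLM_apply_apply hm, key]
    simp [SchwartzMap.smulLeftCLM_apply_apply (hasTemperateGrowth_comp_neg hm)]
  ext x
  rw [Mu_eq, key, SchwartzMap.fourier_coe, SchwartzMap.fourier_coe, h1,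
    Real.fourier_comp_linearIsometry]
  simp

theorem mult_apply {m : Spacetime n → ℂ} (hm : m.HasTemperateGrowth) (u : Dist n) (φ : Sch n) :
    fourierMultiplierCLM ℂ m u φ = u (Mu (fun ξ => m (-ξ)) φ) := by
  rw [fourierMultiplierCLM_apply_apply, fourier_smul_fourierInv hm]

theorem mult_toD {m : Spacetime n → ℂ} (hm : m.HasTemperateGrowth) (f : Sch n) :
    fourierMultiplierCLM ℂ m (toD f) = toD (Mu m f) :=
  fourierMultiplierCLM_toTemperedDistributionCLM_eq hm f

theorem integral_Mu {m : Spacetime n → ℂ} (hm : m.HasTemperateGrowth) (f g : Sch n) :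
    ∫ x, g x * Mu m f x = ∫ x, Mu (fun ξ => m (-ξ)) g x * f x := by
  rw [← toD_apply, ← toD_apply, ← mult_toD hm, mult_apply hm]

/-- Plancherel: a bounded symbol is bounded on the unweighted space. -/
theorem norm_toLp_Mu_le {m : Spacetime n → ℂ} (hm : m.HasTemperateGrowth) {C : ℝ} (hC : 0 ≤ C)
    (h : ∀ ξ, ‖m ξ‖ ≤ C) (f : Sch n) : wn 0 (Mu m f) ≤ C * wn 0 f := by
  have h1 : ∀ g : Sch n, wn 0 g = wn 0 (𝓕 g : Sch n) := fun g => by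
    simp [wn, SchwartzMap.norm_fourier_toL2_eq]
  rw [h1, h1 f]
  refine wn_le_of_forall_norm_le hC fun ξ => ?_
  rw [fourier_Mu hm, norm_mul]
  gcongr
  exact h ξ

/-- Commuting a multiplier with a coordinate differentiates the symbol. -/
theorem XS_Mu {m m' : Spacetime n → ℂ} (hm : m.HasTemperateGrowth) (hm' : m'.HasTemperateGrowth)
    (a : Fin (n + 1)) (hd : ∀ ξ, fderiv ℝ m ξ (ev a) = m' ξ) (f : Sch n) :
    XS a (Mu m f) = Mu m (XS a f) + (Complex.I / (2 * Real.pi)) • Mu m' f := by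
  have hinner : (fun Z : Spacetime n => ((inner ℝ Z (ev a) : ℝ))) = fun Z => Z a := by
    ext Z; exact inner_ev a Z
  have hX : ∀ g : Sch n, SchwartzMap.smulLeftCLM ℂ (inner ℝ · (ev a)) g = XS a g := by
    intro g
    rw [hinner]
    ext Z
    have := SchwartzMap.smulLeftCLM_apply_apply
      (EuclideanSpace.proj (𝕜 := ℝ) a : Spacetime n →L[ℝ] ℝ).hasTemperateGrowth g Z
    rw [XS_apply]
    refine Eq.trans this ?_
    simp
  have hpi : (2 * Real.pi * Complex.I : ℂ) ≠ 0 := by simp [Real.pi_ne_zero]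
  -- On the Fourier side `x_a` is `i / 2π` times the derivative, and `h2` is the product rule.
  have h1 : ∀ g : Sch n, XS a (𝓕⁻ g) = (Complex.I / (2 * Real.pi)) • 𝓕⁻ (∂_{ev a} g) := by
    intro g
    rw [SchwartzMap.fourierInv_lineDerivOp_eq, hX, smul_smul]
    have : Complex.I / (2 * Real.pi) * -(2 * Real.pi * Complex.I) = 1 := by
      have : (Real.pi : ℂ) ≠ 0 := by simp [Real.pi_ne_zero]
      field_simp
      simp
    rw [this, one_smul]
  have h2 : ∂_{ev a} (SchwartzMap.smulLeftCLM ℂ m (𝓕 f)) =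
      SchwartzMap.smulLeftCLM ℂ m' (𝓕 f) + SchwartzMap.smulLeftCLM ℂ m (∂_{ev a} (𝓕 f)) := by
    ext ξ
    have hfun : ⇑(SchwartzMap.smulLeftCLM ℂ m (𝓕 f)) = fun ξ => m ξ * (𝓕 f : Sch n) ξ := by
      ext ξ; rw [SchwartzMap.smulLeftCLM_apply_apply hm, smul_eq_mul]
    rw [SchwartzMap.lineDerivOp_apply_eq_fderiv, hfun, add_apply,
      SchwartzMap.smulLeftCLM_apply_apply hm, SchwartzMap.smulLeftCLM_apply_apply hm',
      SchwartzMap.lineDerivOp_apply_eq_fderiv,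
      fderiv_fun_mul (hm.1.differentiable (by simp) ξ) (SchwartzMap.differentiableAt _), ← hd]
    simp
    ring
  rw [Mu_eq, Mu_eq, Mu_eq, h1, h2, fourierInv_add, smul_add, add_comm,
    SchwartzMap.lineDerivOp_fourier_eq, hX]
  congr 1
  rw [FourierTransform.fourier_smul, map_smul, FourierTransform.fourierInv_smul, smul_smul]
  have : Complex.I / (2 * Real.pi) * -(2 * Real.pi * Complex.I) = 1 := by
    have : (Real.pi : ℂ) ≠ 0 := by simp [Real.pi_ne_zero]
    field_simp
    simp
  rw [this, one_smul]

variable {Θ : Type*} {G : Θ → ℝ}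

/-! ### Families of symbols with bounded derivatives -/

/-- A family `m θ` of smooth functions all of whose derivatives are bounded, the bounds being
polynomial in the gauge `G θ`. -/
def PB (G : Θ → ℝ) (m : Θ → Spacetime n → ℂ) : Prop :=
  (∀ θ, ContDiff ℝ ∞ (m θ)) ∧ ∀ l : ℕ, ∃ (C : ℝ) (N : ℕ), 0 ≤ C ∧
    ∀ θ ξ, ‖iteratedFDeriv ℝ l (m θ) ξ‖ ≤ C * G θ ^ N

theorem PB.temperate {m : Θ → Spacetime n → ℂ} (h : PB G m) (θ : Θ) :
    (m θ).HasTemperateGrowth := by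
  refine ⟨h.1 θ, fun l => ?_⟩
  obtain ⟨C, N, -, hC⟩ := h.2 l
  exact ⟨0, C * G θ ^ N, fun x => by simpa using hC θ x⟩

theorem PB.bound {m : Θ → Spacetime n → ℂ} (h : PB G m) :
    ∃ (C : ℝ) (N : ℕ), 0 ≤ C ∧ ∀ θ ξ, ‖m θ ξ‖ ≤ C * G θ ^ N := by
  obtain ⟨C, N, h0, hC⟩ := h.2 0
  exact ⟨C, N, h0, fun θ x => by simpa using hC θ x⟩

theorem PB.const (c : ℂ) : PB (n := n) G fun _ _ => c := by
  refine ⟨fun θ => contDiff_const, fun l => ⟨‖c‖, 0, norm_nonneg _, fun θ ξ => ?_⟩⟩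
  rcases l with _ | l
  · simp
  · rw [iteratedFDeriv_const_of_ne (by omega)]
    simp

theorem exists_common_bound (hG : ∀ θ, 1 ≤ G θ) {C C' : ℝ} (hC : 0 ≤ C) (hC' : 0 ≤ C') (N N' : ℕ)
    (θ : Θ) : C * G θ ^ N ≤ (C + C') * G θ ^ (N + N') ∧
      C' * G θ ^ N' ≤ (C + C') * G θ ^ (N + N') := by
  have h1 : G θ ^ N ≤ G θ ^ (N + N') := pow_le_pow_right₀ (hG θ) (by omega)
  have h2 : G θ ^ N' ≤ G θ ^ (N + N') := pow_le_pow_right₀ (hG θ) (by omega)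
  have := pow_nonneg (zero_le_one.trans (hG θ)) N
  have := pow_nonneg (zero_le_one.trans (hG θ)) N'
  constructor <;> nlinarith

theorem PB.add (hG : ∀ θ, 1 ≤ G θ) {m m' : Θ → Spacetime n → ℂ} (h : PB G m) (h' : PB G m') :
    PB G fun θ ξ => m θ ξ + m' θ ξ := by
  refine ⟨fun θ => (h.1 θ).add (h'.1 θ), fun l => ?_⟩
  obtain ⟨C, N, h0, hC⟩ := h.2 l
  obtain ⟨C', N', h0', hC'⟩ := h'.2 l
  refine ⟨C + C' + (C + C'), N + N', by positivity, fun θ ξ => ?_⟩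
  rw [fun_iteratedFDeriv_add_apply ((h.1 θ).contDiffAt.of_le (by exact_mod_cast le_top))
    ((h'.1 θ).contDiffAt.of_le (by exact_mod_cast le_top)), add_mul]
  have := exists_common_bound hG h0 h0' N N' θ
  exact (norm_add_le _ _).trans (add_le_add ((hC θ ξ).trans this.1) ((hC' θ ξ).trans this.2))

/-- By the Leibniz formula. -/
theorem PB.mul (hG : ∀ θ, 1 ≤ G θ) {m m' : Θ → Spacetime n → ℂ} (h : PB G m) (h' : PB G m') :
    PB G fun θ ξ => m θ ξ * m' θ ξ := by
  refine ⟨fun θ => (h.1 θ).mul (h'.1 θ), fun l => ?_⟩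
  choose C N h0 hC using h.2
  choose C' N' h0' hC' using h'.2
  have hG0 : ∀ θ, 0 ≤ G θ := fun θ => zero_le_one.trans (hG θ)
  refine ⟨∑ i ∈ Finset.range (l + 1), (l.choose i) * C i * C' (l - i),
    ∑ i ∈ Finset.range (l + 1), (N i + N' (l - i)),
    Finset.sum_nonneg fun i _ => mul_nonneg (mul_nonneg (by positivity) (h0 _)) (h0' _),
    fun θ ξ => ?_⟩
  refine (norm_iteratedFDeriv_mul_le (N := ∞) (h.1 θ) (h'.1 θ) ξ (n := l)
    (by exact_mod_cast le_top)).trans ?_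
  rw [Finset.sum_mul]
  refine Finset.sum_le_sum fun i hi => ?_
  calc _ ≤ (l.choose i : ℝ) * (C i * G θ ^ N i) * (C' (l - i) * G θ ^ N' (l - i)) := by
        have h1 := mul_nonneg (h0 i) (pow_nonneg (hG0 θ) (N i))
        have h2 := hC i θ ξ
        have h3 := hC' (l - i) θ ξ
        gcongr
    _ = (l.choose i) * C i * C' (l - i) * G θ ^ (N i + N' (l - i)) := by ring
    _ ≤ _ := by
        have h1 := mul_nonneg (mul_nonneg (Nat.cast_nonneg (α := ℝ) (l.choose i)) (h0 i))
          (h0' (l - i))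
        refine mul_le_mul_of_nonneg_left (pow_le_pow_right₀ (hG θ) ?_) h1
        exact Finset.single_le_sum (f := fun i => N i + N' (l - i)) (fun _ _ => Nat.zero_le _) hi

/-- The derivative of a family of functions in a coordinate direction. -/
def pd (a : Fin (n + 1)) (m : Θ → Spacetime n → ℂ) (θ : Θ) (ξ : Spacetime n) : ℂ :=
  fderiv ℝ (m θ) ξ (ev a)

theorem pb_pd {m : Θ → Spacetime n → ℂ} (h : PB G m) (a : Fin (n + 1)) : PB G (pd a m) := by
  have h1 : ∀ θ, ContDiff ℝ ∞ (fderiv ℝ (m θ)) := fun θ => (h.1 θ).fderiv_right (by simp)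
  refine ⟨fun θ => (h1 θ).clm_apply contDiff_const, fun l => ?_⟩
  obtain ⟨C, N, h0, hC⟩ := h.2 (l + 1)
  refine ⟨C, N, h0, fun θ ξ => ?_⟩
  have h2 := norm_iteratedFDeriv_clm_apply_const (f := fderiv ℝ (m θ)) (c := ev a) (x := ξ)
    (n := l) (N := ∞) (h1 θ).contDiffAt (by exact_mod_cast le_top)
  refine h2.trans ?_
  rw [norm_iteratedFDeriv_fderiv]
  simpa using hC θ ξ

theorem PB.comp_neg {m : Θ → Spacetime n → ℂ} (h : PB G m) : PB G fun θ ξ => m θ (-ξ) := by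
  refine ⟨fun θ => (h.1 θ).comp contDiff_neg, fun l => ?_⟩
  obtain ⟨C, N, h0, hC⟩ := h.2 l
  refine ⟨C, N, h0, fun θ ξ => ?_⟩
  have := (LinearIsometryEquiv.neg ℝ (E := Spacetime n)).norm_iteratedFDeriv_comp_right (𝕜 := ℝ)
    (m θ) ξ l
  exact this.le.trans (hC θ _)

/-- If an algebra of bounded families is generated by a set whose first derivatives stay in the
algebra, then all derivatives of its members are bounded. -/
theorem PB.of_adjoin (hG : ∀ θ, 1 ≤ G θ) (S : Set (Θ → Spacetime n → ℂ))
    (hb : ∀ m ∈ S, ∃ (C : ℝ) (N : ℕ), 0 ≤ C ∧ ∀ θ ξ, ‖m θ ξ‖ ≤ C * G θ ^ N)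
    (hd : ∀ m ∈ S, ∀ θ, Differentiable ℝ (m θ))
    (hS : ∀ m ∈ S, ∀ a, pd a m ∈ Algebra.adjoin ℂ S) :
    ∀ m ∈ Algebra.adjoin ℂ S, PB G m := by
  have hG0 : ∀ θ, 0 ≤ G θ := fun θ => zero_le_one.trans (hG θ)
  have hb' : ∀ m ∈ Algebra.adjoin ℂ S, ∃ (C : ℝ) (N : ℕ), 0 ≤ C ∧
      ∀ θ ξ, ‖m θ ξ‖ ≤ C * G θ ^ N := by
    intro m hm
    induction hm using Algebra.adjoin_induction with
    | mem m hm => exact hb m hm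
    | algebraMap c => exact ⟨‖c‖, 0, norm_nonneg _, fun θ ξ => by simp⟩
    | add m m' _ _ h h' =>
      obtain ⟨C, N, h0, hC⟩ := h
      obtain ⟨C', N', h0', hC'⟩ := h'
      refine ⟨C + C' + (C + C'), N + N', by positivity, fun θ ξ => ?_⟩
      have := exists_common_bound hG h0 h0' N N' θ
      rw [add_mul]
      exact (norm_add_le _ _).trans (add_le_add ((hC θ ξ).trans this.1) ((hC' θ ξ).trans this.2))
    | mul m m' _ _ h h' =>
      obtain ⟨C, N, h0, hC⟩ := h
      obtain ⟨C', N', h0', hC'⟩ := h'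
      refine ⟨C * C', N + N', by positivity, fun θ ξ => ?_⟩
      change ‖m θ ξ * m' θ ξ‖ ≤ _
      rw [norm_mul, pow_add, mul_mul_mul_comm]
      exact mul_le_mul (hC θ ξ) (hC' θ ξ) (norm_nonneg _) ((norm_nonneg _).trans (hC θ ξ))
  have hd' : ∀ m ∈ Algebra.adjoin ℂ S, (∀ θ, Differentiable ℝ (m θ)) ∧
      ∀ a, pd a m ∈ Algebra.adjoin ℂ S := by
    intro m hm
    induction hm using Algebra.adjoin_induction with
    | mem m hm => exact ⟨hd m hm, hS m hm⟩
    | algebraMap c =>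
      refine ⟨fun θ => differentiable_const c, fun a => ?_⟩
      convert Subalgebra.zero_mem _ using 1
      ext θ ξ
      change fderiv ℝ (fun _ => c) ξ (ev a) = 0
      simp
    | add m m' _ _ h h' =>
      refine ⟨fun θ => (h.1 θ).add (h'.1 θ), fun a => ?_⟩
      convert Subalgebra.add_mem _ (h.2 a) (h'.2 a) using 1
      ext θ ξ
      change fderiv ℝ (m θ + m' θ) ξ (ev a) = _
      rw [fderiv_add (h.1 θ ξ) (h'.1 θ ξ)]
      rfl
    | mul m m' hm hm' h h' =>
      refine ⟨fun θ => (h.1 θ).mul (h'.1 θ), fun a => ?_⟩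
      convert Subalgebra.add_mem _ (Subalgebra.mul_mem _ (h.2 a) hm')
        (Subalgebra.mul_mem _ hm (h'.2 a)) using 1
      ext θ ξ
      change fderiv ℝ (m θ * m' θ) ξ (ev a) = pd a m θ ξ * m' θ ξ + m θ ξ * pd a m' θ ξ
      rw [fderiv_mul (h.1 θ ξ) (h'.1 θ ξ)]
      simp [pd]
      ring
  -- a linear map is the sum of its values on the coordinate vectors
  have hsum : ∀ (m : Θ → Spacetime n → ℂ) (θ : Θ), fderiv ℝ (m θ) =
      fun ξ => ∑ a, ContinuousLinearMap.smulRightL ℝ (Spacetime n) ℂ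
        (EuclideanSpace.proj (𝕜 := ℝ) a) (pd a m θ ξ) := by
    intro m θ
    ext ξ v
    have hv : v = ∑ a, v a • ev a := by
      ext i
      simp [ev, Finset.sum_apply, Pi.single_apply]
    conv_lhs => rw [hv]
    simp [pd]
  have hsm : ∀ N : ℕ, ∀ m ∈ Algebra.adjoin ℂ S, ∀ θ, ContDiff ℝ N (m θ) := by
    intro N
    induction N with
    | zero =>
      intro m hm θ
      exact contDiff_zero.2 ((hd' m hm).1 θ).continuous
    | succ N ih =>
      intro m hm θ
      rw [show ((N + 1 : ℕ) : WithTop ℕ∞) = (N : WithTop ℕ∞) + 1 by push_cast; rfl,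
        contDiff_succ_iff_fderiv]
      refine ⟨(hd' m hm).1 θ, by simp, ?_⟩
      rw [hsum]
      refine ContDiff.sum fun a _ => ?_
      exact ((ContinuousLinearMap.smulRightL ℝ (Spacetime n) ℂ
        (EuclideanSpace.proj (𝕜 := ℝ) a)).contDiff).comp (ih _ ((hd' m hm).2 a) θ)
  intro m hm
  refine ⟨fun θ => contDiff_infty.2 fun N => hsm N m hm θ, fun l => ?_⟩
  induction l generalizing m with
  | zero =>
    obtain ⟨C, N, h0, hC⟩ := hb' m hm
    exact ⟨C, N, h0, fun θ ξ => by simpa using hC θ ξ⟩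
  | succ l ih =>
    choose C N h0 hC using fun a => ih (pd a m) ((hd' m hm).2 a)
    let L := fun a : Fin (n + 1) => ContinuousLinearMap.smulRightL ℝ (Spacetime n) ℂ
        (EuclideanSpace.proj (𝕜 := ℝ) a)
    refine ⟨∑ a, ‖L a‖ * C a, ∑ a, N a, Finset.sum_nonneg fun a _ =>
      mul_nonneg (L a).opNorm_nonneg (h0 a), fun θ ξ => ?_⟩
    have hcd : ∀ a, ContDiff ℝ ∞ (pd a m θ) := fun a =>
      contDiff_infty.2 fun N => hsm N _ ((hd' m hm).2 a) θ
    rw [← norm_iteratedFDeriv_fderiv, hsum, iteratedFDeriv_fun_sum_apply]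
    · refine (norm_sum_le _ _).trans ?_
      rw [Finset.sum_mul]
      refine Finset.sum_le_sum fun a _ => ?_
      refine ((L a).norm_iteratedFDeriv_comp_left (f := pd a m θ) (x := ξ) (N := ∞)
        (hcd a).contDiffAt (by exact_mod_cast le_top)).trans ?_
      rw [mul_assoc]
      gcongr
      refine (hC a θ ξ).trans ?_
      gcongr
      · exact h0 a
      · exact hG θ
      · exact Finset.single_le_sum (f := N) (fun _ _ => Nat.zero_le _) (Finset.mem_univ a)
    · intro a _
      exact ((L a).contDiff.comp (hcd a)).contDiffAt.of_le (by exact_mod_cast le_top)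

/-! ### Multipliers on weighted `L²` spaces -/

/-- The uniform boundedness of a family of multipliers in the weighted space of order `r`. -/
def MuBdd (G : Θ → ℝ) (r : ℝ) (m : Θ → Spacetime n → ℂ) : Prop :=
  ∃ (C : ℝ) (N : ℕ), 0 ≤ C ∧ ∀ θ f, wn r (Mu (m θ) f) ≤ C * G θ ^ N * wn r f

theorem norm_sq_eq_sum (Z : Spacetime n) : ‖Z‖ ^ 2 = ∑ a, Z a ^ 2 := by
  rw [EuclideanSpace.norm_sq_eq]
  simp

theorem wn_succ_sq (r : ℝ) (f : Sch n) :
    wn (r + 1) f ^ 2 = wn r f ^ 2 + ∑ a, wn r (XS a f) ^ 2 := by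
  simp only [wn_sq]
  rw [← integral_finsetSum _ fun a _ => integrable_wn r (XS a f),
    ← integral_add (integrable_wn r f) (integrable_finsetSum _ fun a _ => integrable_wn r (XS a f))]
  congr 1
  ext x
  rw [Real.rpow_add_one (by positivity), norm_sq_eq_sum]
  simp only [XS_apply, norm_mul, Complex.norm_real, Real.norm_eq_abs, mul_pow, sq_abs]
  rw [← Finset.mul_sum, ← Finset.sum_mul]
  ring

theorem wn_succ_le (r : ℝ) (f : Sch n) :
    wn (r + 1) f ≤ wn r f + ∑ a, wn r (XS a f) := by
  have h0 : 0 ≤ ∑ a, wn r (XS a f) := Finset.sum_nonneg fun a _ => wn_nonneg _ _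
  have h1 := wn_nonneg r f
  refine abs_le_of_sq_le_sq' (?_ : wn (r + 1) f ^ 2 ≤ _ ^ 2) (add_nonneg h1 h0) |>.2
  rw [wn_succ_sq]
  have : ∑ a, wn r (XS a f) ^ 2 ≤ (∑ a, wn r (XS a f)) ^ 2 :=
    Finset.sum_sq_le_sq_sum_of_nonneg fun a _ => wn_nonneg _ _
  nlinarith

theorem wn_XS_le (r : ℝ) (a : Fin (n + 1)) (f : Sch n) : wn r (XS a f) ≤ wn (r + 1) f := by
  refine abs_le_of_sq_le_sq' (?_ : wn r (XS a f) ^ 2 ≤ wn (r + 1) f ^ 2) (wn_nonneg _ _) |>.2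
  rw [wn_succ_sq]
  have : wn r (XS a f) ^ 2 ≤ ∑ a, wn r (XS a f) ^ 2 :=
    Finset.single_le_sum (f := fun a => wn r (XS a f) ^ 2) (fun _ _ => sq_nonneg _)
      (Finset.mem_univ a)
  have := sq_nonneg (wn r f)
  linarith

theorem muBdd_zero {m : Θ → Spacetime n → ℂ} (hm : PB G m) : MuBdd G 0 m := by
  obtain ⟨C, N, h0, hC⟩ := hm.bound
  exact ⟨C, N, h0, fun θ f => norm_toLp_Mu_le (hm.temperate θ)
    ((norm_nonneg _).trans (hC θ 0)) (hC θ) f⟩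

/-- The space of order `r + 1` is controlled by the functions `f` and `x_a f` in the space of order
`r`, and the commutator of `x_a` with a multiplier is the multiplier with the differentiated symbol,
which belongs to the same class. -/
theorem muBdd_succ (hG : ∀ θ, 1 ≤ G θ) {r : ℝ}
    (h : ∀ m : Θ → Spacetime n → ℂ, PB G m → MuBdd G r m)
    {m : Θ → Spacetime n → ℂ} (hm : PB G m) : MuBdd G (r + 1) m := by
  obtain ⟨C, N, h0, hC⟩ := h m hm
  choose C' N' h0' hC' using fun a => h (pd a m) (pb_pd hm a)
  have hG0 : ∀ θ, 0 ≤ G θ := fun θ => zero_le_one.trans (hG θ)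
  refine ⟨C + ∑ a, (C + C' a), N + ∑ a, N' a, add_nonneg h0 (Finset.sum_nonneg fun a _ =>
    add_nonneg h0 (h0' a)), fun θ f => ?_⟩
  have hpi : ‖(Complex.I / (2 * Real.pi) : ℂ)‖ ≤ 1 := by
    simp only [Complex.norm_div, Complex.norm_I, Complex.norm_mul, Complex.norm_ofNat,
      Complex.norm_real, Real.norm_eq_abs, abs_of_pos Real.pi_pos]
    rw [div_le_one (by positivity)]
    linarith [Real.pi_gt_three]
  have hmono : wn r f ≤ wn (r + 1) f := wn_mono (by linarith) f
  have hw := wn_nonneg (r + 1) f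
  have hN : G θ ^ N ≤ G θ ^ (N + ∑ a, N' a) := pow_le_pow_right₀ (hG θ) (by omega)
  have hN' : ∀ a, G θ ^ N' a ≤ G θ ^ (N + ∑ a, N' a) := fun a =>
    pow_le_pow_right₀ (hG θ) ((Finset.single_le_sum (f := N') (fun _ _ => Nat.zero_le _)
      (Finset.mem_univ a)).trans (by omega))
  have hP := pow_nonneg (hG0 θ) (N + ∑ a, N' a)
  refine (wn_succ_le r _).trans ?_
  rw [add_mul, add_mul]
  refine add_le_add ?_ ?_
  · refine (hC θ f).trans ?_
    have := pow_nonneg (hG0 θ) N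
    have := wn_nonneg r f
    gcongr
  · rw [Finset.sum_mul, Finset.sum_mul]
    refine Finset.sum_le_sum fun a _ => ?_
    rw [XS_Mu (hm.temperate θ) ((pb_pd hm a).temperate θ) a (fun ξ => rfl)]
    refine (wn_add_le _ _ _).trans ?_
    rw [wn_smul, add_mul, add_mul]
    have h2 := h0' a
    have h3 := pow_nonneg (hG0 θ) N
    have h4 := pow_nonneg (hG0 θ) (N' a)
    refine add_le_add ?_ ?_
    · refine (hC θ _).trans ?_
      have := wn_XS_le r a f
      have := wn_nonneg r (XS a f)
      gcongr
    · refine (mul_le_of_le_one_left (wn_nonneg _ _) hpi).trans ((hC' a θ f).trans ?_)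
      have := hN' a
      have := wn_nonneg r f
      gcongr

theorem muBdd_nat (hG : ∀ θ, 1 ≤ G θ) (k : ℕ) :
    ∀ m : Θ → Spacetime n → ℂ, PB G m → MuBdd G k m := by
  induction k with
  | zero => intro m hm; simpa using muBdd_zero hm
  | succ k ih =>
    intro m hm
    push_cast
    exact muBdd_succ hG ih hm

/-- By duality, the transpose being the multiplier with the reflected symbol. -/
theorem muBdd_neg (hG : ∀ θ, 1 ≤ G θ) {r : ℝ} (h : ∀ m : Θ → Spacetime n → ℂ, PB G m → MuBdd G r m)
    {m : Θ → Spacetime n → ℂ} (hm : PB G m) : MuBdd G (-r) m := by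
  obtain ⟨C, N, h0, hC⟩ := h _ hm.comp_neg
  have hG0 : ∀ θ, 0 ≤ G θ := fun θ => zero_le_one.trans (hG θ)
  refine ⟨C, N, h0, fun θ f => ?_⟩
  have h1 := wn_nonneg (-r) f
  have h2 := pow_nonneg (hG0 θ) N
  refine wn_le_of_dual (by positivity) fun φ => ?_
  rw [integral_Mu (hm.temperate θ), neg_neg]
  refine (norm_integral_mul_le r _ f).trans ?_
  calc _ ≤ (C * G θ ^ N * wn r φ) * wn (-r) f := by
        gcongr
        exact hC θ φ
    _ = _ := by ring

/-! Interpolation between the weights `r` and `r + 1` by the quadratic `K`-method: the weight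
`λ W / (1 + λ W)` with `W = 1 + |x|²` is the smallest norm over all splittings of `f`. -/

/-- The multiplication operator `1 / (1 + λ (1 + |x|²))`. -/
def cutLow (lam : ℝ) (x : Spacetime n) : ℂ := (((1 + lam * (1 + ‖x‖ ^ 2))⁻¹ : ℝ) : ℂ)

theorem hasTemperateGrowth_cutLow {lam : ℝ} (h : 0 < lam) :
    (cutLow lam : Spacetime n → ℂ).HasTemperateGrowth := by
  have h1 := (hasTemperateGrowth_one_add_norm_sq_rpow (Spacetime n) (-1)).comp
    ((Real.sqrt (lam / (1 + lam)) • ContinuousLinearMap.id ℝ (Spacetime n)).hasTemperateGrowth)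
  have h2 := Complex.hasTemperateGrowth_ofReal.comp ((HasTemperateGrowth.const ((1 + lam)⁻¹)).mul h1)
  refine (congrArg HasTemperateGrowth (funext fun x => ?_)).mpr h2
  simp only [cutLow, Pi.mul_apply, Function.comp_apply, ContinuousLinearMap.smul_apply,
    ContinuousLinearMap.id_apply, norm_smul, mul_pow, Real.norm_eq_abs, sq_abs]
  rw [Real.sq_sqrt (by positivity), Real.rpow_neg_one, ← mul_inv]
  congr 2
  field_simp
  ring

/-- The weight of the `K`-functional. -/
def kWeight (r lam : ℝ) (x : Spacetime n) : ℝ :=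
  (1 + ‖x‖ ^ 2) ^ r * (lam * (1 + ‖x‖ ^ 2) / (1 + lam * (1 + ‖x‖ ^ 2)))

/-- An operator bounded by `D` in the spaces of orders `r` and `r + 1` is bounded by `D` for the
`K`-functional: `f = f0 + f1` is the optimal splitting, so that the last equality holds, while any
splitting of `T f` gives an upper bound. -/
theorem kFunctional_le {r D lam : ℝ} (hl : 0 < lam) (T : Sch n →L[ℂ] Sch n) (hD : 0 ≤ D)
    (h0 : ∀ f, wn r (T f) ≤ D * wn r f) (h1 : ∀ f, wn (r + 1) (T f) ≤ D * wn (r + 1) f)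
    (f : Sch n) :
    ∫ x, kWeight r lam x * ‖T f x‖ ^ 2 ≤ D ^ 2 * ∫ x, kWeight r lam x * ‖f x‖ ^ 2 := by
  set f1 : Sch n := SchwartzMap.smulLeftCLM ℂ (cutLow lam) f with hf1
  set f0 : Sch n := f - f1 with hf0
  have e1 : ∀ x, f1 x = (((1 + lam * (1 + ‖x‖ ^ 2))⁻¹ : ℝ) : ℂ) * f x := fun x => by
    rw [hf1, SchwartzMap.smulLeftCLM_apply_apply (hasTemperateGrowth_cutLow hl)]; rfl
  have e0 : ∀ x, f0 x = ((lam * (1 + ‖x‖ ^ 2) / (1 + lam * (1 + ‖x‖ ^ 2)) : ℝ) : ℂ) * f x :=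
      fun x => by
    have : (1 + lam * (1 + ‖x‖ ^ 2)) ≠ 0 := by positivity
    rw [hf0, sub_apply, e1, ← one_sub_mul, ← Complex.ofReal_one, ← Complex.ofReal_sub]
    congr 3
    field_simp
    ring
  have hint : ∀ g : Sch n, Integrable (fun x : Spacetime n => lam * ((1 + ‖x‖ ^ 2) ^ (r + 1) *
      ‖g x‖ ^ 2)) := fun g => (integrable_wn (r + 1) g).const_mul lam
  have hk : Integrable (fun x : Spacetime n => kWeight r lam x * ‖T f x‖ ^ 2) := by
    refine (integrable_wn r (T f)).mono' ?_ (Filter.Eventually.of_forall fun x => ?_)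
    · refine Continuous.aestronglyMeasurable ?_
      unfold kWeight
      refine Continuous.mul (Continuous.mul ?_ ?_) (by fun_prop)
      · exact Continuous.rpow_const (by fun_prop) fun x => Or.inl (by positivity)
      · exact Continuous.div (by fun_prop) (by fun_prop) fun x => by positivity
    · rw [Real.norm_of_nonneg (by unfold kWeight; positivity), kWeight]
      have : lam * (1 + ‖x‖ ^ 2) / (1 + lam * (1 + ‖x‖ ^ 2)) ≤ 1 := by
        rw [div_le_one (by positivity)]; linarith
      have h2 : 0 ≤ (1 + ‖x‖ ^ 2) ^ r := by positivity
      have h3 := sq_nonneg ‖T f x‖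
      nlinarith [mul_nonneg h2 h3]
  calc ∫ x, kWeight r lam x * ‖T f x‖ ^ 2
      ≤ ∫ x, ((1 + ‖x‖ ^ 2) ^ r * ‖T f0 x‖ ^ 2 +
          lam * ((1 + ‖x‖ ^ 2) ^ (r + 1) * ‖T f1 x‖ ^ 2)) := by
        refine integral_mono hk ((integrable_wn r _).add (hint _)) fun x => ?_
        have hT : T f x = T f0 x + T f1 x := by
          rw [← add_apply, ← map_add]; simp [hf0]
        have h4 : ‖T f x‖ ≤ ‖T f0 x‖ + ‖T f1 x‖ := hT ▸ norm_add_le _ _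
        have hW : (0 : ℝ) < 1 + ‖x‖ ^ 2 := by positivity
        simp only [kWeight]
        rw [Real.rpow_add_one hW.ne']
        set W := 1 + ‖x‖ ^ 2
        set A := ‖T f0 x‖
        set B := ‖T f1 x‖
        have h5 : ‖T f x‖ ^ 2 ≤ (A + B) ^ 2 := by gcongr
        -- The weighted Cauchy–Schwarz inequality that makes `kWeight` a lower bound for all
        -- splittings.
        have h6 : lam * W / (1 + lam * W) * (A + B) ^ 2 ≤ A ^ 2 + lam * W * B ^ 2 := by
          rw [div_mul_eq_mul_div, div_le_iff₀ (by positivity)]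
          nlinarith [sq_nonneg (A - lam * W * B)]
        have h7 : 0 ≤ W ^ r := by positivity
        calc _ ≤ W ^ r * (lam * W / (1 + lam * W)) * (A + B) ^ 2 := by gcongr
          _ ≤ W ^ r * (A ^ 2 + lam * W * B ^ 2) := by rw [mul_assoc]; gcongr
          _ = _ := by ring
    _ = wn r (T f0) ^ 2 + lam * wn (r + 1) (T f1) ^ 2 := by
        rw [integral_add (integrable_wn r _) (hint _), integral_const_mul, wn_sq, wn_sq]
    _ ≤ (D * wn r f0) ^ 2 + lam * (D * wn (r + 1) f1) ^ 2 := by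
        have := h0 f0; have := h1 f1
        have := wn_nonneg r (T f0); have := wn_nonneg (r + 1) (T f1)
        gcongr
    _ = D ^ 2 * ∫ x, ((1 + ‖x‖ ^ 2) ^ r * ‖f0 x‖ ^ 2 +
          lam * ((1 + ‖x‖ ^ 2) ^ (r + 1) * ‖f1 x‖ ^ 2)) := by
        rw [integral_add (integrable_wn r _) (hint _), integral_const_mul, ← wn_sq, ← wn_sq]
        ring
    _ = _ := by
        congr 2
        ext x
        have hW : (0 : ℝ) < 1 + ‖x‖ ^ 2 := by positivity
        rw [e0, e1, kWeight, norm_mul, norm_mul, Complex.norm_real, Complex.norm_real,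
          Real.norm_of_nonneg (by positivity), Real.norm_of_nonneg (by positivity),
          Real.rpow_add_one hW.ne']
        have : (1 + lam * (1 + ‖x‖ ^ 2)) ≠ 0 := by positivity
        field_simp
        ring

/-- The one-dimensional integral that recovers the power weight from the `K`-functional. -/
theorem lintegral_kernel {t : ℝ} (h0 : 0 < t) (h1 : t < 1) :
    ∃ c : ℝ≥0∞, c ≠ 0 ∧ c ≠ ⊤ ∧ ∀ W : ℝ, 0 < W →
      ∫⁻ s : ℝ, ENNReal.ofReal (Real.exp (-(s * t)) * (Real.exp s * W / (1 + Real.exp s * W))) =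
        ENNReal.ofReal (W ^ t) * c := by
  set Ψ : ℝ → ℝ := fun s => Real.exp (-(s * t)) * (Real.exp s / (1 + Real.exp s)) with hΨ
  have hpos : ∀ s, 0 < Ψ s := fun s => by positivity
  have hcont : Continuous Ψ := by
    refine Continuous.mul (by fun_prop) (Continuous.div (by fun_prop) (by fun_prop) fun s => ?_)
    positivity
  refine ⟨∫⁻ s, ENNReal.ofReal (Ψ s), ?_, ?_, fun W hW => ?_⟩
  · rw [← pos_iff_ne_zero, lintegral_pos_iff_support (by fun_prop)]
    have : Function.support (fun s => ENNReal.ofReal (Ψ s)) = Set.univ := by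
      ext s; simp [hpos s]
    rw [this]; simp
  · set e := min t (1 - t) with he
    have he0 : 0 < e := lt_min h0 (by linarith)
    -- The integrand decays like `exp (-t s)` at `+∞` and like `exp ((1 - t) s)` at `-∞`.
    have hi : Integrable (fun s : ℝ => Real.exp (-e * |s|)) := by
      rw [← integrableOn_univ, ← Set.Iic_union_Ioi (a := (0 : ℝ))]
      refine IntegrableOn.union ?_ ?_
      · refine (integrableOn_exp_mul_Iic he0 0).congr_fun (fun s hs => ?_) measurableSet_Iic
        simp [abs_of_nonpos (Set.mem_Iic.1 hs)]
      · refine (exp_neg_integrableOn_Ioi 0 he0).congr_fun (fun s hs => ?_) measurableSet_Ioi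
        simp [abs_of_pos (Set.mem_Ioi.1 hs)]
    refine ne_of_lt (lt_of_le_of_lt (lintegral_mono fun s => ENNReal.ofReal_le_ofReal (?_ : Ψ s ≤
      Real.exp (-e * |s|))) hi.lintegral_lt_top)
    have hle : e ≤ t := min_le_left _ _
    have hle' : e ≤ 1 - t := min_le_right _ _
    rcases le_total 0 s with hs | hs
    · rw [abs_of_nonneg hs]
      have : Real.exp s / (1 + Real.exp s) ≤ 1 := by
        rw [div_le_one (by positivity)]; linarith
      calc Ψ s ≤ Real.exp (-(s * t)) * 1 := by simp only [hΨ]; gcongr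
        _ ≤ _ := by rw [mul_one]; apply Real.exp_le_exp.2; nlinarith
    · rw [abs_of_nonpos hs]
      have : Real.exp s / (1 + Real.exp s) ≤ Real.exp s :=
        div_le_self (by positivity) (by linarith [Real.exp_pos s])
      calc Ψ s ≤ Real.exp (-(s * t)) * Real.exp s := by simp only [hΨ]; gcongr
        _ ≤ _ := by rw [← Real.exp_add]; apply Real.exp_le_exp.2; nlinarith
  · -- Substituting `s + log W` for `s` scales the integral by `W ^ t`.
    have hshift := lintegral_add_right_eq_self (μ := volume)
      (fun s => ENNReal.ofReal (Ψ s)) (Real.log W)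
    rw [← hshift, ← lintegral_const_mul' _ _ ENNReal.ofReal_ne_top]
    congr 1
    ext s
    rw [← ENNReal.ofReal_mul (by positivity)]
    congr 1
    simp only [hΨ]
    rw [Real.exp_add, Real.exp_log hW, Real.rpow_def_of_pos hW, ← mul_assoc, ← Real.exp_add]
    congr 2
    ring

/-- Interpolation: boundedness in the spaces of orders `r` and `r + 1` gives boundedness, with the
same constant, for all orders in between. -/
theorem wn_interpolate {r t D : ℝ} (ht0 : 0 < t) (ht1 : t < 1) (T : Sch n →L[ℂ] Sch n) (hD : 0 ≤ D)
    (h0 : ∀ f, wn r (T f) ≤ D * wn r f) (h1 : ∀ f, wn (r + 1) (T f) ≤ D * wn (r + 1) f)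
    (f : Sch n) : wn (r + t) (T f) ≤ D * wn (r + t) f := by
  obtain ⟨c, hc0, hct, hc⟩ := lintegral_kernel ht0 ht1
  -- the weighted norm is the average of the `K`-functionals
  have key : ∀ g : Sch n, ENNReal.ofReal (wn (r + t) g ^ 2) * c = ∫⁻ s : ℝ,
      ENNReal.ofReal (Real.exp (-(s * t))) *
        ENNReal.ofReal (∫ x, kWeight r (Real.exp s) x * ‖g x‖ ^ 2) := by
    intro g
    have hkc : Continuous (fun p : ℝ × Spacetime n => kWeight r (Real.exp p.1) p.2) := by
      unfold kWeight
      refine Continuous.mul ?_ ?_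
      · exact Continuous.rpow_const (by fun_prop) fun x => Or.inl (by positivity)
      · exact Continuous.div (by fun_prop) (by fun_prop) fun x => by positivity
    have hk0 : ∀ s (x : Spacetime n), 0 ≤ kWeight r (Real.exp s) x := fun s x => by
      unfold kWeight; positivity
    have e1 : ∀ s, ENNReal.ofReal (∫ x, kWeight r (Real.exp s) x * ‖g x‖ ^ 2) =
        ∫⁻ x, ENNReal.ofReal (kWeight r (Real.exp s) x * ‖g x‖ ^ 2) := by
      intro s
      refine ofReal_integral_eq_lintegral_ofReal ?_ (Filter.Eventually.of_forall fun x =>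
        mul_nonneg (hk0 s x) (sq_nonneg _))
      refine (integrable_wn r g).mono' ?_ (Filter.Eventually.of_forall fun x => ?_)
      · exact ((hkc.comp (Continuous.prodMk_right s)).mul (by fun_prop)).aestronglyMeasurable
      · rw [Real.norm_of_nonneg (mul_nonneg (hk0 s x) (sq_nonneg _)), kWeight]
        have : Real.exp s * (1 + ‖x‖ ^ 2) / (1 + Real.exp s * (1 + ‖x‖ ^ 2)) ≤ 1 := by
          rw [div_le_one (by positivity)]; linarith
        have h2 : 0 ≤ (1 + ‖x‖ ^ 2) ^ r := by positivity
        have h3 := sq_nonneg ‖g x‖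
        nlinarith [mul_nonneg h2 h3]
    have e2 : ENNReal.ofReal (wn (r + t) g ^ 2) =
        ∫⁻ x, ENNReal.ofReal ((1 + ‖x‖ ^ 2) ^ (r + t) * ‖g x‖ ^ 2) := by
      rw [wn_sq]
      exact ofReal_integral_eq_lintegral_ofReal (integrable_wn _ g)
        (Filter.Eventually.of_forall fun x => by positivity)
    simp_rw [e1, e2]
    have e3 : ∀ s, ENNReal.ofReal (Real.exp (-(s * t))) *
        ∫⁻ x, ENNReal.ofReal (kWeight r (Real.exp s) x * ‖g x‖ ^ 2) =
        ∫⁻ x, ENNReal.ofReal (Real.exp (-(s * t)) * (kWeight r (Real.exp s) x * ‖g x‖ ^ 2)) := by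
      intro s
      rw [← lintegral_const_mul' _ _ ENNReal.ofReal_ne_top]
      congr 1; ext x
      rw [← ENNReal.ofReal_mul (by positivity)]
    simp_rw [e3]
    rw [lintegral_lintegral_swap, ← lintegral_mul_const' _ _ hct]
    · congr 1
      ext x
      have hW : (0 : ℝ) < 1 + ‖x‖ ^ 2 := by positivity
      rw [Real.rpow_add hW, mul_right_comm,
        ENNReal.ofReal_mul (by positivity), mul_assoc, ← hc _ hW,
        ← lintegral_const_mul' _ _ ENNReal.ofReal_ne_top]
      congr 1
      ext s
      rw [← ENNReal.ofReal_mul (by positivity), kWeight]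
      congr 1
      ring
    · refine Measurable.aemeasurable ?_
      refine ENNReal.measurable_ofReal.comp (Continuous.measurable ?_)
      exact (by fun_prop : Continuous fun p : ℝ × Spacetime n => Real.exp (-(p.1 * t))).mul
        (hkc.mul (by fun_prop))
  have hmain : ENNReal.ofReal (wn (r + t) (T f) ^ 2) * c ≤
      ENNReal.ofReal ((D * wn (r + t) f) ^ 2) * c := by
    rw [mul_pow, ENNReal.ofReal_mul (by positivity), mul_assoc, key, key,
      ← lintegral_const_mul' _ _ ENNReal.ofReal_ne_top]
    refine lintegral_mono fun s => ?_
    beta_reduce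
    rw [mul_left_comm, ← ENNReal.ofReal_mul (by positivity : 0 ≤ D ^ 2), mul_comm, mul_comm (ENNReal.ofReal (Real.exp _))]
    refine mul_le_mul_left (ENNReal.ofReal_le_ofReal ?_) _
    exact kFunctional_le (Real.exp_pos s) T hD h0 h1 f
  have h2 := (ENNReal.mul_le_mul_iff_left hc0 hct).1 hmain
  rw [ENNReal.ofReal_le_ofReal_iff (by positivity)] at h2
  exact abs_le_of_sq_le_sq' h2 (mul_nonneg hD (wn_nonneg _ _)) |>.2

/-- Families of symbols with bounded derivatives are bounded in all weighted `L²` spaces. -/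
theorem PB.muBdd (hG : ∀ θ, 1 ≤ G θ) (r : ℝ) {m : Θ → Spacetime n → ℂ} (hm : PB G m) :
    MuBdd G r m := by
  have hpos : ∀ r : ℝ, 0 ≤ r → ∀ m : Θ → Spacetime n → ℂ, PB G m → MuBdd G r m := by
    intro r hr m hm
    obtain ⟨C, N, h0, hC⟩ := muBdd_nat hG ⌊r⌋₊ m hm
    obtain ⟨C', N', h0', hC'⟩ := muBdd_nat hG (⌊r⌋₊ + 1) m hm
    have hle := Nat.floor_le hr
    rcases hle.eq_or_lt with h | h
    · exact ⟨C, N, h0, by rw [← h]; exact hC⟩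
    · have hlt := Nat.lt_floor_add_one r
      refine ⟨C + C', N + N', by positivity, fun θ f => ?_⟩
      have hb := exists_common_bound hG h0 h0' N N' θ
      have h3 : r = ⌊r⌋₊ + (r - ⌊r⌋₊) := by ring
      rw [h3]
      refine wn_interpolate (by linarith) (by linarith) (Mu (m θ)) ?_ (fun f => ?_) (fun f => ?_) f
      · have := zero_le_one.trans (hG θ); positivity
      · exact (hC θ f).trans (mul_le_mul_of_nonneg_right hb.1 (wn_nonneg _ _))
      · have := hC' θ f
        push_cast at this
        exact this.trans (mul_le_mul_of_nonneg_right hb.2 (wn_nonneg _ _))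
  rcases le_total 0 r with hr | hr
  · exact hpos r hr m hm
  · have := muBdd_neg hG (hpos (-r) (by linarith)) hm
    rwa [neg_neg] at this

/-! ### Words in the generators -/

theorem Gen.one_le_order (g : Gen n) : 1 ≤ g.order := by cases g <;> simp [Gen.order]

theorem Gen.order_le_two (g : Gen n) : g.order ≤ 2 := by cases g <;> simp [Gen.order]

/-- The parabolic order of a word in the generators. -/
def wordOrder (w : List (Gen n)) : ℕ := (w.map Gen.order).sum

@[simp] theorem wordOrder_nil : wordOrder ([] : List (Gen n)) = 0 := rfl

@[simp] theorem wordOrder_cons (g : Gen n) (w : List (Gen n)) :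
    wordOrder (g :: w) = g.order + wordOrder w := by simp [wordOrder]

@[simp] theorem wordOrder_append (v w : List (Gen n)) :
    wordOrder (v ++ w) = wordOrder v + wordOrder w := by simp [wordOrder]

section Algebra

variable {R : Type*} [Ring R] [Algebra ℂ R]

/-- The generators of the module, in an algebra with operators `D a` and `X a`. -/
def genIn (D X : Fin (n + 1) → R) (c : ℝ) : Gen n → R
  | .Dz j => D j.castSucc
  | .Dt => D (Fin.last n)
  | .rot i j => X i.castSucc * D j.castSucc - X j.castSucc * D i.castSucc
  | .gal j => X (Fin.last n) * D j.castSucc - ((c / 2 : ℝ) : ℂ) • X j.castSucc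
  | .scal => (2 : ℂ) • (X (Fin.last n) * D (Fin.last n)) +
      ∑ j : Fin n, X j.castSucc * D j.castSucc

/-- The product of a word in the generators. -/
def wordIn (D X : Fin (n + 1) → R) (c : ℝ) (w : List (Gen n)) : R :=
  (w.map (genIn D X c)).prod

@[simp] theorem wordIn_nil (D X : Fin (n + 1) → R) (c : ℝ) : wordIn D X c [] = 1 := rfl

@[simp] theorem wordIn_cons (D X : Fin (n + 1) → R) (c : ℝ) (g : Gen n) (w : List (Gen n)) :
    wordIn D X c (g :: w) = genIn D X c g * wordIn D X c w := by simp [wordIn]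

theorem wordIn_append (D X : Fin (n + 1) → R) (c : ℝ) (v w : List (Gen n)) :
    wordIn D X c (v ++ w) = wordIn D X c v * wordIn D X c w := by simp [wordIn]

/-- The scalar value of the commutator `[D_a, X_b]`. -/
def ccr (a b : Fin (n + 1)) : ℂ := if a = b then -Complex.I else 0

/-- The canonical commutation relations. -/
structure Weyl (D X : Fin (n + 1) → R) : Prop where
  DD : ∀ a b, D a * D b = D b * D a
  XX : ∀ a b, X a * X b = X b * X a
  DX : ∀ a b, D a * X b = X b * D a + ccr a b • 1

/-- The commutator. -/
def bk (x y : R) : R := x * y - y * x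

theorem bk_lie_sub (x y z : R) : bk x (y - z) = bk x y - bk x z := by
  simp only [bk]; noncomm_ring

theorem bk_sub_lie (x y z : R) : bk (x - y) z = bk x z - bk y z := by
  simp only [bk]; noncomm_ring

theorem bk_add_lie (x y z : R) : bk (x + y) z = bk x z + bk y z := by
  simp only [bk]; noncomm_ring

theorem bk_lie_smul (a : ℂ) (x y : R) : bk x (a • y) = a • bk x y := by
  simp [bk, smul_sub]

theorem bk_smul_lie (a : ℂ) (x y : R) : bk (a • x) y = a • bk x y := by
  simp [bk, smul_sub]

theorem bk_sum_lie {ι : Type*} (s : Finset ι) (x : ι → R) (y : R) :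
    bk (∑ i ∈ s, x i) y = ∑ i ∈ s, bk (x i) y := by
  simp [bk, Finset.sum_mul, Finset.mul_sum]

/-- The identity and the generators span a Lie algebra. -/
theorem Weyl.lie_mem {D X : Fin (n + 1) → R} (h : Weyl D X) (c : ℝ) (g g' : Gen n) :
    genIn D X c g * genIn D X c g' - genIn D X c g' * genIn D X c g ∈
      Submodule.span ℂ (insert 1 (Set.range (genIn D X c))) := by
  set V := Submodule.span ℂ (insert 1 (Set.range (genIn D X c))) with hV
  have h1 : (1 : R) ∈ V := Submodule.subset_span (Set.mem_insert _ _)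
  have hg : ∀ g, genIn D X c g ∈ V := fun g =>
    Submodule.subset_span (Set.mem_insert_of_mem _ ⟨g, rfl⟩)
  have eDD : ∀ a b, bk (D a) (D b) = 0 := fun a b => by rw [bk, h.DD, sub_self]
  have eXX : ∀ a b, bk (X a) (X b) = 0 := fun a b => by rw [bk, h.XX, sub_self]
  have eDX : ∀ a b, bk (D a) (X b) = ccr a b • 1 := fun a b => by rw [bk, h.DX]; abel
  have eXD : ∀ a b, bk (X a) (D b) = -ccr b a • 1 := fun a b => by
    rw [bk, h.DX]; module
  have lm : ∀ x y z : R, bk x (y * z) = bk x y * z + y * bk x z := fun x y z => by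
    simp only [bk]; noncomm_ring
  have ml : ∀ x y z : R, bk (y * z) x = bk y x * z + y * bk z x := fun x y z => by
    simp only [bk]; noncomm_ring
  have symm : ∀ {x y : R}, bk x y ∈ V → bk y x ∈ V := fun {x y} hx => by
    rw [show bk y x = -bk x y by simp [bk]]; exact V.neg_mem hx
  have c1 : ∀ j : Fin n, ccr j.castSucc (Fin.last n) = 0 := fun j => by
    simp [ccr, Fin.castSucc_ne_last]
  have c2 : ∀ j : Fin n, ccr (Fin.last n) j.castSucc = 0 := fun j => by
    simp [ccr, (Fin.castSucc_ne_last _).symm]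
  have c3 : ccr (Fin.last n) (Fin.last n) = -Complex.I := by simp [ccr]
  have c4 : ∀ i j : Fin n, ccr i.castSucc j.castSucc = if i = j then -Complex.I else 0 :=
    fun i j => by simp [ccr]
  have c5 : ∀ i j : Fin n, ccr i.castSucc j.castSucc = ccr j.castSucc i.castSucc := fun i j => by
    simp [c4, eq_comm]
  have hz : ∀ {x : R}, x = 0 → x ∈ V := fun hx => hx ▸ V.zero_mem
  -- The scaling generator acts diagonally on the `D a` and the `X a`, hence on the generators.
  have sD : ∀ a, bk (genIn D X c .scal) (D a) =
      (if a = Fin.last n then 2 * Complex.I else Complex.I : ℂ) • D a := fun a => by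
    refine Fin.lastCases ?_ (fun i => ?_) a
    · simp [genIn, ml, bk_add_lie, bk_smul_lie, eDD, eXD, bk_sum_lie, c3, c2]
      module
    · simp [genIn, ml, bk_add_lie, bk_smul_lie, eDD, eXD, bk_sum_lie, c1, c4, ite_smul]
  have sX : ∀ a, bk (genIn D X c .scal) (X a) =
      (if a = Fin.last n then -2 * Complex.I else -Complex.I : ℂ) • X a := fun a => by
    refine Fin.lastCases ?_ (fun i => ?_) a
    · simp [genIn, ml, bk_add_lie, bk_smul_lie, eXX, eDX, bk_sum_lie, c3, c1]
      module
    · simp [genIn, ml, bk_add_lie, bk_smul_lie, eXX, eDX, bk_sum_lie, c2, c4, ite_smul]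
  change bk (genIn D X c g) (genIn D X c g') ∈ V
  have dz : ∀ i g', bk (genIn D X c (.Dz i)) (genIn D X c g') ∈ V := by
    intro i g'
    cases g' with
    | Dz j => exact hz (eDD _ _)
    | Dt => exact hz (eDD _ _)
    | rot j l =>
      have : bk (genIn D X c (.Dz i)) (genIn D X c (.rot j l)) =
          ccr i.castSucc j.castSucc • genIn D X c (.Dz l) -
          ccr i.castSucc l.castSucc • genIn D X c (.Dz j) := by
        simp [genIn, lm, bk_lie_sub, bk_lie_smul, eDD, eDX]
      rw [this]
      exact V.sub_mem (V.smul_mem _ (hg _)) (V.smul_mem _ (hg _))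
    | gal j =>
      have : bk (genIn D X c (.Dz i)) (genIn D X c (.gal j)) =
          (-(((c / 2 : ℝ) : ℂ) * ccr i.castSucc j.castSucc)) • (1 : R) := by
        simp [genIn, lm, bk_lie_sub, bk_lie_smul, eDD, eDX, c1]
        module
      rw [this]
      exact V.smul_mem _ h1
    | scal =>
      refine symm ?_
      rw [show genIn D X c (.Dz i) = D i.castSucc from rfl, sD]
      exact V.smul_mem _ (hg (.Dz i))
  have dt : ∀ g', bk (genIn D X c .Dt) (genIn D X c g') ∈ V := by
    intro g'
    cases g' with
    | Dz j => exact hz (eDD _ _)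
    | Dt => exact hz (eDD _ _)
    | rot j l => exact hz (by simp [genIn, lm, bk_lie_sub, bk_lie_smul, eDD, eDX, c2])
    | gal j =>
      have : bk (genIn D X c .Dt) (genIn D X c (.gal j)) = (-Complex.I) • genIn D X c (.Dz j) := by
        simp [genIn, lm, bk_lie_sub, bk_lie_smul, eDD, eDX, c2, c3]
      rw [this]
      exact V.smul_mem _ (hg _)
    | scal =>
      refine symm ?_
      rw [show genIn D X c .Dt = D (Fin.last n) from rfl, sD]
      exact V.smul_mem _ (hg .Dt)
  have sc : ∀ g', bk (genIn D X c .scal) (genIn D X c g') ∈ V := by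
    intro g'
    cases g' with
    | Dz j => exact symm (dz _ _)
    | Dt => exact symm (dt _)
    | rot j l =>
      refine hz ?_
      rw [show genIn D X c (.rot j l) = X j.castSucc * D l.castSucc - X l.castSucc * D j.castSucc
        from rfl, bk_lie_sub, lm, lm, sX, sX, sD, sD]
      simp [Fin.castSucc_ne_last]
    | gal j =>
      have : bk (genIn D X c .scal) (genIn D X c (.gal j)) = (-Complex.I) • genIn D X c (.gal j) := by
        rw [show genIn D X c (.gal j) = X (Fin.last n) * D j.castSucc -
          ((c / 2 : ℝ) : ℂ) • X j.castSucc from rfl, bk_lie_sub, bk_lie_smul, lm, sX, sX, sD]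
        simp only [Fin.castSucc_ne_last, if_true, if_false, smul_mul_assoc, mul_smul_comm]
        module
      rw [this]
      exact V.smul_mem _ (hg _)
    | scal => exact hz (sub_self _)
  have rr : ∀ i j, ∀ g', bk (genIn D X c (.rot i j)) (genIn D X c g') ∈ V := by
    intro i j g'
    cases g' with
    | Dz l => exact symm (dz _ _)
    | Dt => exact symm (dt _)
    | rot l m =>
      have : bk (genIn D X c (.rot i j)) (genIn D X c (.rot l m)) =
          ccr j.castSucc l.castSucc • genIn D X c (.rot i m) -
          ccr i.castSucc l.castSucc • genIn D X c (.rot j m) -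
          ccr j.castSucc m.castSucc • genIn D X c (.rot i l) +
          ccr i.castSucc m.castSucc • genIn D X c (.rot j l) := by
        simp only [genIn, lm, ml, bk_lie_sub, bk_sub_lie, eDD, eDX, eXX, eXD, c5 m, c5 l, zero_mul,
          mul_zero, add_zero, zero_add, smul_mul_assoc, mul_smul_comm, one_mul, mul_one, mul_sub,
          sub_mul, neg_smul, neg_mul, mul_neg]
        module
      rw [this]
      exact V.add_mem (V.sub_mem (V.sub_mem (V.smul_mem _ (hg _)) (V.smul_mem _ (hg _)))
        (V.smul_mem _ (hg _))) (V.smul_mem _ (hg _))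
    | gal l =>
      have : bk (genIn D X c (.rot i j)) (genIn D X c (.gal l)) =
          ccr j.castSucc l.castSucc • genIn D X c (.gal i) -
          ccr i.castSucc l.castSucc • genIn D X c (.gal j) := by
        simp only [genIn, lm, ml, bk_lie_sub, bk_sub_lie, bk_lie_smul, eDD, eDX, eXX, eXD, c5 l, c1, c2,
          zero_mul, zero_smul,
          mul_zero, add_zero, zero_add, smul_mul_assoc, mul_smul_comm, one_mul, mul_one, mul_sub,
          sub_mul, neg_smul, neg_mul, mul_neg]
        module
      rw [this]
      exact V.sub_mem (V.smul_mem _ (hg _)) (V.smul_mem _ (hg _))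
    | scal => exact symm (sc _)
  cases g with
  | Dz i => exact dz _ _
  | Dt => exact dt _
  | rot i j => exact rr _ _ _
  | scal => exact sc _
  | gal i =>
    cases g' with
    | Dz l => exact symm (dz _ _)
    | Dt => exact symm (dt _)
    | rot l m => exact symm (rr _ _ _)
    | scal => exact symm (sc _)
    | gal j =>
      refine hz ?_
      simp only [genIn, lm, ml, bk_lie_sub, bk_sub_lie, bk_lie_smul, bk_smul_lie, eDD, eDX, eXX, eXD,
        c5 j, c1, c2,
        zero_mul, zero_smul,
        mul_zero, add_zero, zero_add, smul_mul_assoc, mul_smul_comm, one_mul, mul_one, mul_sub,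
        sub_mul, neg_smul, neg_mul, mul_neg]
      module

/-- Reordering a word changes its product by a combination of shorter words. -/
theorem Weyl.perm_mem {D X : Fin (n + 1) → R} (h : Weyl D X) (c : ℝ) {w w' : List (Gen n)}
    (hp : w.Perm w') :
    wordIn D X c w - wordIn D X c w' ∈ Submodule.span ℂ
      {x | ∃ v, v.length < w.length ∧ wordOrder v ≤ wordOrder w ∧ x = wordIn D X c v} := by
  induction hp with
  | nil => simp
  | @cons g l l' _ ih =>
    rw [wordIn_cons, wordIn_cons, ← mul_sub]
    refine Submodule.span_induction (p := fun x _ => genIn D X c g * x ∈ _) ?_ ?_ ?_ ?_ ih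
    · rintro _ ⟨v, hv, hv', rfl⟩
      exact Submodule.subset_span ⟨g :: v, by simpa using hv, by simpa using hv', by simp⟩
    · simp
    · intro x y _ _ hx hy
      rw [mul_add]
      exact Submodule.add_mem _ hx hy
    · intro a x _ hx
      rw [mul_smul_comm]
      exact Submodule.smul_mem _ _ hx
  -- The order of a commutator is at most `2 ≤ g.order + g'.order`, and its length is at most one.
  | swap g g' l =>
    rw [wordIn_cons, wordIn_cons, wordIn_cons, wordIn_cons, ← mul_assoc, ← mul_assoc, ← sub_mul]
    have h2 := g.one_le_order
    have h3 := g'.one_le_order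
    refine Submodule.span_induction (p := fun x _ => x * wordIn D X c l ∈ _) ?_ ?_ ?_ ?_
      (h.lie_mem c g' g)
    · rintro _ (rfl | ⟨v, rfl⟩)
      · exact Submodule.subset_span ⟨l, by simp, by simp only [wordOrder_cons]; omega, by simp⟩
      · have := v.order_le_two
        exact Submodule.subset_span ⟨v :: l, by simp, by simp only [wordOrder_cons]; omega, by simp⟩
    · simp
    · intro x y _ _ hx hy
      rw [add_mul]
      exact Submodule.add_mem _ hx hy
    · intro a x _ hx
      rw [smul_mul_assoc]
      exact Submodule.smul_mem _ _ hx
  | @trans l₁ l₂ l₃ h₁ _ ih₁ ih₂ =>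
    have e1 : l₁.length = l₂.length := h₁.length_eq
    have e2 : wordOrder l₁ = wordOrder l₂ := (h₁.map _).sum_eq
    rw [← sub_add_sub_cancel _ (wordIn D X c l₂)]
    refine Submodule.add_mem _ ih₁ ?_
    rw [e1, e2]
    exact ih₂

end Algebra

theorem mem_gens (g : Gen n) : g ∈ gens n := by
  cases g <;> simp [gens]

/-- Up to order, every word is an ordered monomial. -/
theorem exists_perm_ordered (w : List (Gen n)) : ∃ α : MultiIndex n,
    w.Perm (List.ofFn fun i => List.replicate (α i) ((gens n).get i)).flatten := by
  choose idx hidx using fun g : Gen n => List.mem_iff_get.1 (mem_gens g)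
  refine ⟨fun i => (w.map idx).count i, ?_⟩
  have h1 : (w.map idx).Perm
      (List.ofFn fun i => List.replicate ((w.map idx).count i) i).flatten := by
    rw [List.perm_iff_count]
    intro a
    rw [List.count_flatten, List.map_ofFn, List.sum_ofFn]
    simp [Function.comp_def, List.count_replicate]
  have h2 := h1.map (gens n).get
  rw [List.map_map, List.map_flatten, List.map_ofFn] at h2
  simp only [Function.comp_def, List.map_replicate, hidx, List.map_id'] at h2
  exact h2

/-- Poincaré–Birkhoff–Witt: words are combinations of ordered monomials of no larger order. -/
theorem word_mem_span {D X : Fin (n + 1) → Dist n →L[ℂ] Dist n} (h : Weyl D X) (c : ℝ)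
    (hgen : ∀ g, genOp c g = genIn D X c g) (w : List (Gen n)) :
    wordIn D X c w ∈ Submodule.span ℂ
      {x | ∃ α : MultiIndex n, α.order ≤ wordOrder w ∧ x = monomialOp c α} := by
  induction hN : w.length using Nat.strong_induction_on generalizing w with
  | _ N ih =>
  obtain ⟨α, hα⟩ := exists_perm_ordered w
  have h1 := h.perm_mem c hα
  have h2 : wordIn D X c (List.ofFn fun i => List.replicate (α i) ((gens n).get i)).flatten =
      monomialOp c α := by
    simp [wordIn, monomialOp, List.map_flatten, List.prod_flatten, List.map_ofFn,
      Function.comp_def, hgen]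
  have h3 : α.order = wordOrder w := by
    rw [wordOrder, (hα.map _).sum_eq]
    simp [MultiIndex.order, List.map_flatten, List.sum_flatten, List.map_ofFn,
      Function.comp_def, List.sum_ofFn]
  rw [h2] at h1
  rw [← sub_add_cancel (wordIn D X c w) (monomialOp c α)]
  refine Submodule.add_mem _ ?_ (Submodule.subset_span ⟨α, h3.le, rfl⟩)
  refine Submodule.span_le.2 ?_ h1
  rintro _ ⟨v, hv, hv', rfl⟩
  refine Submodule.span_mono ?_ (ih _ (hN ▸ hv) v rfl)
  rintro _ ⟨β, hβ, rfl⟩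
  exact ⟨β, hβ.trans hv', rfl⟩

/-! ### Commuting words past operators -/

section Algebra

variable {R : Type*} [Ring R] [Algebra ℂ R]

/-- Combinations of products `m W` with `m ∈ M` and `W` a word of order at most `k`. -/
def leftSpan (D X : Fin (n + 1) → R) (c : ℝ) (M : Submodule ℂ R) (k : ℕ) : Submodule ℂ R :=
  Submodule.span ℂ {x | ∃ m ∈ M, ∃ v, wordOrder v ≤ k ∧ x = m * wordIn D X c v}

variable {D X : Fin (n + 1) → R} {c : ℝ} {M : Submodule ℂ R}

theorem mul_word_mem_leftSpan {m : R} (hm : m ∈ M) {v : List (Gen n)} {k : ℕ}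
    (hv : wordOrder v ≤ k) : m * wordIn D X c v ∈ leftSpan D X c M k :=
  Submodule.subset_span ⟨m, hm, v, hv, rfl⟩

theorem mem_leftSpan {m : R} (hm : m ∈ M) (k : ℕ) : m ∈ leftSpan D X c M k := by
  simpa using mul_word_mem_leftSpan (D := D) (X := X) (c := c) (v := []) (k := k) hm (by simp)

theorem mul_gen_mem_leftSpan {m : R} (hm : m ∈ M) {g : Gen n} {k : ℕ} (hg : g.order ≤ k) :
    m * genIn D X c g ∈ leftSpan D X c M k := by
  simpa using mul_word_mem_leftSpan (D := D) (X := X) (c := c) (v := [g]) (k := k) hm (by simpa)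

theorem leftSpan_mono {k k' : ℕ} (h : k ≤ k') : leftSpan D X c M k ≤ leftSpan D X c M k' :=
  Submodule.span_mono fun _ ⟨m, hm, v, hv, e⟩ => ⟨m, hm, v, hv.trans h, e⟩

theorem leftSpan_mul_word {x : R} {k : ℕ} (hx : x ∈ leftSpan D X c M k) (w : List (Gen n)) :
    x * wordIn D X c w ∈ leftSpan D X c M (k + wordOrder w) := by
  induction hx using Submodule.span_induction with
  | mem x hx =>
    obtain ⟨m, hm, v, hv, rfl⟩ := hx
    rw [mul_assoc, ← wordIn_append]
    exact mul_word_mem_leftSpan hm (by simpa using hv)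
  | zero => simp
  | add x y _ _ hx hy => rw [add_mul]; exact Submodule.add_mem _ hx hy
  | smul a x _ hx => rw [smul_mul_assoc]; exact Submodule.smul_mem _ _ hx

/-- If each generator can be commuted past `M`, then so can each word. -/
theorem word_mul_mem_leftSpan
    (H : ∀ g, ∀ m ∈ M, genIn D X c g * m ∈ leftSpan D X c M g.order) (w : List (Gen n)) :
    ∀ m ∈ M, wordIn D X c w * m ∈ leftSpan D X c M (wordOrder w) := by
  induction w with
  | nil => intro m hm; simpa using mem_leftSpan hm 0
  | cons g w ih =>
    intro m hm
    rw [wordIn_cons, mul_assoc]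
    have h1 := ih m hm
    generalize wordIn D X c w * m = y at h1 ⊢
    induction h1 using Submodule.span_induction with
    | mem x hx =>
      obtain ⟨m', hm', v, hv, rfl⟩ := hx
      rw [← mul_assoc]
      refine leftSpan_mono ?_ (leftSpan_mul_word (H g m' hm') v)
      rw [wordOrder_cons]
      omega
    | zero => simp
    | add x y _ _ hx hy => rw [mul_add]; exact Submodule.add_mem _ hx hy
    | smul a x _ hx => rw [mul_smul_comm]; exact Submodule.smul_mem _ _ hx

/-- Operators that commute with the `D a` and whose commutators with the `X a` stay in `M`. -/
theorem gen_mul_mem_of_comm_D (hD : ∀ a, ∀ m ∈ M, D a * m = m * D a)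
    (hX : ∀ a, ∀ m ∈ M, X a * m - m * X a ∈ M) (g : Gen n) (m : R) (hm : m ∈ M) :
    genIn D X c g * m ∈ leftSpan D X c M g.order := by
  obtain ⟨d, hd⟩ : ∃ d : Fin (n + 1) → R, ∀ a, d a = X a * m - m * X a := ⟨_, fun _ => rfl⟩
  have hd' : ∀ a, X a * m = m * X a + d a := fun a => by rw [hd]; abel
  have hdM : ∀ a, d a ∈ M := fun a => hd a ▸ hX a m hm
  have hXD : ∀ a b, X a * D b * m = m * (X a * D b) + d a * D b := fun a b => by
    rw [mul_assoc, hD b m hm, ← mul_assoc, hd', add_mul, mul_assoc]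
  cases g with
  | Dz j =>
    rw [show genIn D X c (.Dz j) * m = m * genIn D X c (.Dz j) from hD _ _ hm]
    exact mul_gen_mem_leftSpan hm le_rfl
  | Dt =>
    rw [show genIn D X c .Dt * m = m * genIn D X c .Dt from hD _ _ hm]
    exact mul_gen_mem_leftSpan hm le_rfl
  | rot i j =>
    have : genIn D X c (.rot i j) * m = m * genIn D X c (.rot i j) +
        (d i.castSucc * genIn D X c (.Dz j) - d j.castSucc * genIn D X c (.Dz i)) := by
      simp only [genIn, sub_mul, hXD]
      noncomm_ring
    rw [this]
    exact Submodule.add_mem _ (mul_gen_mem_leftSpan hm le_rfl) (Submodule.sub_mem _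
      (mul_gen_mem_leftSpan (hdM _) le_rfl) (mul_gen_mem_leftSpan (hdM _) le_rfl))
  | gal j =>
    have : genIn D X c (.gal j) * m = m * genIn D X c (.gal j) +
        (d (Fin.last n) * genIn D X c (.Dz j) - ((c / 2 : ℝ) : ℂ) • d j.castSucc) := by
      simp only [genIn, sub_mul, hXD, mul_sub, smul_mul_assoc, hd', mul_smul_comm, smul_add]
      abel
    rw [this]
    exact Submodule.add_mem _ (mul_gen_mem_leftSpan hm le_rfl) (Submodule.sub_mem _
      (mul_gen_mem_leftSpan (hdM _) le_rfl) (Submodule.smul_mem _ _ (mem_leftSpan (hdM _) _)))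
  | scal =>
    have : genIn D X c .scal * m = m * genIn D X c .scal +
        ((2 : ℂ) • (d (Fin.last n) * genIn D X c .Dt) +
          ∑ j : Fin n, d j.castSucc * genIn D X c (.Dz j)) := by
      simp only [genIn, add_mul, hXD, mul_add, smul_mul_assoc, mul_smul_comm, smul_add,
        Finset.sum_mul, Finset.mul_sum, Finset.sum_add_distrib]
      abel
    rw [this]
    exact Submodule.add_mem _ (mul_gen_mem_leftSpan hm le_rfl) (Submodule.add_mem _
      (Submodule.smul_mem _ _ (mul_gen_mem_leftSpan (hdM _) le_rfl))
      (Submodule.sum_mem _ fun j _ => mul_gen_mem_leftSpan (hdM _) (by simp [Gen.order])))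

/-- Operators that commute with the `X a` and whose commutators with the `D a` stay in `M`, also
after multiplication by `X b`. -/
theorem gen_mul_mem_of_comm_X (hX : ∀ a, ∀ m ∈ M, X a * m = m * X a)
    (hD : ∀ a, ∀ m ∈ M, D a * m - m * D a ∈ M)
    (hXD : ∀ a b, ∀ m ∈ M, X b * (D a * m - m * D a) ∈ M) (g : Gen n) (m : R) (hm : m ∈ M) :
    genIn D X c g * m ∈ leftSpan D X c M g.order := by
  obtain ⟨d, hd⟩ : ∃ d : Fin (n + 1) → R, ∀ a, d a = D a * m - m * D a := ⟨_, fun _ => rfl⟩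
  have hd' : ∀ a, D a * m = m * D a + d a := fun a => by rw [hd]; abel
  have hdM : ∀ a, d a ∈ M := fun a => hd a ▸ hD a m hm
  have hxd : ∀ b a, X b * d a ∈ M := fun b a => hd a ▸ hXD a b m hm
  have hXD : ∀ a b, X a * D b * m = m * (X a * D b) + X a * d b := fun a b => by
    rw [mul_assoc, hd', mul_add, ← mul_assoc, hX a m hm, mul_assoc]
  cases g with
  | Dz j =>
    rw [show genIn D X c (.Dz j) * m = m * genIn D X c (.Dz j) + d j.castSucc from hd' _]
    exact Submodule.add_mem _ (mul_gen_mem_leftSpan hm le_rfl) (mem_leftSpan (hdM _) _)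
  | Dt =>
    rw [show genIn D X c .Dt * m = m * genIn D X c .Dt + d (Fin.last n) from hd' _]
    exact Submodule.add_mem _ (mul_gen_mem_leftSpan hm le_rfl) (mem_leftSpan (hdM _) _)
  | rot i j =>
    have : genIn D X c (.rot i j) * m = m * genIn D X c (.rot i j) +
        (X i.castSucc * d j.castSucc - X j.castSucc * d i.castSucc) := by
      simp only [genIn, sub_mul, hXD]
      noncomm_ring
    rw [this]
    exact Submodule.add_mem _ (mul_gen_mem_leftSpan hm le_rfl) (mem_leftSpan
      (M.sub_mem (hxd _ _) (hxd _ _)) _)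
  | gal j =>
    have : genIn D X c (.gal j) * m = m * genIn D X c (.gal j) +
        X (Fin.last n) * d j.castSucc := by
      simp only [genIn, sub_mul, hXD, mul_sub, smul_mul_assoc, hX _ m hm, mul_smul_comm]
      abel
    rw [this]
    exact Submodule.add_mem _ (mul_gen_mem_leftSpan hm le_rfl) (mem_leftSpan (hxd _ _) _)
  | scal =>
    have : genIn D X c .scal * m = m * genIn D X c .scal +
        ((2 : ℂ) • (X (Fin.last n) * d (Fin.last n)) +
          ∑ j : Fin n, X j.castSucc * d j.castSucc) := by
      simp only [genIn, add_mul, hXD, mul_add, smul_mul_assoc, mul_smul_comm, smul_add,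
        Finset.sum_mul, Finset.mul_sum, Finset.sum_add_distrib]
      abel
    rw [this]
    exact Submodule.add_mem _ (mul_gen_mem_leftSpan hm le_rfl) (mem_leftSpan
      (M.add_mem (M.smul_mem _ (hxd _ _)) (M.sum_mem fun j _ => hxd _ _)) _)

end Algebra

/-! ### Operators on distributions -/

theorem opD_apply (a : Fin (n + 1)) (u : Dist n) (φ : Sch n) :
    opD a u φ = Complex.I * u (∂_{ev a} φ) := by
  change (-Complex.I) • (∂_{ev a} u) φ = _
  rw [lineDerivOp_apply_apply]
  simp

theorem opX_apply (a : Fin (n + 1)) (u : Dist n) (φ : Sch n) : opX a u φ = u (XS a φ) := by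
  rw [opX, smulLeftCLM_apply_apply]
  rfl

theorem lineDeriv_XS (a b : Fin (n + 1)) (φ : Sch n) :
    ∂_{ev a} (XS b φ) = XS b (∂_{ev a} φ) + (if a = b then (1 : ℂ) else 0) • φ := by
  ext x
  have hfun : ⇑(XS b φ) = fun x : Spacetime n => ((x b : ℝ) : ℂ) * φ x := by
    ext x; rw [XS_apply]
  have hc : HasFDerivAt (fun x : Spacetime n => ((x b : ℝ) : ℂ))
      (Complex.ofRealCLM ∘L (EuclideanSpace.proj b : Spacetime n →L[ℝ] ℝ)) x :=
    (Complex.ofRealCLM ∘L (EuclideanSpace.proj b : Spacetime n →L[ℝ] ℝ)).hasFDerivAt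
  have h2 := (hc.mul (φ.differentiableAt (x := x)).hasFDerivAt).fderiv
  rw [SchwartzMap.lineDerivOp_apply_eq_fderiv, hfun, add_apply, XS_apply,
    SchwartzMap.lineDerivOp_apply_eq_fderiv]
  refine (congrArg (fun L => L (ev a)) h2).trans ?_
  by_cases h : a = b
  · subst h
    simp [ev, mul_comm]
  · simp [ev, h, Ne.symm h]

theorem genOp_eq_genIn (c : ℝ) (g : Gen n) : genOp c g = genIn opD opX c g := by
  cases g <;> rfl

/-- A word in the generators, acting on distributions. -/
abbrev Wd (c : ℝ) (w : List (Gen n)) : Dist n →L[ℂ] Dist n := wordIn opD opX c w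

/-- The Fourier multiplier with symbol `m` on distributions. -/
abbrev mulD (m : Spacetime n → ℂ) : Dist n →L[ℂ] Dist n := fourierMultiplierCLM ℂ m

theorem opX_mulD {m m' : Spacetime n → ℂ} (hm : m.HasTemperateGrowth)
    (hm' : m'.HasTemperateGrowth) (a : Fin (n + 1)) (hd : ∀ ξ, fderiv ℝ m ξ (ev a) = m' ξ)
    (u : Dist n) :
    opX a (mulD m u) = mulD m (opX a u) + (Complex.I / (2 * Real.pi)) • mulD m' u := by
  ext φ
  have hd' : ∀ ξ, fderiv ℝ (fun ξ => m (-ξ)) ξ (ev a) = -m' (-ξ) := fun ξ => by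
    have h0 := (hm.1.differentiable (by simp) (-ξ)).hasFDerivAt.comp ξ (hasFDerivAt_id ξ).neg
    rw [← hd]
    refine (congrArg (fun L => L (ev a)) h0.fderiv).trans ?_
    simp
  have h1 := XS_Mu (hasTemperateGrowth_comp_neg hm) (m' := fun ξ => -m' (-ξ))
    (hasTemperateGrowth_comp_neg hm').neg a hd' φ
  have h2 : Mu (fun ξ => -m' (-ξ)) φ = - Mu (fun ξ => m' (-ξ)) φ := by
    refine sch_ext_fourier fun ξ => ?_
    rw [fourier_Mu (m := fun ξ => -m' (-ξ)) (hasTemperateGrowth_comp_neg hm').neg,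
      FourierTransform.fourier_neg, neg_apply, fourier_Mu (hasTemperateGrowth_comp_neg hm')]
    ring
  have e : (mulD m (opX a u) + (Complex.I / (2 * Real.pi)) • mulD m' u) φ =
    mulD m (opX a u) φ + (Complex.I / (2 * Real.pi)) * mulD m' u φ := rfl
  rw [e, opX_apply, mult_apply hm, mult_apply hm, mult_apply hm', opX_apply, h1, h2]
  simp

theorem opD_mulD {m : Spacetime n → ℂ} (hm : m.HasTemperateGrowth) (a : Fin (n + 1))
    (u : Dist n) : opD a (mulD m u) = mulD m (opD a u) := by
  have h : (fun x : Spacetime n => ((inner ℝ x (ev a) : ℝ) : ℂ)).HasTemperateGrowth := by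
    fun_prop
  change (-Complex.I) • ∂_{ev a} (mulD m u) = mulD m ((-Complex.I) • ∂_{ev a} u)
  rw [lineDeriv_eq_fourierMultiplierCLM, lineDeriv_eq_fourierMultiplierCLM, map_smul, map_smul,
    fourierMultiplierCLM_fourierMultiplierCLM_apply hm h,
    fourierMultiplierCLM_fourierMultiplierCLM_apply h hm,
    mul_comm m (fun x : Spacetime n => ((inner ℝ x (ev a) : ℝ) : ℂ))]

/-- The generators on tempered distributions satisfy the canonical commutation relations. -/
theorem weyl_dist : Weyl (R := Dist n →L[ℂ] Dist n) opD opX where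
  DD a b := by
    have h : (fun x : Spacetime n => ((inner ℝ x (ev b) : ℝ) : ℂ)).HasTemperateGrowth := by
      fun_prop
    have hb : ∀ u : Dist n, opD b u = (-Complex.I) • (2 * Real.pi * Complex.I : ℂ) •
        mulD (fun x : Spacetime n => ((inner ℝ x (ev b) : ℝ) : ℂ)) u := fun u => by
      rw [← lineDeriv_eq_fourierMultiplierCLM]
      rfl
    ext1 u
    rw [ContinuousLinearMap.mul_apply, ContinuousLinearMap.mul_apply, hb, hb, map_smul, map_smul,
      opD_mulD h]
  XX a b := by
    ext u φ
    simp only [ContinuousLinearMap.mul_apply, opX_apply]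
    congr 1
    ext x
    simp only [XS_apply]
    ring
  DX a b := by
    ext u φ
    have : (opX b * opD a + ccr a b • (1 : Dist n →L[ℂ] Dist n)) u φ =
      opX b (opD a u) φ + ccr a b * u φ := rfl
    rw [this, ContinuousLinearMap.mul_apply, opD_apply, opX_apply, opX_apply, opD_apply,
      lineDeriv_XS, map_add, map_smul, ccr]
    by_cases h : a = b
    · simp [h]
      ring
    · simp [h]

theorem mulD_mulD {m m' : Spacetime n → ℂ} (hm : m.HasTemperateGrowth)
    (hm' : m'.HasTemperateGrowth) (u : Dist n) :
    mulD m (mulD m' u) = mulD (fun ξ => m ξ * m' ξ) u := by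
  rw [fourierMultiplierCLM_fourierMultiplierCLM_apply hm' hm, mul_comm]
  rfl

theorem mulD_add {m m' : Spacetime n → ℂ} (hm : m.HasTemperateGrowth)
    (hm' : m'.HasTemperateGrowth) (u : Dist n) :
    mulD (fun ξ => m ξ + m' ξ) u = mulD m u + mulD m' u := by
  ext φ
  change _ = mulD m u φ + mulD m' u φ
  rw [mult_apply hm, mult_apply hm', mult_apply (m := fun ξ => m ξ + m' ξ) (hm.add hm'), ← map_add]
  congr 1
  refine sch_ext_fourier fun ξ => ?_
  rw [FourierTransform.fourier_add, add_apply,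
    fourier_Mu (hasTemperateGrowth_comp_neg (m := fun ξ => m ξ + m' ξ) (hm.add hm')),
    fourier_Mu (hasTemperateGrowth_comp_neg hm), fourier_Mu (hasTemperateGrowth_comp_neg hm')]
  ring

theorem mulD_const_mul {m : Spacetime n → ℂ} (hm : m.HasTemperateGrowth) (c : ℂ) (u : Dist n) :
    mulD (fun ξ => c * m ξ) u = c • mulD m u := by
  have hc : (fun _ : Spacetime n => c).HasTemperateGrowth := by fun_prop
  rw [← mulD_mulD hc hm, mulD, fourierMultiplierCLM_const]
  rfl

/-! ### Bounded families of operators -/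

/-- A family of operators, bounded in the weighted `L²` space of order `r` polynomially in the
gauge. -/
def OpBdd (G : Θ → ℝ) (r : ℝ) (T : Θ → Dist n →L[ℂ] Dist n) : Prop :=
  ∃ (C : ℝ) (N : ℕ), 0 ≤ C ∧ ∀ θ u K, Bd r u K → Bd r (T θ u) (C * G θ ^ N * K)

theorem PB.opBdd (hG : ∀ θ, 1 ≤ G θ) (r : ℝ) {m : Θ → Spacetime n → ℂ} (hm : PB G m) :
    OpBdd G r fun θ => mulD (m θ) := by
  obtain ⟨C, N, h0, hC⟩ := hm.comp_neg.muBdd hG (-r)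
  have hG0 : ∀ θ, 0 ≤ G θ := fun θ => zero_le_one.trans (hG θ)
  exact ⟨C, N, h0, fun θ u K hu => Bd.of_transpose (mul_nonneg h0 (pow_nonneg (hG0 θ) N))
    (mult_apply (hm.temperate θ) u) (hC θ) hu⟩

theorem smulLeft_bd {r K C : ℝ} {φ : Spacetime n → ℂ} (hφ : φ.HasTemperateGrowth) (hC : 0 ≤ C)
    (h : ∀ x, ‖φ x‖ ≤ C) {u : Dist n} (hu : Bd r u K) : Bd r (smulLeftCLM ℂ φ u) (C * K) := by
  refine Bd.of_transpose hC (smulLeftCLM_apply_apply φ u) (fun f => ?_) hu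
  refine wn_le_of_forall_norm_le hC fun x => ?_
  rw [SchwartzMap.smulLeftCLM_apply_apply hφ, norm_smul]
  gcongr
  exact h x

theorem PB.smulLeft_opBdd (r : ℝ) {m : Θ → Spacetime n → ℂ} (hm : PB G m) :
    OpBdd G r fun θ => smulLeftCLM ℂ (m θ) := by
  obtain ⟨C, N, h0, hC⟩ := hm.bound
  exact ⟨C, N, h0, fun θ u K hu => smulLeft_bd (hm.temperate θ)
    ((norm_nonneg _).trans (hC θ 0)) (hC θ) hu⟩

theorem OpBdd.comp {r : ℝ} (hG : ∀ θ, 1 ≤ G θ) {T T' : Θ → Dist n →L[ℂ] Dist n}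
    (h : OpBdd G r T) (h' : OpBdd G r T') : OpBdd G r (T * T') := by
  obtain ⟨C, N, h0, hC⟩ := h
  obtain ⟨C', N', h0', hC'⟩ := h'
  refine ⟨C * C', N + N', by positivity, fun θ u K hu => ?_⟩
  refine (hC θ _ _ (hC' θ u K hu)).mono (le_of_eq ?_)
  ring

theorem OpBdd.add {r : ℝ} (hG : ∀ θ, 1 ≤ G θ) {T T' : Θ → Dist n →L[ℂ] Dist n}
    (h : OpBdd G r T) (h' : OpBdd G r T') : OpBdd G r (T + T') := by
  obtain ⟨C, N, h0, hC⟩ := h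
  obtain ⟨C', N', h0', hC'⟩ := h'
  refine ⟨C + C' + (C + C'), N + N', by positivity, fun θ u K hu => ?_⟩
  have hb := exists_common_bound hG h0 h0' N N' θ
  have h1 := (hC θ u K hu).add (hC' θ u K hu)
  refine h1.mono ?_
  have := hu.1
  have hGp : 0 ≤ G θ := zero_le_one.trans (hG θ)
  have e1 := mul_le_mul_of_nonneg_right hb.1 this
  have e2 := mul_le_mul_of_nonneg_right hb.2 this
  linarith [add_mul (C + C') (C + C') (G θ ^ (N + N')), add_mul ((C + C') * G θ ^ (N + N')) ((C + C') * G θ ^ (N + N')) K]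

theorem OpBdd.smul {r : ℝ} {T : Θ → Dist n →L[ℂ] Dist n} (c : ℂ)
    (h : OpBdd G r T) : OpBdd G r (c • T) := by
  obtain ⟨C, N, h0, hC⟩ := h
  refine ⟨‖c‖ * C, N, by positivity, fun θ u K hu => ?_⟩
  refine ((hC θ u K hu).smul c).mono (le_of_eq ?_)
  ring

/-- The constant family of a generator operator. -/
abbrev cst (T : Fin (n + 1) → Dist n →L[ℂ] Dist n) (a : Fin (n + 1)) : Θ → Dist n →L[ℂ] Dist n :=
  fun _ => T a

theorem genIn_cst (D X : Fin (n + 1) → Dist n →L[ℂ] Dist n) (c : ℝ) (g : Gen n) (θ : Θ) :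
    genIn (cst D) (cst X) c g θ = genIn D X c g := by
  cases g <;> simp [genIn, cst]

theorem wordIn_cst (D X : Fin (n + 1) → Dist n →L[ℂ] Dist n) (c : ℝ) (w : List (Gen n)) (θ : Θ) :
    wordIn (cst D) (cst X) c w θ = wordIn D X c w := by
  induction w with
  | nil => rfl
  | cons g w ih => simp [genIn_cst, ih]

/-- Combinations of bounded operators and words are controlled by the words. The operators `S` and
`S'` define the norms before and after. -/
theorem bd_of_mem_leftSpan (hG : ∀ θ, 1 ≤ G θ) {r c : ℝ} {k : ℕ}
    {M : Submodule ℂ (Θ → Dist n →L[ℂ] Dist n)} (S S' : Dist n →L[ℂ] Dist n)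
    (hM : ∀ T ∈ M, ∃ (C : ℝ) (N : ℕ), 0 ≤ C ∧ ∀ θ u K, Bd r (S u) K →
      Bd r (S' (T θ u)) (C * G θ ^ N * K))
    {A : Θ → Dist n →L[ℂ] Dist n} (hA : A ∈ leftSpan (cst opD) (cst opX) c M k) :
    ∃ (C : ℝ) (N : ℕ), 0 ≤ C ∧ ∀ θ u K, (∀ w, wordOrder w ≤ k → Bd r (S (Wd c w u)) K) →
      Bd r (S' (A θ u)) (C * G θ ^ N * K) := by
  induction hA using Submodule.span_induction with
  | mem x hx =>
    obtain ⟨m, hm, v, hv, rfl⟩ := hx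
    obtain ⟨C, N, h0, hC⟩ := hM m hm
    refine ⟨C, N, h0, fun θ u K hu => ?_⟩
    rw [Pi.mul_apply, wordIn_cst]
    exact hC θ _ _ (hu v hv)
  | zero =>
    refine ⟨0, 0, le_rfl, fun θ u K hu => ?_⟩
    simpa using Bd.zero r
  | add x y _ _ hx hy =>
    obtain ⟨C, N, h0, hC⟩ := hx
    obtain ⟨C', N', h0', hC'⟩ := hy
    refine ⟨C + C' + (C + C'), N + N', by positivity, fun θ u K hu => ?_⟩
    have hb := exists_common_bound hG h0 h0' N N' θ
    have h1 := (hC θ u K hu).add (hC' θ u K hu)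
    rw [← map_add] at h1
    refine h1.mono ?_
    have := (hu [] (by simp)).1
    have e1 := mul_le_mul_of_nonneg_right hb.1 this
    have e2 := mul_le_mul_of_nonneg_right hb.2 this
    linarith [add_mul (C + C') (C + C') (G θ ^ (N + N')), add_mul ((C + C') * G θ ^ (N + N')) ((C + C') * G θ ^ (N + N')) K]
  | smul a x _ hx =>
    obtain ⟨C, N, h0, hC⟩ := hx
    refine ⟨‖a‖ * C, N, by positivity, fun θ u K hu => ?_⟩
    have h1 := (hC θ u K hu).smul a
    rw [← map_smul] at h1
    refine h1.mono (le_of_eq ?_)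
    ring

/-! ### Symbols built from the parabolic bracket -/

theorem parabolicBracket_pos (ξ : Spacetime n) : 0 < parabolicBracket ξ := by
  unfold parabolicBracket
  positivity

theorem one_le_parabolicBracket (ξ : Spacetime n) : 1 ≤ parabolicBracket ξ := by
  unfold parabolicBracket
  nlinarith [sq_nonneg (2 * Real.pi * ξ (Fin.last n)),
    sq_nonneg (∑ j : Fin n, (2 * Real.pi * ξ j.castSucc) ^ 2)]

/-- The real power `p^σ` of the parabolic bracket `p = 1 + |ζ|⁴ + τ²`. -/
def pp (σ : ℝ) (ξ : Spacetime n) : ℂ := ((parabolicBracket ξ ^ σ : ℝ) : ℂ)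

theorem hasTemperateGrowth_pp (σ : ℝ) : (pp σ : Spacetime n → ℂ).HasTemperateGrowth :=
  hasTemperateGrowth_parabolicBracket σ

theorem pp_mul (σ σ' : ℝ) (ξ : Spacetime n) : pp σ ξ * pp σ' ξ = pp (σ + σ') ξ := by
  simp only [pp]
  rw [← Complex.ofReal_mul, ← Real.rpow_add (parabolicBracket_pos ξ)]

theorem pp_zero (ξ : Spacetime n) : pp 0 ξ = 1 := by simp [pp]

theorem norm_pp (σ : ℝ) (ξ : Spacetime n) : ‖pp σ ξ‖ = parabolicBracket ξ ^ σ := by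
  rw [pp, Complex.norm_real, Real.norm_of_nonneg (Real.rpow_nonneg (parabolicBracket_pos ξ).le _)]

/-- The normalized frequencies `ζ_j p^{-1/4}` and `τ p^{-1/2}`. -/
def uSym (a : Fin (n + 1)) (ξ : Spacetime n) : ℂ :=
  ((2 * Real.pi * ξ a : ℝ) : ℂ) * pp (if a = Fin.last n then -1 / 2 else -1 / 4) ξ

/-- The logarithmic derivative of `p` in the direction `a`. -/
def qSym (a : Fin (n + 1)) (ξ : Spacetime n) : ℂ :=
  if a = Fin.last n then 4 * Real.pi * uSym (Fin.last n) ξ * pp (-1 / 4) ξ ^ 2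
  else 8 * Real.pi * (∑ j : Fin n, uSym j.castSucc ξ ^ 2) * uSym a ξ * pp (-1 / 4) ξ

/-- The imaginary power `p^{i M y}`. -/
def wSym (M y : ℝ) (ξ : Spacetime n) : ℂ :=
  Complex.exp (((M * y * Real.log (parabolicBracket ξ) : ℝ) : ℂ) * Complex.I)

theorem uSym_castSucc (j : Fin n) (ξ : Spacetime n) :
    uSym j.castSucc ξ = ((2 * Real.pi * ξ j.castSucc : ℝ) : ℂ) * pp (-1 / 4) ξ := by
  simp [uSym, Fin.castSucc_ne_last]

theorem uSym_last (ξ : Spacetime n) :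
    uSym (Fin.last n) ξ = ((2 * Real.pi * ξ (Fin.last n) : ℝ) : ℂ) * pp (-1 / 2) ξ := by
  simp [uSym]

theorem pp_pow (σ : ℝ) (k : ℕ) (ξ : Spacetime n) : pp σ ξ ^ k = pp (k * σ) ξ := by
  simp only [pp]
  rw [← Complex.ofReal_pow, ← Real.rpow_natCast, ← Real.rpow_mul (parabolicBracket_pos ξ).le,
    mul_comm σ]

theorem hasFDerivAt_coord (a : Fin (n + 1)) (ξ : Spacetime n) :
    HasFDerivAt (fun ξ : Spacetime n => 2 * Real.pi * ξ a)
      ((2 * Real.pi) • (EuclideanSpace.proj a : Spacetime n →L[ℝ] ℝ)) ξ :=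
  (EuclideanSpace.proj a : Spacetime n →L[ℝ] ℝ).hasFDerivAt.const_mul (2 * Real.pi)

/-- The logarithmic derivative of `p` is `qSym`, a polynomial in `uSym` and `p^{-1/4}`. -/
theorem exists_hasFDerivAt_parabolicBracket (ξ : Spacetime n) :
    ∃ L : Spacetime n →L[ℝ] ℝ, HasFDerivAt parabolicBracket L ξ ∧
      ∀ a, ((L (ev a) : ℝ) : ℂ) = qSym a ξ * parabolicBracket ξ := by
  have h1 := HasFDerivAt.fun_sum (u := Finset.univ)
    fun (j : Fin n) _ => (hasFDerivAt_coord j.castSucc ξ).pow 2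
  have h2 := ((h1.pow 2).const_add 1).add ((hasFDerivAt_coord (Fin.last n) ξ).pow 2)
  refine ⟨_, h2, fun a => ?_⟩
  have hp : (parabolicBracket ξ : ℂ) = pp 1 ξ := by simp [pp]
  refine Fin.lastCases ?_ (fun i => ?_) a
  · rw [qSym, if_pos rfl, uSym_last, hp, pp_pow]
    have : pp (-1 / 2) ξ * pp ((2 : ℕ) * (-1 / 4)) ξ * pp 1 ξ = 1 := by
      rw [pp_mul, pp_mul, ← pp_zero ξ]; norm_num
    have e : ∀ x : ℂ, 4 * Real.pi * (x * pp (-1 / 2) ξ) * pp ((2 : ℕ) * (-1 / 4)) ξ * pp 1 ξ =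
        4 * Real.pi * x := fun x => by
      linear_combination (4 * Real.pi * x) * this
    rw [e]
    simp [ev, (Fin.castSucc_ne_last _)]
    ring
  · rw [qSym, if_neg (Fin.castSucc_ne_last i), hp]
    simp only [uSym_castSucc, mul_pow, ← Finset.sum_mul]
    rw [pp_pow]
    have : pp ((2 : ℕ) * (-1 / 4)) ξ * pp (-1 / 4) ξ * pp (-1 / 4) ξ * pp 1 ξ = 1 := by
      rw [pp_mul, pp_mul, pp_mul, ← pp_zero ξ]; norm_num
    have e : ∀ S x : ℂ, 8 * Real.pi * (S * pp ((2 : ℕ) * (-1 / 4)) ξ) * (x * pp (-1 / 4) ξ) *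
        pp (-1 / 4) ξ * pp 1 ξ = 8 * Real.pi * S * x := fun S x => by
      linear_combination (8 * Real.pi * S * x) * this
    rw [e]
    simp [ev, Fin.castSucc_ne_last, (Fin.castSucc_ne_last _).symm]
    ring

theorem hasFDerivAt_comp_bracket {φ : ℝ → ℂ} {φ' : ℂ} {ξ : Spacetime n}
    (h : HasDerivAt φ φ' (parabolicBracket ξ)) :
    DifferentiableAt ℝ (fun ξ => φ (parabolicBracket ξ)) ξ ∧
      ∀ a, fderiv ℝ (fun ξ => φ (parabolicBracket ξ)) ξ (ev a) =
        qSym a ξ * parabolicBracket ξ * φ' := by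
  obtain ⟨L, hL, hL'⟩ := exists_hasFDerivAt_parabolicBracket ξ
  have h1 := h.hasFDerivAt.comp ξ hL
  refine ⟨h1.differentiableAt, fun a => ?_⟩
  refine (congrArg (fun L => L (ev a)) h1.fderiv).trans ?_
  rw [← hL']
  simp

theorem fderiv_pp (σ : ℝ) (ξ : Spacetime n) : DifferentiableAt ℝ (pp σ) ξ ∧
    ∀ a, fderiv ℝ (pp σ) ξ (ev a) = σ * qSym a ξ * pp σ ξ := by
  have hp := parabolicBracket_pos ξ
  have h0 := (Real.hasDerivAt_rpow_const (p := σ) (Or.inl hp.ne')).ofReal_comp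
  obtain ⟨h1, h2⟩ := hasFDerivAt_comp_bracket h0
  refine ⟨h1, fun a => (h2 a).trans ?_⟩
  rw [pp, show parabolicBracket ξ ^ σ = parabolicBracket ξ ^ (σ - 1) * parabolicBracket ξ by
    rw [← Real.rpow_add_one hp.ne', sub_add_cancel]]
  push_cast
  ring

theorem fderiv_wSym (M y : ℝ) (ξ : Spacetime n) : DifferentiableAt ℝ (wSym M y) ξ ∧
    ∀ a, fderiv ℝ (wSym M y) ξ (ev a) = (M * y * Complex.I) * qSym a ξ * wSym M y ξ := by
  have hp := parabolicBracket_pos ξ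
  have h0 := ((((Real.hasDerivAt_log hp.ne').const_mul (M * y)).ofReal_comp).mul_const
    Complex.I).cexp
  obtain ⟨h1, h2⟩ := hasFDerivAt_comp_bracket h0
  refine ⟨h1, fun a => (h2 a).trans ?_⟩
  have : (parabolicBracket ξ : ℂ) ≠ 0 := by exact_mod_cast hp.ne'
  rw [wSym]
  push_cast
  field_simp

theorem fderiv_uSym (a : Fin (n + 1)) (ξ : Spacetime n) : DifferentiableAt ℝ (uSym a) ξ ∧
    ∀ b, fderiv ℝ (uSym a) ξ (ev b) =
      (if a = b then 2 * Real.pi * pp (if a = Fin.last n then -1 / 2 else -1 / 4) ξ else 0) +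
      (if a = Fin.last n then -1 / 2 else -1 / 4) * qSym b ξ * uSym a ξ := by
  obtain ⟨h1, h2⟩ := fderiv_pp (if a = Fin.last n then -1 / 2 else -1 / 4) ξ
  have h3 := Complex.ofRealCLM.hasFDerivAt.comp ξ (hasFDerivAt_coord a ξ)
  have h4 := h3.mul h1.hasFDerivAt
  refine ⟨h4.differentiableAt, fun b => ?_⟩
  refine (congrArg (fun L => L (ev b)) h4.fderiv).trans ?_
  simp only [add_apply, ContinuousLinearMap.smul_apply, h2]
  by_cases hb : a = b
  · subst hb
    simp [uSym, ev]
    split_ifs <;> simp <;> ring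
  · simp [uSym, ev, hb]
    split_ifs <;> simp <;> ring

theorem norm_pp_neg_le {σ : ℝ} (h : σ ≤ 0) (ξ : Spacetime n) : ‖pp σ ξ‖ ≤ 1 := by
  rw [norm_pp]
  exact Real.rpow_le_one_of_one_le_of_nonpos (one_le_parabolicBracket ξ) h

/-- `|ζ_j|⁴` and `τ²` are at most `p`. -/
theorem norm_uSym_le (a : Fin (n + 1)) (ξ : Spacetime n) : ‖uSym a ξ‖ ≤ 1 := by
  have hp := parabolicBracket_pos ξ
  refine Fin.lastCases ?_ (fun i => ?_) a
  · rw [uSym_last, norm_mul, norm_pp, Complex.norm_real, Real.norm_eq_abs,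
      show (-1 / 2 : ℝ) = -(1 / 2) by norm_num, Real.rpow_neg hp.le, ← div_eq_mul_inv,
      div_le_one (by positivity), ← Real.sqrt_eq_rpow, ]
    refine Real.abs_le_sqrt ?_
    unfold parabolicBracket
    nlinarith [sq_nonneg (∑ j : Fin n, (2 * Real.pi * ξ j.castSucc) ^ 2)]
  · rw [uSym_castSucc, norm_mul, norm_pp, Complex.norm_real, Real.norm_eq_abs,
      show (-1 / 4 : ℝ) = -(1 / 4) by norm_num, Real.rpow_neg hp.le, ← div_eq_mul_inv,
      div_le_one (by positivity)]
    have h1 : (2 * Real.pi * ξ i.castSucc) ^ 2 ≤ ∑ j : Fin n, (2 * Real.pi * ξ j.castSucc) ^ 2 :=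
      Finset.single_le_sum (f := fun j : Fin n => (2 * Real.pi * ξ j.castSucc) ^ 2)
        (fun _ _ => sq_nonneg _) (Finset.mem_univ i)
    have h2 : |2 * Real.pi * ξ i.castSucc| ^ 4 ≤ parabolicBracket ξ := by
      unfold parabolicBracket
      have : |2 * Real.pi * ξ i.castSucc| ^ 4 = ((2 * Real.pi * ξ i.castSucc) ^ 2) ^ 2 := by
        rw [← sq_abs (2 * Real.pi * ξ i.castSucc)]; ring
      rw [this]
      nlinarith [sq_nonneg (2 * Real.pi * ξ (Fin.last n)),
        pow_le_pow_left₀ (sq_nonneg (2 * Real.pi * ξ i.castSucc)) h1 2]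
    calc |2 * Real.pi * ξ i.castSucc| = (|2 * Real.pi * ξ i.castSucc| ^ 4) ^ (1 / 4 : ℝ) := by
          rw [← Real.rpow_natCast, ← Real.rpow_mul (abs_nonneg _)]; norm_num
      _ ≤ _ := Real.rpow_le_rpow (by positivity) h2 (by norm_num)

theorem norm_wSym (M y : ℝ) (ξ : Spacetime n) : ‖wSym M y ξ‖ = 1 :=
  Complex.norm_exp_ofReal_mul_I _

/-- The generators of the algebra of symbols. The family index `y` is the imaginary exponent. -/
def symGens (n : ℕ) (M : ℝ) : Set (ℝ → Spacetime n → ℂ) :=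
  (Set.range fun (a : Fin (n + 1)) (_ : ℝ) => (uSym a : Spacetime n → ℂ)) ∪ {fun _ => pp (-1 / 4), wSym M, fun (y : ℝ) _ => (y : ℂ)}

theorem uSym_mem (M : ℝ) (a : Fin (n + 1)) : (fun _ => uSym a) ∈ Algebra.adjoin ℂ (symGens n M) :=
  Algebra.subset_adjoin (Or.inl ⟨a, rfl⟩)

theorem pp_mem (M : ℝ) : (fun _ => pp (-1 / 4)) ∈ Algebra.adjoin ℂ (symGens n M) :=
  Algebra.subset_adjoin (Or.inr (by simp))

theorem wSym_mem (M : ℝ) : wSym M ∈ Algebra.adjoin ℂ (symGens n M) :=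
  Algebra.subset_adjoin (Or.inr (by simp))

theorem ySym_mem (M : ℝ) : (fun (y : ℝ) _ => (y : ℂ)) ∈ Algebra.adjoin ℂ (symGens n M) :=
  Algebra.subset_adjoin (Or.inr (by simp))

theorem const_mem (M : ℝ) (c : ℂ) : (fun _ _ => c) ∈ Algebra.adjoin ℂ (symGens n M) :=
  Subalgebra.algebraMap_mem _ c

theorem qSym_mem (M : ℝ) (a : Fin (n + 1)) : (fun _ => qSym a) ∈ Algebra.adjoin ℂ (symGens n M) := by
  by_cases h : a = Fin.last n
  · have : (fun _ => qSym a : ℝ → Spacetime n → ℂ) = (fun _ _ => (4 * Real.pi : ℂ)) *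
        (fun _ => uSym (Fin.last n)) * (fun _ => pp (-1 / 4)) ^ 2 := by
      funext y ξ
      simp [qSym, h]
    rw [this]
    exact mul_mem (mul_mem (const_mem M _) (uSym_mem M _)) (pow_mem (pp_mem M) 2)
  · have : (fun _ => qSym a : ℝ → Spacetime n → ℂ) = (fun _ _ => (8 * Real.pi : ℂ)) *
        (∑ j : Fin n, (fun _ => uSym j.castSucc) ^ 2) * (fun _ => uSym a) *
          (fun _ => pp (-1 / 4)) := by
      funext y ξ
      simp [qSym, h]
    rw [this]
    exact mul_mem (mul_mem (mul_mem (const_mem M _) (sum_mem fun j _ => pow_mem (uSym_mem M _) 2))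
      (uSym_mem M _)) (pp_mem M)

/-- All symbols of the algebra have bounded derivatives. -/
theorem pb_of_mem_symAlg (M : ℝ) {m : ℝ → Spacetime n → ℂ}
    (hm : m ∈ Algebra.adjoin ℂ (symGens n M)) : PB (fun y => 1 + |y|) m := by
  refine PB.of_adjoin (fun y => by linarith [abs_nonneg y]) (symGens n M) ?_ ?_ ?_ m hm
  · rintro m (⟨a, rfl⟩ | rfl | rfl | rfl)
    · exact ⟨1, 0, zero_le_one, fun y ξ => by simpa using norm_uSym_le a ξ⟩
    · exact ⟨1, 0, zero_le_one, fun y ξ => by simpa using norm_pp_neg_le (by norm_num) ξ⟩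
    · exact ⟨1, 0, zero_le_one, fun y ξ => by simp [norm_wSym]⟩
    · exact ⟨1, 1, zero_le_one, fun y ξ => by simp⟩
  · rintro m (⟨a, rfl⟩ | rfl | rfl | rfl) y ξ
    · exact (fderiv_uSym a ξ).1
    · exact (fderiv_pp _ ξ).1
    · exact (fderiv_wSym M y ξ).1
    · exact differentiableAt_const _
  · rintro m (⟨a, rfl⟩ | rfl | rfl | rfl) b
    · have : pd b (fun _ : ℝ => uSym a) =
          (if a = b then (fun _ _ => (2 * Real.pi : ℂ)) *
            (fun _ => pp (if a = Fin.last n then -1 / 2 else -1 / 4)) else 0) +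
          (fun _ _ => (if a = Fin.last n then -1 / 2 else -1 / 4 : ℂ)) * (fun _ => qSym b) *
            (fun _ => uSym a) := by
        funext y ξ
        rw [pd, (fderiv_uSym a ξ).2]
        by_cases h : a = b <;> simp [h]
      rw [this]
      refine add_mem ?_ (mul_mem (mul_mem (const_mem M _) (qSym_mem M b)) (uSym_mem M a))
      split_ifs
      · refine mul_mem (const_mem M _) ?_
        have : (fun _ => pp (-1 / 2) : ℝ → Spacetime n → ℂ) = (fun _ => pp (-1 / 4)) ^ 2 := by
          funext y ξ
          simp only [Pi.pow_apply, pp_pow]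
          norm_num
        rw [this]
        exact pow_mem (pp_mem M) 2
      · exact mul_mem (const_mem M _) (pp_mem M)
      · exact zero_mem _
    · have : pd b (fun _ : ℝ => (pp (-1 / 4) : Spacetime n → ℂ)) =
          (fun _ _ => (-1 / 4 : ℂ)) * (fun _ => qSym b) * (fun _ => pp (-1 / 4)) := by
        funext y ξ
        rw [pd, (fderiv_pp _ ξ).2]
        simp
      rw [this]
      exact mul_mem (mul_mem (const_mem M _) (qSym_mem M b)) (pp_mem M)
    · have : pd b (wSym M : ℝ → Spacetime n → ℂ) =
          (fun _ _ => (M * Complex.I : ℂ)) * (fun (y : ℝ) _ => (y : ℂ)) * (fun _ => qSym b) *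
            wSym M := by
        funext y ξ
        rw [pd, (fderiv_wSym M y ξ).2]
        simp only [Pi.mul_apply]
        ring
      rw [this]
      exact mul_mem (mul_mem (mul_mem (const_mem M _) (ySym_mem M)) (qSym_mem M b)) (wSym_mem M)
    · have : pd b (fun (y : ℝ) (_ : Spacetime n) => (y : ℂ)) = 0 := by
        funext y ξ
        simp [pd]
      rw [this]
      exact zero_mem _

theorem PB.eval {Θ' : Type*} {G' : Θ' → ℝ} {m : Θ → Spacetime n → ℂ} (h : PB G m) (θ₀ : Θ)
    (hG : 0 ≤ G θ₀) : PB G' fun _ => m θ₀ := by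
  refine ⟨fun _ => h.1 θ₀, fun l => ?_⟩
  obtain ⟨C, N, h0, hC⟩ := h.2 l
  exact ⟨C * G θ₀ ^ N, 0, mul_nonneg h0 (pow_nonneg hG N), fun θ ξ => by simpa using hC θ₀ ξ⟩

theorem pb_qSym (a : Fin (n + 1)) : PB G fun _ => qSym a :=
  (pb_of_mem_symAlg 0 (qSym_mem 0 a)).eval 0 (by simp)

/-! ### Commuting words past parabolic multipliers -/

/-- The operator `Op(p^{s/4})` on distributions. -/
def Ts (s : ℝ) : Dist n →L[ℂ] Dist n := mulD (pp (s / 4))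

theorem Ts_Ts (s s' : ℝ) (u : Dist n) : Ts s (Ts s' u) = Ts (s + s') u := by
  rw [Ts, Ts, Ts, mulD_mulD (hasTemperateGrowth_pp _) (hasTemperateGrowth_pp _)]
  simp only [pp_mul, add_div]

theorem Ts_zero (u : Dist n) : Ts 0 u = u := by
  have : (pp (0 / 4) : Spacetime n → ℂ) = fun _ => 1 := by
    funext ξ
    rw [zero_div, pp_zero]
  rw [Ts, mulD, this, fourierMultiplierCLM_const]
  simp

theorem Ts_mulD {m : Spacetime n → ℂ} (hm : m.HasTemperateGrowth) (s : ℝ) (u : Dist n) :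
    Ts s (mulD m u) = mulD m (Ts s u) := by
  rw [Ts, mulD_mulD (hasTemperateGrowth_pp _) hm, mulD_mulD hm (hasTemperateGrowth_pp _)]
  simp only [mul_comm]

/-- The space of multipliers `m p^{s/4}` with `m` in a bounded family. -/
def multSub (n : ℕ) (hG : ∀ θ, 1 ≤ G θ) (s : ℝ) : Submodule ℂ (Θ → Dist n →L[ℂ] Dist n) where
  carrier := {T | ∃ m : Θ → Spacetime n → ℂ, PB G m ∧ T = fun θ => mulD (m θ) * Ts s}
  add_mem' := by
    rintro _ _ ⟨m, hm, rfl⟩ ⟨m', hm', rfl⟩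
    refine ⟨_, hm.add hG hm', ?_⟩
    ext1 θ
    ext1 u
    exact (mulD_add (hm.temperate θ) (hm'.temperate θ) _).symm
  zero_mem' := by
    refine ⟨_, PB.const 0, ?_⟩
    ext1 θ
    ext1 u
    simp [mulD, fourierMultiplierCLM_const]
  smul_mem' := by
    rintro c _ ⟨m, hm, rfl⟩
    refine ⟨_, (PB.const c).mul hG hm, ?_⟩
    ext1 θ
    ext1 u
    exact (mulD_const_mul (hm.temperate θ) c _).symm

theorem opX_mulD_Ts {m : Spacetime n → ℂ} (hm : ContDiff ℝ ∞ m) (hm0 : m.HasTemperateGrowth)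
    {m' : Spacetime n → ℂ} (hm0' : m'.HasTemperateGrowth) (s : ℝ) (a : Fin (n + 1))
    (hm' : ∀ ξ, m' ξ = fderiv ℝ m ξ (ev a) + (s / 4) * qSym a ξ * m ξ)
    (u : Dist n) : opX a (mulD m (Ts s u)) = mulD m (Ts s (opX a u)) +
      (Complex.I / (2 * Real.pi)) • mulD m' (Ts s u) := by
  have hp := hasTemperateGrowth_pp (n := n) (s / 4)
  have h1 : (fun ξ => m ξ * pp (s / 4) ξ).HasTemperateGrowth := hm0.mul hp
  have h2 : (fun ξ => m' ξ * pp (s / 4) ξ).HasTemperateGrowth := hm0'.mul hp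
  rw [Ts, mulD_mulD hm0 hp, mulD_mulD hm0 hp, mulD_mulD hm0' hp, opX_mulD h1 h2 a]
  intro ξ
  have h3 := ((hm.differentiable (by simp) ξ).hasFDerivAt.mul (fderiv_pp (s / 4) ξ).1.hasFDerivAt)
  refine (congrArg (fun L => L (ev a)) h3.fderiv).trans ?_
  simp [(fderiv_pp (s / 4) ξ).2, hm']
  ring

/-- Multipliers commute with the `D a`, and the commutator of `X a` with `m p^{s/4}` is `m'
p^{s/4}`, where `m'` has bounded derivatives since the logarithmic derivative of `p` has. -/
theorem multSub_gen (hG : ∀ θ, 1 ≤ G θ) (s c : ℝ) :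
    ∀ g, ∀ m ∈ multSub n hG s, genIn (cst opD) (cst opX) c g * m ∈
      leftSpan (cst opD) (cst opX) c (multSub n hG s) g.order := by
  refine gen_mul_mem_of_comm_D ?_ ?_
  · rintro a _ ⟨m, hm, rfl⟩
    ext1 θ
    ext1 u
    change opD a (mulD (m θ) (Ts s u)) = mulD (m θ) (Ts s (opD a u))
    rw [opD_mulD (hm.temperate θ), Ts, opD_mulD (hasTemperateGrowth_pp _)]
  · rintro a _ ⟨m, hm, rfl⟩
    have hm' : PB G fun θ ξ => pd a m θ ξ + (s / 4) * qSym a ξ * m θ ξ :=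
      (pb_pd hm a).add hG (((PB.const (s / 4 : ℂ)).mul hG (pb_qSym a)).mul hG hm)
    have : (cst opX a * (fun θ => mulD (m θ) * Ts s) - (fun θ => mulD (m θ) * Ts s) * cst opX a :
        Θ → Dist n →L[ℂ] Dist n) =
        (Complex.I / (2 * Real.pi) : ℂ) • (fun θ =>
          mulD (fun ξ => pd a m θ ξ + (s / 4) * qSym a ξ * m θ ξ) * Ts s :
            Θ → Dist n →L[ℂ] Dist n) := by
      ext1 θ
      ext1 u
      change opX a (mulD (m θ) (Ts s u)) - mulD (m θ) (Ts s (opX a u)) =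
        (Complex.I / (2 * Real.pi) : ℂ) • mulD _ (Ts s u)
      rw [opX_mulD_Ts (hm.1 θ) (hm.temperate θ) (hm'.temperate θ) s a fun ξ => rfl]
      simp
    rw [this]
    exact Submodule.smul_mem _ _ ⟨_, hm', rfl⟩

/-- All words of order at most `k`, applied to `u`, are bounded by `K` in `H_par^{s,r}`. -/
def WordBd (s r : ℝ) (k : ℕ) (c : ℝ) (u : Dist n) (K : ℝ) : Prop :=
  ∀ w, wordOrder w ≤ k → Bd r (Ts s (Wd c w u)) K

theorem WordBd.nonneg {s r : ℝ} {k : ℕ} {c : ℝ} {u : Dist n} {K : ℝ} (h : WordBd s r k c u K) :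
    0 ≤ K := (h [] (by simp)).1

theorem WordBd.mono {s r : ℝ} {k k' : ℕ} {c : ℝ} {u : Dist n} {K : ℝ} (h : WordBd s r k c u K)
    (hk : k' ≤ k) : WordBd s r k' c u K := fun w hw => h w (hw.trans hk)

theorem WordBd.mono_bound {s r : ℝ} {k : ℕ} {c : ℝ} {u : Dist n} {K K' : ℝ}
    (h : WordBd s r k c u K) (hK : K ≤ K') : WordBd s r k c u K' := fun w hw => (h w hw).mono hK

theorem WordBd.word {s r : ℝ} {k : ℕ} {c : ℝ} {u : Dist n} {K : ℝ} (h : WordBd s r k c u K)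
    {w : List (Gen n)} {k' : ℕ} (hw : wordOrder w + k' ≤ k) : WordBd s r k' c (Wd c w u) K := by
  intro v hv
  have := h (v ++ w) (by rw [wordOrder_append]; omega)
  rwa [Wd, wordIn_append] at this

/-- Multipliers `m p^{(s - s')/4}` map `H_par^{s,r}` with module regularity to `H_par^{s',r}` with
module regularity. -/
theorem PB.bd_word (hG : ∀ θ, 1 ≤ G θ) (s s' r c : ℝ) {m : Θ → Spacetime n → ℂ} (hm : PB G m)
    (w : List (Gen n)) : ∃ (C : ℝ) (N : ℕ), 0 ≤ C ∧ ∀ θ u K, WordBd s r (wordOrder w) c u K →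
      Bd r (Ts s' (Wd c w (mulD (m θ) (Ts (s - s') u)))) (C * G θ ^ N * K) := by
  have hM : ∀ T ∈ multSub n hG (s - s'), ∃ (C : ℝ) (N : ℕ), 0 ≤ C ∧ ∀ θ u K, Bd r (Ts s u) K →
      Bd r (Ts s' (T θ u)) (C * G θ ^ N * K) := by
    rintro _ ⟨m, hm, rfl⟩
    obtain ⟨C, N, h0, hC⟩ := hm.opBdd hG r
    refine ⟨C, N, h0, fun θ u K hu => ?_⟩
    change Bd r (Ts s' (mulD (m θ) (Ts (s - s') u))) _
    rw [Ts_mulD (hm.temperate θ), Ts_Ts, add_sub_cancel]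
    exact hC θ _ K hu
  obtain ⟨C, N, h0, hC⟩ := bd_of_mem_leftSpan hG (Ts s) (Ts s') hM
    (word_mul_mem_leftSpan (multSub_gen hG (s - s') c) w _ ⟨m, hm, rfl⟩)
  refine ⟨C, N, h0, fun θ u K hu => ?_⟩
  have := hC θ u K hu
  rwa [Pi.mul_apply, wordIn_cst] at this

/-- Every generator has order at least one, so the order of a word bounds its length. -/
theorem finite_words (k : ℕ) : {w : List (Gen n) | wordOrder w ≤ k}.Finite := by
  have hfin : Finite (Gen n) := Set.finite_univ_iff.1
    ((List.finite_toSet (gens n)).subset fun g _ => mem_gens g)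
  refine (List.finite_length_le (Gen n) k).subset fun w hw => ?_
  have h1 : ∀ w : List (Gen n), w.length ≤ wordOrder w := by
    intro w
    induction w with
    | nil => simp
    | cons g w ih =>
      have := g.one_le_order
      simp only [List.length_cons, wordOrder_cons]
      omega
  exact (h1 w).trans hw

theorem PB.wordBd (hG : ∀ θ, 1 ≤ G θ) (s s' r c : ℝ) {m : Θ → Spacetime n → ℂ} (hm : PB G m)
    (k : ℕ) : ∃ (C : ℝ) (N : ℕ), 0 ≤ C ∧ ∀ θ u K, WordBd s r k c u K →
      WordBd s' r k c (mulD (m θ) (Ts (s - s') u)) (C * G θ ^ N * K) := by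
  choose C N h0 hC using hm.bd_word hG s s' r c
  have hf := finite_words (n := n) k
  refine ⟨∑ w ∈ hf.toFinset, C w, ∑ w ∈ hf.toFinset, N w, Finset.sum_nonneg fun w _ => h0 w,
    fun θ u K hu w hw => ?_⟩
  have hw' : w ∈ hf.toFinset := by simpa using hw
  refine (hC w θ u K (hu.mono hw)).mono ?_
  have h1 : C w ≤ ∑ w ∈ hf.toFinset, C w := Finset.single_le_sum (fun w _ => h0 w) hw'
  have h2 : N w ≤ ∑ w ∈ hf.toFinset, N w := Finset.single_le_sum (f := N)
    (fun w _ => Nat.zero_le _) hw'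
  have h3 := pow_le_pow_right₀ (hG θ) h2
  have h4 := hu.nonneg
  have h5 := h0 w
  have h7 := h5.trans h1
  have h6 : 0 ≤ G θ ^ N w := pow_nonneg (zero_le_one.trans (hG θ)) _
  gcongr

/-- `Op(p^{(s - s')/4})` preserves module regularity. -/
theorem Ts_wordBd (s s' r c : ℝ) (k : ℕ) : ∃ C : ℝ, 0 ≤ C ∧ ∀ (u : Dist n) K, WordBd s r k c u K →
    WordBd s' r k c (Ts (s - s') u) (C * K) := by
  obtain ⟨C, N, h0, hC⟩ := (PB.const (n := n) (G := fun _ : Unit => 1) 1).wordBd (fun _ => le_rfl)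
    s s' r c k
  refine ⟨C, h0, fun u K hu => ?_⟩
  have := hC () u K hu
  simpa [mulD, fourierMultiplierCLM_const] using this

/-! ### Near-identity changes of variables -/

open Measure in
/-- Lebesgue measure is a multiple of the Hausdorff measure, for which the images under Lipschitz
and antilipschitz maps are controlled. -/
theorem exists_volume_eq_smul_hausdorff (n : ℕ) : ∃ c : ℝ≥0, ∀ s : Set (Spacetime n),
    volume s = c * μH[((n + 1 : ℕ) : ℝ)] s := by
  have : (μH[((n + 1 : ℕ) : ℝ)] : Measure (Spacetime n)).IsAddHaarMeasure := by
    have h := MeasureTheory.isAddHaarMeasure_hausdorffMeasure (E := Spacetime n)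
    rwa [finrank_euclideanSpace_fin] at h
  refine ⟨addHaarScalarFactor (volume : Measure (Spacetime n)) μH[((n + 1 : ℕ) : ℝ)], fun s => ?_⟩
  have h := isAddLeftInvariant_eq_smul (volume : Measure (Spacetime n)) μH[((n + 1 : ℕ) : ℝ)]
  have h2 := congrArg (fun μ => μ s) h
  exact h2

section NearIdentity

variable {η : Spacetime n → Spacetime n}

theorem antilipschitz_add_of_lipschitz (hη : LipschitzWith (1 / 2) η) :
    AntilipschitzWith 2 fun P => P + η P := by
  refine AntilipschitzWith.of_le_mul_dist fun P Q => ?_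
  have h1 := hη.dist_le_mul P Q
  rw [dist_eq_norm, dist_eq_norm] at *
  have h2 : P - Q = (P + η P - (Q + η Q)) - (η P - η Q) := by abel
  have h3 : ‖P - Q‖ ≤ ‖P + η P - (Q + η Q)‖ + ‖η P - η Q‖ := by
    conv_lhs => rw [h2]
    exact norm_sub_le _ _
  push_cast at *
  linarith

theorem lipschitz_add_of_lipschitz (hη : LipschitzWith (1 / 2) η) :
    LipschitzWith 2 fun P => P + η P :=
  (LipschitzWith.id.add hη).weaken (by
    rw [← NNReal.coe_le_coe]; push_cast; norm_num)

theorem surjective_add_of_lipschitz (hη : LipschitzWith (1 / 2) η) :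
    Function.Surjective fun P => P + η P := by
  intro Z
  have hc : ContractingWith (1 / 2) fun P => Z - η P := by
    refine ⟨by rw [← NNReal.coe_lt_coe]; push_cast; norm_num, ?_⟩
    refine LipschitzWith.of_dist_le_mul fun P Q => ?_
    rw [dist_sub_left]
    exact hη.dist_le_mul P Q
  refine ⟨hc.fixedPoint, ?_⟩
  have h := hc.fixedPoint_isFixedPt
  have h' : Z - η hc.fixedPoint = hc.fixedPoint := h
  exact (sub_eq_iff_eq_add.1 h').symm

theorem lintegral_add_lipschitz_le (hη : LipschitzWith (1 / 2) η) {F : Spacetime n → ℝ≥0∞}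
    (hF : Measurable F) :
    ∫⁻ P, F (P + η P) ≤ 2 ^ (n + 1) * ∫⁻ P, F P := by
  obtain ⟨c, hc⟩ := exists_volume_eq_smul_hausdorff n
  have hm : Measurable fun P => P + η P := (lipschitz_add_of_lipschitz hη).continuous.measurable
  have h : Measure.map (fun P => P + η P) volume ≤ (2 ^ (n + 1) : ℝ≥0∞) • volume := by
    refine Measure.le_iff.2 fun s hs => ?_
    rw [Measure.map_apply hm hs, Measure.smul_apply, smul_eq_mul, hc, hc, mul_left_comm]
    gcongr
    have := (antilipschitz_add_of_lipschitz hη).hausdorffMeasure_preimage_le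
      (d := ((n + 1 : ℕ) : ℝ)) (by positivity) s
    rw [ENNReal.rpow_natCast] at this
    exact_mod_cast this
  rw [← lintegral_map hF hm, ← smul_eq_mul, ← lintegral_smul_measure]
  exact lintegral_mono' h le_rfl

theorem lintegral_le_add_lipschitz (hη : LipschitzWith (1 / 2) η) {F : Spacetime n → ℝ≥0∞}
    (hF : Measurable F) :
    ∫⁻ P, F P ≤ 2 ^ (n + 1) * ∫⁻ P, F (P + η P) := by
  obtain ⟨c, hc⟩ := exists_volume_eq_smul_hausdorff n
  have hm : Measurable fun P => P + η P := (lipschitz_add_of_lipschitz hη).continuous.measurable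
  have h : volume ≤ (2 ^ (n + 1) : ℝ≥0∞) • Measure.map (fun P => P + η P) volume := by
    refine Measure.le_iff.2 fun s hs => ?_
    rw [Measure.smul_apply, Measure.map_apply hm hs, smul_eq_mul, hc, hc, mul_left_comm]
    gcongr
    have := (lipschitz_add_of_lipschitz hη).hausdorffMeasure_image_le
      (d := ((n + 1 : ℕ) : ℝ)) (by positivity) ((fun P => P + η P) ⁻¹' s)
    rw [ENNReal.rpow_natCast, Set.image_preimage_eq _ (surjective_add_of_lipschitz hη)] at this
    exact_mod_cast this
  rw [← lintegral_map hF hm, ← smul_eq_mul, ← lintegral_smul_measure]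
  exact lintegral_mono' h le_rfl

end NearIdentity

/-! ### Lens coordinates and anisotropic boxes -/

/-- The unit vector in the time direction. -/
abbrev et : Spacetime n := ev (Fin.last n)

/-- The projection to the space variables. -/
def sp : Spacetime n →L[ℝ] Spacetime n :=
  ContinuousLinearMap.id ℝ _ -
    (EuclideanSpace.proj (Fin.last n) : Spacetime n →L[ℝ] ℝ).smulRight et

theorem sp_apply (Y : Spacetime n) : sp Y = Y - Y (Fin.last n) • et := rfl

@[simp] theorem sp_last (Y : Spacetime n) : sp Y (Fin.last n) = 0 := by simp [sp_apply, ev]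

@[simp] theorem sp_castSucc (Y : Spacetime n) (j : Fin n) : sp Y j.castSucc = Y j.castSucc := by
  simp [sp_apply, ev, Fin.castSucc_ne_last]

theorem sp_add_smul (Y : Spacetime n) : sp Y + Y (Fin.last n) • et = Y := by simp [sp_apply]

theorem norm_sq_sp (Y : Spacetime n) : ‖sp Y‖ ^ 2 = ∑ j : Fin n, Y j.castSucc ^ 2 := by
  rw [norm_sq_eq_sum, Fin.sum_univ_castSucc]
  simp

theorem norm_sq_eq_sp (Y : Spacetime n) : ‖Y‖ ^ 2 = ‖sp Y‖ ^ 2 + Y (Fin.last n) ^ 2 := by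
  rw [norm_sq_sp, norm_sq_eq_sum, Fin.sum_univ_castSucc]

theorem norm_sp_le (Y : Spacetime n) : ‖sp Y‖ ≤ ‖Y‖ := by
  refine abs_le_of_sq_le_sq' (?_ : ‖sp Y‖ ^ 2 ≤ ‖Y‖ ^ 2) (norm_nonneg _) |>.2
  rw [norm_sq_eq_sp Y]
  nlinarith [sq_nonneg (Y (Fin.last n))]

theorem abs_coord_le (Y : Spacetime n) (a : Fin (n + 1)) : |Y a| ≤ ‖Y‖ := by
  simpa using PiLp.norm_apply_le Y a

/-- The lens map, `(y, τ) ↦ (y cosh τ, sinh τ)`. -/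
def lens (Y : Spacetime n) : Spacetime n :=
  Real.cosh (Y (Fin.last n)) • sp Y + Real.sinh (Y (Fin.last n)) • et

@[simp] theorem lens_last (Y : Spacetime n) :
    lens Y (Fin.last n) = Real.sinh (Y (Fin.last n)) := by simp [lens, ev]

@[simp] theorem lens_castSucc (Y : Spacetime n) (j : Fin n) :
    lens Y j.castSucc = Real.cosh (Y (Fin.last n)) * Y j.castSucc := by
  simp [lens, ev, Fin.castSucc_ne_last]

theorem one_add_norm_sq_lens (Y : Spacetime n) :
    1 + ‖lens Y‖ ^ 2 = Real.cosh (Y (Fin.last n)) ^ 2 * (1 + ‖sp Y‖ ^ 2) := by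
  rw [norm_sq_eq_sp (lens Y), norm_sq_sp, norm_sq_sp, lens_last]
  simp only [lens_castSucc, mul_pow, ← Finset.mul_sum]
  have := Real.cosh_sq (Y (Fin.last n))
  linear_combination -this

theorem contDiff_lens : ContDiff ℝ ∞ (lens : Spacetime n → Spacetime n) := by
  have h : ContDiff ℝ ∞ fun Y : Spacetime n => Y (Fin.last n) :=
    (EuclideanSpace.proj (Fin.last n) : Spacetime n →L[ℝ] ℝ).contDiff
  exact ((Real.contDiff_cosh.comp h).smul sp.contDiff).add
    ((Real.contDiff_sinh.comp h).smul contDiff_const)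

/-- The derivative of the lens map. -/
def lensDeriv (Y : Spacetime n) : Spacetime n →L[ℝ] Spacetime n :=
  Real.cosh (Y (Fin.last n)) • ContinuousLinearMap.id ℝ _ +
    (EuclideanSpace.proj (Fin.last n) : Spacetime n →L[ℝ] ℝ).smulRight
      (Real.sinh (Y (Fin.last n)) • sp Y)

theorem hasFDerivAt_lens (Y : Spacetime n) : HasFDerivAt lens (lensDeriv Y) Y := by
  have h : HasFDerivAt (fun Y : Spacetime n => Y (Fin.last n))
    (EuclideanSpace.proj (Fin.last n) : Spacetime n →L[ℝ] ℝ) Y :=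
    (EuclideanSpace.proj (Fin.last n) : Spacetime n →L[ℝ] ℝ).hasFDerivAt
  have h1 := ((Real.hasDerivAt_cosh _).comp_hasFDerivAt Y h).smul (sp (n := n)).hasFDerivAt
  have h2 := ((Real.hasDerivAt_sinh _).comp_hasFDerivAt Y h).smul_const (et : Spacetime n)
  refine (h1.add h2).congr_fderiv ?_
  ext1 v
  simp only [lensDeriv, add_apply, ContinuousLinearMap.smul_apply,
    ContinuousLinearMap.smulRight_apply, ContinuousLinearMap.id_apply, Function.comp_apply]
  conv_rhs => rw [← sp_add_smul v]
  simp [ev]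
  module

theorem det_lensDeriv (Y : Spacetime n) :
    (lensDeriv Y).det = Real.cosh (Y (Fin.last n)) ^ (n + 1) := by
  have hc := Real.cosh_pos (Y (Fin.last n))
  have h : (lensDeriv Y : Spacetime n →ₗ[ℝ] Spacetime n) = Real.cosh (Y (Fin.last n)) •
      LinearMap.transvection
        (EuclideanSpace.proj (Fin.last n) : Spacetime n →L[ℝ] ℝ).toLinearMap
        ((Real.sinh (Y (Fin.last n)) / Real.cosh (Y (Fin.last n))) • sp Y) := by
    ext1 v
    simp [lensDeriv, LinearMap.transvection.apply, smul_smul]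
    congr 1
    field_simp
  rw [ContinuousLinearMap.det, h, LinearMap.det_smul, LinearMap.transvection.det]
  simp

/-- The change of variables by the lens map. -/
theorem lintegral_lens (F : Spacetime n → ℝ≥0∞) :
    ∫⁻ Z, F Z = ∫⁻ Y : Spacetime n,
      ENNReal.ofReal (Real.cosh (Y (Fin.last n)) ^ (n + 1)) * F (lens Y) := by
  have hinj : Set.InjOn (lens : Spacetime n → Spacetime n) Set.univ := by
    intro Y _ Y' _ h
    have h1 : Y (Fin.last n) = Y' (Fin.last n) := by
      have := congrArg (fun Z : Spacetime n => Z (Fin.last n)) h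
      simpa using this
    ext a
    refine Fin.lastCases h1 (fun j => ?_) a
    have := congrArg (fun Z : Spacetime n => Z j.castSucc) h
    simp only [lens_castSucc, h1] at this
    exact mul_left_cancel₀ (Real.cosh_pos _).ne' this
  -- The inverse of the lens map is `(z, t) ↦ (z / √(1 + t²), arsinh t)`.
  have hsurj : (lens : Spacetime n → Spacetime n) '' Set.univ = Set.univ := by
    rw [Set.image_univ, Set.range_eq_univ]
    intro Z
    refine ⟨(Real.cosh (Real.arsinh (Z (Fin.last n))))⁻¹ • sp Z +
      Real.arsinh (Z (Fin.last n)) • et, ?_⟩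
    ext a
    refine Fin.lastCases ?_ (fun j => ?_) a
    · simp [ev]
    · have := (Real.cosh_pos (Real.arsinh (Z (Fin.last n)))).ne'
      rw [lens_castSucc]
      simp only [PiLp.add_apply, PiLp.smul_apply, sp_last, sp_castSucc, ev, smul_eq_mul,
        EuclideanSpace.single_apply, Fin.castSucc_ne_last, if_true, if_false, mul_zero, add_zero,
        zero_add, mul_one]
      rw [mul_inv_cancel_left₀ this]
  have h := lintegral_image_eq_lintegral_abs_det_fderiv_mul volume MeasurableSet.univ
    (fun Y _ => (hasFDerivAt_lens Y).hasFDerivWithinAt) hinj F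
  rw [hsurj, setLIntegral_univ, setLIntegral_univ] at h
  rw [h]
  congr 1
  ext Y
  rw [det_lensDeriv, abs_of_pos (pow_pos (Real.cosh_pos _) _)]

/-- The size `⟨y⟩` of the space part of a point. -/
def jb (P : Spacetime n) : ℝ := Real.sqrt (1 + ‖sp P‖ ^ 2)

theorem jb_sq (P : Spacetime n) : jb P ^ 2 = 1 + ‖sp P‖ ^ 2 := Real.sq_sqrt (by positivity)

theorem one_le_jb (P : Spacetime n) : 1 ≤ jb P := by
  rw [jb, Real.one_le_sqrt]
  nlinarith [sq_nonneg ‖sp P‖]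

theorem jb_pos (P : Spacetime n) : 0 < jb P := zero_lt_one.trans_le (one_le_jb P)

theorem norm_sp_le_jb (P : Spacetime n) : ‖sp P‖ ≤ jb P :=
  Real.le_sqrt_of_sq_le (by linarith)

theorem abs_jb_sub_le (P Q : Spacetime n) : |jb P - jb Q| ≤ ‖P - Q‖ := by
  have h1 : |(jb P - jb Q) * (jb P + jb Q)| ≤ ‖P - Q‖ * (jb P + jb Q) := by
    have : (jb P - jb Q) * (jb P + jb Q) = (‖sp P‖ - ‖sp Q‖) * (‖sp P‖ + ‖sp Q‖) := by
      nlinarith [jb_sq P, jb_sq Q]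
    rw [this, abs_mul, abs_of_nonneg (by positivity : 0 ≤ ‖sp P‖ + ‖sp Q‖)]
    have h2 := abs_norm_sub_norm_le (sp P) (sp Q)
    rw [← map_sub] at h2
    have h3 := h2.trans (norm_sp_le _)
    have h4 := norm_sp_le_jb P
    have h5 := norm_sp_le_jb Q
    have : 0 ≤ ‖sp P‖ + ‖sp Q‖ := by positivity
    gcongr
  have h2 : 0 < jb P + jb Q := add_pos (jb_pos P) (jb_pos Q)
  rw [abs_mul, abs_of_pos h2] at h1
  exact le_of_mul_le_mul_right h1 h2

theorem continuous_jb : Continuous (jb : Spacetime n → ℝ) := by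
  unfold jb
  fun_prop

/-- The scale `δ = 1 / ⟨y⟩`. -/
def dl (P : Spacetime n) : ℝ := (jb P)⁻¹

theorem dl_pos (P : Spacetime n) : 0 < dl P := inv_pos.2 (jb_pos P)

theorem dl_le_one (P : Spacetime n) : dl P ≤ 1 := inv_le_one_of_one_le₀ (one_le_jb P)

theorem dl_mul_jb (P : Spacetime n) : dl P * jb P = 1 := inv_mul_cancel₀ (jb_pos P).ne'

/-- The normalized space part `b = y / ⟨y⟩`. -/
def bv (P : Spacetime n) : Spacetime n := dl P • sp P

theorem norm_sq_bv (P : Spacetime n) : ‖bv P‖ ^ 2 = 1 - dl P ^ 2 := by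
  rw [bv, norm_smul, mul_pow, Real.norm_eq_abs, sq_abs]
  have h1 := dl_mul_jb P
  have h2 := jb_sq P
  have h3 : dl P ^ 2 * jb P ^ 2 = 1 := by rw [← mul_pow, h1, one_pow]
  rw [h2] at h3
  linarith

theorem norm_bv_le (P : Spacetime n) : ‖bv P‖ ≤ 1 := by
  have := norm_sq_bv P
  nlinarith [sq_nonneg (dl P), norm_nonneg (bv P)]

@[simp] theorem bv_last (P : Spacetime n) : bv P (Fin.last n) = 0 := by simp [bv]

theorem abs_dl_sub_le (P Q : Spacetime n) : |dl P - dl Q| ≤ dl P * ‖P - Q‖ := by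
  have h : dl P - dl Q = dl P * (dl Q * (jb Q - jb P)) := by
    have h1 := dl_mul_jb P
    have h2 := dl_mul_jb Q
    linear_combination (dl Q) * h1 - (dl P) * h2
  rw [h, abs_mul, abs_mul, abs_of_pos (dl_pos P), abs_of_pos (dl_pos Q), abs_sub_comm]
  have h1 := abs_jb_sub_le P Q
  have h2 := dl_le_one Q
  have h3 := dl_pos P
  have h4 := dl_pos Q
  calc dl P * (dl Q * |jb P - jb Q|) ≤ dl P * (1 * ‖P - Q‖) := by gcongr
    _ = _ := by ring

theorem norm_bv_sub_le (P Q : Spacetime n) : ‖bv P - bv Q‖ ≤ 2 * ‖P - Q‖ := by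
  have h : bv P - bv Q = dl P • (sp (P - Q)) + (dl P - dl Q) • sp Q := by
    simp only [bv, map_sub]
    module
  have h1 : ‖dl P • (sp (P - Q))‖ ≤ 1 * ‖P - Q‖ := by
    rw [norm_smul, Real.norm_of_nonneg (dl_pos P).le]
    exact mul_le_mul (dl_le_one P) (norm_sp_le _) (norm_nonneg _) zero_le_one
  have h2 : ‖(dl P - dl Q) • sp Q‖ ≤ 1 * ‖P - Q‖ := by
    rw [norm_smul, Real.norm_eq_abs, abs_sub_comm]
    have e1 := abs_dl_sub_le Q P
    have e2 := norm_sp_le_jb Q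
    have e3 := dl_mul_jb Q
    rw [norm_sub_rev] at e1
    calc |dl Q - dl P| * ‖sp Q‖ ≤ (dl Q * ‖P - Q‖) * jb Q := by
          have := dl_pos Q
          gcongr
      _ = (dl Q * jb Q) * ‖P - Q‖ := by ring
      _ = _ := by rw [e3]
  rw [h]
  refine (norm_add_le _ _).trans ?_
  linarith

/-- The linear part of the parametrization of the box around `P`: space vectors are contracted in
the direction of `P`, and time is contracted by `δ²`. -/
def boxL (P : Spacetime n) : Spacetime n →L[ℝ] Spacetime n :=
  ContinuousLinearMap.id ℝ _ - (innerSL ℝ (bv P)).smulRight (bv P) -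
    (1 - dl P ^ 2) • (EuclideanSpace.proj (Fin.last n) : Spacetime n →L[ℝ] ℝ).smulRight et

theorem boxL_apply (P x : Spacetime n) :
    boxL P x = x - inner ℝ (bv P) x • bv P - (1 - dl P ^ 2) • x (Fin.last n) • et := rfl

/-- One factor `δ²` comes from the direction of `P`, the other one from time. Both rank-one
perturbations of the identity are transvections in the sense of `LinearMap.transvection`. -/
theorem det_boxL (P : Spacetime n) : (boxL P).det = dl P ^ 4 := by
  have h : (boxL P : Spacetime n →ₗ[ℝ] Spacetime n) =
      (LinearMap.transvection (-(innerSL ℝ (bv P))).toLinearMap (bv P)) ∘ₗ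
      (LinearMap.transvection ((-(1 - dl P ^ 2)) •
        (EuclideanSpace.proj (Fin.last n) : Spacetime n →L[ℝ] ℝ)).toLinearMap et) := by
    ext1 v
    have : inner ℝ (bv P) (et : Spacetime n) = 0 := by rw [inner_ev, bv_last]
    simp [boxL_apply, LinearMap.transvection.apply, inner_add_right, inner_smul_right, this]
    module
  rw [ContinuousLinearMap.det, h, LinearMap.det_comp, LinearMap.transvection.det,
    LinearMap.transvection.det]
  have h1 : inner ℝ (bv P) (bv P) = 1 - dl P ^ 2 := by
    rw [real_inner_self_eq_norm_sq, norm_sq_bv]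
  have h2 : (EuclideanSpace.proj (Fin.last n) : Spacetime n →L[ℝ] ℝ) et = 1 := by simp [ev]
  simp only [ContinuousLinearMap.coe_coe, neg_apply, innerSL_apply_apply, h1, h2,
    ContinuousLinearMap.smul_apply, smul_eq_mul]
  ring

theorem lintegral_boxL (P : Spacetime n) {F : Spacetime n → ℝ≥0∞} (hF : Measurable F) :
    ∫⁻ x, F (P + boxL P x) = ENNReal.ofReal (jb P ^ 4) * ∫⁻ Y, F Y := by
  have hd : LinearMap.det (boxL P : Spacetime n →ₗ[ℝ] Spacetime n) = dl P ^ 4 := det_boxL P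
  have hd0 : dl P ^ 4 ≠ 0 := (pow_pos (dl_pos P) 4).ne'
  have h := Measure.map_linearMap_addHaar_eq_smul_addHaar (volume : Measure (Spacetime n))
    (f := (boxL P : Spacetime n →ₗ[ℝ] Spacetime n)) (by rw [hd]; exact hd0)
  have hF' : Measurable fun Y => F (P + Y) := hF.comp (measurable_const_add P)
  have h2 := lintegral_map (μ := volume) hF' (boxL P).continuous.measurable
  have h3 : Measure.map (⇑(boxL P)) volume = ENNReal.ofReal |(dl P ^ 4)⁻¹| •
      (volume : Measure (Spacetime n)) := by
    rw [← hd]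
    exact h
  rw [← h2, h3, lintegral_smul_measure, smul_eq_mul, lintegral_add_left_eq_self]
  congr 2
  rw [dl, inv_pow, inv_inv, abs_of_pos (pow_pos (jb_pos P) 4)]

/-- The shape of the box depends on its centre in a Lipschitz way, so that `P ↦ P + boxL P x` is a
near-identity change of variables for small `x`. -/
theorem norm_boxL_sub_le (P Q x : Spacetime n) :
    ‖boxL P x - boxL Q x‖ ≤ 6 * ‖x‖ * ‖P - Q‖ := by
  have h : boxL P x - boxL Q x = -(inner ℝ (bv P) x • (bv P - bv Q)) -
      inner ℝ (bv P - bv Q) x • bv Q + ((dl P - dl Q) * (dl P + dl Q) * x (Fin.last n)) • et := by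
    simp only [boxL_apply, inner_sub_left]
    module
  have h1 := norm_bv_sub_le P Q
  have hx := norm_nonneg x
  have e1 : ‖inner ℝ (bv P) x • (bv P - bv Q)‖ ≤ ‖x‖ * (2 * ‖P - Q‖) := by
    rw [norm_smul]
    have := (norm_inner_le_norm (𝕜 := ℝ) (bv P) x).trans
      (mul_le_mul_of_nonneg_right (norm_bv_le P) hx)
    rw [one_mul] at this
    gcongr
  have e2 : ‖inner ℝ (bv P - bv Q) x • bv Q‖ ≤ (2 * ‖P - Q‖) * ‖x‖ := by
    rw [norm_smul]
    have := (norm_inner_le_norm (𝕜 := ℝ) (bv P - bv Q) x).trans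
      (mul_le_mul_of_nonneg_right h1 hx)
    have h3 := norm_bv_le Q
    calc _ ≤ (2 * ‖P - Q‖ * ‖x‖) * 1 := by gcongr
      _ = _ := mul_one _
  have e3 : ‖((dl P - dl Q) * (dl P + dl Q) * x (Fin.last n)) • (et : Spacetime n)‖ ≤
      ‖P - Q‖ * 2 * ‖x‖ := by
    rw [norm_smul]
    have h2 := abs_dl_sub_le P Q
    have h3 := dl_le_one P
    have h4 := dl_le_one Q
    have h5 := dl_pos P
    have h6 := dl_pos Q
    have h7 := abs_coord_le x (Fin.last n)
    have h8 : |dl P - dl Q| ≤ ‖P - Q‖ := h2.trans (mul_le_of_le_one_left (norm_nonneg _) h3)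
    have h9 : |dl P + dl Q| ≤ 2 := by rw [abs_of_pos (by positivity)]; linarith
    have h10 : ‖(et : Spacetime n)‖ = 1 := by simp [ev]
    rw [h10, mul_one, norm_mul, norm_mul]
    simp only [Real.norm_eq_abs]
    gcongr
  rw [h]
  refine (norm_add_le _ _).trans ?_
  have := norm_sub_le (-(inner ℝ (bv P) x • (bv P - bv Q))) (inner ℝ (bv P - bv Q) x • bv Q)
  rw [norm_neg] at this
  linarith

theorem norm_boxL_le (P x : Spacetime n) : ‖boxL P x‖ ≤ 3 * ‖x‖ := by
  have e1 : ‖inner ℝ (bv P) x • bv P‖ ≤ ‖x‖ := by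
    rw [norm_smul]
    have := (norm_inner_le_norm (𝕜 := ℝ) (bv P) x).trans
      (mul_le_mul_of_nonneg_right (norm_bv_le P) (norm_nonneg x))
    rw [one_mul] at this
    calc _ ≤ ‖x‖ * 1 := by
          have := norm_bv_le P
          gcongr
      _ = _ := mul_one _
  have e2 : ‖(1 - dl P ^ 2) • x (Fin.last n) • (et : Spacetime n)‖ ≤ ‖x‖ := by
    have h10 : ‖(et : Spacetime n)‖ = 1 := by simp [ev]
    rw [norm_smul, norm_smul, h10, mul_one]
    have h1 := dl_pos P
    have h2 := dl_le_one P
    have h3 : |1 - dl P ^ 2| ≤ 1 := by rw [abs_le]; constructor <;> nlinarith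
    have h7 := abs_coord_le x (Fin.last n)
    simp only [Real.norm_eq_abs]
    calc _ ≤ 1 * ‖x‖ := by gcongr
      _ = _ := one_mul _
  rw [boxL_apply]
  refine (norm_sub_le _ _).trans ?_
  have := norm_sub_le x (inner ℝ (bv P) x • bv P)
  linarith

theorem lipschitz_boxL {x : Spacetime n} (hx : ‖x‖ ≤ 1 / 12) :
    LipschitzWith (1 / 2) fun P => boxL P x := by
  refine LipschitzWith.of_dist_le_mul fun P Q => ?_
  rw [dist_eq_norm, dist_eq_norm]
  refine (norm_boxL_sub_le P Q x).trans ?_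
  push_cast
  have := norm_nonneg (P - Q)
  nlinarith

/-- The weight `⟨y⟩^α (cosh τ)^β` in lens coordinates. -/
def lw (α β : ℝ) (P : Spacetime n) : ℝ := jb P ^ α * Real.cosh (P (Fin.last n)) ^ β

theorem lw_pos (α β : ℝ) (P : Spacetime n) : 0 < lw α β P :=
  mul_pos (Real.rpow_pos_of_pos (jb_pos P) _) (Real.rpow_pos_of_pos (Real.cosh_pos _) _)

theorem continuous_lw (α β : ℝ) : Continuous (lw α β : Spacetime n → ℝ) := by
  refine (continuous_jb.rpow_const fun P => Or.inl (jb_pos P).ne').mul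
    (Continuous.rpow_const ?_ fun P => Or.inl (Real.cosh_pos _).ne')
  fun_prop

theorem lw_mul (α β α' β' : ℝ) (P : Spacetime n) :
    lw α β P * lw α' β' P = lw (α + α') (β + β') P := by
  simp only [lw]
  rw [Real.rpow_add (jb_pos P), Real.rpow_add (Real.cosh_pos _)]
  ring

theorem rpow_le_of_comparable {a b : ℝ} (ha : 0 < a) (hb : 0 < b) (h1 : a ≤ 2 * b) (h2 : b ≤ 2 * a)
    (α : ℝ) : a ^ α ≤ 2 ^ |α| * b ^ α := by
  rcases le_total 0 α with h | h
  · rw [abs_of_nonneg h, ← Real.mul_rpow (by norm_num) hb.le]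
    exact Real.rpow_le_rpow ha.le h1 h
  · rw [abs_of_nonpos h, Real.rpow_neg (by norm_num), ← Real.inv_rpow (by norm_num),
      ← Real.mul_rpow (by norm_num) hb.le]
    exact Real.rpow_le_rpow_of_nonpos (by positivity) (by linarith) h

theorem cosh_le_of_abs_sub_le {x y : ℝ} (h : |x - y| ≤ 1 / 4) : Real.cosh x ≤ 2 * Real.cosh y := by
  have h1 : Real.cosh x = Real.cosh (y + (x - y)) := by ring_nf
  have h2 : Real.cosh (x - y) + |Real.sinh (x - y)| ≤ 2 := by
    have e : Real.cosh (x - y) + |Real.sinh (x - y)| = Real.exp |x - y| := by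
      rw [Real.abs_sinh, ← Real.cosh_abs, Real.cosh_add_sinh]
    rw [e]
    calc Real.exp |x - y| ≤ Real.exp (1 / 4) := Real.exp_le_exp.2 h
      _ ≤ 2 := by
        have := Real.exp_one_lt_d9
        have h4 : Real.exp (1 / 4) ^ 4 = Real.exp 1 := by rw [← Real.exp_nat_mul]; norm_num
        by_contra! hc
        have : (2 : ℝ) ^ 4 < Real.exp (1 / 4) ^ 4 := by gcongr
        linarith
  have h3 : |Real.sinh y| ≤ Real.cosh y := by
    have := Real.cosh_sq y
    exact abs_le_of_sq_le_sq (by linarith) (Real.cosh_pos y).le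
  rw [h1, Real.cosh_add]
  have h4 : Real.sinh y * Real.sinh (x - y) ≤ Real.cosh y * |Real.sinh (x - y)| := by
    refine (le_abs_self _).trans ?_
    rw [abs_mul]
    gcongr
  have := Real.cosh_pos y
  nlinarith

/-- The weights are comparable throughout a box. -/
theorem lw_le_of_box (α β : ℝ) {P Q : Spacetime n} (h : ‖P - Q‖ ≤ 1 / 4) :
    lw α β P ≤ 2 ^ (|α| + |β|) * lw α β Q := by
  have h1 := (abs_le.1 ((abs_jb_sub_le P Q).trans h))
  have hP := one_le_jb P
  have hQ := one_le_jb Q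
  have h2 : |P (Fin.last n) - Q (Fin.last n)| ≤ 1 / 4 := by
    refine le_trans ?_ h
    simpa using abs_coord_le (P - Q) (Fin.last n)
  have e1 := rpow_le_of_comparable (jb_pos P) (jb_pos Q) (by linarith) (by linarith) α
  have e2 := rpow_le_of_comparable (Real.cosh_pos _) (Real.cosh_pos _) (cosh_le_of_abs_sub_le h2)
    (cosh_le_of_abs_sub_le (by rwa [abs_sub_comm])) β
  rw [lw, lw, Real.rpow_add (by norm_num)]
  calc _ ≤ (2 ^ |α| * jb Q ^ α) * (2 ^ |β| * Real.cosh (Q (Fin.last n)) ^ β) := by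
        have := Real.rpow_pos_of_pos (jb_pos P) α
        have := Real.rpow_pos_of_pos (jb_pos Q) α
        have := Real.rpow_pos_of_pos (Real.cosh_pos (P (Fin.last n))) β
        gcongr
    _ = _ := by ring

theorem norm_box_sub_le {x : Spacetime n} (hx : ‖x‖ ≤ 1 / 12) (P : Spacetime n) :
    ‖P + boxL P x - P‖ ≤ 1 / 4 := by
  rw [add_sub_cancel_left]
  refine (norm_boxL_le P x).trans ?_
  linarith

/-! ### Words on Schwartz functions -/

/-- The operator `D_a = -i ∂_a` on Schwartz functions. -/
def opDs (a : Fin (n + 1)) : Sch n →L[ℂ] Sch n := (-Complex.I) • lineDerivOpCLM ℂ (Sch n) (ev a)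

theorem opDs_apply (a : Fin (n + 1)) (f : Sch n) (x : Spacetime n) :
    opDs a f x = -Complex.I * fderiv ℝ f x (ev a) := by
  change (-Complex.I) • (∂_{ev a} f : Sch n) x = _
  rw [SchwartzMap.lineDerivOp_apply_eq_fderiv, smul_eq_mul]

/-- A word in the generators, acting on Schwartz functions. -/
abbrev Ws (c : ℝ) (w : List (Gen n)) : Sch n →L[ℂ] Sch n := wordIn opDs XS c w

/-- A generator, acting on Schwartz functions. -/
abbrev Gs (c : ℝ) (g : Gen n) : Sch n →L[ℂ] Sch n := genIn opDs XS c g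

theorem toD_opDs (a : Fin (n + 1)) (f : Sch n) : toD (opDs a f) = opD a (toD f) := by
  change toD ((-Complex.I) • ∂_{ev a} f) = (-Complex.I) • ∂_{ev a} (toD f)
  rw [map_smul, lineDerivOp_toTemperedDistributionCLM_eq]

theorem toD_XS (a : Fin (n + 1)) (f : Sch n) : toD (XS a f) = opX a (toD f) := by
  ext φ
  rw [opX_apply, toD_apply, toD_apply]
  congr 1
  ext x
  rw [XS_apply, XS_apply]
  ring

theorem toD_Gs (c : ℝ) (g : Gen n) (f : Sch n) : toD (Gs c g f) = genIn opD opX c g (toD f) := by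
  cases g <;> simp [genIn, toD_opDs, toD_XS]

theorem toD_Ws (c : ℝ) (w : List (Gen n)) (f : Sch n) : toD (Ws c w f) = Wd c w (toD f) := by
  induction w with
  | nil => rfl
  | cons g w ih =>
    rw [Ws, Wd, wordIn_cons, wordIn_cons, ContinuousLinearMap.mul_apply,
      ContinuousLinearMap.mul_apply, toD_Gs, ih]

theorem Ws_cons (c : ℝ) (g : Gen n) (w : List (Gen n)) (f : Sch n) :
    Ws c (g :: w) f = Gs c g (Ws c w f) := by
  rw [Ws, wordIn_cons, ContinuousLinearMap.mul_apply]

theorem Gs_Dz (c : ℝ) (j : Fin n) (f : Sch n) (x : Spacetime n) :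
    Gs c (.Dz j) f x = opDs j.castSucc f x := rfl

theorem Gs_Dt (c : ℝ) (f : Sch n) (x : Spacetime n) :
    Gs c .Dt f x = opDs (Fin.last n) f x := rfl

theorem Gs_rot (c : ℝ) (i j : Fin n) (f : Sch n) (x : Spacetime n) :
    Gs c (.rot i j) f x =
      x i.castSucc * opDs j.castSucc f x - x j.castSucc * opDs i.castSucc f x := by
  change XS i.castSucc (opDs j.castSucc f) x - XS j.castSucc (opDs i.castSucc f) x = _
  rw [XS_apply, XS_apply]

theorem Gs_gal (c : ℝ) (j : Fin n) (f : Sch n) (x : Spacetime n) :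
    Gs c (.gal j) f x =
      x (Fin.last n) * opDs j.castSucc f x - (c / 2) * (x j.castSucc * f x) := by
  change XS (Fin.last n) (opDs j.castSucc f) x - ((c / 2 : ℝ) : ℂ) * (XS j.castSucc f x) = _
  rw [XS_apply, XS_apply]
  push_cast
  ring

theorem Gs_scal (c : ℝ) (f : Sch n) (x : Spacetime n) :
    Gs c .scal f x = 2 * (x (Fin.last n) * opDs (Fin.last n) f x) +
      ∑ j : Fin n, x j.castSucc * opDs j.castSucc f x := by
  have h : ∀ (F : Fin n → Sch n →L[ℂ] Sch n), (∑ j, F j) f x = ∑ j, F j f x := fun F => by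
    rw [sum_apply, sum_apply]
  change 2 * XS (Fin.last n) (opDs (Fin.last n) f) x +
    (∑ j : Fin n, XS j.castSucc * opDs j.castSucc) f x = _
  rw [XS_apply, h]
  congr 1
  refine Finset.sum_congr rfl fun j _ => ?_
  rw [ContinuousLinearMap.mul_apply, XS_apply]

theorem opDs_mulS (a : Fin (n + 1)) (f g : Sch n) :
    opDs a (mulS f g) = mulS (opDs a f) g + mulS f (opDs a g) := by
  ext x
  have hfun : ⇑(mulS f g) = fun x => f x * g x := by ext x; simp
  rw [add_apply, mulS_apply, mulS_apply, opDs_apply, opDs_apply, opDs_apply, hfun,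
    fderiv_fun_mul (SchwartzMap.differentiableAt _) (SchwartzMap.differentiableAt _)]
  simp
  ring

/-- The generators act as derivations on products if the parameters add: the only term of order
zero, `-(c / 2) z_j`, is additive in the parameter. -/
theorem Gs_mulS (c₁ c₂ : ℝ) (g : Gen n) (f h : Sch n) :
    Gs (c₁ + c₂) g (mulS f h) = mulS (Gs c₁ g f) h + mulS f (Gs c₂ g h) := by
  ext x
  rw [add_apply, mulS_apply, mulS_apply]
  cases g with
  | Dz j => simp only [Gs_Dz, opDs_mulS, add_apply, mulS_apply]
  | Dt => simp only [Gs_Dt, opDs_mulS, add_apply, mulS_apply]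
  | rot i j => simp only [Gs_rot, opDs_mulS, add_apply, mulS_apply]; ring
  | gal j => simp only [Gs_gal, opDs_mulS, add_apply, mulS_apply]; push_cast; ring
  | scal =>
    simp only [Gs_scal, opDs_mulS, add_apply, mulS_apply, mul_add, add_mul, Finset.sum_add_distrib,
      Finset.mul_sum, Finset.sum_mul, mul_assoc]
    have e1 : ∑ j : Fin n, (x j.castSucc : ℂ) * (f x * opDs j.castSucc h x) =
        ∑ j : Fin n, f x * ((x j.castSucc : ℂ) * opDs j.castSucc h x) :=
      Finset.sum_congr rfl fun j _ => by ring
    rw [e1]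
    ring

/-- The bilinear expressions `(f, g) ↦ V f · W g` with words of total order at most `k`. -/
def leibSpan (c₁ c₂ : ℝ) (k : ℕ) : Submodule ℂ (Sch n → Sch n → Sch n) :=
  Submodule.span ℂ {B | ∃ v w, wordOrder v + wordOrder w ≤ k ∧
    B = fun f g => mulS (Ws c₁ v f) (Ws c₂ w g)}

/-- The Leibniz rule for words; the parameters of the modules add. -/
theorem Ws_mulS_mem (c₁ c₂ : ℝ) (w : List (Gen n)) :
    (fun f g => Ws (c₁ + c₂) w (mulS f g)) ∈ leibSpan c₁ c₂ (wordOrder w) := by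
  induction w with
  | nil => exact Submodule.subset_span ⟨[], [], by simp, rfl⟩
  | cons g w ih =>
    have h : (fun f h => Ws (c₁ + c₂) (g :: w) (mulS f h)) =
        (fun (f h : Sch n) => Gs (c₁ + c₂) g ((fun f h => Ws (c₁ + c₂) w (mulS f h)) f h)) := by
      funext f h
      rw [Ws_cons]
    rw [h]
    generalize (fun f h => Ws (c₁ + c₂) w (mulS f h)) = B at ih ⊢
    induction ih using Submodule.span_induction with
    | mem B hB =>
      obtain ⟨v, v', hv, rfl⟩ := hB
      have : (fun f h => Gs (c₁ + c₂) g (mulS (Ws c₁ v f) (Ws c₂ v' h))) =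
          (fun f h => mulS (Ws c₁ (g :: v) f) (Ws c₂ v' h)) +
            fun f h => mulS (Ws c₁ v f) (Ws c₂ (g :: v') h) := by
        funext f h
        rw [Gs_mulS]
        simp only [Pi.add_apply, Ws_cons]
      rw [this]
      refine Submodule.add_mem _ (Submodule.subset_span ⟨g :: v, v', ?_, rfl⟩)
        (Submodule.subset_span ⟨v, g :: v', ?_, rfl⟩) <;> simp only [wordOrder_cons] <;> omega
    | zero =>
      have : (fun (f h : Sch n) => Gs (c₁ + c₂) g ((0 : Sch n → Sch n → Sch n) f h)) = 0 := by
        funext f h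
        simp
      rw [this]
      exact Submodule.zero_mem _
    | add x y _ _ hx hy =>
      have : (fun (f h : Sch n) => Gs (c₁ + c₂) g ((x + y) f h)) =
          (fun (f h : Sch n) => Gs (c₁ + c₂) g (x f h)) +
            fun (f h : Sch n) => Gs (c₁ + c₂) g (y f h) := by
        funext f h
        simp
      rw [this]
      exact Submodule.add_mem _ hx hy
    | smul a x _ hx =>
      have : (fun (f h : Sch n) => Gs (c₁ + c₂) g ((a • x) f h)) =
          a • (fun (f h : Sch n) => Gs (c₁ + c₂) g (x f h)) := by
        funext f h
        simp
      rw [this]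
      exact Submodule.smul_mem _ _ hx

/-! ### Dephased functions in lens coordinates -/

/-- The phase `(c/4) |y|² sinh τ`. -/
def lphase (c : ℝ) (Y : Spacetime n) : ℝ := c / 4 * ‖sp Y‖ ^ 2 * Real.sinh (Y (Fin.last n))

/-- The function `f` in lens coordinates, with the quadratic oscillation removed. -/
def lensF (c : ℝ) (f : Sch n) (Y : Spacetime n) : ℂ :=
  Complex.exp (-(lphase c Y * Complex.I)) * f (lens Y)

/-- The coefficient `1 / cosh τ`. -/
def pc (Y : Spacetime n) : ℝ := (Real.cosh (Y (Fin.last n)))⁻¹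

/-- The coefficient `tanh τ`. -/
def qc (Y : Spacetime n) : ℝ := Real.sinh (Y (Fin.last n)) * (Real.cosh (Y (Fin.last n)))⁻¹

theorem hasFDerivAt_time (Y : Spacetime n) : HasFDerivAt (fun Y : Spacetime n => Y (Fin.last n))
    (EuclideanSpace.proj (Fin.last n) : Spacetime n →L[ℝ] ℝ) Y :=
  (EuclideanSpace.proj (Fin.last n) : Spacetime n →L[ℝ] ℝ).hasFDerivAt

theorem contDiff_time : ContDiff ℝ ∞ fun Y : Spacetime n => Y (Fin.last n) :=
  (EuclideanSpace.proj (Fin.last n) : Spacetime n →L[ℝ] ℝ).contDiff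

theorem contDiff_pc : ContDiff ℝ ∞ (pc : Spacetime n → ℝ) :=
  (Real.contDiff_cosh.comp contDiff_time).inv fun Y => (Real.cosh_pos _).ne'

theorem contDiff_qc : ContDiff ℝ ∞ (qc : Spacetime n → ℝ) :=
  (Real.contDiff_sinh.comp contDiff_time).mul contDiff_pc

theorem fderiv_pc (Y v : Spacetime n) :
    fderiv ℝ pc Y v = v (Fin.last n) * (-(pc Y * qc Y)) := by
  have hc := (Real.cosh_pos (Y (Fin.last n))).ne'
  have h := ((Real.hasDerivAt_cosh (Y (Fin.last n))).inv hc).comp_hasFDerivAt Y (hasFDerivAt_time Y)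
  refine (congrArg (fun L => L v) h.fderiv).trans ?_
  simp only [ContinuousLinearMap.smul_apply, pc, qc, smul_eq_mul]
  change _ * v (Fin.last n) = _
  field_simp

theorem fderiv_qc (Y v : Spacetime n) :
    fderiv ℝ qc Y v = v (Fin.last n) * (pc Y * pc Y) := by
  have hc := (Real.cosh_pos (Y (Fin.last n))).ne'
  have h := ((Real.hasDerivAt_sinh (Y (Fin.last n))).mul
    ((Real.hasDerivAt_cosh (Y (Fin.last n))).inv hc)).comp_hasFDerivAt Y (hasFDerivAt_time Y)
  refine (congrArg (fun L => L v) h.fderiv).trans ?_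
  simp only [ContinuousLinearMap.smul_apply, pc, smul_eq_mul]
  change _ * v (Fin.last n) = _
  have := Real.cosh_sq (Y (Fin.last n))
  field_simp
  simp only [Pi.inv_apply]
  field_simp
  linear_combination (v (Fin.last n)) * this

theorem abs_pc_le (Y : Spacetime n) : |pc Y| ≤ 1 := by
  rw [pc, abs_inv, abs_of_pos (Real.cosh_pos _)]
  exact inv_le_one_of_one_le₀ (Real.one_le_cosh _)

theorem abs_qc_le (Y : Spacetime n) : |qc Y| ≤ 1 := by
  have hc := Real.cosh_pos (Y (Fin.last n))
  have := Real.cosh_sq (Y (Fin.last n))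
  rw [qc, abs_mul, abs_inv, abs_of_pos hc, ← div_eq_mul_inv, div_le_one hc]
  exact abs_le_of_sq_le_sq (by linarith) hc.le

theorem hasFDerivAt_lphase (c : ℝ) (Y : Spacetime n) : ∃ L : Spacetime n →L[ℝ] ℝ,
    HasFDerivAt (lphase c) L Y ∧ ∀ v, L v =
      c / 2 * Real.sinh (Y (Fin.last n)) * inner ℝ (sp Y) (sp v) +
        c / 4 * ‖sp Y‖ ^ 2 * Real.cosh (Y (Fin.last n)) * v (Fin.last n) := by
  have h1 := ((sp (n := n)).hasFDerivAt (x := Y)).norm_sq.const_mul (c / 4)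
  have h2 := (Real.hasDerivAt_sinh (Y (Fin.last n))).comp_hasFDerivAt Y (hasFDerivAt_time Y)
  refine ⟨_, h1.mul h2, fun v => ?_⟩
  simp
  ring

theorem contDiff_lphase (c : ℝ) : ContDiff ℝ ∞ (lphase c : Spacetime n → ℝ) :=
  (contDiff_const.mul ((sp (n := n)).contDiff.norm_sq ℝ)).mul
    (Real.contDiff_sinh.comp contDiff_time)

theorem contDiff_lensF (c : ℝ) (f : Sch n) : ContDiff ℝ ∞ (lensF c f) := by
  refine ContDiff.mul ?_ ((f.smooth _).comp contDiff_lens)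
  exact ((Complex.ofRealCLM.contDiff.comp (contDiff_lphase c)).mul contDiff_const).neg.cexp

theorem norm_lensF (c : ℝ) (f : Sch n) (Y : Spacetime n) : ‖lensF c f Y‖ = ‖f (lens Y)‖ := by
  rw [lensF, norm_mul, ← neg_mul, ← Complex.ofReal_neg, Complex.norm_exp_ofReal_mul_I, one_mul]

theorem fderiv_lensF (c : ℝ) (f : Sch n) (Y v : Spacetime n) :
    fderiv ℝ (lensF c f) Y v = Complex.exp (-(lphase c Y * Complex.I)) *
      (fderiv ℝ f (lens Y) (lensDeriv Y v) - Complex.I * (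
        c / 2 * Real.sinh (Y (Fin.last n)) * inner ℝ (sp Y) (sp v) +
        c / 4 * ‖sp Y‖ ^ 2 * Real.cosh (Y (Fin.last n)) * v (Fin.last n) : ℝ) * f (lens Y)) := by
  obtain ⟨L, hL, hL'⟩ := hasFDerivAt_lphase c Y
  have h0 : HasFDerivAt (fun Y => ((lphase c Y : ℝ) : ℂ)) (Complex.ofRealCLM ∘L L) Y :=
    Complex.ofRealCLM.hasFDerivAt.comp Y hL
  have h1 := ((h0.mul_const Complex.I).fun_neg).cexp
  have h2 := (f.differentiableAt (x := lens Y)).hasFDerivAt.comp Y (hasFDerivAt_lens Y)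
  refine (congrArg (fun L => L v) (h1.mul h2).fderiv).trans ?_
  simp only [add_apply, ContinuousLinearMap.smul_apply, ContinuousLinearMap.comp_apply,
    neg_apply, Function.comp_apply, ContinuousLinearMap.smulRight_apply, Complex.ofRealCLM_apply,
    smul_eq_mul, hL']
  push_cast
  ring

theorem fderiv_eq_opDs (f : Sch n) (x : Spacetime n) (a : Fin (n + 1)) :
    fderiv ℝ f x (ev a) = Complex.I * opDs a f x := by
  rw [opDs_apply, ← mul_assoc, mul_neg, Complex.I_mul_I]
  ring

theorem sp_ev (j : Fin n) : sp (ev j.castSucc) = (ev j.castSucc : Spacetime n) := by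
  simp [sp_apply, ev, (Fin.castSucc_ne_last j).symm]

theorem sp_et : sp (et : Spacetime n) = 0 := by simp [sp_apply, ev]

theorem sp_eq_sum (Y : Spacetime n) : sp Y = ∑ j : Fin n, Y j.castSucc • ev j.castSucc := by
  ext a
  refine Fin.lastCases ?_ (fun i => ?_) a
  · simp [ev, (Fin.castSucc_ne_last _).symm]
  · simp [ev, Finset.sum_apply, Pi.single_apply]

/-- Space derivatives of a dephased function, by the translations and the Galilei boosts. -/
theorem fderiv_lensF_space (c : ℝ) (f : Sch n) (Y : Spacetime n) (j : Fin n) :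
    fderiv ℝ (lensF c f) Y (ev j.castSucc) =
      Complex.I * (pc Y * lensF c (Gs c (.Dz j) f) Y + qc Y * lensF c (Gs c (.gal j) f) Y) := by
  have hc := (Real.cosh_pos (Y (Fin.last n))).ne'
  have hcs := Real.cosh_sq (Y (Fin.last n))
  have h1 : lensDeriv Y (ev j.castSucc) = Real.cosh (Y (Fin.last n)) • ev j.castSucc := by
    simp [lensDeriv, ev, (Fin.castSucc_ne_last j).symm]
  have h2 : (ev j.castSucc : Spacetime n) (Fin.last n) = 0 := by
    simp [ev, (Fin.castSucc_ne_last j).symm]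
  rw [fderiv_lensF, h1, map_smul, fderiv_eq_opDs, sp_ev, inner_ev, sp_castSucc, h2]
  simp only [lensF, Gs_Dz, Gs_gal, lens_castSucc, lens_last, pc, qc, Complex.real_smul]
  have hc' : (Complex.cosh (Y (Fin.last n) : ℂ)) ≠ 0 := by
    rw [← Complex.ofReal_cosh]; exact_mod_cast hc
  have hcs' : Complex.cosh (Y (Fin.last n) : ℂ) ^ 2 = Complex.sinh (Y (Fin.last n) : ℂ) ^ 2 + 1 := by
    rw [← Complex.ofReal_cosh, ← Complex.ofReal_sinh]; exact_mod_cast hcs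
  push_cast
  field_simp
  ring_nf
  rw [hcs']
  ring

/-- The time derivative of a dephased function. -/
theorem fderiv_lensF_time (c : ℝ) (f : Sch n) (Y : Spacetime n) :
    fderiv ℝ (lensF c f) Y et = Complex.I * (pc Y * lensF c (Gs c .Dt f) Y +
      qc Y / 2 * lensF c (Gs c .scal f) Y +
        1 / 2 * ∑ j : Fin n, Y j.castSucc * lensF c (Gs c (.gal j) f) Y) := by
  have hc := (Real.cosh_pos (Y (Fin.last n))).ne'
  have hcs := Real.cosh_sq (Y (Fin.last n))
  have h1 : lensDeriv Y et = Real.cosh (Y (Fin.last n)) • et +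
      Real.sinh (Y (Fin.last n)) • ∑ j : Fin n, Y j.castSucc • ev j.castSucc := by
    rw [← sp_eq_sum]
    simp [lensDeriv, ev]
  have h2 : (et : Spacetime n) (Fin.last n) = 1 := by simp [ev]
  have hc' : (Complex.cosh (Y (Fin.last n) : ℂ)) ≠ 0 := by
    rw [← Complex.ofReal_cosh]; exact_mod_cast hc
  have hcs' : Complex.cosh (Y (Fin.last n) : ℂ) ^ 2 = Complex.sinh (Y (Fin.last n) : ℂ) ^ 2 + 1 := by
    rw [← Complex.ofReal_cosh, ← Complex.ofReal_sinh]; exact_mod_cast hcs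
  have e1 : ∀ F : Fin n → ℂ, ∑ j : Fin n, (Y j.castSucc : ℂ) *
      (Complex.exp (-(lphase c Y * Complex.I)) * (Complex.sinh (Y (Fin.last n)) * F j -
        c / 2 * (Complex.cosh (Y (Fin.last n)) * Y j.castSucc * f (lens Y)))) =
      Complex.exp (-(lphase c Y * Complex.I)) * (Complex.sinh (Y (Fin.last n)) *
        (∑ j : Fin n, Y j.castSucc * F j) - c / 2 * Complex.cosh (Y (Fin.last n)) *
          (∑ j : Fin n, (Y j.castSucc : ℂ) ^ 2) * f (lens Y)) := fun F => by
    simp only [Finset.mul_sum, Finset.sum_mul, mul_sub, ← Finset.sum_sub_distrib]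
    exact Finset.sum_congr rfl fun j _ => by ring
  have e2 : ∑ j : Fin n, (Complex.cosh (Y (Fin.last n)) * Y j.castSucc : ℂ) *
      opDs j.castSucc f (lens Y) = Complex.cosh (Y (Fin.last n)) *
        ∑ j : Fin n, Y j.castSucc * opDs j.castSucc f (lens Y) := by
    rw [Finset.mul_sum]
    exact Finset.sum_congr rfl fun j _ => by ring
  have e3 : ∑ j : Fin n, (Y j.castSucc : ℂ) * (Complex.I * opDs j.castSucc f (lens Y)) =
      Complex.I * ∑ j : Fin n, Y j.castSucc * opDs j.castSucc f (lens Y) := by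
    rw [Finset.mul_sum]
    exact Finset.sum_congr rfl fun j _ => by ring
  rw [fderiv_lensF, h1, map_add, map_smul, map_smul, map_sum]
  simp only [map_smul, fderiv_eq_opDs, sp_et, inner_zero_right, h2, lensF, Gs_Dt, Gs_gal, Gs_scal,
    lens_castSucc, lens_last, pc, qc, Complex.real_smul, norm_sq_sp]
  push_cast
  rw [e1, e2, e3]
  generalize ∑ j : Fin n, (Y j.castSucc : ℂ) * opDs j.castSucc f (lens Y) = A
  generalize ∑ j : Fin n, (Y j.castSucc : ℂ) ^ 2 = B
  field_simp
  ring_nf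
  rw [hcs']
  ring

/-- Multiplication by a space coordinate is of order one, since the parameter `c` is not zero. -/
theorem coord_mul_lensF {c : ℝ} (hc0 : c ≠ 0) (f : Sch n) (Y : Spacetime n) (j : Fin n) :
    (Y j.castSucc : ℂ) * lensF c f Y =
      2 / c * (qc Y * lensF c (Gs c (.Dz j) f) Y - pc Y * lensF c (Gs c (.gal j) f) Y) := by
  have hc := (Real.cosh_pos (Y (Fin.last n))).ne'
  have hc0' : (c : ℂ) ≠ 0 := by exact_mod_cast hc0
  have hc' : (Complex.cosh (Y (Fin.last n) : ℂ)) ≠ 0 := by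
    rw [← Complex.ofReal_cosh]; exact_mod_cast hc
  simp only [lensF, Gs_Dz, Gs_gal, lens_castSucc, lens_last, pc, qc]
  push_cast
  field_simp
  ring

/-- The rotation fields act on dephased functions as rotation generators. -/
theorem fderiv_lensF_rot (c : ℝ) (f : Sch n) (Y : Spacetime n) (i j : Fin n) :
    fderiv ℝ (lensF c f) Y (Y i.castSucc • ev j.castSucc - Y j.castSucc • ev i.castSucc) =
      Complex.I * lensF c (Gs c (.rot i j) f) Y := by
  have hc := (Real.cosh_pos (Y (Fin.last n))).ne'
  have hc' : (Complex.cosh (Y (Fin.last n) : ℂ)) ≠ 0 := by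
    rw [← Complex.ofReal_cosh]; exact_mod_cast hc
  rw [map_sub, map_smul, map_smul, fderiv_lensF_space, fderiv_lensF_space]
  simp only [lensF, Gs_Dz, Gs_gal, Gs_rot, lens_castSucc, lens_last, pc, qc, Complex.real_smul]
  have hcs' : Complex.cosh (Y (Fin.last n) : ℂ) ^ 2 = Complex.sinh (Y (Fin.last n) : ℂ) ^ 2 + 1 := by
    rw [← Complex.ofReal_cosh, ← Complex.ofReal_sinh]; exact_mod_cast Real.cosh_sq (Y (Fin.last n))
  push_cast
  field_simp
  ring_nf
  rw [hcs']
  ring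

/-! ### Majorants in lens coordinates -/

/-- The finitely many words of order at most `m`. -/
def wds (n m : ℕ) : Finset (List (Gen n)) := (finite_words m).toFinset

theorem mem_wds {m : ℕ} {w : List (Gen n)} : w ∈ wds n m ↔ wordOrder w ≤ m := by simp [wds]

/-- The sum of the absolute values of all dephased words of order at most `m`. -/
def maj (c : ℝ) (m : ℕ) (f : Sch n) (Y : Spacetime n) : ℝ :=
  ∑ w ∈ wds n m, ‖lensF c (Ws c w f) Y‖

theorem maj_nonneg (c : ℝ) (m : ℕ) (f : Sch n) (Y : Spacetime n) : 0 ≤ maj c m f Y :=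
  Finset.sum_nonneg fun _ _ => norm_nonneg _

theorem norm_lensF_le_maj (c : ℝ) {m : ℕ} (f : Sch n) (Y : Spacetime n) {w : List (Gen n)}
    (hw : wordOrder w ≤ m) : ‖lensF c (Ws c w f) Y‖ ≤ maj c m f Y :=
  Finset.single_le_sum (f := fun w => ‖lensF c (Ws c w f) Y‖) (fun _ _ => norm_nonneg _)
    (mem_wds.2 hw)

theorem continuous_lensF (c : ℝ) (f : Sch n) : Continuous (lensF c f) :=
  (contDiff_lensF c f).continuous

theorem continuous_maj (c : ℝ) (m : ℕ) (f : Sch n) : Continuous (maj c m f) :=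
  continuous_finsetSum _ fun _ _ => (continuous_lensF c _).norm

theorem jb_le_one_add_sum (Y : Spacetime n) : jb Y ≤ 1 + ∑ j : Fin n, |Y j.castSucc| := by
  have h0 : 0 ≤ ∑ j : Fin n, |Y j.castSucc| := Finset.sum_nonneg fun _ _ => abs_nonneg _
  refine Real.sqrt_le_iff.2 ⟨by positivity, ?_⟩
  have h1 : ∑ j : Fin n, |Y j.castSucc| ^ 2 ≤ (∑ j : Fin n, |Y j.castSucc|) ^ 2 :=
    Finset.sum_sq_le_sq_sum_of_nonneg fun _ _ => abs_nonneg _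
  rw [norm_sq_sp]
  simp only [sq_abs] at h1
  nlinarith

/-- A factor `⟨y⟩` costs one order. -/
theorem jb_mul_maj_le {c : ℝ} (hc : c ≠ 0) (m : ℕ) : ∃ C : ℝ, 0 ≤ C ∧
    ∀ (f : Sch n) Y, jb Y * maj c m f Y ≤ C * maj c (m + 1) f Y := by
  refine ⟨(wds n m).card * (1 + n * (2 / |c| * 2)), by positivity, fun f Y => ?_⟩
  have hw : ∀ w ∈ wds n m, jb Y * ‖lensF c (Ws c w f) Y‖ ≤
      (1 + n * (2 / |c| * 2)) * maj c (m + 1) f Y := fun w hw => by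
    rw [mem_wds] at hw
    have h1 : ∀ j : Fin n, |Y j.castSucc| * ‖lensF c (Ws c w f) Y‖ ≤
        2 / |c| * 2 * maj c (m + 1) f Y := fun j => by
      have e : |Y j.castSucc| * ‖lensF c (Ws c w f) Y‖ =
          ‖(Y j.castSucc : ℂ) * lensF c (Ws c w f) Y‖ := by
        rw [norm_mul, Complex.norm_real, Real.norm_eq_abs]
      have hp : ‖(pc Y : ℂ)‖ ≤ 1 := by rw [Complex.norm_real]; exact abs_pc_le Y
      have hq : ‖(qc Y : ℂ)‖ ≤ 1 := by rw [Complex.norm_real]; exact abs_qc_le Y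
      have hD := norm_lensF_le_maj c (m := m + 1) f Y (w := .Dz j :: w)
        (by simp [Gen.order]; omega)
      have hG := norm_lensF_le_maj c (m := m + 1) f Y (w := .gal j :: w)
        (by simp [Gen.order]; omega)
      rw [Ws_cons] at hD hG
      rw [e, coord_mul_lensF hc, norm_mul, mul_assoc]
      have e2 : ‖(2 / c : ℂ)‖ = 2 / |c| := by simp
      rw [e2]
      gcongr
      refine (norm_sub_le _ _).trans ?_
      rw [norm_mul, norm_mul]
      have := norm_nonneg (lensF c (Gs c (.Dz j) (Ws c w f)) Y)
      have := norm_nonneg (lensF c (Gs c (.gal j) (Ws c w f)) Y)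
      nlinarith
    have h2 := norm_lensF_le_maj c (m := m + 1) f Y (w := w) (by omega)
    calc jb Y * ‖lensF c (Ws c w f) Y‖
        ≤ (1 + ∑ j : Fin n, |Y j.castSucc|) * ‖lensF c (Ws c w f) Y‖ := by
          gcongr; exact jb_le_one_add_sum Y
      _ = ‖lensF c (Ws c w f) Y‖ + ∑ j : Fin n, |Y j.castSucc| * ‖lensF c (Ws c w f) Y‖ := by
          rw [add_mul, one_mul, Finset.sum_mul]
      _ ≤ maj c (m + 1) f Y + ∑ _j : Fin n, 2 / |c| * 2 * maj c (m + 1) f Y :=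
          add_le_add h2 (Finset.sum_le_sum fun j _ => h1 j)
      _ = _ := by simp; ring
  calc jb Y * maj c m f Y = ∑ w ∈ wds n m, jb Y * ‖lensF c (Ws c w f) Y‖ := by
        rw [maj, Finset.mul_sum]
    _ ≤ ∑ w ∈ wds n m, (1 + n * (2 / |c| * 2)) * maj c (m + 1) f Y := Finset.sum_le_sum hw
    _ = _ := by rw [Finset.sum_const, nsmul_eq_mul]; ring

theorem jb_pow_mul_maj_le {c : ℝ} (hc : c ≠ 0) (m i : ℕ) : ∃ C : ℝ, 0 ≤ C ∧
    ∀ (f : Sch n) Y, jb Y ^ i * maj c m f Y ≤ C * maj c (m + i) f Y := by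
  induction i with
  | zero => exact ⟨1, zero_le_one, fun f Y => by simp⟩
  | succ i ih =>
    obtain ⟨C, hC, h⟩ := ih
    obtain ⟨C', hC', h'⟩ := jb_mul_maj_le (n := n) hc (m + i)
    refine ⟨C * C', by positivity, fun f Y => ?_⟩
    have hj := jb_pos Y
    calc jb Y ^ (i + 1) * maj c m f Y = jb Y * (jb Y ^ i * maj c m f Y) := by ring
      _ ≤ jb Y * (C * maj c (m + i) f Y) := mul_le_mul_of_nonneg_left (h f Y) hj.le
      _ = C * (jb Y * maj c (m + i) f Y) := by ring
      _ ≤ C * (C' * maj c (m + i + 1) f Y) := mul_le_mul_of_nonneg_left (h' f Y) hC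
      _ = _ := by rw [add_assoc]; ring

theorem lintegral_wn (r : ℝ) (f : Sch n) :
    ∫⁻ Z : Spacetime n, ENNReal.ofReal ((1 + ‖Z‖ ^ 2) ^ r * ‖f Z‖ ^ 2) =
      ENNReal.ofReal (wn r f ^ 2) := by
  rw [wn_sq, ofReal_integral_eq_lintegral_ofReal (integrable_wn r f)]
  exact Filter.Eventually.of_forall fun Z => by positivity

/-- The weighted `L²` norm in lens coordinates. -/
theorem lintegral_lensF (c r : ℝ) (f : Sch n) :
    ∫⁻ Y, ENNReal.ofReal (lw (2 * r) (2 * r + (n + 1)) Y * ‖lensF c f Y‖ ^ 2) =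
      ENNReal.ofReal (wn r f ^ 2) := by
  rw [← lintegral_wn]
  symm
  rw [lintegral_lens]
  symm
  refine lintegral_congr fun Y => ?_
  have hc := Real.cosh_pos (Y (Fin.last n))
  have hj := jb_pos Y
  rw [← ENNReal.ofReal_mul (by positivity), norm_lensF, ← mul_assoc]
  congr 2
  rw [one_add_norm_sq_lens, ← jb_sq, ← mul_pow, lw, ← Real.rpow_natCast (Real.cosh _ * jb Y) 2,
    ← Real.rpow_mul (by positivity), Real.mul_rpow hc.le hj.le, ← mul_assoc,
    ← Real.rpow_natCast _ (n + 1), ← Real.rpow_add hc]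
  push_cast
  rw [add_comm (2 * r), mul_comm]

/-- The majorant in lens coordinates has the weighted `L²` norm of the words. -/
theorem lintegral_maj_le (c r : ℝ) (m : ℕ) (f : Sch n) {K : ℝ}
    (hK : ∀ w, wordOrder w ≤ m → wn r (Ws c w f) ≤ K) :
    ∫⁻ Y, ENNReal.ofReal (lw (2 * r) (2 * r + (n + 1)) Y * maj c m f Y ^ 2) ≤
      ENNReal.ofReal (((wds n m).card * K) ^ 2) := by
  have h1 : ∀ Y : Spacetime n, ENNReal.ofReal (lw (2 * r) (2 * r + (n + 1)) Y * maj c m f Y ^ 2) ≤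
      ∑ w ∈ wds n m, ENNReal.ofReal ((wds n m).card) * ENNReal.ofReal
        (lw (2 * r) (2 * r + (n + 1)) Y * ‖lensF c (Ws c w f) Y‖ ^ 2) := fun Y => by
    have hl := lw_pos (2 * r) (2 * r + (n + 1)) Y
    simp only [← ENNReal.ofReal_mul (Nat.cast_nonneg _)]
    rw [← ENNReal.ofReal_sum_of_nonneg fun w _ => by positivity]
    refine ENNReal.ofReal_le_ofReal ?_
    have := sq_sum_le_card_mul_sum_sq (s := wds n m) (f := fun w => ‖lensF c (Ws c w f) Y‖)
    calc lw (2 * r) (2 * r + (n + 1)) Y * maj c m f Y ^ 2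
        ≤ lw (2 * r) (2 * r + (n + 1)) Y * ((wds n m).card *
          ∑ w ∈ wds n m, ‖lensF c (Ws c w f) Y‖ ^ 2) := by gcongr; exact this
      _ = _ := by rw [Finset.mul_sum, Finset.mul_sum]; exact Finset.sum_congr rfl fun w _ => by ring
  have hm : ∀ w : List (Gen n), Measurable fun Y : Spacetime n =>
      ENNReal.ofReal (lw (2 * r) (2 * r + (n + 1)) Y * ‖lensF c (Ws c w f) Y‖ ^ 2) := fun w =>
    ((continuous_lw _ _).mul ((continuous_lensF c _).norm.pow 2)).measurable.ennreal_ofReal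
  refine (lintegral_mono h1).trans ?_
  rw [lintegral_finsetSum _ fun w _ => (hm w).const_mul _]
  simp only [lintegral_const_mul _ (hm _), lintegral_lensF]
  calc ∑ w ∈ wds n m, ENNReal.ofReal ((wds n m).card) * ENNReal.ofReal (wn r (Ws c w f) ^ 2)
      ≤ ∑ w ∈ wds n m, ENNReal.ofReal ((wds n m).card) * ENNReal.ofReal (K ^ 2) := by
        gcongr with w hw
        · exact wn_nonneg _ _
        · exact hK w (mem_wds.1 hw)
    _ = _ := by
        rw [Finset.sum_const, nsmul_eq_mul, ← ENNReal.ofReal_natCast,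
          ← ENNReal.ofReal_mul (by positivity), ← ENNReal.ofReal_mul (by positivity)]
        congr 1
        ring

/-! ### Functions on boxes -/

/-- Coefficients: functions of the centre `P` and the position `x` in the box, generated by bounded
functions of `P`, smooth functions of `x`, and `1 / cosh τ`, `tanh τ` at the point `P + boxL P x`. -/
inductive Coef : (Spacetime n → Spacetime n → ℂ) → Prop
  | fst (b : Spacetime n → ℂ) (C : ℝ) (hb : ∀ P, ‖b P‖ ≤ C) : Coef fun P _ => b P
  | snd (φ : Spacetime n → ℂ) (hφ : ContDiff ℝ ∞ φ) : Coef fun _ x => φ x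
  | pc : Coef fun P x => ((pc (P + boxL P x) : ℝ) : ℂ)
  | qc : Coef fun P x => ((qc (P + boxL P x) : ℝ) : ℂ)
  | add {a b : Spacetime n → Spacetime n → ℂ} (ha : Coef a) (hb : Coef b) :
      Coef fun P x => a P x + b P x
  | mul {a b : Spacetime n → Spacetime n → ℂ} (ha : Coef a) (hb : Coef b) :
      Coef fun P x => a P x * b P x

theorem Coef.const (z : ℂ) : Coef fun (_ : Spacetime n) (_ : Spacetime n) => z :=
  .fst (fun _ => z) ‖z‖ fun _ => le_rfl

theorem contDiff_box (P : Spacetime n) : ContDiff ℝ ∞ fun x => P + boxL P x :=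
  contDiff_const.add (boxL P).contDiff

theorem Coef.contDiff {a : Spacetime n → Spacetime n → ℂ} (ha : Coef a) (P : Spacetime n) :
    ContDiff ℝ ∞ (a P) := by
  induction ha with
  | fst b C hb => exact contDiff_const
  | snd φ hφ => exact hφ
  | pc => exact Complex.ofRealCLM.contDiff.comp (contDiff_pc.comp (contDiff_box P))
  | qc => exact Complex.ofRealCLM.contDiff.comp (contDiff_qc.comp (contDiff_box P))
  | add _ _ ha hb => exact ha.add hb
  | mul _ _ ha hb => exact ha.mul hb

theorem Coef.bounded {a : Spacetime n → Spacetime n → ℂ} (ha : Coef a) :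
    ∃ C : ℝ, 0 ≤ C ∧ ∀ P x, ‖x‖ ≤ 1 → ‖a P x‖ ≤ C := by
  induction ha with
  | fst b C hb => exact ⟨C, (norm_nonneg _).trans (hb 0), fun P x _ => hb P⟩
  | snd φ hφ =>
    obtain ⟨C, hC⟩ := (isCompact_closedBall (0 : Spacetime n) 1).exists_bound_of_continuousOn
      hφ.continuous.continuousOn
    exact ⟨C, (norm_nonneg _).trans (hC 0 (by simp)), fun P x hx => hC x (by simpa using hx)⟩
  | pc => exact ⟨1, zero_le_one, fun P x _ => by rw [Complex.norm_real]; exact abs_pc_le _⟩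
  | qc => exact ⟨1, zero_le_one, fun P x _ => by rw [Complex.norm_real]; exact abs_qc_le _⟩
  | add _ _ ha hb =>
    obtain ⟨C, hC, h⟩ := ha
    obtain ⟨C', hC', h'⟩ := hb
    exact ⟨C + C', by positivity, fun P x hx => norm_add_le_of_le (h P x hx) (h' P x hx)⟩
  | mul _ _ ha hb =>
    obtain ⟨C, hC, h⟩ := ha
    obtain ⟨C', hC', h'⟩ := hb
    exact ⟨C * C', by positivity, fun P x hx => norm_mul_le_of_le (h P x hx) (h' P x hx)⟩

theorem fderiv_comp_box {E : Type*} [NormedAddCommGroup E] [NormedSpace ℝ E]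
    {F : Spacetime n → E} (hF : ContDiff ℝ ∞ F) (P x v : Spacetime n) :
    fderiv ℝ (fun x => F (P + boxL P x)) x v = fderiv ℝ F (P + boxL P x) (boxL P v) := by
  have h1 : HasFDerivAt (fun x => P + boxL P x) (boxL P) x := (boxL P).hasFDerivAt.const_add P
  have h2 := ((hF.differentiable (by simp)) (P + boxL P x)).hasFDerivAt.comp x h1
  rw [show (fun x => F (P + boxL P x)) = F ∘ fun x => P + boxL P x from rfl, h2.fderiv]
  rfl

theorem fderiv_ofReal_comp {F : Spacetime n → ℝ} (hF : ContDiff ℝ ∞ F) (x v : Spacetime n) :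
    fderiv ℝ (fun x => ((F x : ℝ) : ℂ)) x v = (fderiv ℝ F x v : ℝ) := by
  have h2 := Complex.ofRealCLM.hasFDerivAt.comp x ((hF.differentiable (by simp)) x).hasFDerivAt
  exact congrArg (fun L => L v) h2.fderiv

theorem norm_boxL_ev_last_le (P : Spacetime n) (j : Fin (n + 1)) :
    ‖((boxL P (ev j) (Fin.last n) : ℝ) : ℂ)‖ ≤ 3 := by
  rw [Complex.norm_real]
  refine (abs_coord_le _ _).trans ((norm_boxL_le _ _).trans ?_)
  simp [ev]

/-- The derivatives of `1 / cosh τ` and `tanh τ` are polynomials in these two functions. -/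
theorem Coef.fderiv {a : Spacetime n → Spacetime n → ℂ} (ha : Coef a) (j : Fin (n + 1)) :
    Coef fun P x => fderiv ℝ (a P) x (ev j) := by
  induction ha with
  | fst b C hb => simpa using Coef.const (n := n) 0
  | snd φ hφ =>
    exact .snd (fun x => _root_.fderiv ℝ φ x (ev j))
      ((hφ.fderiv_right (m := ∞) (by simp)).clm_apply contDiff_const)
  | pc =>
    have : (fun P x : Spacetime n =>
        _root_.fderiv ℝ (fun x => ((NLSMult.pc (P + boxL P x) : ℝ) : ℂ)) x (ev j)) =
        fun P x => ((boxL P (ev j) (Fin.last n) : ℝ) : ℂ) *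
          (-1 * (NLSMult.pc (P + boxL P x) * NLSMult.qc (P + boxL P x))) := by
      funext P x
      rw [fderiv_ofReal_comp (F := fun x => NLSMult.pc (P + boxL P x))
          (contDiff_pc.comp (contDiff_box P)), fderiv_comp_box contDiff_pc,
        fderiv_pc]
      push_cast
      ring
    rw [this]
    exact (Coef.fst _ 3 fun P => norm_boxL_ev_last_le P j).mul ((Coef.const _).mul (Coef.pc.mul .qc))
  | qc =>
    have : (fun P x : Spacetime n =>
        _root_.fderiv ℝ (fun x => ((NLSMult.qc (P + boxL P x) : ℝ) : ℂ)) x (ev j)) =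
        fun P x => ((boxL P (ev j) (Fin.last n) : ℝ) : ℂ) *
          (NLSMult.pc (P + boxL P x) * NLSMult.pc (P + boxL P x)) := by
      funext P x
      rw [fderiv_ofReal_comp (F := fun x => NLSMult.qc (P + boxL P x))
          (contDiff_qc.comp (contDiff_box P)), fderiv_comp_box contDiff_qc,
        fderiv_qc]
      push_cast
      ring
    rw [this]
    exact (Coef.fst _ 3 fun P => norm_boxL_ev_last_le P j).mul (Coef.pc.mul .pc)
  | @add a b ha hb iha ihb =>
    have : (fun P x => _root_.fderiv ℝ (fun x => a P x + b P x) x (ev j)) = fun P x =>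
        _root_.fderiv ℝ (a P) x (ev j) + _root_.fderiv ℝ (b P) x (ev j) := by
      funext P x
      rw [fderiv_fun_add ((ha.contDiff P).differentiable (by simp) x)
        ((hb.contDiff P).differentiable (by simp) x), add_apply]
    rw [this]
    exact iha.add ihb
  | @mul a b ha hb iha ihb =>
    have : (fun P x => _root_.fderiv ℝ (fun x => a P x * b P x) x (ev j)) = fun P x =>
        a P x * _root_.fderiv ℝ (b P) x (ev j) + b P x * _root_.fderiv ℝ (a P) x (ev j) := by
      funext P x
      rw [fderiv_fun_mul ((ha.contDiff P).differentiable (by simp) x)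
        ((hb.contDiff P).differentiable (by simp) x), add_apply, smul_apply,
        smul_apply, smul_eq_mul, smul_eq_mul]
    rw [this]
    exact (ha.mul ihb).add (hb.mul iha)

/-- The parabolic order of the derivative in a coordinate direction. -/
def dOrd (a : Fin (n + 1)) : ℕ := if a = Fin.last n then 2 else 1

/-- Functions on boxes, depending linearly on a Schwartz function: sums of terms of the form
`a(P, x) δ(P)^j (e^{-iφ} W f)(P + boxL P x)` with a coefficient `a`, a word `W` of order at most
`j`, and `j ≤ m`. -/
inductive BoxCl (c : ℝ) (m : ℕ) : (Sch n → Spacetime n → Spacetime n → ℂ) → Prop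
  | word (w : List (Gen n)) (j : ℕ) (hw : wordOrder w ≤ j) (hj : j ≤ m) :
      BoxCl c m fun f P x => (dl P : ℂ) ^ j * lensF c (Ws c w f) (P + boxL P x)
  | add {H H' : Sch n → Spacetime n → Spacetime n → ℂ} (h : BoxCl c m H) (h' : BoxCl c m H') :
      BoxCl c m fun f P x => H f P x + H' f P x
  | mul {a : Spacetime n → Spacetime n → ℂ} {H : Sch n → Spacetime n → Spacetime n → ℂ}
      (ha : Coef a) (h : BoxCl c m H) : BoxCl c m fun f P x => a P x * H f P x

theorem BoxCl.mono {c : ℝ} {m m' : ℕ} (hm : m ≤ m') {H : Sch n → Spacetime n → Spacetime n → ℂ}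
    (h : BoxCl c m H) : BoxCl c m' H := by
  induction h with
  | word w j hw hj => exact .word w j hw (hj.trans hm)
  | add _ _ h h' => exact h.add h'
  | mul ha _ h => exact h.mul ha

theorem BoxCl.zero (c : ℝ) (m : ℕ) :
    BoxCl c m fun (_ : Sch n) (_ : Spacetime n) (_ : Spacetime n) => (0 : ℂ) := by
  have := (BoxCl.word (c := c) (m := m) [] 0 (by simp) (Nat.zero_le _)).mul (Coef.const (n := n) 0)
  simpa using this

theorem BoxCl.sum {c : ℝ} {m : ℕ} {ι : Type*} (s : Finset ι)
    {H : ι → Sch n → Spacetime n → Spacetime n → ℂ} (h : ∀ i ∈ s, BoxCl c m (H i)) :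
    BoxCl c m fun f P x => ∑ i ∈ s, H i f P x := by
  classical
  induction s using Finset.induction_on with
  | empty => simpa using BoxCl.zero c m
  | insert i s hi ih =>
    have h1 := (h i (Finset.mem_insert_self _ _)).add
      (ih fun j hj => h j (Finset.mem_insert_of_mem hj))
    simpa only [Finset.sum_insert hi] using h1

theorem BoxCl.contDiff {c : ℝ} {m : ℕ} {H : Sch n → Spacetime n → Spacetime n → ℂ}
    (h : BoxCl c m H) (f : Sch n) (P : Spacetime n) : ContDiff ℝ ∞ (H f P) := by
  induction h with
  | word w j hw hj =>
    exact contDiff_const.mul ((contDiff_lensF c _).comp (contDiff_box P))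
  | add _ _ h h' => exact h.add h'
  | mul ha _ h => exact (ha.contDiff P).mul h

/-- In a box, the space directions are combinations of `δ² ∂_j` and of rotations with coefficients
of size `δ`. -/
theorem boxL_ev_space (P x : Spacetime n) (j : Fin n) :
    boxL P (ev j.castSucc) = (dl P ^ 2) • ev j.castSucc + dl P • ∑ i : Fin n, (bv P i.castSucc) •
      (((P + boxL P x) i.castSucc • ev j.castSucc - (P + boxL P x) j.castSucc • ev i.castSucc) -
        (boxL P x i.castSucc • ev j.castSucc - boxL P x j.castSucc • ev i.castSucc)) := by
  have h1 : ∀ i : Fin n, (P + boxL P x) i.castSucc - boxL P x i.castSucc = P i.castSucc :=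
    fun i => by simp
  have h2 : ∀ i : Fin n, dl P * P i.castSucc = bv P i.castSucc := fun i => by simp [bv]
  have h3 : ∑ i : Fin n, bv P i.castSucc ^ 2 = 1 - dl P ^ 2 := by
    rw [← norm_sq_bv, ← norm_sq_sp]
    congr 2
    simp [sp_apply]
  have h4 : bv P = ∑ i : Fin n, bv P i.castSucc • (ev i.castSucc : Spacetime n) := by
    rw [← sp_eq_sum]
    simp [sp_apply]
  have h5 : ∀ i : Fin n, (((P + boxL P x) i.castSucc • ev j.castSucc -
      (P + boxL P x) j.castSucc • ev i.castSucc) -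
        (boxL P x i.castSucc • ev j.castSucc - boxL P x j.castSucc • ev i.castSucc)) =
      (P i.castSucc • ev j.castSucc - P j.castSucc • ev i.castSucc : Spacetime n) := fun i => by
    rw [← h1 i, ← h1 j]
    simp only [sub_smul]
    abel
  simp only [h5]
  -- `δ ∑ b_i (P_i e_j - P_j e_i) = |b|² e_j - b_j b`, where `|b|² = 1 - δ²`.
  have h6 : dl P • ∑ i : Fin n, (bv P i.castSucc) •
      (P i.castSucc • ev j.castSucc - P j.castSucc • ev i.castSucc : Spacetime n) =
      (1 - dl P ^ 2) • ev j.castSucc - bv P j.castSucc • bv P := by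
    conv_rhs =>
      rw [← h3]
      enter [2, 2]
      rw [h4]
    rw [Finset.smul_sum, Finset.sum_smul, Finset.smul_sum, ← Finset.sum_sub_distrib]
    refine Finset.sum_congr rfl fun i _ => ?_
    rw [← h2 j, smul_sub, smul_sub, smul_smul, smul_smul, smul_smul, smul_smul, smul_smul]
    congr 2
    · rw [sq]
      nth_rewrite 2 [← h2 i]
      ring
    · ring
  rw [h6, boxL_apply]
  have h7 : (ev j.castSucc : Spacetime n) (Fin.last n) = 0 := by
    simp [ev, (Fin.castSucc_ne_last j).symm]
  rw [inner_ev, h7, zero_smul, smul_zero, sub_zero, sub_smul, one_smul]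
  abel

theorem boxL_et (P : Spacetime n) : boxL P et = (dl P ^ 2) • et := by
  have h7 : (et : Spacetime n) (Fin.last n) = 1 := by simp [ev]
  rw [boxL_apply, inner_ev, bv_last, h7, zero_smul, sub_zero, one_smul, sub_smul, one_smul]
  abel

theorem Coef.dl : Coef fun (P : Spacetime n) _ => ((dl P : ℝ) : ℂ) :=
  .fst _ 1 fun P => by
    rw [Complex.norm_real, Real.norm_of_nonneg (dl_pos P).le]; exact dl_le_one P

theorem Coef.bv (a : Fin (n + 1)) : Coef fun (P : Spacetime n) _ => ((bv P a : ℝ) : ℂ) :=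
  .fst _ 1 fun P => by
    rw [Complex.norm_real]; exact (abs_coord_le _ _).trans (norm_bv_le P)

theorem Coef.coord (a : Fin (n + 1)) : Coef fun (_ x : Spacetime n) => ((x a : ℝ) : ℂ) :=
  .snd _ (Complex.ofRealCLM.contDiff.comp
    (EuclideanSpace.proj a : Spacetime n →L[ℝ] ℝ).contDiff)

theorem Coef.sum {ι : Type*} (s : Finset ι) {a : ι → Spacetime n → Spacetime n → ℂ}
    (h : ∀ i ∈ s, Coef (a i)) : Coef fun P x => ∑ i ∈ s, a i P x := by
  classical
  induction s using Finset.induction_on with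
  | empty => simpa using Coef.const (n := n) 0
  | insert i s hi ih =>
    have h1 := (h i (Finset.mem_insert_self _ _)).add
      (ih fun j hj => h j (Finset.mem_insert_of_mem hj))
    simpa only [Finset.sum_insert hi] using h1

theorem Coef.boxL_coord (j : Fin n) :
    Coef fun P x : Spacetime n => ((boxL P x j.castSucc : ℝ) : ℂ) := by
  have : (fun P x : Spacetime n => ((boxL P x j.castSucc : ℝ) : ℂ)) = fun P x =>
      (x j.castSucc : ℂ) + -1 * ((∑ i : Fin n, (NLSMult.bv P i.castSucc : ℂ) * x i.castSucc) *
        NLSMult.bv P j.castSucc) := by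
    funext P x
    have h1 : inner ℝ (NLSMult.bv P) x = ∑ i : Fin n, NLSMult.bv P i.castSucc * x i.castSucc := by
      rw [PiLp.inner_apply, Fin.sum_univ_castSucc, bv_last]
      simp [mul_comm]
    rw [boxL_apply, h1]
    simp [ev, (Fin.castSucc_ne_last j)]
    ring
  rw [this]
  exact (Coef.coord _).add ((Coef.const _).mul
    ((Coef.sum _ fun i _ => (Coef.bv _).mul (Coef.coord _)).mul (Coef.bv _)))

/-- A derivative of parabolic order one or two in the box variable raises the class by its order. -/
theorem BoxCl.fderiv {c : ℝ} (hc : c ≠ 0) {m : ℕ} {H : Sch n → Spacetime n → Spacetime n → ℂ}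
    (h : BoxCl c m H) (a : Fin (n + 1)) :
    BoxCl c (m + dOrd a) fun f P x => fderiv ℝ (H f P) x (ev a) := by
  induction h with
  | word w j hw hj =>
    -- the term `δ^(j+i) L(Vw f)` with a word `V` of order at most `i`
    have T : ∀ (i : ℕ) (v : List (Gen n)), wordOrder v ≤ i → i ≤ dOrd a →
        BoxCl c (m + dOrd a) fun f P x =>
          (NLSMult.dl P : ℂ) ^ (j + i) * lensF c (Ws c (v ++ w) f) (P + boxL P x) :=
      fun i v hv hi => .word _ _ (by simp; omega) (by omega)
    have hd : ∀ (f : Sch n) (P x : Spacetime n), _root_.fderiv ℝ (fun x => (NLSMult.dl P : ℂ) ^ j *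
        lensF c (Ws c w f) (P + boxL P x)) x (ev a) = (NLSMult.dl P : ℂ) ^ j *
          _root_.fderiv ℝ (lensF c (Ws c w f)) (P + boxL P x) (boxL P (ev a)) := fun f P x => by
      have hdiff : DifferentiableAt ℝ (fun x => lensF c (Ws c w f) (P + boxL P x)) x :=
        ((contDiff_lensF c _).comp (contDiff_box P)).differentiable (by simp) x
      rw [← fderiv_comp_box (contDiff_lensF c _), fderiv_const_mul hdiff]
      rfl
    simp only [hd]
    refine Fin.lastCases (motive := fun a => (∀ (i : ℕ) (v : List (Gen n)), wordOrder v ≤ i →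
      i ≤ dOrd a → BoxCl c (m + dOrd a) fun f P x =>
          (NLSMult.dl P : ℂ) ^ (j + i) * lensF c (Ws c (v ++ w) f) (P + boxL P x)) →
      BoxCl c (m + dOrd a) fun f P x => (NLSMult.dl P : ℂ) ^ j *
          _root_.fderiv ℝ (lensF c (Ws c w f)) (P + boxL P x) (boxL P (ev a))) ?_ ?_ a T
    · intro T
      -- In the time derivative, the coordinates `y_i` in front of the boosts are traded for further
      -- generators of order one, which brings in the second-order words `Dz gal` and `gal gal`.
      have e : (fun (f : Sch n) (P x : Spacetime n) => (NLSMult.dl P : ℂ) ^ j *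
          _root_.fderiv ℝ (lensF c (Ws c w f)) (P + boxL P x) (boxL P et)) = fun f P x =>
          Complex.I * (pc (P + boxL P x) * ((NLSMult.dl P : ℂ) ^ (j + 2) *
            lensF c (Ws c ([.Dt] ++ w) f) (P + boxL P x)) +
          ((1 / 2 : ℂ) * (qc (P + boxL P x) * ((NLSMult.dl P : ℂ) ^ (j + 2) *
            lensF c (Ws c ([.scal] ++ w) f) (P + boxL P x))) +
          (1 / 2 : ℂ) * ∑ i : Fin n, ((2 / c : ℂ) * (qc (P + boxL P x) *
            ((NLSMult.dl P : ℂ) ^ (j + 2) *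
              lensF c (Ws c ([.Dz i, .gal i] ++ w) f) (P + boxL P x)) +
            -1 * (pc (P + boxL P x) * ((NLSMult.dl P : ℂ) ^ (j + 2) *
              lensF c (Ws c ([.gal i, .gal i] ++ w) f) (P + boxL P x))))))) := by
        funext f P x
        rw [boxL_et, map_smul, fderiv_lensF_time]
        simp only [coord_mul_lensF hc, List.cons_append, List.nil_append, Ws_cons]
        rw [Finset.mul_sum, Finset.mul_sum, Complex.real_smul]
        have e1 : ∀ F F' : Fin n → ℂ, (∑ i, (1 / 2 : ℂ) * (2 / c * ((qc (P + boxL P x) : ℝ) *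
            ((NLSMult.dl P : ℂ) ^ (j + 2) * F i) + -1 * ((pc (P + boxL P x) : ℝ) *
            ((NLSMult.dl P : ℂ) ^ (j + 2) * F' i))))) = (NLSMult.dl P : ℂ) ^ (j + 2) *
            ∑ i, (1 / 2 : ℂ) * (2 / c * ((qc (P + boxL P x) : ℝ) * F i -
              (pc (P + boxL P x) : ℝ) * F' i)) := fun F F' => by
          rw [Finset.mul_sum]
          exact Finset.sum_congr rfl fun i _ => by ring
        rw [e1]
        push_cast
        ring
      rw [e]
      exact (((T 2 [.Dt] (by simp [Gen.order]) (by simp [dOrd])).mul .pc).add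
        ((((T 2 [.scal] (by simp [Gen.order]) (by simp [dOrd])).mul .qc).mul (.const _)).add
        ((BoxCl.sum _ fun i _ => (((T 2 [.Dz i, .gal i] (by simp [Gen.order])
          (by simp [dOrd])).mul .qc).add (((T 2 [.gal i, .gal i] (by simp [Gen.order])
          (by simp [dOrd])).mul .pc).mul (.const _))).mul (.const _)).mul (.const _)))).mul (.const _)
    · intro l T
      -- the term with a space derivative of order one
      have S : ∀ i : Fin n, BoxCl c (m + dOrd l.castSucc) fun f P x => (NLSMult.dl P : ℂ) ^ (j + 1) *
          _root_.fderiv ℝ (lensF c (Ws c w f)) (P + boxL P x) (ev i.castSucc) := fun i => by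
        have e : (fun (f : Sch n) (P x : Spacetime n) => (NLSMult.dl P : ℂ) ^ (j + 1) *
          _root_.fderiv ℝ (lensF c (Ws c w f)) (P + boxL P x) (ev i.castSucc)) = fun f P x =>
            Complex.I * (pc (P + boxL P x) * ((NLSMult.dl P : ℂ) ^ (j + 1) *
              lensF c (Ws c ([.Dz i] ++ w) f) (P + boxL P x)) +
            qc (P + boxL P x) * ((NLSMult.dl P : ℂ) ^ (j + 1) *
              lensF c (Ws c ([.gal i] ++ w) f) (P + boxL P x))) := by
          funext f P x
          rw [fderiv_lensF_space]
          simp only [List.cons_append, List.nil_append, Ws_cons]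
          ring
        rw [e]
        exact (((T 1 [.Dz i] (by simp [Gen.order]) (by simp [dOrd])).mul .pc).add
          ((T 1 [.gal i] (by simp [Gen.order]) (by simp [dOrd])).mul .qc)).mul (.const _)
      have e : (fun (f : Sch n) (P x : Spacetime n) => (NLSMult.dl P : ℂ) ^ j *
          _root_.fderiv ℝ (lensF c (Ws c w f)) (P + boxL P x) (boxL P (ev l.castSucc))) =
          fun f P x => NLSMult.dl P * ((NLSMult.dl P : ℂ) ^ (j + 1) *
            _root_.fderiv ℝ (lensF c (Ws c w f)) (P + boxL P x) (ev l.castSucc)) +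
          ∑ i : Fin n, NLSMult.bv P i.castSucc * (Complex.I * ((NLSMult.dl P : ℂ) ^ (j + 1) *
              lensF c (Ws c ([.rot i l] ++ w) f) (P + boxL P x)) +
            -1 * (boxL P x i.castSucc * ((NLSMult.dl P : ℂ) ^ (j + 1) *
              _root_.fderiv ℝ (lensF c (Ws c w f)) (P + boxL P x) (ev l.castSucc)) +
            -1 * (boxL P x l.castSucc * ((NLSMult.dl P : ℂ) ^ (j + 1) *
              _root_.fderiv ℝ (lensF c (Ws c w f)) (P + boxL P x) (ev i.castSucc))))) := by
        funext f P x
        rw [boxL_ev_space P x, map_add, map_smul, map_smul, map_sum]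
        simp only [map_smul, map_sub, ← fderiv_lensF_rot, List.cons_append, List.nil_append,
          Ws_cons, Complex.real_smul]
        have e1 : ∀ F : Fin n → ℂ, (NLSMult.dl P : ℂ) ^ j * ((NLSMult.dl P ^ 2 : ℝ) *
            _root_.fderiv ℝ (lensF c (Ws c w f)) (P + boxL P x) (ev l.castSucc) +
            NLSMult.dl P * ∑ i, F i) = NLSMult.dl P * ((NLSMult.dl P : ℂ) ^ (j + 1) *
            _root_.fderiv ℝ (lensF c (Ws c w f)) (P + boxL P x) (ev l.castSucc)) +
            ∑ i, (NLSMult.dl P : ℂ) ^ (j + 1) * F i := fun F => by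
          rw [← Finset.mul_sum]
          push_cast
          ring
        rw [e1]
        congr 1
        refine Finset.sum_congr rfl fun i _ => ?_
        rw [← mul_assoc Complex.I, mul_comm Complex.I, mul_assoc, ← fderiv_lensF_rot, map_sub,
          map_smul, map_smul, Complex.real_smul, Complex.real_smul]
        ring
      rw [e]
      exact ((S l).mul .dl).add (BoxCl.sum _ fun i _ =>
        (((T 1 [.rot i l] (by simp [Gen.order]) (by simp [dOrd])).mul (.const _)).add
          ((((S l).mul (.boxL_coord i)).add (((S i).mul (.boxL_coord l)).mul (.const _))).mul
            (.const _))).mul (.bv _))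
  | @add H H' h h' ih ih' =>
    have : (fun (f : Sch n) P x => _root_.fderiv ℝ (fun x => H f P x + H' f P x) x (ev a)) =
        fun f P x => _root_.fderiv ℝ (H f P) x (ev a) + _root_.fderiv ℝ (H' f P) x (ev a) := by
      funext f P x
      rw [fderiv_fun_add ((h.contDiff f P).differentiable (by simp) x)
        ((h'.contDiff f P).differentiable (by simp) x), add_apply]
    rw [this]
    exact ih.add ih'
  | @mul b H hb h ih =>
    have : (fun (f : Sch n) P x => _root_.fderiv ℝ (fun x => b P x * H f P x) x (ev a)) =
        fun f P x => b P x * _root_.fderiv ℝ (H f P) x (ev a) +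
          _root_.fderiv ℝ (b P) x (ev a) * H f P x := by
      funext f P x
      rw [fderiv_fun_mul ((hb.contDiff P).differentiable (by simp) x)
        ((h.contDiff f P).differentiable (by simp) x), add_apply, smul_apply, smul_apply,
        smul_eq_mul, smul_eq_mul, mul_comm (H f P x)]
    rw [this]
    exact (ih.mul hb).add ((h.mono (Nat.le_add_right _ _)).mul (hb.fderiv a))

/-- A function of class `k` is of size `δ^k` times a majorant of order `k`. -/
theorem BoxCl.norm_le {c : ℝ} (hc : c ≠ 0) {k : ℕ} {H : Sch n → Spacetime n → Spacetime n → ℂ}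
    (h : BoxCl c k H) : ∃ C : ℝ, 0 ≤ C ∧ ∀ f P x, ‖x‖ ≤ 1 / 12 →
      ‖H f P x‖ ≤ C * (NLSMult.dl P ^ k * maj c k f (P + boxL P x)) := by
  induction h with
  | word w j hw hj =>
    obtain ⟨C, hC, h⟩ := jb_pow_mul_maj_le (n := n) hc j (k - j)
    refine ⟨2 ^ (k - j) * C, by positivity, fun f P x hx => ?_⟩
    have h1 := norm_lensF_le_maj c f (P + boxL P x) hw
    have hd := dl_pos P
    have h2 := h f (P + boxL P x)
    rw [Nat.add_sub_cancel' hj] at h2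
    have h3 : jb P ≤ 2 * jb (P + boxL P x) := by
      have := (abs_le.1 (abs_jb_sub_le (P + boxL P x) P)).1
      have := norm_box_sub_le hx P
      have := one_le_jb (P + boxL P x)
      linarith
    -- The missing powers of `δ` are gained at the expense of the order, by `jb_pow_mul_maj_le`.
    have h4 : NLSMult.dl P ^ j = NLSMult.dl P ^ k * jb P ^ (k - j) := by
      rw [← Nat.add_sub_cancel' hj, pow_add, Nat.add_sub_cancel' hj, mul_assoc, ← mul_pow,
        dl_mul_jb, one_pow, mul_one]
    have hj0 := jb_pos P
    have hm := maj_nonneg c j f (P + boxL P x)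
    rw [norm_mul, norm_pow, Complex.norm_real, Real.norm_of_nonneg hd.le]
    calc NLSMult.dl P ^ j * ‖lensF c (Ws c w f) (P + boxL P x)‖
        ≤ NLSMult.dl P ^ j * maj c j f (P + boxL P x) := by gcongr
      _ = NLSMult.dl P ^ k * (jb P ^ (k - j) * maj c j f (P + boxL P x)) := by rw [h4, mul_assoc]
      _ ≤ NLSMult.dl P ^ k * ((2 * jb (P + boxL P x)) ^ (k - j) * maj c j f (P + boxL P x)) := by
          gcongr
      _ = NLSMult.dl P ^ k * (2 ^ (k - j) *
          (jb (P + boxL P x) ^ (k - j) * maj c j f (P + boxL P x))) := by rw [mul_pow]; ring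
      _ ≤ NLSMult.dl P ^ k * (2 ^ (k - j) * (C * maj c k f (P + boxL P x))) :=
          mul_le_mul_of_nonneg_left (mul_le_mul_of_nonneg_left h2 (by positivity)) (by positivity)
      _ = _ := by ring
  | add _ _ h h' =>
    obtain ⟨C, hC, h⟩ := h
    obtain ⟨C', hC', h'⟩ := h'
    exact ⟨C + C', by positivity, fun f P x hx => by
      rw [add_mul]; exact norm_add_le_of_le (h f P x hx) (h' f P x hx)⟩
  | mul ha _ h =>
    obtain ⟨C, hC, h⟩ := h
    obtain ⟨C', hC', h'⟩ := ha.bounded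
    exact ⟨C' * C, by positivity, fun f P x hx => by
      rw [mul_assoc]
      exact norm_mul_le_of_le (h' P x (hx.trans (by norm_num))) (h f P x hx)⟩

/-! ### A product estimate for anisotropic Sobolev norms -/

/-- An iterated derivative. -/
def Ds (l : List (Fin (n + 1))) (f : Sch n) : Sch n := l.foldr (fun a g => opDs a g) f

theorem Ds_cons (a : Fin (n + 1)) (l : List (Fin (n + 1))) (f : Sch n) :
    Ds (a :: l) f = opDs a (Ds l f) := rfl

/-- The parabolic order of an iterated derivative. -/
def lOrd (l : List (Fin (n + 1))) : ℕ := (l.map dOrd).sum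

@[simp] theorem lOrd_nil : lOrd ([] : List (Fin (n + 1))) = 0 := rfl

@[simp] theorem lOrd_cons (a : Fin (n + 1)) (l : List (Fin (n + 1))) :
    lOrd (a :: l) = dOrd a + lOrd l := by simp [lOrd]

theorem finite_lists (k : ℕ) : {l : List (Fin (n + 1)) | lOrd l ≤ k}.Finite := by
  refine (List.finite_length_le (Fin (n + 1)) k).subset fun l hl => ?_
  have h : ∀ l : List (Fin (n + 1)), l.length ≤ lOrd l := by
    intro l
    induction l with
    | nil => simp
    | cons a l ih =>
      have : 1 ≤ dOrd a := by unfold dOrd; split <;> omega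
      simp
      omega
  exact (h l).trans hl

/-- The iterated derivatives of order at most `k`. -/
def dls (n k : ℕ) : Finset (List (Fin (n + 1))) := (finite_lists k).toFinset

theorem mem_dls {k : ℕ} {l : List (Fin (n + 1))} : l ∈ dls n k ↔ lOrd l ≤ k := by simp [dls]

/-- The monomial in the frequencies that belongs to an iterated derivative. -/
def fmon (l : List (Fin (n + 1))) (ξ : Spacetime n) : ℝ :=
  (l.map fun a => 2 * Real.pi * ξ a).prod

theorem fmon_cons (a : Fin (n + 1)) (l : List (Fin (n + 1))) (ξ : Spacetime n) :
    fmon (a :: l) ξ = 2 * Real.pi * ξ a * fmon l ξ := by simp [fmon]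

theorem continuous_fmon (l : List (Fin (n + 1))) : Continuous (fmon l) := by
  induction l with
  | nil => exact (continuous_const (y := (1 : ℝ))).congr fun ξ => by simp [fmon]
  | cons a l ih =>
    have : fmon (a :: l) = fun ξ => 2 * Real.pi * ξ a * fmon l ξ := funext (fmon_cons a l)
    rw [this]
    fun_prop

theorem fourier_opDs (a : Fin (n + 1)) (f : Sch n) (ξ : Spacetime n) :
    (𝓕 (opDs a f) : Sch n) ξ = (2 * Real.pi * ξ a : ℝ) * (𝓕 f : Sch n) ξ := by
  have h1 : (𝓕 (opDs a f) : Sch n) = (-Complex.I) • (𝓕 (∂_{ev a} f : Sch n) : Sch n) :=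
    map_smul (fourierCLE ℂ (Sch n)) (-Complex.I) _
  have h2 : (fun x : Spacetime n => inner ℝ x (ev a)).HasTemperateGrowth := by
    simp only [inner_ev]
    exact (EuclideanSpace.proj (𝕜 := ℝ) a : Spacetime n →L[ℝ] ℝ).hasTemperateGrowth
  rw [h1, SchwartzMap.fourier_lineDerivOp_eq]
  change (-Complex.I) * ((2 * Real.pi * Complex.I) *
    (SchwartzMap.smulLeftCLM ℂ (fun x : Spacetime n => inner ℝ x (ev a)) (𝓕 f : Sch n)) ξ) = _
  rw [SchwartzMap.smulLeftCLM_apply_apply h2, inner_ev, Complex.real_smul]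
  push_cast
  linear_combination (-(2 * Real.pi * ξ a * (𝓕 f : Sch n) ξ) : ℂ) * Complex.I_mul_I

theorem fourier_Ds (l : List (Fin (n + 1))) (f : Sch n) (ξ : Spacetime n) :
    (𝓕 (Ds l f) : Sch n) ξ = fmon l ξ * (𝓕 f : Sch n) ξ := by
  induction l with
  | nil => simp [Ds, fmon]
  | cons a l ih => rw [Ds_cons, fourier_opDs, ih, fmon_cons]; push_cast; ring

/-- The Fourier weight of the anisotropic Sobolev norm of order `k`. -/
def fwt (k : ℕ) (ξ : Spacetime n) : ℝ := ∑ l ∈ dls n k, fmon l ξ ^ 2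

theorem continuous_fwt (k : ℕ) : Continuous (fwt k : Spacetime n → ℝ) :=
  continuous_finsetSum _ fun l _ => (continuous_fmon l).pow 2

theorem fmon_sq_le_fwt {k : ℕ} {l : List (Fin (n + 1))} (hl : lOrd l ≤ k) (ξ : Spacetime n) :
    fmon l ξ ^ 2 ≤ fwt k ξ :=
  Finset.single_le_sum (f := fun l => fmon l ξ ^ 2) (fun _ _ => sq_nonneg _) (mem_dls.2 hl)

theorem one_le_fwt (k : ℕ) (ξ : Spacetime n) : 1 ≤ fwt k ξ := by
  simpa [fmon] using fmon_sq_le_fwt (k := k) (l := []) (by simp) ξ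

/-- The anisotropic Sobolev norm. -/
def sob (k : ℕ) (f : Sch n) : ℝ := ∑ l ∈ dls n k, wn 0 (Ds l f)

theorem sob_nonneg (k : ℕ) (f : Sch n) : 0 ≤ sob k f := Finset.sum_nonneg fun _ _ => wn_nonneg _ _

theorem wn_zero_fourier (g : Sch n) : wn 0 (𝓕 g : Sch n) = wn 0 g := by
  simp only [wn, wt_zero]
  exact SchwartzMap.norm_fourier_toL2_eq g

theorem lintegral_fwt (k : ℕ) (f : Sch n) :
    ∫⁻ ξ, ENNReal.ofReal (fwt k ξ) * ‖(𝓕 f : Sch n) ξ‖ₑ ^ 2 ≤ ENNReal.ofReal (sob k f ^ 2) := by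
  have h1 : ∀ ξ : Spacetime n, ENNReal.ofReal (fwt k ξ) * ‖(𝓕 f : Sch n) ξ‖ₑ ^ 2 =
      ∑ l ∈ dls n k, ENNReal.ofReal ((1 + ‖ξ‖ ^ 2) ^ (0 : ℝ) * ‖(𝓕 (Ds l f) : Sch n) ξ‖ ^ 2) :=
    fun ξ => by
      rw [← ENNReal.ofReal_sum_of_nonneg fun l _ => by positivity,
        ← ofReal_norm, ← ENNReal.ofReal_pow (norm_nonneg _),
        ← ENNReal.ofReal_mul (zero_le_one.trans (one_le_fwt k ξ)), fwt, Finset.sum_mul]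
      congr 1
      refine Finset.sum_congr rfl fun l _ => ?_
      rw [Real.rpow_zero, one_mul, fourier_Ds, norm_mul, Complex.norm_real, mul_pow,
        Real.norm_eq_abs, sq_abs]
  simp only [h1]
  rw [lintegral_finsetSum _ fun l _ => by fun_prop]
  simp only [lintegral_wn, wn_zero_fourier]
  rw [← ENNReal.ofReal_sum_of_nonneg fun l _ => sq_nonneg _]
  exact ENNReal.ofReal_le_ofReal (Finset.sum_sq_le_sq_sum_of_nonneg fun l _ => wn_nonneg _ _)

/-- `1 + |ζ|²`. -/
def fa (ξ : Spacetime n) : ℝ := 1 + ∑ j : Fin n, (2 * Real.pi * ξ j.castSucc) ^ 2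

/-- `1 + |ζ|² + |τ|`. -/
def fq (ξ : Spacetime n) : ℝ := fa ξ + |2 * Real.pi * ξ (Fin.last n)|

theorem one_le_fa (ξ : Spacetime n) : 1 ≤ fa ξ :=
  le_add_of_nonneg_right (Finset.sum_nonneg fun _ _ => sq_nonneg _)

theorem fa_le_fq (ξ : Spacetime n) : fa ξ ≤ fq ξ := le_add_of_nonneg_right (abs_nonneg _)

/-- The factor `1 + |ζ|²` costs one order, by prepending a space derivative to each monomial. -/
theorem fa_mul_fwt_le (k : ℕ) : ∃ C : ℝ, 0 ≤ C ∧
    ∀ ξ : Spacetime n, fa ξ * fwt k ξ ≤ C * fwt (k + 1) ξ := by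
  refine ⟨(dls n k).card * (1 + n), by positivity, fun ξ => ?_⟩
  have h : ∀ l ∈ dls n k, fa ξ * fmon l ξ ^ 2 ≤ (1 + n) * fwt (k + 1) ξ := fun l hl => by
    rw [mem_dls] at hl
    have h1 : ∀ j : Fin n, (2 * Real.pi * ξ j.castSucc) ^ 2 * fmon l ξ ^ 2 ≤ fwt (k + 1) ξ :=
      fun j => by
        have := fmon_sq_le_fwt (k := k + 1) (l := j.castSucc :: l)
          (by simp [dOrd, (Fin.castSucc_ne_last j)]; omega) ξ
        rwa [fmon_cons, mul_pow] at this
    have h2 := fmon_sq_le_fwt (k := k + 1) (l := l) (by omega) ξ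
    have h3 := Finset.sum_le_sum fun (j : Fin n) (_ : j ∈ Finset.univ) => h1 j
    rw [← Finset.sum_mul] at h3
    simp at h3
    rw [fa, add_mul, add_mul, one_mul, one_mul]
    exact add_le_add h2 h3
  rw [fwt, Finset.mul_sum]
  refine (Finset.sum_le_sum h).trans_eq ?_
  rw [Finset.sum_const, nsmul_eq_mul]
  ring

/-- The factor `τ²` costs two orders, by prepending a time derivative to each monomial. -/
theorem tau_mul_fwt_le (k : ℕ) : ∃ C : ℝ, 0 ≤ C ∧ ∀ ξ : Spacetime n,
    (2 * Real.pi * ξ (Fin.last n)) ^ 2 * fwt k ξ ≤ C * fwt (k + 2) ξ := by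
  refine ⟨(dls n k).card, by positivity, fun ξ => ?_⟩
  rw [fwt, Finset.mul_sum]
  refine (Finset.sum_le_sum fun l hl => ?_).trans_eq (b := ∑ l ∈ dls n k, fwt (k + 2) ξ) ?_
  · rw [mem_dls] at hl
    have := fmon_sq_le_fwt (k := k + 2) (l := Fin.last n :: l) (by simp [dOrd]; omega) ξ
    rwa [fmon_cons, mul_pow] at this
  · rw [Finset.sum_const, nsmul_eq_mul]

/-- The weight of order `k + 1` dominates `a q^k`. The half-integral powers of `τ` come from
`a |τ| ≤ a² + τ²`. -/
theorem fa_mul_fq_pow_le (k : ℕ) : ∃ C : ℝ, 0 < C ∧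
    ∀ ξ : Spacetime n, fa ξ * fq ξ ^ k ≤ C * fwt (k + 1) ξ := by
  have step : ∀ k (φ : Spacetime n → ℝ), (∃ C : ℝ, 0 ≤ C ∧ ∀ ξ, φ ξ ≤ C * fwt k ξ) →
      ∃ C : ℝ, 0 ≤ C ∧ ∀ ξ, (fa ξ ^ 2 + (2 * Real.pi * ξ (Fin.last n)) ^ 2) * φ ξ ≤
        C * fwt (k + 2) ξ := by
    rintro k φ ⟨C, hC, h⟩
    obtain ⟨C₁, hC₁, h₁⟩ := fa_mul_fwt_le (n := n) k
    obtain ⟨C₂, hC₂, h₂⟩ := fa_mul_fwt_le (n := n) (k + 1)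
    obtain ⟨C₃, hC₃, h₃⟩ := tau_mul_fwt_le (n := n) k
    refine ⟨C * (C₁ * C₂ + C₃), by positivity, fun ξ => ?_⟩
    have ha := zero_le_one.trans (one_le_fa ξ)
    calc (fa ξ ^ 2 + (2 * Real.pi * ξ (Fin.last n)) ^ 2) * φ ξ
        ≤ (fa ξ ^ 2 + (2 * Real.pi * ξ (Fin.last n)) ^ 2) * (C * fwt k ξ) :=
          mul_le_mul_of_nonneg_left (h ξ) (by positivity)
      _ = C * (fa ξ * (fa ξ * fwt k ξ) + (2 * Real.pi * ξ (Fin.last n)) ^ 2 * fwt k ξ) := by ring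
      _ ≤ C * (fa ξ * (C₁ * fwt (k + 1) ξ) + C₃ * fwt (k + 2) ξ) :=
          mul_le_mul_of_nonneg_left (add_le_add (mul_le_mul_of_nonneg_left (h₁ ξ) ha) (h₃ ξ)) hC
      _ = C * (C₁ * (fa ξ * fwt (k + 1) ξ) + C₃ * fwt (k + 2) ξ) := by ring
      _ ≤ C * (C₁ * (C₂ * fwt (k + 1 + 1) ξ) + C₃ * fwt (k + 2) ξ) :=
          mul_le_mul_of_nonneg_left
            (add_le_add_left (mul_le_mul_of_nonneg_left (h₂ ξ) hC₁) _) hC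
      _ = _ := by ring
  have main : ∀ k, ∃ C : ℝ, 0 ≤ C ∧ ∀ ξ : Spacetime n, fa ξ * fq ξ ^ k ≤ C * fwt (k + 1) ξ := by
    intro k
    induction k using Nat.strong_induction_on with
    | _ k ih =>
      match k, ih with
      | 0, _ =>
        obtain ⟨C, hC, h⟩ := fa_mul_fwt_le (n := n) 0
        refine ⟨C, hC, fun ξ => ?_⟩
        have := one_le_fwt 0 ξ
        have := one_le_fa ξ
        have := h ξ
        rw [pow_zero]
        nlinarith
      | 1, _ =>
        obtain ⟨C, hC, h⟩ := step 0 (fun _ => 1) ⟨1, zero_le_one, fun ξ => by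
          simpa using one_le_fwt 0 ξ⟩
        refine ⟨2 * C, by positivity, fun ξ => ?_⟩
        have h1 := h ξ
        have h2 := sq_abs (2 * Real.pi * ξ (Fin.last n))
        rw [pow_one, fq]
        nlinarith [sq_nonneg (fa ξ - |2 * Real.pi * ξ (Fin.last n)|)]
      | k + 2, ih =>
        obtain ⟨C, hC, h⟩ := step (k + 1) (fun ξ => fa ξ * fq ξ ^ k) (ih k (by omega))
        refine ⟨2 * C, by positivity, fun ξ => ?_⟩
        have h0 : 0 ≤ fa ξ * fq ξ ^ k := by
          have := one_le_fa ξ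
          have := fa_le_fq ξ
          have : 0 ≤ fq ξ := by linarith
          positivity
        have h1 : fq ξ ^ 2 ≤ 2 * (fa ξ ^ 2 + (2 * Real.pi * ξ (Fin.last n)) ^ 2) := by
          have h2 := sq_abs (2 * Real.pi * ξ (Fin.last n))
          rw [fq]
          nlinarith [sq_nonneg (fa ξ - |2 * Real.pi * ξ (Fin.last n)|)]
        calc fa ξ * fq ξ ^ (k + 2) = fq ξ ^ 2 * (fa ξ * fq ξ ^ k) := by ring
          _ ≤ 2 * (fa ξ ^ 2 + (2 * Real.pi * ξ (Fin.last n)) ^ 2) * (fa ξ * fq ξ ^ k) :=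
            mul_le_mul_of_nonneg_right h1 h0
          _ ≤ 2 * C * fwt (k + 2 + 1) ξ := by
            have := h ξ
            rw [show k + 2 + 1 = k + 1 + 2 from rfl]
            linarith
  obtain ⟨C, hC, h⟩ := main k
  refine ⟨C + 1, by positivity, fun ξ => (h ξ).trans ?_⟩
  have := one_le_fwt (k + 1) ξ
  nlinarith

/-- The integrable majorant `1 / (a q^(k-2))`. -/
def fN (k : ℕ) (ξ : Spacetime n) : ℝ := (fa ξ * fq ξ ^ (k - 2))⁻¹

/-- However the order `k` is distributed over the two frequencies, the product of the weights
dominates `a q^{k-2}` at one of them: each factor dominates its own `a q^{k_i - 1}`, and one of the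
two values of `q` can be replaced by the smaller one. -/
theorem inv_fwt_mul_le {k k₁ k₂ : ℕ} (hk : 2 ≤ k) (h : k ≤ k₁ + k₂) : ∃ C : ℝ, 0 ≤ C ∧
    ∀ ξ η : Spacetime n, (fwt k₁ ξ * fwt k₂ η)⁻¹ ≤ C * (fN k ξ + fN k η) := by
  have hN : ∀ ξ : Spacetime n, 0 ≤ fN k ξ := fun ξ => by
    have := one_le_fa ξ
    have := fa_le_fq ξ
    have : 0 ≤ fq ξ := by linarith
    unfold fN
    positivity
  have h0 : ∀ k' : ℕ, k ≤ k' → ∃ C : ℝ, 0 ≤ C ∧ ∀ ξ : Spacetime n, (fwt k' ξ)⁻¹ ≤ C * fN k ξ := by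
    intro k' hk'
    obtain ⟨C, hC, h⟩ := fa_mul_fq_pow_le (n := n) (k' - 1)
    refine ⟨C, hC.le, fun ξ => ?_⟩
    have h1 := h ξ
    rw [Nat.sub_add_cancel (by omega)] at h1
    have ha := one_le_fa ξ
    have hq : 1 ≤ fq ξ := ha.trans (fa_le_fq ξ)
    have h2 : fa ξ * fq ξ ^ (k - 2) ≤ fa ξ * fq ξ ^ (k' - 1) := by
      gcongr ?_ * fq ξ ^ ?_
      omega
    have hw := one_le_fwt k' ξ
    rw [fN, ← div_eq_mul_inv, le_div_iff₀ (by positivity), inv_mul_le_iff₀ (by linarith)]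
    linarith
  rcases Nat.eq_zero_or_pos k₁ with rfl | hk₁
  · obtain ⟨C, hC, h1⟩ := h0 k₂ (by omega)
    refine ⟨C, hC, fun ξ η => ?_⟩
    have e1 := h1 η
    have e2 := one_le_fwt 0 ξ
    have e3 := one_le_fwt k₂ η
    have e4 : (fwt 0 ξ * fwt k₂ η)⁻¹ ≤ (fwt k₂ η)⁻¹ := by
      apply inv_anti₀ (by linarith)
      nlinarith
    have := mul_nonneg hC (hN ξ)
    linarith
  rcases Nat.eq_zero_or_pos k₂ with rfl | hk₂
  · obtain ⟨C, hC, h1⟩ := h0 k₁ (by omega)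
    refine ⟨C, hC, fun ξ η => ?_⟩
    have e1 := h1 ξ
    have e2 := one_le_fwt 0 η
    have e3 := one_le_fwt k₁ ξ
    have e4 : (fwt k₁ ξ * fwt 0 η)⁻¹ ≤ (fwt k₁ ξ)⁻¹ := by
      apply inv_anti₀ (by linarith)
      nlinarith
    have := mul_nonneg hC (hN η)
    linarith
  obtain ⟨C₁, hC₁, h₁⟩ := fa_mul_fq_pow_le (n := n) (k₁ - 1)
  obtain ⟨C₂, hC₂, h₂⟩ := fa_mul_fq_pow_le (n := n) (k₂ - 1)
  rw [Nat.sub_add_cancel hk₁] at h₁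
  rw [Nat.sub_add_cancel hk₂] at h₂
  refine ⟨C₁ * C₂, by positivity, fun ξ η => ?_⟩
  have e1 := h₁ ξ
  have e2 := h₂ η
  have ha := one_le_fa ξ
  have ha' := one_le_fa η
  have hq : 1 ≤ fq ξ := ha.trans (fa_le_fq ξ)
  have hq' : 1 ≤ fq η := ha'.trans (fa_le_fq η)
  have e3 := mul_le_mul e1 e2 (by positivity)
    (mul_nonneg hC₁.le (zero_le_one.trans (one_le_fwt k₁ ξ)))
  have w1 := one_le_fwt k₁ ξ
  have w2 := one_le_fwt k₂ η
  -- the smaller of the two values of `q` carries the whole weight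
  have key : (fa ξ * fq ξ ^ (k₁ - 1) * (fa η * fq η ^ (k₂ - 1)))⁻¹ ≤ fN k ξ + fN k η := by
    rcases le_total (fq ξ) (fq η) with hle | hle
    · have : fa ξ * fq ξ ^ (k - 2) ≤ fa ξ * fq ξ ^ (k₁ - 1) * (fa η * fq η ^ (k₂ - 1)) := by
        calc fa ξ * fq ξ ^ (k - 2) ≤ fa ξ * fq ξ ^ ((k₁ - 1) + (k₂ - 1)) := by
              gcongr ?_ * fq ξ ^ ?_
              omega
          _ = fa ξ * fq ξ ^ (k₁ - 1) * (1 * fq ξ ^ (k₂ - 1)) := by rw [pow_add]; ring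
          _ ≤ _ := by gcongr
      refine (inv_anti₀ (by positivity) this).trans ?_
      exact le_add_of_nonneg_right (hN η)
    · have : fa η * fq η ^ (k - 2) ≤ fa ξ * fq ξ ^ (k₁ - 1) * (fa η * fq η ^ (k₂ - 1)) := by
        calc fa η * fq η ^ (k - 2) ≤ fa η * fq η ^ ((k₁ - 1) + (k₂ - 1)) := by
              gcongr ?_ * fq η ^ ?_
              omega
          _ = 1 * fq η ^ (k₁ - 1) * (fa η * fq η ^ (k₂ - 1)) := by rw [pow_add]; ring
          _ ≤ _ := by gcongr
      refine (inv_anti₀ (by positivity) this).trans ?_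
      exact le_add_of_nonneg_left (hN ξ)
  refine le_trans ?_ (mul_le_mul_of_nonneg_left key (by positivity))
  rw [← div_eq_mul_inv, le_div_iff₀ (by positivity), inv_mul_le_iff₀ (by positivity)]
  linarith

/-- Integrability of `1 / (a q^{k-2})`. With exponents `k - 1 - σ` for `1 + |ζ|²` and `σ` for `1 +
|τ|`, it needs `2 (k - 1 - σ) > n` and `σ > 1`, where `σ ≤ k - 2`; such a `σ` exists since `k > max
(n/2 + 2, 3)`. -/
theorem lintegral_fN_lt_top {k : ℕ} (hk : (n : ℝ) / 2 + 2 < k) (hk' : 3 < k) :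
    ∫⁻ ξ : Spacetime n, ENNReal.ofReal (fN k ξ) < ⊤ := by
  -- split the powers of `q` between `1 + |ζ|²` and `1 + |τ|`
  obtain ⟨σ, hσ1, hσ2, hσ3⟩ : ∃ σ : ℝ, 1 < σ ∧ σ ≤ (k : ℝ) - 2 ∧ (n : ℝ) < 2 * (k - 1 - σ) := by
    have h4 : (4 : ℝ) ≤ k := by exact_mod_cast hk'
    refine ⟨min ((k : ℝ) - 2) ((1 + (k - 1 - n / 2)) / 2), ?_, min_le_left _ _, ?_⟩
    · apply lt_min <;> linarith
    · have := min_le_right ((k : ℝ) - 2) ((1 + (k - 1 - n / 2)) / 2)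
      linarith
  let A : (Fin n → ℝ) → ℝ := fun z => (1 + ‖z‖) ^ (-(2 * (k - 1 - σ)))
  let B : ℝ → ℝ := fun τ => (1 + ‖τ‖) ^ (-σ)
  have hA : ∫⁻ z, ENNReal.ofReal (A z) < ⊤ := by
    refine finite_integral_one_add_norm ?_
    simpa using hσ3
  have hB : ∫⁻ τ, ENNReal.ofReal (B τ) < ⊤ := by
    refine finite_integral_one_add_norm ?_
    simpa using hσ1
  have hbound : ∀ ξ : Spacetime n, fN k ξ ≤
      2 ^ ((k : ℝ) - 1 - σ) * (A (fun j => ξ j.castSucc) * B (ξ (Fin.last n))) := fun ξ => by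
    have h2π : 1 ≤ 2 * Real.pi := by linarith [Real.pi_gt_three]
    set z : Fin n → ℝ := fun j => ξ j.castSucc with hz
    have ha1 := one_le_fa ξ
    have hq1 : 1 ≤ fq ξ := ha1.trans (fa_le_fq ξ)
    have ha2 : (1 + ‖z‖) ^ 2 ≤ 2 * fa ξ := by
      have h1 : ‖z‖ ^ 2 ≤ ∑ j : Fin n, (2 * Real.pi * ξ j.castSucc) ^ 2 := by
        have h0 : 0 ≤ ∑ j : Fin n, (2 * Real.pi * ξ j.castSucc) ^ 2 :=
          Finset.sum_nonneg fun _ _ => sq_nonneg _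
        have h2 : ‖z‖ ≤ Real.sqrt (∑ j : Fin n, (2 * Real.pi * ξ j.castSucc) ^ 2) := by
          refine (pi_norm_le_iff_of_nonneg (Real.sqrt_nonneg _)).2 fun j => ?_
          refine Real.le_sqrt_of_sq_le (le_trans ?_ (Finset.single_le_sum (f := fun j : Fin n =>
            (2 * Real.pi * ξ j.castSucc) ^ 2) (fun _ _ => sq_nonneg _) (Finset.mem_univ j)))
          rw [Real.norm_eq_abs, sq_abs, mul_pow]
          change ξ j.castSucc ^ 2 ≤ _
          exact le_mul_of_one_le_left (sq_nonneg _) (one_le_pow₀ h2π)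
        calc ‖z‖ ^ 2 ≤ Real.sqrt (∑ j : Fin n, (2 * Real.pi * ξ j.castSucc) ^ 2) ^ 2 := by gcongr
          _ = _ := Real.sq_sqrt h0
      have := sq_nonneg (1 - ‖z‖)
      rw [fa]
      nlinarith
    have hq2 : 1 + ‖ξ (Fin.last n)‖ ≤ fq ξ := by
      have : ‖ξ (Fin.last n)‖ ≤ |2 * Real.pi * ξ (Fin.last n)| := by
        rw [abs_mul, abs_of_pos (by linarith : (0 : ℝ) < 2 * Real.pi), Real.norm_eq_abs]
        nlinarith [abs_nonneg (ξ (Fin.last n))]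
      rw [fq]
      linarith
    have hq0 : 0 < fq ξ := by linarith
    have ha0 : 0 < fa ξ := by linarith
    have e1 : fa ξ ^ ((k : ℝ) - 1 - σ) * (1 + ‖ξ (Fin.last n)‖) ^ σ ≤ fa ξ * fq ξ ^ (k - 2) := by
      have e2 : fq ξ ^ (k - 2) = fq ξ ^ ((k : ℝ) - 2 - σ) * fq ξ ^ σ := by
        rw [← Real.rpow_add hq0, ← Real.rpow_natCast, Nat.cast_sub (by omega)]
        congr 1
        push_cast
        ring
      have e3 : fa ξ ^ ((k : ℝ) - 1 - σ) = fa ξ * fa ξ ^ ((k : ℝ) - 2 - σ) := by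
        nth_rewrite 2 [← Real.rpow_one (fa ξ)]
        rw [← Real.rpow_add ha0]
        congr 1
        ring
      rw [e2, e3, mul_assoc]
      have e4 : fa ξ ^ ((k : ℝ) - 2 - σ) ≤ fq ξ ^ ((k : ℝ) - 2 - σ) :=
        Real.rpow_le_rpow ha0.le (fa_le_fq ξ) (by linarith)
      have e5 : (1 + ‖ξ (Fin.last n)‖) ^ σ ≤ fq ξ ^ σ :=
        Real.rpow_le_rpow (by positivity) hq2 (by linarith)
      gcongr
    have e6 : (1 + ‖z‖) ^ (2 * ((k : ℝ) - 1 - σ)) ≤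
        2 ^ ((k : ℝ) - 1 - σ) * fa ξ ^ ((k : ℝ) - 1 - σ) := by
      rw [Real.rpow_mul (by positivity), Real.rpow_two, ← Real.mul_rpow (by norm_num) ha0.le]
      refine Real.rpow_le_rpow (by positivity) ha2 ?_
      have : (0 : ℝ) ≤ n := Nat.cast_nonneg n
      linarith
    have p1 : 0 < (1 + ‖z‖) ^ (2 * ((k : ℝ) - 1 - σ)) := by positivity
    have p2 : 0 < (1 + ‖ξ (Fin.last n)‖) ^ σ := by positivity
    have p3 : 0 < fa ξ ^ ((k : ℝ) - 1 - σ) := by positivity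
    change (fa ξ * fq ξ ^ (k - 2))⁻¹ ≤ 2 ^ ((k : ℝ) - 1 - σ) *
      ((1 + ‖z‖) ^ (-(2 * ((k : ℝ) - 1 - σ))) * (1 + ‖ξ (Fin.last n)‖) ^ (-σ))
    rw [Real.rpow_neg (by positivity), Real.rpow_neg (by positivity)]
    refine (inv_anti₀ (by positivity) e1).trans ?_
    rw [mul_inv, ← mul_assoc]
    refine mul_le_mul_of_nonneg_right ?_ (by positivity)
    rw [← div_eq_mul_inv, le_div_iff₀ p1, inv_mul_le_iff₀ p3]
    linarith
  have hm : Measurable fun q : ℝ × (Fin n → ℝ) => ENNReal.ofReal (A q.2 * B q.1) := by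
    fun_prop
  -- The majorant is a product of a function of `ζ` and a function of `τ`.
  calc ∫⁻ ξ : Spacetime n, ENNReal.ofReal (fN k ξ)
      ≤ ∫⁻ ξ : Spacetime n, ENNReal.ofReal (2 ^ ((k : ℝ) - 1 - σ)) *
          ENNReal.ofReal (A (fun j => ξ j.castSucc) * B (ξ (Fin.last n))) :=
        lintegral_mono fun ξ => by
          rw [← ENNReal.ofReal_mul (by positivity)]
          exact ENNReal.ofReal_le_ofReal (hbound ξ)
    _ = ENNReal.ofReal (2 ^ ((k : ℝ) - 1 - σ)) * ∫⁻ ξ : Spacetime n,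
          ENNReal.ofReal (A (fun j => ξ j.castSucc) * B (ξ (Fin.last n))) :=
        lintegral_const_mul' _ _ ENNReal.ofReal_ne_top
    _ = ENNReal.ofReal (2 ^ ((k : ℝ) - 1 - σ)) * ∫⁻ q : ℝ × (Fin n → ℝ),
          ENNReal.ofReal (A q.2 * B q.1) := by
        congr 1
        have h1 := (volume_preserving_piFinSuccAbove (fun _ : Fin (n + 1) => ℝ) (Fin.last n)).comp
          (PiLp.volume_preserving_ofLp (Fin (n + 1)))
        rw [← h1.lintegral_comp hm]
        refine lintegral_congr fun ξ => ?_
        simp only [Function.comp_apply, MeasurableEquiv.piFinSuccAbove_apply,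
          Fin.insertNthEquiv_symm_apply]
        congr 4
        funext j
        simp [Fin.removeNth_apply, Fin.succAbove_last]
    _ = ENNReal.ofReal (2 ^ ((k : ℝ) - 1 - σ)) *
        ((∫⁻ τ, ENNReal.ofReal (B τ)) * ∫⁻ z, ENNReal.ofReal (A z)) := by
        congr 1
        rw [Measure.volume_eq_prod, ← lintegral_prod_mul (by fun_prop) (by fun_prop)]
        refine lintegral_congr fun q => ?_
        rw [mul_comm, ENNReal.ofReal_mul (by positivity)]
    _ < ⊤ := ENNReal.mul_lt_top ENNReal.ofReal_lt_top (ENNReal.mul_lt_top hB hA)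

theorem fourier_mulS (f g : Sch n) (ξ : Spacetime n) :
    (𝓕 (mulS f g) : Sch n) ξ = ∫ η, (𝓕 f : Sch n) η * (𝓕 g : Sch n) (ξ - η) := by
  have h1 : (𝓕 (mulS f g) : Sch n) =
      SchwartzMap.convolution (ContinuousLinearMap.mul ℂ ℂ) (𝓕 f) (𝓕 g) := by
    have key : ∀ (g : Sch n) (x : Spacetime n), (𝓕 (𝓕 g : Sch n) : Sch n) x = g (-x) := by
      intro g x
      have h2 : (𝓕⁻ (𝓕 g : Sch n) : Sch n) (-x) = (𝓕 (𝓕 g : Sch n) : Sch n) x := by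
        rw [SchwartzMap.fourierInv_apply_eq]
        simp
      rw [← h2, fourierInv_fourier_eq (E := Sch n)]
    refine sch_ext_fourier fun x => ?_
    rw [SchwartzMap.fourier_convolution, key, mulS_apply]
    change _ = (𝓕 (𝓕 f : Sch n) : Sch n) x * (𝓕 (𝓕 g : Sch n) : Sch n) x
    rw [key, key]
  rw [h1, SchwartzMap.convolution_apply]
  rfl

theorem continuous_fN (k : ℕ) : Continuous (fN k : Spacetime n → ℝ) := by
  have h1 : Continuous (fa : Spacetime n → ℝ) := by unfold fa; fun_prop
  have h2 : Continuous (fq : Spacetime n → ℝ) := by unfold fq; fun_prop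
  refine (h1.mul (h2.pow _)).inv₀ fun ξ => ?_
  have h3 := one_le_fa ξ
  have h4 := fa_le_fq ξ
  have h5 : 0 < fq ξ := by linarith
  have h6 : 0 < fa ξ := by linarith
  exact (mul_pos h6 (pow_pos h5 _)).ne'

/-- The product estimate: `k` anisotropic derivatives, distributed arbitrarily over the two
factors, suffice. -/
theorem wn_mulS_le_sob {k k₁ k₂ : ℕ} (hk : (n : ℝ) / 2 + 2 < k) (hk' : 3 < k)
    (h : k ≤ k₁ + k₂) : ∃ C : ℝ, 0 ≤ C ∧ ∀ f g : Sch n,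
      wn 0 (mulS f g) ≤ C * (sob k₁ f * sob k₂ g) := by
  obtain ⟨C, hC, hw⟩ := inv_fwt_mul_le (n := n) (k := k) (by omega) h
  set I := ∫⁻ ξ : Spacetime n, ENNReal.ofReal (fN k ξ) with hI
  have hIt : I < ⊤ := lintegral_fN_lt_top hk hk'
  set M : ℝ≥0∞ := ENNReal.ofReal C * (I + I) with hM
  have hMt : M ≠ ⊤ := ENNReal.mul_ne_top ENNReal.ofReal_ne_top (by simp [hIt.ne])
  refine ⟨Real.sqrt M.toReal, Real.sqrt_nonneg _, fun f g => ?_⟩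
  let F : Spacetime n → ℝ≥0∞ := fun ξ => ENNReal.ofReal (fwt k₁ ξ) * ‖(𝓕 f : Sch n) ξ‖ₑ ^ 2
  let H : Spacetime n → ℝ≥0∞ := fun ξ => ENNReal.ofReal (fwt k₂ ξ) * ‖(𝓕 g : Sch n) ξ‖ₑ ^ 2
  have hF : Measurable F := ((continuous_fwt k₁).measurable.ennreal_ofReal).mul
    ((𝓕 f : Sch n).continuous.enorm.measurable.pow_const 2)
  have hH : Measurable H := ((continuous_fwt k₂).measurable.ennreal_ofReal).mul
    ((𝓕 g : Sch n).continuous.enorm.measurable.pow_const 2)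
  let Q : Spacetime n → Spacetime n → ℝ≥0∞ := fun ξ η =>
    ENNReal.ofReal ((fwt k₁ η * fwt k₂ (ξ - η))⁻¹)
  have hQm : ∀ ξ, Measurable (Q ξ) := fun ξ =>
    (((continuous_fwt k₁).measurable.mul ((continuous_fwt k₂).measurable.comp
      (measurable_const.sub measurable_id))).inv).ennreal_ofReal
  have hHs : ∀ ξ, Measurable fun η => H (ξ - η) := fun ξ =>
    hH.comp (measurable_const.sub measurable_id)
  have hQ : ∀ ξ, ∫⁻ η, Q ξ η ≤ M := fun ξ => by
    calc ∫⁻ η, Q ξ η ≤ ∫⁻ η, ENNReal.ofReal C *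
          (ENNReal.ofReal (fN k η) + ENNReal.ofReal (fN k (ξ - η))) :=
          lintegral_mono fun η => by
            refine (ENNReal.ofReal_le_ofReal (hw η (ξ - η))).trans ?_
            rw [ENNReal.ofReal_mul hC]
            gcongr
            exact ENNReal.ofReal_add_le
      _ = M := by
          rw [lintegral_const_mul' _ _ ENNReal.ofReal_ne_top, lintegral_add_left
            (continuous_fN k).measurable.ennreal_ofReal,
            lintegral_sub_left_eq_self (fun η => ENNReal.ofReal (fN k η)) ξ]
  -- Cauchy–Schwarz in the convolution, after multiplying and dividing by the weights.
  have key : ∀ ξ, ‖(𝓕 (mulS f g) : Sch n) ξ‖ₑ ^ 2 ≤ M * ∫⁻ η, F η * H (ξ - η) := fun ξ => by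
    have e1 : ‖(𝓕 (mulS f g) : Sch n) ξ‖ₑ ≤
        ∫⁻ η, (Q ξ η) ^ (1 / 2 : ℝ) * (F η * H (ξ - η)) ^ (1 / 2 : ℝ) := by
      rw [fourier_mulS]
      refine (enorm_integral_le_lintegral_enorm _).trans_eq (lintegral_congr fun η => ?_)
      have p1 := one_le_fwt k₁ η
      have p2 := one_le_fwt k₂ (ξ - η)
      rw [← ENNReal.mul_rpow_of_nonneg _ _ (by norm_num)]
      have : Q ξ η * (F η * H (ξ - η)) = ‖(𝓕 f : Sch n) η * (𝓕 g : Sch n) (ξ - η)‖ₑ ^ 2 := by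
        simp only [Q, F, H]
        rw [enorm_mul, mul_pow, mul_mul_mul_comm (ENNReal.ofReal (fwt k₁ η)), ← mul_assoc,
          ← ENNReal.ofReal_mul (by linarith), ← ENNReal.ofReal_mul (by positivity),
          inv_mul_cancel₀ (by positivity), ENNReal.ofReal_one, one_mul]
      rw [this, ← ENNReal.rpow_natCast, ← ENNReal.rpow_mul]
      norm_num
    have e2 := ENNReal.lintegral_mul_le_Lp_mul_Lq (volume : Measure (Spacetime n))
      Real.HolderConjugate.two_two (f := fun η => (Q ξ η) ^ (1 / 2 : ℝ))
      (g := fun η => (F η * H (ξ - η)) ^ (1 / 2 : ℝ)) 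
      ((hQm ξ).pow_const _).aemeasurable
      ((hF.mul (hHs ξ)).pow_const _).aemeasurable
    have e3 : ∀ x : ℝ≥0∞, (x ^ (1 / 2 : ℝ)) ^ (2 : ℝ) = x := fun x => by
      rw [← ENNReal.rpow_mul]; norm_num
    simp only [e3] at e2
    have e4 := e1.trans e2
    calc ‖(𝓕 (mulS f g) : Sch n) ξ‖ₑ ^ 2
        ≤ ((∫⁻ η, Q ξ η) ^ (1 / 2 : ℝ) * (∫⁻ η, F η * H (ξ - η)) ^ (1 / 2 : ℝ)) ^ 2 := by
          gcongr
      _ = (∫⁻ η, Q ξ η) * ∫⁻ η, F η * H (ξ - η) := by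
          rw [mul_pow, ← ENNReal.rpow_two, ← ENNReal.rpow_two, e3, e3]
      _ ≤ _ := by gcongr; exact hQ ξ
  -- The remaining convolution of two integrable functions is integrated by Tonelli.
  have hconv : ∫⁻ ξ, ∫⁻ η, F η * H (ξ - η) = (∫⁻ ξ, F ξ) * ∫⁻ ξ, H ξ := by
    rw [lintegral_lintegral_swap
      ((hF.comp measurable_snd).mul (hH.comp (measurable_fst.sub measurable_snd))).aemeasurable]
    have : ∀ η, ∫⁻ ξ, F η * H (ξ - η) = F η * ∫⁻ ξ, H ξ := fun η => by
      have hm : Measurable fun ξ => H (ξ - η) := hH.comp (measurable_id.sub measurable_const)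
      rw [lintegral_const_mul _ hm,
        lintegral_sub_right_eq_self H η]
    simp only [this]
    rw [lintegral_mul_const _ hF]
  have h2 : ENNReal.ofReal (wn 0 (mulS f g) ^ 2) ≤
      M * (ENNReal.ofReal (sob k₁ f ^ 2) * ENNReal.ofReal (sob k₂ g ^ 2)) := by
    rw [← wn_zero_fourier, ← lintegral_wn]
    calc ∫⁻ ξ, ENNReal.ofReal ((1 + ‖ξ‖ ^ 2) ^ (0 : ℝ) * ‖(𝓕 (mulS f g) : Sch n) ξ‖ ^ 2)
        = ∫⁻ ξ, ‖(𝓕 (mulS f g) : Sch n) ξ‖ₑ ^ 2 := lintegral_congr fun ξ => by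
          rw [Real.rpow_zero, one_mul, ENNReal.ofReal_pow (norm_nonneg _), ofReal_norm]
      _ ≤ ∫⁻ ξ, M * ∫⁻ η, F η * H (ξ - η) := lintegral_mono key
      _ = M * ((∫⁻ ξ, F ξ) * ∫⁻ ξ, H ξ) := by rw [lintegral_const_mul' _ _ hMt, hconv]
      _ ≤ _ := by gcongr <;> exact lintegral_fwt _ _
  have h3 : wn 0 (mulS f g) ^ 2 ≤ M.toReal * (sob k₁ f ^ 2 * sob k₂ g ^ 2) := by
    rw [← ENNReal.ofReal_mul (sq_nonneg _), ← ENNReal.ofReal_toReal hMt,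
      ← ENNReal.ofReal_mul ENNReal.toReal_nonneg] at h2
    have := ENNReal.toReal_mono ENNReal.ofReal_ne_top h2
    rwa [ENNReal.toReal_ofReal (sq_nonneg _), ENNReal.toReal_ofReal (by positivity)] at this
  have p1 := sob_nonneg k₁ f
  have p2 := sob_nonneg k₂ g
  refine abs_le_of_sq_le_sq' ?_ (by positivity) |>.2
  rw [mul_pow, Real.sq_sqrt ENNReal.toReal_nonneg, mul_pow]
  exact h3

/-! ### Averaging over boxes -/

theorem continuous_box : Continuous fun p : Spacetime n × Spacetime n => p.1 + boxL p.1 p.2 := by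
  have h1 : Continuous (dl : Spacetime n → ℝ) := continuous_jb.inv₀ fun P => (jb_pos P).ne'
  have h2 : Continuous (bv : Spacetime n → Spacetime n) := h1.smul sp.continuous
  simp only [boxL_apply]
  have h3 : Continuous fun p : Spacetime n × Spacetime n => bv p.1 := h2.comp continuous_fst
  have h4 : Continuous fun p : Spacetime n × Spacetime n => dl p.1 := h1.comp continuous_fst
  fun_prop

/-- The cutoff function of a box. -/
def cutoff : ContDiffBump (0 : Spacetime n) := ⟨1 / 24, 1 / 12, by norm_num, by norm_num⟩

theorem cutoff_eq_one {x : Spacetime n} (hx : ‖x‖ ≤ 1 / 24) : cutoff (n := n) x = 1 :=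
  (cutoff (n := n)).one_of_mem_closedBall (by simpa [cutoff] using hx)

theorem cutoff_eq_zero {x : Spacetime n} (hx : 1 / 12 ≤ ‖x‖) : cutoff (n := n) x = 0 :=
  (cutoff (n := n)).zero_of_le_dist (by simpa [cutoff] using hx)

theorem contDiff_cutoff_mul (c : ℝ) (f : Sch n) (P : Spacetime n) :
    ContDiff ℝ ∞ fun x => ((cutoff (n := n) x : ℝ) : ℂ) * lensF c f (P + boxL P x) :=
  (Complex.ofRealCLM.contDiff.comp (cutoff (n := n)).contDiff).mul
    ((contDiff_lensF c f).comp (contDiff_box P))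

theorem hasCompactSupport_cutoff_mul (c : ℝ) (f : Sch n) (P : Spacetime n) :
    HasCompactSupport fun x => ((cutoff (n := n) x : ℝ) : ℂ) * lensF c f (P + boxL P x) :=
  ((cutoff (n := n)).hasCompactSupport.comp_left Complex.ofReal_zero).mul_right

/-- A dephased function, localized to a box. -/
def boxS (c : ℝ) (f : Sch n) (P : Spacetime n) : Sch n :=
  (hasCompactSupport_cutoff_mul c f P).toSchwartzMap (contDiff_cutoff_mul c f P)

theorem boxS_apply (c : ℝ) (f : Sch n) (P x : Spacetime n) :
    boxS c f P x = ((cutoff (n := n) x : ℝ) : ℂ) * lensF c f (P + boxL P x) := rfl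

/-- The derivatives of a localized function belong to the class of their order. -/
theorem exists_boxCl_Ds {c : ℝ} (hc : c ≠ 0) (l : List (Fin (n + 1))) :
    ∃ H, BoxCl c (lOrd l) H ∧ ∀ f P x, Ds l (boxS c f P) x = H f P x := by
  induction l with
  | nil =>
    refine ⟨_, (BoxCl.word [] 0 (by simp) (by simp)).mul
      (Coef.snd _ (Complex.ofRealCLM.contDiff.comp (cutoff (n := n)).contDiff)), fun f P x => ?_⟩
    change boxS c f P x = _
    rw [boxS_apply, pow_zero, one_mul]
    rfl
  | cons a l ih =>
    obtain ⟨H, hH, h⟩ := ih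
    refine ⟨_, ((hH.fderiv hc a).mono (m' := lOrd (a :: l)) (by simp; omega)).mul
      (Coef.const (-Complex.I)), fun f P x => ?_⟩
    rw [Ds_cons, opDs_apply, show ⇑(Ds l (boxS c f P)) = H f P from funext (h f P)]

theorem Ds_boxS_eq_zero (c : ℝ) (f : Sch n) (P : Spacetime n) (l : List (Fin (n + 1)))
    {x : Spacetime n} (hx : 1 / 12 < ‖x‖) : Ds l (boxS c f P) x = 0 := by
  induction l generalizing x with
  | nil =>
    change boxS c f P x = 0
    rw [boxS_apply, cutoff_eq_zero hx.le, Complex.ofReal_zero, zero_mul]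
  | cons a l ih =>
    have h1 : ⇑(Ds l (boxS c f P)) =ᶠ[nhds x] fun _ => 0 := by
      filter_upwards [(isOpen_lt continuous_const continuous_norm).mem_nhds hx] with y hy
      exact ih hy
    rw [Ds_cons, opDs_apply, h1.fderiv_eq]
    simp

/-- The square integral of a majorant over a box. -/
def boxI (c : ℝ) (k : ℕ) (f : Sch n) (P : Spacetime n) : ℝ≥0∞ :=
  ∫⁻ x in Metric.closedBall (0 : Spacetime n) (1 / 12), ENNReal.ofReal (maj c k f (P + boxL P x) ^ 2)

/-- Each derivative in the box gains a factor `δ` per order. -/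
theorem sob_boxS_le {c : ℝ} (hc : c ≠ 0) (k : ℕ) : ∃ C : ℝ, 0 ≤ C ∧ ∀ (f : Sch n) P,
    ENNReal.ofReal (sob k (boxS c f P) ^ 2) ≤
      ENNReal.ofReal C * (ENNReal.ofReal (dl P ^ (2 * k)) * boxI c k f P) := by
  have h1 : ∀ l ∈ dls n k, ∃ C : ℝ, 0 ≤ C ∧ ∀ (f : Sch n) P,
      ENNReal.ofReal (wn 0 (Ds l (boxS c f P)) ^ 2) ≤
        ENNReal.ofReal C * (ENNReal.ofReal (dl P ^ (2 * k)) * boxI c k f P) := fun l hl => by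
    obtain ⟨H, hH, h⟩ := exists_boxCl_Ds (n := n) hc l
    obtain ⟨C, hC, hb⟩ := (hH.mono (mem_dls.1 hl)).norm_le hc
    refine ⟨C ^ 2, by positivity, fun f P => ?_⟩
    have hd := dl_pos P
    rw [← lintegral_wn, boxI, ← lintegral_const_mul' _ _ ENNReal.ofReal_ne_top,
      ← lintegral_const_mul' _ _ ENNReal.ofReal_ne_top,
      ← lintegral_indicator Metric.isClosed_closedBall.measurableSet]
    refine lintegral_mono fun x => ?_
    rw [Real.rpow_zero, one_mul]
    by_cases hx : ‖x‖ ≤ 1 / 12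
    · rw [Set.indicator_of_mem (by simpa using hx), ← ENNReal.ofReal_mul (by positivity),
        ← ENNReal.ofReal_mul (by positivity)]
      refine ENNReal.ofReal_le_ofReal ?_
      rw [h]
      calc ‖H f P x‖ ^ 2 ≤ (C * (dl P ^ k * maj c k f (P + boxL P x))) ^ 2 := by
            gcongr; exact hb f P x hx
        _ = _ := by ring
    · rw [Ds_boxS_eq_zero c f P l (not_le.1 hx)]
      simp
  choose! C hC h using h1
  refine ⟨(dls n k).card * ∑ l ∈ dls n k, C l,
    mul_nonneg (Nat.cast_nonneg _) (Finset.sum_nonneg hC), fun f P => ?_⟩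
  calc ENNReal.ofReal (sob k (boxS c f P) ^ 2)
      ≤ ENNReal.ofReal ((dls n k).card * ∑ l ∈ dls n k, wn 0 (Ds l (boxS c f P)) ^ 2) :=
        ENNReal.ofReal_le_ofReal (sq_sum_le_card_mul_sum_sq ..)
    _ = ENNReal.ofReal ((dls n k).card) * ∑ l ∈ dls n k,
          ENNReal.ofReal (wn 0 (Ds l (boxS c f P)) ^ 2) := by
        rw [ENNReal.ofReal_mul (Nat.cast_nonneg _),
          ENNReal.ofReal_sum_of_nonneg fun l _ => sq_nonneg _]
    _ ≤ ENNReal.ofReal ((dls n k).card) * ∑ l ∈ dls n k,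
          ENNReal.ofReal (C l) * (ENNReal.ofReal (dl P ^ (2 * k)) * boxI c k f P) := by
        gcongr with l hl
        exact h l hl f P
    _ = _ := by
        rw [← Finset.sum_mul, ← mul_assoc, ← ENNReal.ofReal_sum_of_nonneg hC,
          ← ENNReal.ofReal_mul (Nat.cast_nonneg _)]

theorem measurable_comp_box {F : Spacetime n → ℝ} (hF : Continuous F) :
    Measurable fun p : Spacetime n × Spacetime n => ENNReal.ofReal (F (p.1 + boxL p.1 p.2)) :=
  (hF.comp continuous_box).measurable.ennreal_ofReal

/-- Weights are comparable on boxes. -/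
theorem lw_mul_boxI_le (α β c : ℝ) (k : ℕ) (f : Sch n) (P : Spacetime n) :
    ENNReal.ofReal (lw α β P) * boxI c k f P ≤ ENNReal.ofReal (2 ^ (|α| + |β|)) *
      ∫⁻ x in Metric.closedBall (0 : Spacetime n) (1 / 12),
        ENNReal.ofReal (lw α β (P + boxL P x) * maj c k f (P + boxL P x) ^ 2) := by
  rw [boxI, ← lintegral_const_mul' _ _ ENNReal.ofReal_ne_top,
    ← lintegral_const_mul' _ _ ENNReal.ofReal_ne_top]
  refine setLIntegral_mono' Metric.isClosed_closedBall.measurableSet fun x hx => ?_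
  have hl := lw_pos α β P
  rw [← ENNReal.ofReal_mul hl.le, ← ENNReal.ofReal_mul (by positivity), ← mul_assoc]
  refine ENNReal.ofReal_le_ofReal (mul_le_mul_of_nonneg_right ?_ (sq_nonneg _))
  refine lw_le_of_box α β ?_
  rw [norm_sub_rev]
  exact norm_box_sub_le (by simpa using hx) P

/-- The uniform bound in a single box: the box has volume of order `δ⁴` relative to its parameter
ball, which explains the factor. -/
theorem lw_mul_boxI_le_sup (r c : ℝ) (k : ℕ) : ∃ C : ℝ≥0∞, C ≠ ⊤ ∧ ∀ (f : Sch n) (K : ℝ),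
    (∀ w, wordOrder w ≤ k → wn r (Ws c w f) ≤ K) → ∀ P,
      ENNReal.ofReal (dl P ^ 4) * (ENNReal.ofReal (lw (2 * r) (2 * r + (n + 1)) P) * boxI c k f P) ≤
        C * ENNReal.ofReal (K ^ 2) := by
  refine ⟨ENNReal.ofReal (2 ^ (|2 * r| + |2 * r + (n + 1)|)) *
    ENNReal.ofReal ((wds n k).card ^ 2), by finiteness, fun f K hK P => ?_⟩
  have hcont : Continuous fun Y : Spacetime n => lw (2 * r) (2 * r + (n + 1)) Y * maj c k f Y ^ 2 :=
    (continuous_lw _ _).mul ((continuous_maj c k f).pow 2)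
  have hd := dl_pos P
  calc _ ≤ ENNReal.ofReal (dl P ^ 4) * (ENNReal.ofReal (2 ^ (|2 * r| + |2 * r + (n + 1)|)) *
        ∫⁻ x, ENNReal.ofReal (lw (2 * r) (2 * r + (n + 1)) (P + boxL P x) *
          maj c k f (P + boxL P x) ^ 2)) := by
        gcongr ENNReal.ofReal (dl P ^ 4) * ?_
        refine (lw_mul_boxI_le ..).trans (mul_le_mul_right ?_ _)
        exact setLIntegral_le_lintegral _ _
    _ ≤ ENNReal.ofReal (dl P ^ 4) * (ENNReal.ofReal (2 ^ (|2 * r| + |2 * r + (n + 1)|)) *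
        (ENNReal.ofReal (jb P ^ 4) * ENNReal.ofReal (((wds n k).card * K) ^ 2))) := by
        rw [lintegral_boxL P hcont.measurable.ennreal_ofReal]
        gcongr
        exact lintegral_maj_le c r k f hK
    _ = _ := by
        rw [← ENNReal.ofReal_mul (by positivity), ← ENNReal.ofReal_mul (by positivity),
          ← ENNReal.ofReal_mul (by positivity), ← ENNReal.ofReal_mul (by positivity),
          ← ENNReal.ofReal_mul (by positivity)]
        congr 1
        have : dl P ^ 4 * jb P ^ 4 = 1 := by rw [← mul_pow, dl_mul_jb, one_pow]
        linear_combination (2 ^ (|2 * r| + |2 * r + (n + 1)|) * ((wds n k).card * K) ^ 2) * this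

/-- The integrated bound: for fixed position `x` in the box, the centre is a near-identity change of
variables away from the point `P + boxL P x`. -/
theorem lintegral_lw_mul_boxI_le (r c : ℝ) (k : ℕ) : ∃ C : ℝ≥0∞, C ≠ ⊤ ∧ ∀ (f : Sch n) (K : ℝ),
    (∀ w, wordOrder w ≤ k → wn r (Ws c w f) ≤ K) →
      ∫⁻ P, ENNReal.ofReal (lw (2 * r) (2 * r + (n + 1)) P) * boxI c k f P ≤
        C * ENNReal.ofReal (K ^ 2) := by
  refine ⟨ENNReal.ofReal (2 ^ (|2 * r| + |2 * r + (n + 1)|)) *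
    (2 ^ (n + 1) * ENNReal.ofReal ((wds n k).card ^ 2) *
      volume (Metric.closedBall (0 : Spacetime n) (1 / 12))), ?_, fun f K hK => ?_⟩
  · have := measure_closedBall_lt_top (μ := volume) (x := (0 : Spacetime n)) (r := 1 / 12)
    finiteness
  have hcont : Continuous fun Y : Spacetime n => lw (2 * r) (2 * r + (n + 1)) Y * maj c k f Y ^ 2 :=
    (continuous_lw _ _).mul ((continuous_maj c k f).pow 2)
  calc _ ≤ ∫⁻ P, ENNReal.ofReal (2 ^ (|2 * r| + |2 * r + (n + 1)|)) *
        ∫⁻ x in Metric.closedBall (0 : Spacetime n) (1 / 12), ENNReal.ofReal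
          (lw (2 * r) (2 * r + (n + 1)) (P + boxL P x) * maj c k f (P + boxL P x) ^ 2) :=
        lintegral_mono fun P => lw_mul_boxI_le ..
    _ = ENNReal.ofReal (2 ^ (|2 * r| + |2 * r + (n + 1)|)) *
        ∫⁻ x in Metric.closedBall (0 : Spacetime n) (1 / 12), ∫⁻ P, ENNReal.ofReal
          (lw (2 * r) (2 * r + (n + 1)) (P + boxL P x) * maj c k f (P + boxL P x) ^ 2) := by
        rw [lintegral_const_mul' _ _ ENNReal.ofReal_ne_top, lintegral_lintegral_swap]
        exact (measurable_comp_box hcont).aemeasurable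
    _ ≤ ENNReal.ofReal (2 ^ (|2 * r| + |2 * r + (n + 1)|)) *
        ∫⁻ _x in Metric.closedBall (0 : Spacetime n) (1 / 12),
          2 ^ (n + 1) * ENNReal.ofReal (((wds n k).card * K) ^ 2) := by
        refine mul_le_mul_right ?_ _
        refine setLIntegral_mono' Metric.isClosed_closedBall.measurableSet fun x hx => ?_
        refine (lintegral_add_lipschitz_le (lipschitz_boxL (by simpa using hx))
          hcont.measurable.ennreal_ofReal).trans ?_
        gcongr
        exact lintegral_maj_le c r k f hK
    _ = _ := by
        rw [setLIntegral_const, mul_pow, ENNReal.ofReal_mul (by positivity)]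
        ring

/-- A weighted integral is dominated by its average over the positions in a box. -/
theorem lintegral_lw_le_average (α β : ℝ) {p : Spacetime n → ℝ} (hp : Continuous p)
    (hp0 : ∀ Q, 0 ≤ p Q) :
    volume (Metric.closedBall (0 : Spacetime n) (1 / 24)) *
      ∫⁻ Q, ENNReal.ofReal (lw α β Q * p Q) ≤
      2 ^ (n + 1) * ENNReal.ofReal (2 ^ (|α| + |β|)) * ∫⁻ P, ENNReal.ofReal (lw α β P) *
        ∫⁻ x in Metric.closedBall (0 : Spacetime n) (1 / 24), ENNReal.ofReal (p (P + boxL P x)) := by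
  have hlp : Continuous fun Q => lw α β Q * p Q := (continuous_lw α β).mul hp
  have hb : MeasurableSet (Metric.closedBall (0 : Spacetime n) (1 / 24)) :=
    Metric.isClosed_closedBall.measurableSet
  have h1 : ∀ x ∈ Metric.closedBall (0 : Spacetime n) (1 / 24),
      ∫⁻ Q, ENNReal.ofReal (lw α β Q * p Q) ≤
      2 ^ (n + 1) * ENNReal.ofReal (2 ^ (|α| + |β|)) *
        ∫⁻ P, ENNReal.ofReal (lw α β P) * ENNReal.ofReal (p (P + boxL P x)) := fun x hx => by
    have hx' : ‖x‖ ≤ 1 / 12 := (by simpa using hx : ‖x‖ ≤ 1 / 24).trans (by norm_num)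
    rw [mul_assoc]
    refine (lintegral_le_add_lipschitz (lipschitz_boxL hx') hlp.measurable.ennreal_ofReal).trans
      (mul_le_mul_right ?_ _)
    rw [← lintegral_const_mul' _ _ ENNReal.ofReal_ne_top]
    refine lintegral_mono fun P => ?_
    have hl := lw_pos α β P
    rw [← ENNReal.ofReal_mul hl.le, ← ENNReal.ofReal_mul (by positivity), ← mul_assoc]
    exact ENNReal.ofReal_le_ofReal (mul_le_mul_of_nonneg_right
      (lw_le_of_box α β (norm_box_sub_le hx' P)) (hp0 _))
  rw [mul_comm, ← setLIntegral_const]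
  refine (setLIntegral_mono' hb h1).trans_eq ?_
  rw [lintegral_const_mul' _ _ (by finiteness), lintegral_lintegral_swap]
  · congr 1
    refine lintegral_congr fun P => ?_
    rw [lintegral_const_mul' _ _ ENNReal.ofReal_ne_top]
  · refine Measurable.aemeasurable ?_
    exact ((continuous_lw α β).comp continuous_snd).measurable.ennreal_ofReal.mul
      ((measurable_comp_box hp).comp measurable_swap)

/-- The Sobolev estimate in a single box. -/
theorem lintegral_box_le {k k₁ k₂ : ℕ} (hk : (n : ℝ) / 2 + 2 < k) (hk' : 3 < k) (h : k ≤ k₁ + k₂)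
    {c₁ c₂ : ℝ} (hc₁ : c₁ ≠ 0) (hc₂ : c₂ ≠ 0) : ∃ C : ℝ≥0∞, C ≠ ⊤ ∧ ∀ (f g : Sch n) P,
      ∫⁻ x in Metric.closedBall (0 : Spacetime n) (1 / 24), ENNReal.ofReal
        ((‖lensF c₁ f (P + boxL P x)‖ * ‖lensF c₂ g (P + boxL P x)‖) ^ 2) ≤
      C * (ENNReal.ofReal (dl P ^ (2 * k₁) * dl P ^ (2 * k₂)) *
        (boxI c₁ k₁ f P * boxI c₂ k₂ g P)) := by
  obtain ⟨Cs, hCs, hs⟩ := wn_mulS_le_sob (n := n) hk hk' h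
  obtain ⟨B₁, hB₁, hb₁⟩ := sob_boxS_le (n := n) hc₁ k₁
  obtain ⟨B₂, hB₂, hb₂⟩ := sob_boxS_le (n := n) hc₂ k₂
  refine ⟨ENNReal.ofReal (Cs ^ 2) * (ENNReal.ofReal B₁ * ENNReal.ofReal B₂), by finiteness,
    fun f g P => ?_⟩
  have e1 : ∫⁻ x in Metric.closedBall (0 : Spacetime n) (1 / 24), ENNReal.ofReal
      ((‖lensF c₁ f (P + boxL P x)‖ * ‖lensF c₂ g (P + boxL P x)‖) ^ 2) ≤
      ENNReal.ofReal (wn 0 (mulS (boxS c₁ f P) (boxS c₂ g P)) ^ 2) := by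
    rw [← lintegral_wn]
    refine le_trans ?_ (setLIntegral_le_lintegral
      (Metric.closedBall (0 : Spacetime n) (1 / 24)) _)
    refine setLIntegral_mono' Metric.isClosed_closedBall.measurableSet fun x hx => ?_
    have hx' : ‖x‖ ≤ 1 / 24 := by simpa using hx
    rw [Real.rpow_zero, one_mul, mulS_apply, boxS_apply, boxS_apply, cutoff_eq_one hx',
      Complex.ofReal_one, one_mul, one_mul, norm_mul]
  have e2 : ENNReal.ofReal (wn 0 (mulS (boxS c₁ f P) (boxS c₂ g P)) ^ 2) ≤
      ENNReal.ofReal (Cs ^ 2) * (ENNReal.ofReal (sob k₁ (boxS c₁ f P) ^ 2) *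
        ENNReal.ofReal (sob k₂ (boxS c₂ g P) ^ 2)) := by
    rw [← ENNReal.ofReal_mul (by positivity), ← ENNReal.ofReal_mul (by positivity),
      ← mul_pow, ← mul_pow]
    refine ENNReal.ofReal_le_ofReal (pow_le_pow_left₀ (wn_nonneg _ _) (hs _ _) 2)
  have hd := dl_pos P
  refine (e1.trans e2).trans ((mul_le_mul_right (mul_le_mul' (hb₁ f P) (hb₂ g P)) _).trans_eq ?_)
  rw [ENNReal.ofReal_mul (by positivity)]
  ring

/-- The powers of `δ` gained in each box compensate the volume of the boxes and improve the
decay. -/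
theorem lw_mul_dl_le {k₁ k₂ : ℕ} (h : n + 5 ≤ 2 * k₁ + 2 * k₂) (r₁ r₂ : ℝ) (P : Spacetime n) :
    lw (2 * (r₁ + r₂ + ((n : ℝ) + 1) / 2)) (2 * (r₁ + r₂ + ((n : ℝ) + 1) / 2) + (n + 1)) P *
      (dl P ^ (2 * k₁) * dl P ^ (2 * k₂)) ≤ dl P ^ 4 *
        (lw (2 * r₁) (2 * r₁ + (n + 1)) P * lw (2 * r₂) (2 * r₂ + (n + 1)) P) := by
  have hj := jb_pos P
  rw [lw_mul, lw, lw]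
  have hnat : (n : ℝ) + 5 ≤ 2 * k₁ + 2 * k₂ := by exact_mod_cast h
  have e4 : ∀ m : ℕ, dl P ^ m = jb P ^ (-(m : ℝ)) := fun m => by
    rw [Real.rpow_neg hj.le, Real.rpow_natCast, dl, inv_pow]
  have e5 : 2 * (r₁ + r₂ + ((n : ℝ) + 1) / 2) + (n + 1) =
    2 * r₁ + (n + 1) + (2 * r₂ + (n + 1)) := by ring
  rw [e4, e4, e4, ← e5, ← Real.rpow_add hj, mul_right_comm, ← Real.rpow_add hj, ← mul_assoc,
    ← Real.rpow_add hj]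
  refine mul_le_mul_of_nonneg_right (Real.rpow_le_rpow_of_exponent_le (one_le_jb P) ?_)
    (Real.rpow_pos_of_pos (Real.cosh_pos _) _).le
  push_cast
  linarith

/-- The product estimate without loss in the decay: for words of total order `k`. -/
theorem wn_mulS_le {k k₁ k₂ : ℕ} (hk : (n : ℝ) / 2 + 2 < k) (hk' : 3 < k) (h : k ≤ k₁ + k₂)
    {c₁ c₂ : ℝ} (hc₁ : c₁ ≠ 0) (hc₂ : c₂ ≠ 0) (r₁ r₂ : ℝ) : ∃ C : ℝ, 0 ≤ C ∧
      ∀ (f g : Sch n) (K₁ K₂ : ℝ), (∀ w, wordOrder w ≤ k₁ → wn r₁ (Ws c₁ w f) ≤ K₁) →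
        (∀ w, wordOrder w ≤ k₂ → wn r₂ (Ws c₂ w g) ≤ K₂) →
          wn (r₁ + r₂ + ((n : ℝ) + 1) / 2) (mulS f g) ≤ C * (K₁ * K₂) := by
  obtain ⟨B, hB, hb⟩ := lintegral_box_le (n := n) hk hk' h hc₁ hc₂
  obtain ⟨D₁, hD₁, hd₁⟩ := lw_mul_boxI_le_sup (n := n) r₁ c₁ k₁
  obtain ⟨D₂, hD₂, hd₂⟩ := lintegral_lw_mul_boxI_le (n := n) r₂ c₂ k₂
  -- `2 k > n + 4` for integers.
  have hnk : n + 5 ≤ 2 * k₁ + 2 * k₂ := by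
    have h3 : n + 4 < 2 * k := by
      have : (n : ℝ) + 4 < 2 * k := by linarith
      exact_mod_cast this
    omega
  set r := r₁ + r₂ + ((n : ℝ) + 1) / 2 with hr
  set V := volume (Metric.closedBall (0 : Spacetime n) (1 / 24)) with hV
  have hV0 : V ≠ 0 := (Metric.measure_closedBall_pos _ _ (by norm_num)).ne'
  have hVt : V ≠ ⊤ := measure_closedBall_lt_top.ne
  set W : ℝ≥0∞ := 2 ^ (n + 1) * ENNReal.ofReal (2 ^ (|2 * r| + |2 * r + (n + 1)|)) with hW
  have hWt : W ≠ ⊤ := by rw [hW]; finiteness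
  set M : ℝ≥0∞ := W * (B * (D₁ * D₂)) / V with hM
  have hMt : M ≠ ⊤ := by
    rw [hM]
    exact ENNReal.div_ne_top (by finiteness) hV0
  refine ⟨Real.sqrt M.toReal, Real.sqrt_nonneg _, fun f g K₁ K₂ hf hg => ?_⟩
  have hK₁ : 0 ≤ K₁ := (wn_nonneg _ _).trans (hf [] (by simp))
  have hK₂ : 0 ≤ K₂ := (wn_nonneg _ _).trans (hg [] (by simp))
  have hX : ENNReal.ofReal (wn r (mulS f g) ^ 2) = ∫⁻ Q, ENNReal.ofReal
      (lw (2 * r) (2 * r + (n + 1)) Q * (‖lensF c₁ f Q‖ * ‖lensF c₂ g Q‖) ^ 2) := by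
    rw [← lintegral_lensF 0 r]
    refine lintegral_congr fun Q => ?_
    simp only [norm_lensF, mulS_apply, norm_mul]
  -- The squared norm is an average over boxes. In each box one factor is estimated uniformly and
  -- the other one is integrated over the centres.
  have h1 := lintegral_lw_le_average (2 * r) (2 * r + ((n : ℝ) + 1))
    (p := fun Q : Spacetime n => (‖lensF c₁ f Q‖ * ‖lensF c₂ g Q‖) ^ 2)
    (((continuous_lensF _ _).norm.mul (continuous_lensF _ _).norm).pow 2) fun Q => sq_nonneg _
  rw [← hX, ← hV, ← hW] at h1
  have h2 : ∀ P, ENNReal.ofReal (lw (2 * r) (2 * r + (n + 1)) P) *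
      ∫⁻ x in Metric.closedBall (0 : Spacetime n) (1 / 24), ENNReal.ofReal
        ((‖lensF c₁ f (P + boxL P x)‖ * ‖lensF c₂ g (P + boxL P x)‖) ^ 2) ≤
      B * (D₁ * ENNReal.ofReal (K₁ ^ 2)) *
          (ENNReal.ofReal (lw (2 * r₂) (2 * r₂ + (n + 1)) P) * boxI c₂ k₂ g P) := fun P => by
    have hd := dl_pos P
    calc _ ≤ ENNReal.ofReal (lw (2 * r) (2 * r + (n + 1)) P) *
          (B * (ENNReal.ofReal (dl P ^ (2 * k₁) * dl P ^ (2 * k₂)) *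
            (boxI c₁ k₁ f P * boxI c₂ k₂ g P))) := mul_le_mul_right (hb f g P) _
      _ = B * (ENNReal.ofReal (lw (2 * r) (2 * r + (n + 1)) P *
            (dl P ^ (2 * k₁) * dl P ^ (2 * k₂))) * (boxI c₁ k₁ f P * boxI c₂ k₂ g P)) := by
          rw [ENNReal.ofReal_mul (lw_pos _ _ _).le]
          ring
      _ ≤ B * (ENNReal.ofReal (dl P ^ 4 * (lw (2 * r₁) (2 * r₁ + (n + 1)) P *
            lw (2 * r₂) (2 * r₂ + (n + 1)) P)) * (boxI c₁ k₁ f P * boxI c₂ k₂ g P)) :=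
          mul_le_mul_right (mul_le_mul_left
            (ENNReal.ofReal_le_ofReal (lw_mul_dl_le hnk r₁ r₂ P)) _) _
      _ = B * (ENNReal.ofReal (dl P ^ 4) * (ENNReal.ofReal (lw (2 * r₁) (2 * r₁ + (n + 1)) P) *
            boxI c₁ k₁ f P)) *
            (ENNReal.ofReal (lw (2 * r₂) (2 * r₂ + (n + 1)) P) * boxI c₂ k₂ g P) := by
          rw [ENNReal.ofReal_mul (by positivity), ENNReal.ofReal_mul (lw_pos _ _ _).le]
          ring
      _ ≤ _ := mul_le_mul_left (mul_le_mul_right (hd₁ f K₁ hf P) _) _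
  have h3 : V * ENNReal.ofReal (wn r (mulS f g) ^ 2) ≤ V * (M * ENNReal.ofReal ((K₁ * K₂) ^ 2)) := by
    calc _ ≤ W * ∫⁻ P, B * (D₁ * ENNReal.ofReal (K₁ ^ 2)) *
          (ENNReal.ofReal (lw (2 * r₂) (2 * r₂ + (n + 1)) P) * boxI c₂ k₂ g P) :=
          h1.trans (mul_le_mul_right (lintegral_mono h2) _)
      _ ≤ W * (B * (D₁ * ENNReal.ofReal (K₁ ^ 2)) * (D₂ * ENNReal.ofReal (K₂ ^ 2))) := by
          rw [lintegral_const_mul' _ _ (by finiteness)]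
          exact mul_le_mul_right (mul_le_mul_right (hd₂ g K₂ hg) _) _
      _ = (M * V) * ENNReal.ofReal ((K₁ * K₂) ^ 2) := by
          rw [hM, ENNReal.div_mul_cancel hV0 hVt, mul_pow, ENNReal.ofReal_mul (by positivity)]
          ring
      _ = _ := by ring
  have h4 := (ENNReal.mul_le_mul_iff_right hV0 hVt).1 h3
  have h5 : wn r (mulS f g) ^ 2 ≤ M.toReal * (K₁ * K₂) ^ 2 := by
    rw [← ENNReal.ofReal_toReal hMt, ← ENNReal.ofReal_mul ENNReal.toReal_nonneg] at h4
    exact (ENNReal.ofReal_le_ofReal_iff (by positivity)).1 h4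
  refine abs_le_of_sq_le_sq' ?_ (by positivity) |>.2
  rw [mul_pow, Real.sq_sqrt ENNReal.toReal_nonneg]
  exact h5

/-! ### Interpolation with complex powers -/

section Analytic

variable {α : Type*} [MeasurableSpace α] {μ : Measure α} {K : α → ℂ} {L : α → ℝ}

/-- The integral of `K e^{z L}`. -/
def expInt (μ : Measure α) (K : α → ℂ) (L : α → ℝ) (z : ℂ) : ℂ := ∫ a, K a * Complex.exp (z * L a) ∂μ

theorem norm_exp_mul_le (hL : ∀ a, L a ≤ 0) {z : ℂ} (hz : 0 ≤ z.re) (a : α) :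
    ‖Complex.exp (z * L a)‖ ≤ 1 := by
  rw [Complex.norm_exp, Real.exp_le_one_iff]
  simpa using mul_nonpos_of_nonneg_of_nonpos hz (hL a)

theorem aestronglyMeasurable_expInt (hK : Integrable K μ) (hLm : Measurable L) (z : ℂ) :
    AEStronglyMeasurable (fun a => K a * Complex.exp (z * L a)) μ :=
  hK.aestronglyMeasurable.mul ((Complex.measurable_exp.comp
    ((Complex.measurable_ofReal.comp hLm).const_mul z)).aestronglyMeasurable)

theorem norm_expInt_le (hK : Integrable K μ) (hL : ∀ a, L a ≤ 0) {z : ℂ} (hz : 0 ≤ z.re) :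
    ‖expInt μ K L z‖ ≤ ∫ a, ‖K a‖ ∂μ := by
  refine norm_integral_le_of_norm_le hK.norm (Filter.Eventually.of_forall fun a => ?_)
  rw [norm_mul]
  exact mul_le_of_le_one_right (norm_nonneg _) (norm_exp_mul_le hL hz a)

theorem continuousOn_expInt (hK : Integrable K μ) (hLm : Measurable L) (hL : ∀ a, L a ≤ 0) :
    ContinuousOn (expInt μ K L) {z | 0 ≤ z.re} := by
  refine continuousOn_of_dominated (bound := fun a => ‖K a‖)
    (fun z _ => aestronglyMeasurable_expInt hK hLm z) (fun z hz => ?_) hK.norm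
    (Filter.Eventually.of_forall fun a => by fun_prop)
  refine Filter.Eventually.of_forall fun a => ?_
  rw [norm_mul]
  exact mul_le_of_le_one_right (norm_nonneg _) (norm_exp_mul_le hL hz a)

/-- Differentiation under the integral sign. The exponent `L` may be unbounded below, but in the
open half plane `|L| e^{z L}` is bounded. -/
theorem differentiableAt_expInt (hK : Integrable K μ) (hLm : Measurable L) (hL : ∀ a, L a ≤ 0)
    {z₀ : ℂ} (hz₀ : 0 < z₀.re) : DifferentiableAt ℂ (expInt μ K L) z₀ := by
  have hs : {z : ℂ | z₀.re / 2 < z.re} ∈ nhds z₀ :=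
    (isOpen_lt continuous_const Complex.continuous_re).mem_nhds (by simp; linarith)
  refine (hasDerivAt_integral_of_dominated_loc_of_deriv_le (μ := μ)
    (F := fun z a => K a * Complex.exp (z * L a))
    (F' := fun z a => K a * (Complex.exp (z * L a) * L a)) (bound := fun a => ‖K a‖ * (z₀.re / 2)⁻¹)
    hs (Filter.Eventually.of_forall fun z => aestronglyMeasurable_expInt hK hLm z) ?_ ?_ ?_
    (hK.norm.mul_const _) ?_).2.differentiableAt
  · refine hK.mono (aestronglyMeasurable_expInt hK hLm z₀) (Filter.Eventually.of_forall fun a => ?_)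
    rw [norm_mul]
    exact mul_le_of_le_one_right (norm_nonneg _) (norm_exp_mul_le hL hz₀.le a)
  · have := (aestronglyMeasurable_expInt hK hLm z₀).mul
      (Complex.measurable_ofReal.comp hLm).aestronglyMeasurable
    refine this.congr (Filter.Eventually.of_forall fun a => ?_)
    simp [mul_assoc]
  · refine Filter.Eventually.of_forall fun a z hz => ?_
    have hz' : z₀.re / 2 < z.re := hz
    have hε : 0 < z₀.re / 2 := by linarith
    rw [norm_mul, norm_mul, Complex.norm_exp]
    refine mul_le_mul_of_nonneg_left ?_ (norm_nonneg _)
    -- `t e^{-ε t} ≤ 1 / ε`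
    have h1 : (z * (L a : ℂ)).re ≤ z₀.re / 2 * L a := by
      simp only [Complex.mul_re, Complex.ofReal_re, Complex.ofReal_im, mul_zero, sub_zero]
      exact mul_le_mul_of_nonpos_right hz'.le (hL a)
    have h2 := Real.add_one_le_exp (-(z₀.re / 2 * L a))
    have h3 : Real.exp (z₀.re / 2 * L a) * Real.exp (-(z₀.re / 2 * L a)) = 1 := by
      rw [← Real.exp_add]; simp
    have h4 := Real.exp_pos (z₀.re / 2 * L a)
    rw [Complex.norm_real, Real.norm_of_nonpos (hL a), ← one_div, le_div_iff₀ hε]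
    have h5 := Real.exp_le_exp.2 h1
    calc Real.exp (z * (L a : ℂ)).re * -L a * (z₀.re / 2)
        ≤ Real.exp (z₀.re / 2 * L a) * -L a * (z₀.re / 2) := by
          gcongr
          exact neg_nonneg.2 (hL a)
      _ ≤ 1 := by nlinarith
  · refine Filter.Eventually.of_forall fun a z _ => ?_
    have h1 : HasDerivAt (fun z : ℂ => z * (L a : ℂ)) (L a : ℂ) z := by
      simpa using (hasDerivAt_id z).mul_const (L a : ℂ)
    exact h1.cexp.const_mul (K a)

/-- The three lines theorem for `e^{z²} ∫ K e^{z L}`: the Gaussian factor allows polynomial growth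
along the boundary lines. -/
theorem norm_expInt_le_of_lines (hK : Integrable K μ) (hLm : Measurable L) {C₀ : ℝ} (hC₀ : 0 ≤ C₀)
    (hL : ∀ a, L a ≤ C₀) {A : ℝ} {N : ℕ}
    (h0 : ∀ y : ℝ, ‖expInt μ K L (y * Complex.I)‖ ≤ A * (1 + |y|) ^ N)
    (h1 : ∀ y : ℝ, ‖expInt μ K L (1 + y * Complex.I)‖ ≤ A * (1 + |y|) ^ N)
    {θ : ℝ} (hθ0 : 0 ≤ θ) (hθ1 : θ ≤ 1) :
    ‖expInt μ K L θ‖ ≤ A * (N.factorial * Real.exp 3) := by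
  have hA : 0 ≤ A := by simpa using (norm_nonneg _).trans (h0 0)
  -- Subtracting the upper bound makes the exponent nonpositive.
  set L' : α → ℝ := fun a => L a - C₀ with hL'
  have hL'm : Measurable L' := hLm.sub_const _
  have hL'0 : ∀ a, L' a ≤ 0 := fun a => sub_nonpos.2 (hL a)
  let Φ : ℂ → ℂ := fun z => Complex.exp (z ^ 2) * (Complex.exp (z * C₀) * expInt μ K L' z)
  have hΦ : ∀ z, Φ z = Complex.exp (z ^ 2) * expInt μ K L z := fun z => by
    simp only [Φ, expInt]
    rw [← integral_const_mul (Complex.exp (z * C₀))]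
    congr 1
    refine integral_congr_ae (Filter.Eventually.of_forall fun a => ?_)
    simp only [hL']
    rw [mul_left_comm, ← Complex.exp_add]
    congr 2
    push_cast
    ring
  have hsq : ∀ x y : ℝ, ‖Complex.exp ((x + y * Complex.I) ^ 2)‖ = Real.exp (x ^ 2 - y ^ 2) :=
    fun x y => by
      rw [Complex.norm_exp]
      congr 1
      simp [sq]
  -- `(1 + |y|)^N ≤ N! e^{1 + |y|}` and `|y| ≤ 1 + y²`
  have hy : ∀ y : ℝ, Real.exp (1 - y ^ 2) * (1 + |y|) ^ N ≤ N.factorial * Real.exp 3 := fun y => by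
    have e1 := Real.pow_div_factorial_le_exp (1 + |y|) (by positivity) N
    rw [div_le_iff₀ (by positivity)] at e1
    calc Real.exp (1 - y ^ 2) * (1 + |y|) ^ N
        ≤ Real.exp (1 - y ^ 2) * (Real.exp (1 + |y|) * N.factorial) := by gcongr
      _ = N.factorial * Real.exp ((1 - y ^ 2) + (1 + |y|)) := by rw [Real.exp_add (1 - y ^ 2)]; ring
      _ ≤ N.factorial * Real.exp 3 := by
        gcongr
        nlinarith [sq_abs y, sq_nonneg (|y| - 1 / 2)]
  have hd : DiffContOnCl ℂ Φ (Complex.HadamardThreeLines.verticalStrip 0 1) := by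
    have hcl : closure (Complex.HadamardThreeLines.verticalStrip 0 1) ⊆ {z | 0 ≤ z.re} := by
      refine closure_minimal (fun z hz => ?_) (isClosed_le continuous_const Complex.continuous_re)
      exact (show (0 : ℝ) < z.re from hz.1).le
    refine ⟨fun z hz => ?_, ?_⟩
    · refine DifferentiableAt.differentiableWithinAt ?_
      have := differentiableAt_expInt hK hL'm hL'0 (show (0 : ℝ) < z.re from hz.1)
      simp only [Φ]
      fun_prop
    · have := (continuousOn_expInt hK hL'm hL'0).mono hcl
      simp only [Φ]
      fun_prop
  have hB : BddAbove ((norm ∘ Φ) '' Complex.HadamardThreeLines.verticalClosedStrip 0 1) := by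
    refine ⟨Real.exp 1 * (Real.exp C₀ * ∫ a, ‖K a‖ ∂μ), ?_⟩
    rintro _ ⟨z, hz, rfl⟩
    have hz0 : 0 ≤ z.re := hz.1
    have hz1 : z.re ≤ 1 := hz.2
    simp only [Function.comp_apply, Φ, norm_mul]
    have e1 : ‖Complex.exp (z ^ 2)‖ ≤ Real.exp 1 := by
      rw [Complex.norm_exp]
      refine Real.exp_le_exp.2 ?_
      simp only [sq, Complex.mul_re]
      nlinarith [mul_self_nonneg z.im]
    have e2 : ‖Complex.exp (z * C₀)‖ ≤ Real.exp C₀ := by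
      rw [Complex.norm_exp]
      refine Real.exp_le_exp.2 ?_
      simp
      nlinarith
    have e3 := norm_expInt_le hK hL'0 hz0
    gcongr
  have hθ := Complex.HadamardThreeLines.norm_le_interp_of_mem_verticalClosedStrip' (f := Φ)
    (z := (θ : ℂ)) (a := A * (N.factorial * Real.exp 3)) (b := A * (N.factorial * Real.exp 3))
    zero_lt_one (by
      change (θ : ℂ).re ∈ Set.Icc (0 : ℝ) 1
      simpa using ⟨hθ0, hθ1⟩) hd hB (fun z hz => ?_) fun z hz => ?_
  · rw [← Real.rpow_add_of_nonneg (by positivity) (by simpa using hθ1) (by simpa using hθ0)] at hθ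
    simp only [sub_zero, div_one, sub_add_cancel, Real.rpow_one] at hθ
    have e1 : ‖Complex.exp ((θ : ℂ) ^ 2)‖ = Real.exp (θ ^ 2) := by
      simpa using hsq θ 0
    rw [hΦ, norm_mul, e1] at hθ
    have e2 := Real.one_le_exp (sq_nonneg θ)
    have e3 := norm_nonneg (expInt μ K L θ)
    nlinarith
  · have hz' : z = (z.im : ℂ) * Complex.I := by
      apply Complex.ext <;> simp [show z.re = 0 from hz]
    rw [hΦ, norm_mul, hz']
    have e1 : ‖Complex.exp (((z.im : ℂ) * Complex.I) ^ 2)‖ ≤ Real.exp (1 - z.im ^ 2) := by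
      have := hsq 0 z.im
      rw [Complex.ofReal_zero, zero_add] at this
      rw [this]
      exact Real.exp_le_exp.2 (by linarith [sq_nonneg z.im])
    calc _ ≤ Real.exp (1 - z.im ^ 2) * (A * (1 + |z.im|) ^ N) := by gcongr; exact h0 _
      _ = A * (Real.exp (1 - z.im ^ 2) * (1 + |z.im|) ^ N) := by ring
      _ ≤ _ := mul_le_mul_of_nonneg_left (hy _) hA
  · have hz' : z = 1 + (z.im : ℂ) * Complex.I := by
      apply Complex.ext <;> simp [show z.re = 1 from hz]
    rw [hΦ, norm_mul, hz']
    have e1 := hsq 1 z.im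
    rw [Complex.ofReal_one, one_pow] at e1
    rw [e1]
    calc _ ≤ Real.exp (1 - z.im ^ 2) * (A * (1 + |z.im|) ^ N) := by gcongr; exact h1 _
      _ = A * (Real.exp (1 - z.im ^ 2) * (1 + |z.im|) ^ N) := by ring
      _ ≤ _ := mul_le_mul_of_nonneg_left (hy _) hA

end Analytic

/-! ### Products of Fourier multipliers -/

/-- The kernel of the trilinear form, on the Fourier side. -/
def triK (h f g : Sch n) (p : Spacetime n × Spacetime n) : ℂ :=
  (𝓕⁻ h : Sch n) p.1 * ((𝓕 f : Sch n) p.2 * (𝓕 g : Sch n) (p.1 - p.2))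

theorem integrable_triK (h f g : Sch n) : Integrable (triK h f g) := by
  obtain ⟨C, hC⟩ : ∃ C, ∀ x, ‖(𝓕 g : Sch n) x‖ ≤ C :=
    ⟨_, fun x => SchwartzMap.norm_le_seminorm ℝ (𝓕 g : Sch n) x⟩
  have h1 : Integrable fun p : Spacetime n × Spacetime n =>
      (𝓕⁻ h : Sch n) p.1 * (𝓕 f : Sch n) p.2 :=
    (𝓕⁻ h : Sch n).integrable.mul_prod (𝓕 f : Sch n).integrable
  refine (h1.bdd_mul (c := C) (f := fun p => (𝓕 g : Sch n) (p.1 - p.2)) ?_ ?_).congr ?_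
  · exact ((𝓕 g : Sch n).continuous.comp
      (continuous_fst.sub continuous_snd)).aestronglyMeasurable
  · exact Filter.Eventually.of_forall fun p => hC _
  · refine Filter.Eventually.of_forall fun p => ?_
    simp only [triK]
    ring

/-- The trilinear form `∫ h a(D)(b(D) f · b(D) g)` by its kernel on the Fourier side. The
frequencies `ξ = p.1`, `η = p.2` and `ξ - η` are those of `h`, `f` and `g`. -/
theorem integral_mul_Mu_mulS {a b : Spacetime n → ℂ} (ha : a.HasTemperateGrowth)
    (hb : b.HasTemperateGrowth) {E : Spacetime n × Spacetime n → ℂ}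
    (hE : ∀ p, E p = a p.1 * (b p.2 * b (p.1 - p.2))) {C : ℝ} (hEb : ∀ p, ‖E p‖ ≤ C)
    (h f g : Sch n) :
    ∫ x, h x * Mu a (mulS (Mu b f) (Mu b g)) x = ∫ p, triK h f g p * E p := by
  have h1 : ∫ x, h x * Mu a (mulS (Mu b f) (Mu b g)) x =
      ∫ ξ, (𝓕⁻ h : Sch n) ξ * (𝓕 (Mu a (mulS (Mu b f) (Mu b g))) : Sch n) ξ := by
    have := SchwartzMap.integral_fourier_mul_eq (𝓕⁻ h : Sch n) (Mu a (mulS (Mu b f) (Mu b g)))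
    rw [← this, fourier_fourierInv_eq (E := Sch n)]
  have hEm : AEStronglyMeasurable E (volume : Measure (Spacetime n × Spacetime n)) := by
    have h2 : Continuous fun p : Spacetime n × Spacetime n => a p.1 * (b p.2 * b (p.1 - p.2)) :=
      (ha.1.continuous.comp continuous_fst).mul ((hb.1.continuous.comp continuous_snd).mul
        (hb.1.continuous.comp (continuous_fst.sub continuous_snd)))
    rw [show E = _ from funext hE]
    exact h2.aestronglyMeasurable
  have hint : Integrable fun p => triK h f g p * E p :=
    (integrable_triK h f g).mul_bdd hEm (Filter.Eventually.of_forall hEb)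
  rw [h1, Measure.volume_eq_prod, integral_prod _ hint]
  refine integral_congr_ae (Filter.Eventually.of_forall fun ξ => ?_)
  simp only [triK, hE]
  rw [fourier_Mu ha, fourier_mulS, ← integral_const_mul, ← integral_const_mul]
  refine integral_congr_ae (Filter.Eventually.of_forall fun η => ?_)
  simp only [fourier_Mu hb]
  ring

/-- Polynomials in the frequencies, of parabolic order at most `m`. -/
def polySpan (n m : ℕ) : Submodule ℂ (Spacetime n → ℂ) :=
  Submodule.span ℂ {q | ∃ l, lOrd l ≤ m ∧ q = fun ξ => ((fmon l ξ : ℝ) : ℂ)}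

theorem fmon_mem_polySpan {m : ℕ} {l : List (Fin (n + 1))} (hl : lOrd l ≤ m) :
    (fun ξ : Spacetime n => ((fmon l ξ : ℝ) : ℂ)) ∈ polySpan n m :=
  Submodule.subset_span ⟨l, hl, rfl⟩

theorem mul_mem_polySpan {m m' : ℕ} {q q' : Spacetime n → ℂ} (hq : q ∈ polySpan n m)
    (hq' : q' ∈ polySpan n m') : q * q' ∈ polySpan n (m + m') := by
  refine (?_ : polySpan n m * polySpan n m' ≤ polySpan n (m + m')) (Submodule.mul_mem_mul hq hq')
  rw [polySpan, polySpan, Submodule.span_mul_span]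
  refine Submodule.span_le.2 ?_
  rintro _ ⟨_, ⟨l, hl, rfl⟩, _, ⟨l', hl', rfl⟩, rfl⟩
  have : ((fun ξ : Spacetime n => ((fmon l ξ : ℝ) : ℂ)) * fun ξ => ((fmon l' ξ : ℝ) : ℂ)) =
      fun ξ => ((fmon (l ++ l') ξ : ℝ) : ℂ) := by
    funext ξ
    simp [fmon]
  change _ * _ ∈ _
  rw [this]
  refine fmon_mem_polySpan ?_
  simp only [lOrd, List.map_append, List.sum_append] at *
  omega

theorem one_mem_polySpan (m : ℕ) : (fun _ : Spacetime n => (1 : ℂ)) ∈ polySpan n m := by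
  have := fmon_mem_polySpan (n := n) (m := m) (l := []) (by simp)
  simpa [fmon] using this

theorem coord_sq_mem_polySpan (a : Fin (n + 1)) :
    (fun ξ : Spacetime n => ((2 * Real.pi * ξ a : ℝ) : ℂ) ^ 2) ∈ polySpan n (2 * dOrd a) := by
  have := fmon_mem_polySpan (n := n) (m := 2 * dOrd a) (l := [a, a]) (by simp; omega)
  simpa [fmon, sq] using this

theorem laplace_mem_polySpan : (fun ξ : Spacetime n =>
    ∑ j : Fin n, ((2 * Real.pi * ξ j.castSucc : ℝ) : ℂ) ^ 2) ∈ polySpan n 2 := by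
  have h : ∑ j : Fin n, (fun ξ : Spacetime n => ((2 * Real.pi * ξ j.castSucc : ℝ) : ℂ) ^ 2) ∈
      polySpan n 2 := Submodule.sum_mem _ fun j _ => by
    have := coord_sq_mem_polySpan (n := n) j.castSucc
    rwa [show 2 * dOrd j.castSucc = 2 by simp [dOrd, Fin.castSucc_ne_last]] at this
  convert h using 1
  funext ξ
  rw [Finset.sum_apply]

theorem pp_one_eq : (pp 1 : Spacetime n → ℂ) = (fun _ : Spacetime n => 1) +
    (fun ξ : Spacetime n => ∑ j : Fin n, ((2 * Real.pi * ξ j.castSucc : ℝ) : ℂ) ^ 2) *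
      (fun ξ : Spacetime n => ∑ j : Fin n, ((2 * Real.pi * ξ j.castSucc : ℝ) : ℂ) ^ 2) +
    fun ξ : Spacetime n => ((2 * Real.pi * ξ (Fin.last n) : ℝ) : ℂ) ^ 2 := by
  funext ξ
  simp only [Pi.add_apply, Pi.mul_apply, pp, Real.rpow_one, parabolicBracket]
  push_cast
  ring

/-- The symbol `p = 1 + |ζ|⁴ + τ²` is a polynomial of parabolic order four. -/
theorem pp_one_mem : (pp 1 : Spacetime n → ℂ) ∈ polySpan n 4 := by
  have h3 := coord_sq_mem_polySpan (Fin.last n)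
  rw [show 2 * dOrd (Fin.last n) = 4 by simp [dOrd]] at h3
  have h4 := mul_mem_polySpan (laplace_mem_polySpan (n := n)) laplace_mem_polySpan
  rw [show 2 + 2 = 4 from rfl] at h4
  rw [pp_one_eq]
  exact Submodule.add_mem _ (Submodule.add_mem _ (one_mem_polySpan 4) h4) h3

theorem pp_nat_mem (M : ℕ) : pp (M : ℝ) ∈ polySpan n (4 * M) := by
  induction M with
  | zero =>
    have h0 := fmon_mem_polySpan (n := n) (m := 4 * 0) (l := []) (by simp)
    convert h0 using 1
    funext ξ
    simp [fmon, pp_zero]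
  | succ M ih =>
    have h := mul_mem_polySpan ih (pp_one_mem (n := n))
    rw [show 4 * (M + 1) = 4 * M + 4 by ring]
    convert h using 1
    funext ξ
    rw [Pi.mul_apply, pp_mul]
    push_cast
    rfl

/-- The bilinear expressions `(F, G) ↦ D^l F · D^l' G` of total order at most `m`. -/
def derSpan (n m : ℕ) : Submodule ℂ (Sch n → Sch n → Sch n) :=
  Submodule.span ℂ {B | ∃ l l', lOrd l + lOrd l' ≤ m ∧ B = fun F G => mulS (Ds l F) (Ds l' G)}

/-- Leibniz' rule for iterated derivatives. -/
theorem Ds_mulS_mem (l : List (Fin (n + 1))) :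
    (fun F G => Ds l (mulS F G)) ∈ derSpan n (lOrd l) := by
  induction l with
  | nil => exact Submodule.subset_span ⟨[], [], by simp, rfl⟩
  | cons a l ih =>
    change (fun F G => opDs a ((fun F G => Ds l (mulS F G)) F G)) ∈ _
    generalize (fun F G => Ds l (mulS F G)) = B at ih ⊢
    induction ih using Submodule.span_induction with
    | mem B hB =>
      obtain ⟨v, v', hv, rfl⟩ := hB
      have : (fun F G => opDs a (mulS (Ds v F) (Ds v' G))) =
          (fun F G => mulS (Ds (a :: v) F) (Ds v' G)) +
            fun F G => mulS (Ds v F) (Ds (a :: v') G) := by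
        funext F G
        rw [opDs_mulS]
        rfl
      rw [this]
      refine Submodule.add_mem _ (Submodule.subset_span ⟨a :: v, v', ?_, rfl⟩)
        (Submodule.subset_span ⟨v, a :: v', ?_, rfl⟩) <;> simp only [lOrd_cons] <;> omega
    | zero =>
      have : (fun (F G : Sch n) => opDs a ((0 : Sch n → Sch n → Sch n) F G)) = 0 := by
        funext F G
        simp
      rw [this]
      exact Submodule.zero_mem _
    | add x y _ _ hx hy =>
      have : (fun (F G : Sch n) => opDs a ((x + y) F G)) =
          (fun (F G : Sch n) => opDs a (x F G)) + fun (F G : Sch n) => opDs a (y F G) := by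
        funext F G
        simp
      rw [this]
      exact Submodule.add_mem _ hx hy
    | smul z x _ hx =>
      have : (fun (F G : Sch n) => opDs a ((z • x) F G)) =
          z • (fun (F G : Sch n) => opDs a (x F G)) := by
        funext F G
        simp
      rw [this]
      exact Submodule.smul_mem _ _ hx

/-- A differential operator applied to a product. -/
theorem exists_derSpan {m : ℕ} {q : Spacetime n → ℂ} (hq : q ∈ polySpan n m) :
    ∃ B ∈ derSpan n m, ∀ F G ξ, (𝓕 (B F G) : Sch n) ξ = q ξ * (𝓕 (mulS F G) : Sch n) ξ := by
  induction hq using Submodule.span_induction with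
  | mem q hq =>
    obtain ⟨l, hl, rfl⟩ := hq
    have hle : derSpan n (lOrd l) ≤ derSpan n m :=
      Submodule.span_mono fun _ ⟨v, v', h, e⟩ => ⟨v, v', h.trans hl, e⟩
    exact ⟨_, hle (Ds_mulS_mem l), fun F G ξ => fourier_Ds l _ ξ⟩
  | zero => exact ⟨0, Submodule.zero_mem _, fun F G ξ => by
      rw [Pi.zero_apply, Pi.zero_apply, Pi.zero_apply, zero_mul, FourierTransform.fourier_zero]
      rfl⟩
  | add x y _ _ hx hy =>
    obtain ⟨B, hB, h⟩ := hx
    obtain ⟨B', hB', h'⟩ := hy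
    refine ⟨B + B', Submodule.add_mem _ hB hB', fun F G ξ => ?_⟩
    rw [Pi.add_apply, Pi.add_apply, Pi.add_apply, FourierTransform.fourier_add, add_apply, h, h',
      add_mul]
  | smul z x _ hx =>
    obtain ⟨B, hB, h⟩ := hx
    refine ⟨z • B, Submodule.smul_mem _ _ hB, fun F G ξ => ?_⟩
    rw [Pi.smul_apply, Pi.smul_apply, Pi.smul_apply, FourierTransform.fourier_smul, smul_apply, h,
      smul_eq_mul, smul_eq_mul, mul_assoc]

theorem wordBd_zero_toD_iff {r c K : ℝ} {k : ℕ} {f : Sch n} :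
    WordBd 0 r k c (toD f) K ↔ ∀ w, wordOrder w ≤ k → wn r (Ws c w f) ≤ K := by
  refine forall₂_congr fun w _ => ?_
  rw [Ts_zero, ← toD_Ws, bd_toD_iff]

/-- The monomials of parabolic order at most `4 M`, divided by `p^M`, are symbols of order zero. -/
theorem fmon_sym_mem (M : ℕ) (N : ℝ) {l : List (Fin (n + 1))} (hl : lOrd l ≤ 4 * M) :
    (fun (y : ℝ) ξ => ((fmon l ξ : ℝ) : ℂ) * (pp (-(M : ℝ)) ξ * wSym N y ξ)) ∈
      Algebra.adjoin ℂ (symGens n N) := by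
  have h1 : ∀ l : List (Fin (n + 1)), (fun (_ : ℝ) ξ => ((fmon l ξ : ℝ) : ℂ) *
      pp (-(lOrd l : ℝ) / 4) ξ) ∈ Algebra.adjoin ℂ (symGens n N) := by
    intro l
    induction l with
    | nil =>
      convert const_mem (n := n) N 1 using 3
      simp [fmon, pp_zero]
    | cons a l ih =>
      convert mul_mem (uSym_mem (n := n) N a) ih using 1
      funext y ξ
      have : pp (-(lOrd (a :: l) : ℝ) / 4) ξ =
          pp (if a = Fin.last n then -1 / 2 else -1 / 4) ξ * pp (-(lOrd l : ℝ) / 4) ξ := by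
        rw [pp_mul, lOrd_cons, dOrd]
        congr 1
        split <;> · push_cast; ring
      change _ = uSym a ξ * (((fmon l ξ : ℝ) : ℂ) * pp (-(lOrd l : ℝ) / 4) ξ)
      rw [this, uSym, fmon_cons]
      push_cast
      ring
  convert mul_mem (mul_mem (h1 l) (pow_mem (pp_mem (n := n) N) (4 * M - lOrd l)))
    (wSym_mem N) using 1
  funext y ξ
  change _ = ((fmon l ξ : ℝ) : ℂ) * pp (-(lOrd l : ℝ) / 4) ξ *
    pp (-1 / 4) ξ ^ (4 * M - lOrd l) * wSym N y ξ
  rw [pp_pow, mul_assoc (((fmon l ξ : ℝ) : ℂ)), pp_mul, mul_assoc]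
  congr 3
  rw [Nat.cast_sub hl]
  push_cast
  ring

theorem one_le_gauge (y : ℝ) : 1 ≤ 1 + |y| := le_add_of_nonneg_right (abs_nonneg y)

/-- The symbol `p^{-M + i N y}`. -/
def bSym (M : ℕ) (N y : ℝ) (ξ : Spacetime n) : ℂ := pp (-(M : ℝ)) ξ * wSym N y ξ

theorem hasTemperateGrowth_wSym (N y : ℝ) : (wSym N y : Spacetime n → ℂ).HasTemperateGrowth :=
  (pb_of_mem_symAlg N (wSym_mem N)).temperate y

theorem hasTemperateGrowth_bSym (M : ℕ) (N y : ℝ) :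
    (bSym M N y : Spacetime n → ℂ).HasTemperateGrowth :=
  (hasTemperateGrowth_pp _).mul (hasTemperateGrowth_wSym N y)

/-- The derivatives `D^l p^{-M + i N y}` with `l` of order at most `4 M` are multipliers of order
zero. They preserve module regularity, with bounds that grow polynomially in `y`. -/
theorem wordBd_Ds_Mu (M : ℕ) (N r c : ℝ) (k : ℕ) {l : List (Fin (n + 1))} (hl : lOrd l ≤ 4 * M) :
    ∃ (C : ℝ) (d : ℕ), 0 ≤ C ∧ ∀ (y : ℝ) (f : Sch n) (K : ℝ), WordBd 0 r k c (toD f) K →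
      WordBd 0 r k c (toD (Ds l (Mu (bSym M N y) f))) (C * (1 + |y|) ^ d * K) := by
  have hm := pb_of_mem_symAlg N (fmon_sym_mem (n := n) M N hl)
  obtain ⟨C, d, hC, hb⟩ := PB.wordBd one_le_gauge 0 0 r c hm k
  refine ⟨C, d, hC, fun y f K hf => ?_⟩
  have h1 := hb y _ K hf
  rw [sub_zero, Ts_zero] at h1
  have h2 : toD (Ds l (Mu (bSym M N y) f)) = mulD (fun ξ => ((fmon l ξ : ℝ) : ℂ) *
      (pp (-(M : ℝ)) ξ * wSym N y ξ)) (toD f) := by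
    rw [mulD, mult_toD (hm.temperate y)]
    congr 1
    refine sch_ext_fourier fun ξ => ?_
    rw [fourier_Ds, fourier_Mu (hasTemperateGrowth_bSym M N y), fourier_Mu (hm.temperate y), bSym]
    ring
  rw [h2]
  exact h1

/-- The product estimate `wn_mulS_le`, applied to the terms of `p^M (F G)`: the derivatives that
fall on a factor are compensated by its multiplier `p^{-M + i N y}`. -/
theorem derSpan_bound {k k₁ k₂ : ℕ} (hk : (n : ℝ) / 2 + 2 < k) (hk' : 3 < k) (h : k ≤ k₁ + k₂)
    {c₁ c₂ : ℝ} (hc₁ : c₁ ≠ 0) (hc₂ : c₂ ≠ 0) (r₁ r₂ : ℝ) (M : ℕ) (N : ℝ)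
    {B : Sch n → Sch n → Sch n} (hB : B ∈ derSpan n (4 * M)) :
    ∃ (C : ℝ) (d : ℕ), 0 ≤ C ∧ ∀ (y : ℝ) (f g : Sch n) (K₁ K₂ : ℝ), WordBd 0 r₁ k₁ c₁ (toD f) K₁ →
      WordBd 0 r₂ k₂ c₂ (toD g) K₂ → wn (r₁ + r₂ + ((n : ℝ) + 1) / 2)
        (B (Mu (bSym M N y) f) (Mu (bSym M N y) g)) ≤ C * (1 + |y|) ^ d * (K₁ * K₂) := by
  induction hB using Submodule.span_induction with
  | mem B hB =>
    obtain ⟨l, l', hl, rfl⟩ := hB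
    obtain ⟨C, hC, hmul⟩ := wn_mulS_le (n := n) hk hk' h hc₁ hc₂ r₁ r₂
    obtain ⟨C₁, d₁, hC₁, hb₁⟩ := wordBd_Ds_Mu (n := n) M N r₁ c₁ k₁ (l := l) (by omega)
    obtain ⟨C₂, d₂, hC₂, hb₂⟩ := wordBd_Ds_Mu (n := n) M N r₂ c₂ k₂ (l := l') (by omega)
    refine ⟨C * (C₁ * C₂), d₁ + d₂, by positivity, fun y f g K₁ K₂ hf hg => ?_⟩
    refine (hmul _ _ _ _ (wordBd_zero_toD_iff.1 (hb₁ y f K₁ hf))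
      (wordBd_zero_toD_iff.1 (hb₂ y g K₂ hg))).trans_eq ?_
    rw [pow_add]
    ring
  | zero =>
    refine ⟨0, 0, le_rfl, fun y f g K₁ K₂ _ _ => ?_⟩
    change wn _ 0 ≤ _
    rw [wn_zero]
    simp
  | add x x' _ _ hx hx' =>
    obtain ⟨C, d, hC, hb⟩ := hx
    obtain ⟨C', d', hC', hb'⟩ := hx'
    refine ⟨(C + C') * 2, d + d', by positivity, fun y f g K₁ K₂ hf hg => ?_⟩
    obtain ⟨e1, e2⟩ := exists_common_bound one_le_gauge hC hC' d d' y
    have hK : 0 ≤ K₁ * K₂ := mul_nonneg hf.nonneg hg.nonneg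
    have e3 := mul_le_mul_of_nonneg_right e1 hK
    have e4 := mul_le_mul_of_nonneg_right e2 hK
    have e5 := hb y f g K₁ K₂ hf hg
    have e6 := hb' y f g K₁ K₂ hf hg
    refine (wn_add_le _ _ _).trans ?_
    linarith
  | smul z x _ hx =>
    obtain ⟨C, d, hC, hb⟩ := hx
    refine ⟨‖z‖ * C, d, by positivity, fun y f g K₁ K₂ hf hg => ?_⟩
    change wn _ (z • x _ _) ≤ _
    rw [wn_smul, mul_assoc ‖z‖, mul_assoc ‖z‖]
    exact mul_le_mul_of_nonneg_left (hb y f g K₁ K₂ hf hg) (norm_nonneg _)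

/-- The estimate on the lines `Re z = 0` and `Re z = 1`, where `p^M` is a differential operator. -/
theorem line_bound {k k₁ k₂ : ℕ} (hk : (n : ℝ) / 2 + 2 < k) (hk' : 3 < k) (h : k ≤ k₁ + k₂)
    {c₁ c₂ : ℝ} (hc₁ : c₁ ≠ 0) (hc₂ : c₂ ≠ 0) (r₁ r₂ : ℝ) (M : ℕ) (N : ℝ) :
    ∃ (C : ℝ) (d : ℕ), 0 ≤ C ∧ ∀ (y : ℝ) (f g h : Sch n) (K₁ K₂ : ℝ),
      WordBd 0 r₁ k₁ c₁ (toD f) K₁ → WordBd 0 r₂ k₂ c₂ (toD g) K₂ →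
        ‖∫ x, h x * Mu (fun ξ => pp M ξ * wSym N y ξ)
          (mulS (Mu (bSym M (-N) y) f) (Mu (bSym M (-N) y) g)) x‖ ≤
        C * (1 + |y|) ^ d * (K₁ * K₂ * wn (-(r₁ + r₂ + ((n : ℝ) + 1) / 2)) h) := by
  obtain ⟨B, hB, hBe⟩ := exists_derSpan (pp_nat_mem (n := n) M)
  obtain ⟨C, d, hC, hb⟩ := derSpan_bound hk hk' h hc₁ hc₂ r₁ r₂ M (-N) hB
  have hw := pb_of_mem_symAlg N (wSym_mem (n := n) N)
  obtain ⟨C', d', hC', hb'⟩ := hw.muBdd one_le_gauge (r₁ + r₂ + ((n : ℝ) + 1) / 2)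
  refine ⟨C' * C, d' + d, by positivity, fun y f g h K₁ K₂ hf hg => ?_⟩
  set F := Mu (bSym M (-N) y) f
  set H := Mu (bSym M (-N) y) g
  -- Leibniz' rule expands `p^M` on the product; only the bounded imaginary power is left outside.
  have e1 : Mu (fun ξ => pp M ξ * wSym N y ξ) (mulS F H) = Mu (wSym N y) (B F H) := by
    refine sch_ext_fourier fun ξ => ?_
    have hm : (fun ξ : Spacetime n => pp M ξ * wSym N y ξ).HasTemperateGrowth :=
      (hasTemperateGrowth_pp _).mul (hasTemperateGrowth_wSym N y)
    rw [fourier_Mu hm,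
      fourier_Mu (hasTemperateGrowth_wSym N y), hBe]
    ring
  rw [e1]
  have hh := wn_nonneg (-(r₁ + r₂ + ((n : ℝ) + 1) / 2)) h
  have hy : 0 ≤ C' * (1 + |y|) ^ d' := by positivity
  have e2 := norm_integral_mul_le (-(r₁ + r₂ + ((n : ℝ) + 1) / 2)) h (Mu (wSym N y) (B F H))
  rw [neg_neg] at e2
  calc _ ≤ _ := e2
    _ ≤ wn (-(r₁ + r₂ + ((n : ℝ) + 1) / 2)) h * (C' * (1 + |y|) ^ d' *
        (C * (1 + |y|) ^ d * (K₁ * K₂))) :=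
      mul_le_mul_of_nonneg_left ((hb' y _).trans
        (mul_le_mul_of_nonneg_left (hb y f g K₁ K₂ hf hg) hy)) hh
    _ = _ := by rw [pow_add]; ring

/-- The parabolic bracket is submultiplicative up to a constant: it is at most eight times the sum
of the two values, which are at least `1`. -/
theorem parabolicBracket_add_le (ξ η : Spacetime n) :
    parabolicBracket ξ ≤ 16 * (parabolicBracket η * parabolicBracket (ξ - η)) := by
  have h1 : ∀ a : Fin (n + 1), (2 * Real.pi * ξ a) ^ 2 ≤
      2 * (2 * Real.pi * η a) ^ 2 + 2 * (2 * Real.pi * (ξ - η) a) ^ 2 := fun a => by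
    have : 2 * Real.pi * ξ a = 2 * Real.pi * η a + 2 * Real.pi * (ξ - η) a := by simp; ring
    rw [this]
    nlinarith [sq_nonneg (2 * Real.pi * η a - 2 * Real.pi * (ξ - η) a)]
  have h2 : ∑ j : Fin n, (2 * Real.pi * ξ j.castSucc) ^ 2 ≤
      2 * (∑ j : Fin n, (2 * Real.pi * η j.castSucc) ^ 2) +
        2 * ∑ j : Fin n, (2 * Real.pi * (ξ - η) j.castSucc) ^ 2 := by
    rw [Finset.mul_sum, Finset.mul_sum, ← Finset.sum_add_distrib]
    exact Finset.sum_le_sum fun j _ => h1 j.castSucc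
  have h3 := h1 (Fin.last n)
  have p0 : ∀ ζ : Spacetime n, 0 ≤ ∑ j : Fin n, (2 * Real.pi * ζ j.castSucc) ^ 2 :=
    fun ζ => Finset.sum_nonneg fun _ _ => sq_nonneg _
  have q1 := one_le_parabolicBracket η
  have q2 := one_le_parabolicBracket (ξ - η)
  have h4 : parabolicBracket ξ ≤ 8 * (parabolicBracket η + parabolicBracket (ξ - η)) := by
    unfold parabolicBracket
    have a1 := p0 ξ
    have a2 := p0 η
    have a3 := p0 (ξ - η)
    generalize ∑ j : Fin n, (2 * Real.pi * ξ j.castSucc) ^ 2 = A at *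
    generalize ∑ j : Fin n, (2 * Real.pi * η j.castSucc) ^ 2 = B at *
    generalize ∑ j : Fin n, (2 * Real.pi * (ξ - η) j.castSucc) ^ 2 = D at *
    have h5 : A ^ 2 ≤ (2 * B + 2 * D) ^ 2 := pow_le_pow_left₀ a1 h2 2
    nlinarith [sq_nonneg (B - D), sq_nonneg (2 * Real.pi * η (Fin.last n)),
      sq_nonneg (2 * Real.pi * (ξ - η) (Fin.last n))]
  nlinarith [mul_nonneg (sub_nonneg.2 q1) (sub_nonneg.2 q2)]

/-- The logarithm of `p(ξ) / (p(η) p(ξ - η))`. -/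
def logQ (p : Spacetime n × Spacetime n) : ℝ :=
  Real.log (parabolicBracket p.1) - Real.log (parabolicBracket p.2) -
    Real.log (parabolicBracket (p.1 - p.2))

theorem continuous_parabolicBracket : Continuous (parabolicBracket : Spacetime n → ℝ) := by
  unfold parabolicBracket
  fun_prop

theorem measurable_logQ : Measurable (logQ : Spacetime n × Spacetime n → ℝ) := by
  have h : Continuous fun ξ : Spacetime n => Real.log (parabolicBracket ξ) :=
    continuous_parabolicBracket.log fun ξ => (parabolicBracket_pos ξ).ne'
  exact (((h.comp continuous_fst).sub (h.comp continuous_snd)).sub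
    (h.comp (continuous_fst.sub continuous_snd))).measurable

/-- There is no lower bound, but an upper bound suffices for exponential integrals in the half plane
`0 ≤ Re z`. -/
theorem logQ_le (p : Spacetime n × Spacetime n) : logQ p ≤ Real.log 16 := by
  have h := Real.log_le_log (parabolicBracket_pos p.1) (parabolicBracket_add_le p.1 p.2)
  have p1 := (parabolicBracket_pos p.2).ne'
  have p2 := (parabolicBracket_pos (p.1 - p.2)).ne'
  rw [Real.log_mul (by norm_num) (mul_ne_zero p1 p2), Real.log_mul p1 p2] at h
  unfold logQ
  linarith

theorem pp_mul_wSym (σ N y : ℝ) (ξ : Spacetime n) : pp σ ξ * wSym N y ξ =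
    Complex.exp ((σ + N * y * Complex.I) * Real.log (parabolicBracket ξ)) := by
  rw [pp, wSym, Real.rpow_def_of_pos (parabolicBracket_pos ξ), Complex.ofReal_exp, ← Complex.exp_add]
  congr 1
  push_cast
  ring

/-- The trilinear form with the symbol `p^{M (x + i y)}` is an exponential integral. -/
theorem expInt_eq (N x y : ℝ) (hx0 : 0 ≤ x) (hx1 : x ≤ 1) (hN : 0 ≤ N) (h f g : Sch n) :
    ∫ X, h X * Mu (fun ξ => pp (N * x) ξ * wSym N y ξ)
      (mulS (Mu (fun ξ => pp (-(N * x)) ξ * wSym (-N) y ξ) f)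
        (Mu (fun ξ => pp (-(N * x)) ξ * wSym (-N) y ξ) g)) X =
    expInt volume (triK h f g) (fun p => N * logQ p) (x + y * Complex.I) := by
  refine integral_mul_Mu_mulS ((hasTemperateGrowth_pp _).mul (hasTemperateGrowth_wSym N y))
    ((hasTemperateGrowth_pp _).mul (hasTemperateGrowth_wSym (-N) y))
    (C := Real.exp (N * Real.log 16)) (fun p => ?_) (fun p => ?_) h f g
  · simp only [Pi.mul_apply]
    rw [pp_mul_wSym, pp_mul_wSym, pp_mul_wSym, ← Complex.exp_add, ← Complex.exp_add, logQ]
    congr 1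
    push_cast
    ring
  · rw [Complex.norm_exp]
    refine Real.exp_le_exp.2 ?_
    have e : ((x + y * Complex.I) * ((N * logQ p : ℝ) : ℂ)).re = x * (N * logQ p) := by simp
    rw [e]
    have h1 := mul_le_mul_of_nonneg_left (logQ_le p) hN
    have h2 : 0 ≤ N * Real.log 16 := mul_nonneg hN (Real.log_nonneg (by norm_num))
    nlinarith [mul_le_mul_of_nonneg_left h1 hx0]

/-- The product estimate at regularity `s`, by interpolation between the integers divisible by
four. -/
theorem wn_Mu_mulS_le {k k₁ k₂ : ℕ} (hk : (n : ℝ) / 2 + 2 < k) (hk' : 3 < k) (h : k ≤ k₁ + k₂)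
    {c₁ c₂ : ℝ} (hc₁ : c₁ ≠ 0) (hc₂ : c₂ ≠ 0) (r₁ r₂ : ℝ) {σ : ℝ} (hσ : 0 ≤ σ) :
    ∃ C : ℝ, 0 ≤ C ∧ ∀ (f g : Sch n) (K₁ K₂ : ℝ),
      WordBd 0 r₁ k₁ c₁ (toD f) K₁ → WordBd 0 r₂ k₂ c₂ (toD g) K₂ →
        wn (r₁ + r₂ + ((n : ℝ) + 1) / 2)
          (Mu (pp σ) (mulS (Mu (pp (-σ)) f) (Mu (pp (-σ)) g))) ≤ C * (K₁ * K₂) := by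
  obtain ⟨M, hM⟩ := exists_nat_gt σ
  have hM0 : (0 : ℝ) < M := hσ.trans_lt hM
  -- The lines `Re z = 1` and `Re z = 0` of the trilinear form with the symbol `p^{M z}`. The
  -- assertion is its value at the point `θ = σ / M` between them.
  obtain ⟨C, d, hC, hb⟩ := line_bound (n := n) hk hk' h hc₁ hc₂ r₁ r₂ M M
  obtain ⟨C', d', hC', hb'⟩ := line_bound (n := n) hk hk' h hc₁ hc₂ r₁ r₂ 0 M
  refine ⟨(C + C') * ((d + d').factorial * Real.exp 3), by positivity,
    fun f g K₁ K₂ hf hg => ?_⟩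
  have hK : 0 ≤ K₁ * K₂ := mul_nonneg hf.nonneg hg.nonneg
  refine wn_le_of_dual (by positivity) fun φ => ?_
  set κ := K₁ * K₂ * wn (-(r₁ + r₂ + ((n : ℝ) + 1) / 2)) φ with hκ
  have hκ0 : 0 ≤ κ := mul_nonneg hK (wn_nonneg _ _)
  set θ := σ / M with hθ
  have hθ0 : 0 ≤ θ := by positivity
  have hθ1 : θ ≤ 1 := (div_le_one hM0).2 hM.le
  have hMθ : M * θ = σ := by rw [hθ]; field_simp
  have hL : ∀ p : Spacetime n × Spacetime n, M * logQ p ≤ M * Real.log 16 := fun p =>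
    mul_le_mul_of_nonneg_left (logQ_le p) hM0.le
  have key := norm_expInt_le_of_lines (μ := volume) (integrable_triK φ f g)
    (measurable_logQ.const_mul (M : ℝ)) (C₀ := M * Real.log 16)
    (mul_nonneg hM0.le (Real.log_nonneg (by norm_num))) hL (A := (C + C') * κ) (N := d + d')
    (fun y => ?_) (fun y => ?_) hθ0 hθ1
  · have e := expInt_eq (M : ℝ) θ 0 hθ0 hθ1 hM0.le φ f g
    have e0 : ∀ N : ℝ, (wSym N 0 : Spacetime n → ℂ) = fun _ => 1 := fun N => by
      funext ξ; simp [wSym]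
    simp only [e0, mul_one, hMθ] at e
    rw [Complex.ofReal_zero, zero_mul, add_zero] at e
    rw [← e] at key
    refine key.trans_eq ?_
    rw [hκ]
    ring
  · have e := expInt_eq (M : ℝ) 0 y le_rfl zero_le_one hM0.le φ f g
    rw [Complex.ofReal_zero, zero_add] at e
    rw [← e]
    obtain ⟨-, e2⟩ := exists_common_bound one_le_gauge hC hC' d d' y
    have e3 := hb' y f g φ K₁ K₂ hf hg
    have e4 : (fun ξ : Spacetime n => pp (-((M : ℝ) * 0)) ξ * wSym (-(M : ℝ)) y ξ) =
        bSym 0 (-M) y := by funext ξ; simp [bSym]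
    rw [e4, mul_zero]
    rw [Nat.cast_zero] at e3
    calc _ ≤ _ := e3
      _ ≤ _ := mul_le_mul_of_nonneg_right e2 hκ0
      _ = _ := by ring
  · have e := expInt_eq (M : ℝ) 1 y zero_le_one le_rfl hM0.le φ f g
    rw [Complex.ofReal_one] at e
    rw [← e]
    obtain ⟨e2, -⟩ := exists_common_bound one_le_gauge hC hC' d d' y
    have e3 := hb y f g φ K₁ K₂ hf hg
    have e4 : (fun ξ : Spacetime n => pp (-((M : ℝ) * 1)) ξ * wSym (-(M : ℝ)) y ξ) =
        bSym M (-M) y := by funext ξ; simp [bSym]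
    rw [e4, mul_one]
    calc _ ≤ _ := e3
      _ ≤ _ := mul_le_mul_of_nonneg_right e2 hκ0
      _ = _ := by ring

theorem Ts_toD (s : ℝ) (f : Sch n) : Ts s (toD f) = toD (Mu (pp (s / 4)) f) :=
  mult_toD (hasTemperateGrowth_pp _) f

/-- The bound for the product itself. The preceding estimate is applied to `p^{s/4} f` and `p^{s/4}
g`. -/
theorem bd_Ts_mulS {k k₁ k₂ : ℕ} (hk : (n : ℝ) / 2 + 2 < k) (hk' : 3 < k) (h : k ≤ k₁ + k₂)
    {c₁ c₂ : ℝ} (hc₁ : c₁ ≠ 0) (hc₂ : c₂ ≠ 0) (r₁ r₂ : ℝ) {s : ℝ} (hs : 0 ≤ s) :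
    ∃ C : ℝ, 0 ≤ C ∧ ∀ (f g : Sch n) (K₁ K₂ : ℝ),
      WordBd s r₁ k₁ c₁ (toD f) K₁ → WordBd s r₂ k₂ c₂ (toD g) K₂ →
        Bd (r₁ + r₂ + ((n : ℝ) + 1) / 2) (Ts s (toD (mulS f g))) (C * (K₁ * K₂)) := by
  obtain ⟨C, hC, hb⟩ := wn_Mu_mulS_le (n := n) hk hk' h hc₁ hc₂ r₁ r₂ (σ := s / 4) (by positivity)
  obtain ⟨C₁, hC₁, hb₁⟩ := Ts_wordBd (n := n) s 0 r₁ c₁ k₁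
  obtain ⟨C₂, hC₂, hb₂⟩ := Ts_wordBd (n := n) s 0 r₂ c₂ k₂
  refine ⟨C * (C₁ * C₂), by positivity, fun f g K₁ K₂ hf hg => ?_⟩
  have e1 := hb₁ _ _ hf
  have e2 := hb₂ _ _ hg
  rw [sub_zero, Ts_toD] at e1 e2
  have e3 : ∀ f : Sch n, Mu (pp (-(s / 4))) (Mu (pp (s / 4)) f) = f := fun f => by
    rw [Mu_Mu (hasTemperateGrowth_pp _) (hasTemperateGrowth_pp _)]
    simp only [pp_mul, neg_add_cancel, pp_zero]
    exact Mu_one f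
  have e4 := hb _ _ _ _ e1 e2
  rw [e3, e3] at e4
  rw [Ts_toD, bd_toD_iff]
  refine e4.trans_eq ?_
  ring

/-- The product estimate for Schwartz functions. -/
theorem wordBd_mulS {k : ℕ} (hk : (n : ℝ) / 2 + 2 < k) (hk' : 3 < k)
    {c₁ c₂ : ℝ} (hc₁ : c₁ ≠ 0) (hc₂ : c₂ ≠ 0) (r₁ r₂ : ℝ) {s : ℝ} (hs : 0 ≤ s) :
    ∃ C : ℝ, 0 ≤ C ∧ ∀ (f g : Sch n) (K₁ K₂ : ℝ),
      WordBd s r₁ k c₁ (toD f) K₁ → WordBd s r₂ k c₂ (toD g) K₂ →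
        WordBd s (r₁ + r₂ + ((n : ℝ) + 1) / 2) k (c₁ + c₂) (toD (mulS f g)) (C * (K₁ * K₂)) := by
  have h1 : ∀ w ∈ wds n k, ∃ C : ℝ, 0 ≤ C ∧ ∀ (f g : Sch n) (K₁ K₂ : ℝ),
      WordBd s r₁ k c₁ (toD f) K₁ → WordBd s r₂ k c₂ (toD g) K₂ →
        Bd (r₁ + r₂ + ((n : ℝ) + 1) / 2) (Ts s (toD (Ws (c₁ + c₂) w (mulS f g))))
          (C * (K₁ * K₂)) := fun w hw => by
    rw [mem_wds] at hw
    have hmem := Ws_mulS_mem (n := n) c₁ c₂ w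
    change ∃ C : ℝ, 0 ≤ C ∧ ∀ (f g : Sch n) (K₁ K₂ : ℝ),
      WordBd s r₁ k c₁ (toD f) K₁ → WordBd s r₂ k c₂ (toD g) K₂ →
        Bd (r₁ + r₂ + ((n : ℝ) + 1) / 2)
          (Ts s (toD ((fun f g => Ws (c₁ + c₂) w (mulS f g)) f g))) (C * (K₁ * K₂))
    generalize (fun f g => Ws (c₁ + c₂) w (mulS f g)) = B at hmem ⊢
    induction hmem using Submodule.span_induction with
    | mem B hB =>
      obtain ⟨v, v', hv, rfl⟩ := hB
      obtain ⟨C, hC, hb⟩ := bd_Ts_mulS (n := n) hk hk' (k₁ := k - wordOrder v)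
        (k₂ := k - wordOrder v') (by omega) hc₁ hc₂ r₁ r₂ hs
      refine ⟨C, hC, fun f g K₁ K₂ hf hg => hb _ _ _ _ ?_ ?_⟩
      · rw [toD_Ws]
        exact hf.word (by omega)
      · rw [toD_Ws]
        exact hg.word (by omega)
    | zero =>
      refine ⟨0, le_rfl, fun f g K₁ K₂ _ _ => ?_⟩
      simp only [Pi.zero_apply, map_zero, zero_mul]
      exact Bd.zero _
    | add x x' _ _ hx hx' =>
      obtain ⟨C, hC, hb⟩ := hx
      obtain ⟨C', hC', hb'⟩ := hx'
      refine ⟨C + C', by positivity, fun f g K₁ K₂ hf hg => ?_⟩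
      simp only [Pi.add_apply, map_add, add_mul]
      exact (hb f g K₁ K₂ hf hg).add (hb' f g K₁ K₂ hf hg)
    | smul z x _ hx =>
      obtain ⟨C, hC, hb⟩ := hx
      refine ⟨‖z‖ * C, by positivity, fun f g K₁ K₂ hf hg => ?_⟩
      simp only [Pi.smul_apply, map_smul, mul_assoc]
      exact (hb f g K₁ K₂ hf hg).smul z
  choose! C hC hb using h1
  refine ⟨∑ w ∈ wds n k, C w, Finset.sum_nonneg hC, fun f g K₁ K₂ hf hg w hw => ?_⟩
  rw [← toD_Ws]
  refine (hb w (mem_wds.2 hw) f g K₁ K₂ hf hg).mono ?_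
  exact mul_le_mul_of_nonneg_right (Finset.single_le_sum hC (mem_wds.2 hw))
    (mul_nonneg hf.nonneg hg.nonneg)

/-! ### Regularization of distributions -/

theorem opD_smulLeft {m m' : Spacetime n → ℂ} (hm : m.HasTemperateGrowth)
    (hm' : m'.HasTemperateGrowth) (a : Fin (n + 1)) (hd : ∀ x, fderiv ℝ m x (ev a) = m' x)
    (u : Dist n) : opD a (smulLeftCLM ℂ m u) =
      smulLeftCLM ℂ m (opD a u) + (-Complex.I) • smulLeftCLM ℂ m' u := by
  ext φ
  have h1 : ∂_{ev a} (SchwartzMap.smulLeftCLM ℂ m φ) =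
      SchwartzMap.smulLeftCLM ℂ m (∂_{ev a} φ) + SchwartzMap.smulLeftCLM ℂ m' φ := by
    ext x
    have hfun : ⇑(SchwartzMap.smulLeftCLM ℂ m φ) = fun x => m x * φ x := by
      ext x; rw [SchwartzMap.smulLeftCLM_apply_apply hm, smul_eq_mul]
    have h2 := ((hm.1.differentiable (by simp) x).hasFDerivAt.mul
      (φ.differentiableAt (x := x)).hasFDerivAt).fderiv
    rw [SchwartzMap.lineDerivOp_apply_eq_fderiv, hfun, add_apply,
      SchwartzMap.smulLeftCLM_apply_apply hm, SchwartzMap.smulLeftCLM_apply_apply hm',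
      SchwartzMap.lineDerivOp_apply_eq_fderiv]
    refine (congrArg (fun L => L (ev a)) h2).trans ?_
    simp [hd, mul_comm]
  have e : (smulLeftCLM ℂ m (opD a u) + (-Complex.I) • smulLeftCLM ℂ m' u) φ =
    smulLeftCLM ℂ m (opD a u) φ + (-Complex.I) * smulLeftCLM ℂ m' u φ := rfl
  rw [e, opD_apply, smulLeftCLM_apply_apply, smulLeftCLM_apply_apply, smulLeftCLM_apply_apply,
    opD_apply, h1, map_add]
  ring

/-- The scales `1, 1/2, 1/3, …`. -/
def eps (j : ℕ) : ℝ := ((j : ℝ) + 1)⁻¹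

theorem eps_pos (j : ℕ) : 0 < eps j := by unfold eps; positivity

theorem eps_le_one (j : ℕ) : eps j ≤ 1 := inv_le_one_of_one_le₀ (by simp)

/-- The dilated function `x ↦ φ (eps j • x)`. -/
def dil (φ : Sch n) (j : ℕ) : Sch n :=
  SchwartzMap.compCLMOfContinuousLinearEquiv ℂ
    (ContinuousLinearEquiv.smulLeft (R₁ := ℝ) (Units.mk0 (eps j) (eps_pos j).ne')) φ

theorem dil_apply (φ : Sch n) (j : ℕ) (x : Spacetime n) : dil φ j x = φ (eps j • x) := rfl

theorem fderiv_dil (φ : Sch n) (j : ℕ) (a : Fin (n + 1)) (x : Spacetime n) :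
    fderiv ℝ (dil φ j) x (ev a) = eps j * dil (∂_{ev a} φ) j x := by
  have h0 : HasFDerivAt (fun x : Spacetime n => eps j • x)
      (eps j • ContinuousLinearMap.id ℝ (Spacetime n)) x := (hasFDerivAt_id x).const_smul (eps j)
  have h1 := ((φ.differentiableAt (x := eps j • x)).hasFDerivAt.comp x h0).fderiv
  refine (congrArg (fun L => L (ev a)) h1).trans ?_
  rw [dil_apply, SchwartzMap.lineDerivOp_apply_eq_fderiv]
  simp

/-- The dilations of Schwartz functions, with powers of the scale as coefficients. -/
def dilSet (n : ℕ) : Set (ℕ → Spacetime n → ℂ) :=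
  {m | ∃ (i : ℕ) (φ : Sch n), m = fun j x => (eps j : ℂ) ^ i * dil φ j x}

theorem pd_dil (i : ℕ) (φ : Sch n) (a : Fin (n + 1)) :
    pd a (fun j x => (eps j : ℂ) ^ i * dil φ j x) =
      fun j x => (eps j : ℂ) ^ (i + 1) * dil (∂_{ev a} φ) j x := by
  funext j x
  have h := ((dil φ j).differentiableAt (x := x)).hasFDerivAt.const_mul ((eps j : ℂ) ^ i)
  refine (congrArg (fun L => L (ev a)) h.fderiv).trans ?_
  change _ * fderiv ℝ (dil φ j) x (ev a) = _
  rw [fderiv_dil]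
  ring

/-- The dilations are bounded uniformly in the scale, and derivatives of dilations are again
dilations of Schwartz functions. -/
theorem pb_dil {m : ℕ → Spacetime n → ℂ} (hm : m ∈ dilSet n) : PB (fun _ : ℕ => 1) m := by
  refine PB.of_adjoin (fun _ => le_rfl) (dilSet n) ?_ ?_ ?_ m (Algebra.subset_adjoin hm)
  · rintro _ ⟨i, φ, rfl⟩
    refine ⟨SchwartzMap.seminorm ℝ 0 0 φ, 0, apply_nonneg _ _, fun j x => ?_⟩
    rw [norm_mul, norm_pow, Complex.norm_real, Real.norm_eq_abs, abs_of_pos (eps_pos j), dil_apply]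
    refine (mul_le_mul (pow_le_one₀ (eps_pos j).le (eps_le_one j)) (φ.norm_le_seminorm ℝ _)
      (norm_nonneg _) zero_le_one).trans (by simp)
  · rintro _ ⟨i, φ, rfl⟩ j
    exact (dil φ j).differentiable.const_mul _
  · rintro _ ⟨i, φ, rfl⟩ a
    rw [pd_dil]
    exact Algebra.subset_adjoin ⟨_, _, rfl⟩

theorem mem_dilSet (i : ℕ) (φ : Sch n) : (fun j x => (eps j : ℂ) ^ i * dil φ j x) ∈ dilSet n :=
  ⟨i, φ, rfl⟩

theorem dil_mem_dilSet (φ : Sch n) : (fun j x => dil φ j x) ∈ dilSet n :=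
  ⟨0, φ, by simp⟩

/-- The span of the multiplications by dilations. -/
def dilSub (n : ℕ) : Submodule ℂ (ℕ → Dist n →L[ℂ] Dist n) :=
  Submodule.span ℂ {T | ∃ m ∈ dilSet n, T = fun j => smulLeftCLM ℂ (m j)}

theorem smulLeft_mem_dilSub {m : ℕ → Spacetime n → ℂ} (hm : m ∈ dilSet n) :
    (fun j => smulLeftCLM ℂ (m j)) ∈ dilSub n := Submodule.subset_span ⟨m, hm, rfl⟩

theorem opX_smulLeft {m m' : Spacetime n → ℂ} (hm : m.HasTemperateGrowth)
    (hm' : m'.HasTemperateGrowth) (a : Fin (n + 1)) (h : ∀ x, m' x = x a * m x) (u : Dist n) :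
    opX a (smulLeftCLM ℂ m u) = smulLeftCLM ℂ m' u := by
  ext φ
  rw [opX_apply, smulLeftCLM_apply_apply, smulLeftCLM_apply_apply]
  congr 1
  ext x
  rw [SchwartzMap.smulLeftCLM_apply_apply hm, SchwartzMap.smulLeftCLM_apply_apply hm', XS_apply, h,
    smul_eq_mul, smul_eq_mul]
  ring

theorem opX_smulLeft_comm {m : Spacetime n → ℂ} (hm : m.HasTemperateGrowth) (a : Fin (n + 1))
    (u : Dist n) : opX a (smulLeftCLM ℂ m u) = smulLeftCLM ℂ m (opX a u) := by
  ext φ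
  rw [opX_apply, smulLeftCLM_apply_apply, smulLeftCLM_apply_apply, opX_apply]
  congr 1
  ext x
  simp only [SchwartzMap.smulLeftCLM_apply_apply hm, XS_apply, smul_eq_mul]
  ring

theorem comm_opD_dil (i : ℕ) (φ : Sch n) (a : Fin (n + 1)) :
    (cst opD a * (fun j => smulLeftCLM ℂ (fun x => (eps j : ℂ) ^ i * dil φ j x)) -
      (fun j => smulLeftCLM ℂ (fun x => (eps j : ℂ) ^ i * dil φ j x)) * cst opD a :
        ℕ → Dist n →L[ℂ] Dist n) = (-Complex.I) •
      fun j => smulLeftCLM ℂ (fun x => (eps j : ℂ) ^ (i + 1) * dil (∂_{ev a} φ) j x) := by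
  ext1 j
  ext1 u
  have := opD_smulLeft ((pb_dil (mem_dilSet i φ)).temperate j)
    ((pb_dil (mem_dilSet (i + 1) (∂_{ev a} φ))).temperate j) a
    (fun x => congrFun (congrFun (pd_dil i φ a) j) x) u
  exact sub_eq_of_eq_add' this

/-- Commutators of the generators with the dilated cutoffs stay in the span of such cutoffs: a
coordinate costs one power of the scale, which a derivative of the cutoff gains. -/
theorem dilSub_gen (c : ℝ) : ∀ g, ∀ m ∈ dilSub n, genIn (cst opD) (cst opX) c g * m ∈
    leftSpan (cst opD) (cst opX) c (dilSub n) g.order := by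
  refine gen_mul_mem_of_comm_X (fun a m hm => ?_) (fun a m hm => ?_) (fun a b m hm => ?_)
  · induction hm using Submodule.span_induction with
    | mem x hx =>
      obtain ⟨_, ⟨i, φ, rfl⟩, rfl⟩ := hx
      ext1 j
      ext1 u
      exact opX_smulLeft_comm ((pb_dil (mem_dilSet i φ)).temperate j) a u
    | zero => simp
    | add x y _ _ hx hy => rw [mul_add, add_mul, hx, hy]
    | smul a x _ hx => rw [mul_smul_comm, smul_mul_assoc, hx]
  · induction hm using Submodule.span_induction with
    | mem x hx =>
      obtain ⟨_, ⟨i, φ, rfl⟩, rfl⟩ := hx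
      rw [comm_opD_dil]
      exact Submodule.smul_mem _ _ (smulLeft_mem_dilSub (mem_dilSet _ _))
    | zero => simp
    | add x y _ _ hx hy =>
      rw [mul_add, add_mul, add_sub_add_comm]
      exact Submodule.add_mem _ hx hy
    | smul a x _ hx =>
      rw [mul_smul_comm, smul_mul_assoc, ← smul_sub]
      exact Submodule.smul_mem _ _ hx
  · induction hm using Submodule.span_induction with
    | mem x hx =>
      obtain ⟨_, ⟨i, φ, rfl⟩, rfl⟩ := hx
      rw [comm_opD_dil, mul_smul_comm]
      refine Submodule.smul_mem _ _ ?_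
      -- one power of the scale turns the coordinate into a dilated coordinate
      have : (cst opX b * fun j => smulLeftCLM ℂ
          (fun x => (eps j : ℂ) ^ (i + 1) * dil (∂_{ev a} φ) j x) : ℕ → Dist n →L[ℂ] Dist n) =
          fun j => smulLeftCLM ℂ (fun x => (eps j : ℂ) ^ i * dil (XS b (∂_{ev a} φ)) j x) := by
        ext1 j
        ext1 u
        refine opX_smulLeft ((pb_dil (mem_dilSet _ _)).temperate j)
          ((pb_dil (mem_dilSet _ _)).temperate j) b (fun x => ?_) u
        simp only [dil_apply, XS_apply, PiLp.smul_apply, smul_eq_mul, Complex.ofReal_mul]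
        ring
      rw [this]
      exact smulLeft_mem_dilSub (mem_dilSet _ _)
    | zero => simp
    | add x y _ _ hx hy =>
      rw [mul_add, add_mul, add_sub_add_comm, mul_add]
      exact Submodule.add_mem _ hx hy
    | smul a x _ hx =>
      rw [mul_smul_comm, smul_mul_assoc, ← smul_sub, mul_smul_comm]
      exact Submodule.smul_mem _ _ hx

/-- The regularization: truncation at frequencies, then at points, of size `1 / eps j`. -/
def reg (χ : Sch n) (j : ℕ) : Dist n →L[ℂ] Dist n :=
  smulLeftCLM ℂ (dil χ j) * mulD (dil χ j)

theorem bd_reg (r : ℝ) (χ : Sch n) :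
    ∃ C : ℝ, 0 ≤ C ∧ ∀ j v K, Bd r v K → Bd r (reg χ j v) (C * K) := by
  have hp := pb_dil (dil_mem_dilSet χ)
  obtain ⟨C, N, h0, hC⟩ := (hp.smulLeft_opBdd r).comp (fun _ => le_rfl)
    (hp.opBdd (fun _ => le_rfl) r)
  refine ⟨C, h0, fun j v K hv => ?_⟩
  have := hC j v K hv
  simp only [one_pow, mul_one] at this
  exact this

/-- Regularization preserves module regularity, uniformly in the scale. -/
theorem wordBd_reg (r c : ℝ) (k : ℕ) (χ : Sch n) : ∃ C : ℝ, 0 ≤ C ∧ ∀ j v K,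
    WordBd 0 r k c v K → WordBd 0 r k c (reg χ j v) (C * K) := by
  have hp := pb_dil (dil_mem_dilSet χ)
  obtain ⟨C, N, h0, hC⟩ := hp.wordBd (fun _ => le_rfl) 0 0 r c k
  have hM : ∀ T ∈ dilSub n, ∃ (C : ℝ) (N : ℕ), 0 ≤ C ∧ ∀ j u K,
      Bd r (Ts 0 u) K → Bd r (Ts 0 (T j u)) (C * (fun _ : ℕ => (1 : ℝ)) j ^ N * K) := by
    intro T hT
    have : OpBdd (fun _ : ℕ => 1) r T := by
      induction hT using Submodule.span_induction with
      | mem x hx =>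
        obtain ⟨m, hm, rfl⟩ := hx
        exact (pb_dil hm).smulLeft_opBdd r
      | zero => exact ⟨0, 0, le_rfl, fun j u K _ => by simpa using Bd.zero r⟩
      | add x y _ _ hx hy => exact hx.add (fun _ => le_rfl) hy
      | smul a x _ hx => exact hx.smul a
    simpa only [OpBdd, Ts_zero] using this
  choose C' N' h0' hC' using fun w : List (Gen n) =>
    bd_of_mem_leftSpan (fun _ => le_rfl) (Ts 0) (Ts 0) hM
      (word_mul_mem_leftSpan (dilSub_gen c) w _ (smulLeft_mem_dilSub (dil_mem_dilSet χ)))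
  have hf := finite_words (n := n) k
  refine ⟨(∑ w ∈ hf.toFinset, C' w) * C, mul_nonneg (Finset.sum_nonneg fun w _ => h0' w) h0,
    fun j v K hv w hw => ?_⟩
  have h1 := hC j v K hv
  simp only [sub_self, Ts_zero, one_pow, mul_one] at h1
  have h2 := hC' w j _ _ (h1.mono hw)
  rw [Pi.mul_apply, wordIn_cst] at h2
  refine h2.mono ?_
  have h3 : C' w ≤ ∑ w ∈ hf.toFinset, C' w :=
    Finset.single_le_sum (fun w _ => h0' w) (by simpa using hw)
  have := mul_nonneg h0 hv.nonneg
  simp only [one_pow, mul_one, mul_assoc]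
  gcongr

/-! ### Approximation by Schwartz functions -/

/-- Combinations of `f · Op(g)` with Schwartz functions `f` and `g`. -/
def smoothSub (n : ℕ) : Submodule ℂ (Dist n →L[ℂ] Dist n) :=
  Submodule.span ℂ {T | ∃ f g : Sch n, T = smulLeftCLM ℂ f * mulD g}

theorem fourierMultiplier_mem_smoothSub (f g : Sch n) :
    smulLeftCLM ℂ f * mulD g ∈ smoothSub n := Submodule.subset_span ⟨f, g, rfl⟩

theorem opX_mul_mem_smoothSub (a : Fin (n + 1)) {T : Dist n →L[ℂ] Dist n} (hT : T ∈ smoothSub n) :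
    opX a * T ∈ smoothSub n := by
  induction hT using Submodule.span_induction with
  | mem x hx =>
    obtain ⟨f, g, rfl⟩ := hx
    have : opX a * (smulLeftCLM ℂ f * mulD g) = smulLeftCLM ℂ (XS a f) * mulD g := by
      ext1 u
      exact opX_smulLeft f.hasTemperateGrowth (XS a f).hasTemperateGrowth a (XS_apply a f) _
    rw [this]
    exact fourierMultiplier_mem_smoothSub _ _
  | zero => simp
  | add x y _ _ hx hy => rw [mul_add]; exact Submodule.add_mem _ hx hy
  | smul a x _ hx => rw [mul_smul_comm]; exact Submodule.smul_mem _ _ hx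

/-- A derivative of `f · Op(g) u` falls on `f`, or it multiplies the symbol `g` by a coordinate. -/
theorem opD_mul_mem_smoothSub (a : Fin (n + 1)) {T : Dist n →L[ℂ] Dist n} (hT : T ∈ smoothSub n) :
    opD a * T ∈ smoothSub n := by
  induction hT using Submodule.span_induction with
  | mem x hx =>
    obtain ⟨f, g, rfl⟩ := hx
    have h1 : ∀ u : Dist n, opD a (mulD g u) = (2 * Real.pi : ℂ) • mulD (XS a g) u := by
      intro u
      have h : (fun x : Spacetime n => ((inner ℝ x (ev a) : ℝ) : ℂ)).HasTemperateGrowth := by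
        fun_prop
      change (-Complex.I) • ∂_{ev a} (mulD g u) = _
      rw [lineDeriv_eq_fourierMultiplierCLM, mulD_mulD h g.hasTemperateGrowth, smul_smul]
      have e : (fun ξ : Spacetime n => ((inner ℝ ξ (ev a) : ℝ) : ℂ) * g ξ) = XS a g := by
        funext ξ; rw [XS_apply, inner_ev]
      rw [e]
      congr 1
      linear_combination (-2 * Real.pi : ℂ) * Complex.I_mul_I
    have : opD a * (smulLeftCLM ℂ f * mulD g) =
        (2 * Real.pi : ℂ) • (smulLeftCLM ℂ f * mulD (XS a g)) +
          (-Complex.I) • (smulLeftCLM ℂ (∂_{ev a} f : Sch n) * mulD g) := by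
      ext1 u
      have := opD_smulLeft f.hasTemperateGrowth (∂_{ev a} f : Sch n).hasTemperateGrowth a
        (fun x => (SchwartzMap.lineDerivOp_apply_eq_fderiv ..).symm) (mulD g u)
      rw [h1, map_smul] at this
      exact this
    rw [this]
    exact Submodule.add_mem _ (Submodule.smul_mem _ _ (fourierMultiplier_mem_smoothSub _ _))
      (Submodule.smul_mem _ _ (fourierMultiplier_mem_smoothSub _ _))
  | zero => simp
  | add x y _ _ hx hy => rw [mul_add]; exact Submodule.add_mem _ hx hy
  | smul a x _ hx => rw [mul_smul_comm]; exact Submodule.smul_mem _ _ hx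

theorem word_mul_mem_smoothSub (c : ℝ) (w : List (Gen n)) {T : Dist n →L[ℂ] Dist n}
    (hT : T ∈ smoothSub n) : Wd c w * T ∈ smoothSub n := by
  induction w with
  | nil => simpa using hT
  | cons g w ih =>
    rw [Wd, wordIn_cons, mul_assoc]
    have hX := fun a => opX_mul_mem_smoothSub a ih
    have hD := fun a => opD_mul_mem_smoothSub a ih
    have hXD := fun a b => opX_mul_mem_smoothSub a (hD b)
    cases g with
    | Dz j => exact hD _
    | Dt => exact hD _
    | rot i j =>
      simp only [genIn, sub_mul, mul_assoc]
      exact Submodule.sub_mem _ (hXD _ _) (hXD _ _)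
    | gal j =>
      simp only [genIn, sub_mul, mul_assoc, smul_mul_assoc]
      exact Submodule.sub_mem _ (hXD _ _) (Submodule.smul_mem _ _ (hX _))
    | scal =>
      simp only [genIn, add_mul, mul_assoc, smul_mul_assoc, Finset.sum_mul]
      exact Submodule.add_mem _ (Submodule.smul_mem _ _ (hXD _ _))
        (Submodule.sum_mem _ fun j _ => hXD _ _)

theorem pb_schwartz (f : Sch n) : PB (fun _ : Unit => 1) fun _ => f :=
  ⟨fun _ => f.smooth _, fun l => ⟨SchwartzMap.seminorm ℝ 0 l f, 0, apply_nonneg _ _, fun _ x => by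
    simpa using SchwartzMap.norm_iteratedFDeriv_le_seminorm ℝ f l x⟩⟩

/-- A regularized element of a weighted `L²` space has all module regularity. -/
theorem wordBd_of_smoothSub (r c : ℝ) (k : ℕ) {T : Dist n →L[ℂ] Dist n} (hT : T ∈ smoothSub n) :
    ∃ C : ℝ, 0 ≤ C ∧ ∀ v K, Bd r v K → WordBd 0 r k c (T v) (C * K) := by
  have key : ∀ w : List (Gen n), OpBdd (fun _ : Unit => 1) r fun _ => Wd c w * T := by
    intro w
    have := word_mul_mem_smoothSub c w hT
    generalize Wd c w * T = A at this
    induction this using Submodule.span_induction with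
    | mem x hx =>
      obtain ⟨f, g, rfl⟩ := hx
      exact ((pb_schwartz f).smulLeft_opBdd r).comp (fun _ => le_rfl)
        ((pb_schwartz g).opBdd (fun _ => le_rfl) r)
    | zero => exact ⟨0, 0, le_rfl, fun j u K _ => by simpa using Bd.zero r⟩
    | add x y _ _ hx hy => exact hx.add (fun _ => le_rfl) hy
    | smul a x _ hx => exact hx.smul a
  choose C N h0 hC using key
  have hf := finite_words (n := n) k
  refine ⟨∑ w ∈ hf.toFinset, C w, Finset.sum_nonneg fun w _ => h0 w, fun v K hv w hw => ?_⟩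
  have h2 := hC w () v K hv
  simp only [one_pow, mul_one] at h2
  rw [Ts_zero]
  exact h2.mono (mul_le_mul_of_nonneg_right (Finset.single_le_sum (fun w _ => h0 w)
    (by simpa using hw)) hv.1)

theorem reg_toD (χ : Sch n) (j : ℕ) (h : Sch n) :
    reg χ j (toD h) = toD (SchwartzMap.smulLeftCLM ℂ (dil χ j) (Mu (dil χ j) h)) := by
  change smulLeftCLM ℂ (dil χ j) (mulD (dil χ j) (toD h)) = _
  rw [mulD, mult_toD (dil χ j).hasTemperateGrowth]
  ext φ
  rw [smulLeftCLM_apply_apply, toD_apply, toD_apply]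
  congr 1
  ext x
  simp only [SchwartzMap.smulLeftCLM_apply_apply (dil χ j).hasTemperateGrowth, smul_eq_mul]
  ring

theorem eps_tendsto : Filter.Tendsto eps Filter.atTop (nhds 0) := by
  have := tendsto_one_div_add_atTop_nhds_zero_nat (𝕜 := ℝ)
  exact this.congr fun j => one_div _

theorem norm_dil_sub_one_le {χ : Sch n} (h1 : χ 0 = 1) : ∃ L : ℝ, 0 ≤ L ∧
    ∀ j x, ‖dil χ j x - 1‖ ≤ L * eps j * ‖x‖ := by
  refine ⟨SchwartzMap.seminorm ℝ 0 1 χ, apply_nonneg _ _, fun j x => ?_⟩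
  have := Convex.norm_image_sub_le_of_norm_fderiv_le (𝕜 := ℝ) (f := χ) (s := Set.univ)
    (C := SchwartzMap.seminorm ℝ 0 1 χ) (fun x _ => χ.differentiableAt) (fun x _ => by
      have := SchwartzMap.norm_iteratedFDeriv_le_seminorm ℝ χ 1 x
      rwa [norm_iteratedFDeriv_one] at this) convex_univ (Set.mem_univ 0) (Set.mem_univ (eps j • x))
  rw [h1, sub_zero, norm_smul, Real.norm_eq_abs, abs_of_pos (eps_pos j), ← mul_assoc] at this
  exact this

theorem wn_smul_dil_sub_le {χ : Sch n} (h1 : χ 0 = 1) : ∃ L : ℝ, 0 ≤ L ∧ ∀ j (f : Sch n),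
    wn 0 (SchwartzMap.smulLeftCLM ℂ (dil χ j) f - f) ≤ L * eps j * wn 1 f := by
  obtain ⟨L, h0, hL⟩ := norm_dil_sub_one_le h1
  refine ⟨L, h0, fun j f => wn_le_of_norm_le (mul_nonneg h0 (eps_pos j).le) fun x => ?_⟩
  rw [bracket_zero, one_mul, sub_apply,
    SchwartzMap.smulLeftCLM_apply_apply (dil χ j).hasTemperateGrowth, smul_eq_mul,
    ← sub_one_mul, norm_mul, norm_mul, norm_bracket, ← mul_assoc]
  have h2 : ‖x‖ ≤ (1 + ‖x‖ ^ 2) ^ ((1 : ℝ) / 2) := by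
    rw [← Real.sqrt_eq_rpow]
    exact Real.le_sqrt_of_sq_le (by linarith)
  have h3 := (hL j x).trans (mul_le_mul_of_nonneg_left h2 (mul_nonneg h0 (eps_pos j).le))
  gcongr

theorem wn_Mu_dil_sub_le {χ : Sch n} (h1 : χ 0 = 1) : ∃ L : ℝ, 0 ≤ L ∧ ∀ j (f : Sch n),
    wn 0 (Mu (dil χ j) f - f) ≤ L * eps j * wn 1 (𝓕 f : Sch n) := by
  obtain ⟨L, h0, hL⟩ := wn_smul_dil_sub_le h1
  refine ⟨L, h0, fun j f => ?_⟩
  have h2 : ∀ g : Sch n, wn 0 g = wn 0 (𝓕 g : Sch n) := fun g => by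
    simp [wn, SchwartzMap.norm_fourier_toL2_eq]
  have h3 : (𝓕 (Mu (dil χ j) f - f) : Sch n) =
      SchwartzMap.smulLeftCLM ℂ (dil χ j) (𝓕 f : Sch n) - 𝓕 f := by
    ext ξ
    rw [sub_eq_add_neg, FourierTransform.fourier_add, FourierTransform.fourier_neg, add_apply,
      fourier_Mu (dil χ j).hasTemperateGrowth, sub_apply, neg_apply,
      SchwartzMap.smulLeftCLM_apply_apply (dil χ j).hasTemperateGrowth, smul_eq_mul]
    ring
  rw [h2, h3]
  exact hL j _

/-- Regularizations of Schwartz functions converge. -/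
theorem tendsto_reg_toD {χ : Sch n} (h1 : χ 0 = 1) (h φ : Sch n) :
    Filter.Tendsto (fun j => reg χ j (toD h) φ) Filter.atTop (nhds (toD h φ)) := by
  obtain ⟨L, h0, hL⟩ := wn_smul_dil_sub_le (n := n) h1
  obtain ⟨L', h0', hL'⟩ := wn_Mu_dil_sub_le (n := n) h1
  obtain ⟨C, N, -, hC⟩ := (pb_dil (dil_mem_dilSet χ)).bound
  simp only [one_pow, mul_one] at hC
  have hC0 : 0 ≤ C := (norm_nonneg _).trans (hC 0 0)
  rw [tendsto_iff_norm_sub_tendsto_zero]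
  have key : ∀ j, ‖reg χ j (toD h) φ - toD h φ‖ ≤
      eps j * (C * wn 0 φ * (L' * wn 1 (𝓕 h : Sch n)) + L * wn 1 φ * wn 0 h) := by
    intro j
    have e1 : reg χ j (toD h) φ - toD h φ =
        toD (Mu (dil χ j) h - h) (SchwartzMap.smulLeftCLM ℂ (dil χ j) φ) +
          toD h (SchwartzMap.smulLeftCLM ℂ (dil χ j) φ - φ) := by
      change smulLeftCLM ℂ (dil χ j) (mulD (dil χ j) (toD h)) φ - _ = _
      rw [smulLeftCLM_apply_apply, mulD, mult_toD (dil χ j).hasTemperateGrowth, map_sub, map_sub]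
      exact (sub_add_sub_cancel _ _ _).symm
    have e2 : ∀ f g : Sch n, ‖toD f g‖ ≤ wn 0 g * wn 0 f := fun f g => by
      simpa [toD_apply] using norm_integral_mul_le 0 g f
    rw [e1]
    refine (norm_add_le _ _).trans ((add_le_add ((e2 _ _).trans (mul_le_mul
      (wn_le_of_forall_norm_le (f := φ) hC0 fun x => ?_) (hL' j h) (wn_nonneg _ _)
      (mul_nonneg hC0 (wn_nonneg _ _)))) ((e2 _ _).trans (mul_le_mul_of_nonneg_right (hL j φ)
      (wn_nonneg _ _)))).trans (le_of_eq (by ring)))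
    rw [SchwartzMap.smulLeftCLM_apply_apply (dil χ j).hasTemperateGrowth, norm_smul]
    exact mul_le_mul_of_nonneg_right (hC j x) (norm_nonneg _)
  refine squeeze_zero (fun _ => norm_nonneg _) key ?_
  simpa using eps_tendsto.mul_const _

theorem bd_smulLeft_Lp (r : ℝ) (g : Lp ℂ 2 (volume : Measure (Spacetime n))) :
    Bd r (smulLeftCLM ℂ (bracket (-r)) (g : Dist n)) ‖g‖ := by
  refine ⟨norm_nonneg _, fun φ => ?_⟩
  have h1 : (g : Dist n) (wt (-r) φ) = inner ℂ ((cj (wt (-r) φ)).toLp 2 volume) g := by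
    rw [L2.inner_def, Lp.toTemperedDistribution_apply]
    refine integral_congr_ae ?_
    filter_upwards [(cj (wt (-r) φ)).coeFn_toLp 2 volume] with x hx
    rw [hx]
    simp [mul_comm]
  have h2 : ‖(cj (wt (-r) φ)).toLp 2 volume‖ = wn (-r) φ := by
    have := wn_cj 0 (wt (-r) φ)
    rwa [wn_wt, zero_add, wn, wt_zero] at this
  rw [smulLeftCLM_apply_apply]
  change ‖(g : Dist n) (wt (-r) φ)‖ ≤ _
  rw [h1, ← h2, mul_comm]
  exact norm_inner_le_norm _ _

/-- Schwartz functions are dense in the weighted `L²` spaces. -/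
theorem Bd.exists_sub_toD {r K δ : ℝ} {v : Dist n} (hv : Bd r v K) (hδ : 0 < δ) :
    ∃ h : Sch n, Bd r (v - toD h) δ := by
  obtain ⟨g, -, rfl⟩ := hv.exists_Lp
  obtain ⟨_, hη, ⟨η, rfl⟩⟩ := Metric.dense_iff.1 (SchwartzMap.denseRange_toLpCLM (E := Spacetime n)
    (F := ℂ) (p := 2) (by norm_num)) g δ hδ
  refine ⟨wt (-r) η, ?_⟩
  have e1 : toD (wt (-r) η) = smulLeftCLM ℂ (bracket (-r)) (toD η) := by
    ext φ
    rw [smulLeftCLM_apply_apply, toD_apply, toD_apply]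
    congr 1
    ext x
    change _ = wt (-r) φ x * _
    rw [wt_apply, wt_apply]
    ring
  have e2 : (g : Dist n) - toD η = ((g - η.toLp 2 volume :
      Lp ℂ 2 (volume : Measure (Spacetime n))) : Dist n) := by
    rw [← Lp.toTemperedDistribution_toLp_eq (p := 2)]
    exact (map_sub (Lp.toTemperedDistributionCLM ℂ volume 2) _ _).symm
  rw [e1, ← map_sub, e2]
  refine (bd_smulLeft_Lp r _).mono ?_
  rw [← dist_eq_norm, dist_comm]
  exact (Metric.mem_ball.1 hη).le

theorem exists_sch_one_at_zero : ∃ χ : Sch n, χ 0 = 1 := by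
  let b : ContDiffBump (0 : Spacetime n) := ⟨1, 2, one_pos, one_lt_two⟩
  have h1 : HasCompactSupport fun x => (b x : ℂ) :=
    b.hasCompactSupport.comp_left Complex.ofReal_zero
  have h2 : ContDiff ℝ ∞ fun x => (b x : ℂ) := Complex.ofRealCLM.contDiff.comp b.contDiff
  refine ⟨h1.toSchwartzMap h2, ?_⟩
  change ((b 0 : ℝ) : ℂ) = 1
  rw [b.one_of_mem_closedBall (by simp [b.rIn_pos.le]), Complex.ofReal_one]

/-- Regularizations converge weakly: this holds on the dense subspace of Schwartz functions, and the
regularizations are uniformly bounded. -/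
theorem tendsto_reg {r K : ℝ} {v : Dist n} (hv : Bd r v K) {χ : Sch n} (h1 : χ 0 = 1) (φ : Sch n) :
    Filter.Tendsto (fun j => reg χ j v φ) Filter.atTop (nhds (v φ)) := by
  obtain ⟨C, h0, hC⟩ := bd_reg r χ
  rw [Metric.tendsto_atTop]
  intro η hη
  obtain ⟨δ, hδ, hδ'⟩ : ∃ δ : ℝ, 0 < δ ∧ C * δ * wn (-r) φ + δ * wn (-r) φ < η / 2 := by
    refine ⟨η / 2 / (2 * ((C + 1) * (wn (-r) φ + 1))), ?_, ?_⟩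
    · have := wn_nonneg (-r) φ
      positivity
    · have := wn_nonneg (-r) φ
      have h2 : η / 2 / (2 * ((C + 1) * (wn (-r) φ + 1))) * ((C + 1) * (wn (-r) φ + 1)) = η / 4 := by
        field_simp
        ring
      have h3 : 0 < η / 2 / (2 * ((C + 1) * (wn (-r) φ + 1))) := by positivity
      nlinarith [mul_pos h3 (show 0 < C + 1 by linarith)]
  obtain ⟨h, hh⟩ := hv.exists_sub_toD hδ
  obtain ⟨J, hJ⟩ := Metric.tendsto_atTop.1 (tendsto_reg_toD h1 h φ) (η / 2) (half_pos hη)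
  refine ⟨J, fun j hj => ?_⟩
  have e := hJ j hj
  rw [dist_eq_norm] at e ⊢
  have e1 : reg χ j v φ - v φ =
      reg χ j (v - toD h) φ - (v - toD h) φ + (reg χ j (toD h) φ - toD h φ) := by
    rw [map_sub]
    change reg χ j v φ - v φ =
      (reg χ j v φ - reg χ j (toD h) φ) - (v φ - toD h φ) + (reg χ j (toD h) φ - toD h φ)
    ring
  have e2 := (hC j _ _ hh).2 φ
  have e3 := hh.2 φ
  rw [e1]
  have := norm_add_le (reg χ j (v - toD h) φ - (v - toD h) φ) (reg χ j (toD h) φ - toD h φ)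
  have := norm_sub_le (reg χ j (v - toD h) φ) ((v - toD h) φ)
  linarith

theorem reg_mem_smoothSub (χ : Sch n) (j : ℕ) : reg χ j ∈ smoothSub n :=
  fourierMultiplier_mem_smoothSub _ _

/-- Elements of the module regularity spaces are weak limits of bounded sequences of Schwartz
functions: regularize at a small scale, after an approximation in the weighted `L²` space which is
so good that the loss from the regularization is harmless. -/
theorem exists_approx (s r c : ℝ) (k : ℕ) : ∃ C : ℝ, 0 ≤ C ∧ ∀ (u : Dist n) K,
    WordBd s r k c u K → ∃ f : ℕ → Sch n, (∀ j, WordBd s r k c (toD (f j)) (C * K)) ∧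
      ∀ φ, Filter.Tendsto (fun j => toD (f j) φ) Filter.atTop (nhds (u φ)) := by
  obtain ⟨χ, h1⟩ := exists_sch_one_at_zero (n := n)
  obtain ⟨C₁, h₁, hC₁⟩ := Ts_wordBd (n := n) s 0 r c k
  obtain ⟨C₂, h₂, hC₂⟩ := wordBd_reg r c k χ
  obtain ⟨C₃, h₃, hC₃⟩ := Ts_wordBd (n := n) 0 s r c k
  obtain ⟨C₄, h₄, hC₄⟩ := bd_reg r χ
  choose A hA0 hA using fun j => wordBd_of_smoothSub r c k (reg_mem_smoothSub χ j)
  refine ⟨C₃ * (C₂ * C₁ + 1), by positivity, fun u K hu => ?_⟩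
  rcases hu.nonneg.eq_or_lt with hK | hK
  · -- the distribution vanishes
    have hz : ∀ φ, u φ = 0 := fun φ => by
      have h2 := hC₁ u K hu [] (by simp)
      have h3 := hC₃ _ _ (hC₁ u K hu) [] (by simp)
      have h4 := hu [] (by simp)
      have h5 : Ts s u = 0 := by
        ext φ
        have := h4.2 φ
        rw [← hK, zero_mul] at this
        exact norm_le_zero_iff.1 this
      have h6 : u = Ts (-s) (Ts s u) := by rw [Ts_Ts, neg_add_cancel, Ts_zero]
      rw [h6, h5, map_zero]
      rfl
    refine ⟨fun _ => 0, fun j w hw => ?_, fun φ => ?_⟩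
    · simpa [← hK] using Bd.zero r
    · rw [hz]
      simp
  -- It suffices to approximate `v = p^{s/4} u`, at regularity zero.
  set v := Ts s u with hv
  have hu' : u = Ts (-s) v := by rw [hv, Ts_Ts, neg_add_cancel, Ts_zero]
  have hvw : WordBd 0 r k c v (C₁ * K) := by simpa [hv] using hC₁ u K hu
  have hvb : Bd r v K := hu [] (by simp)
  -- `A j` is the loss of the regularization at the scale `eps j`, so `h j` has to be closer to `v`
  -- than `K / A j`; the factor `eps j` makes the error converge to zero.
  have hd : ∀ j, 0 < K * eps j / (A j + 1) := fun j =>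
    div_pos (mul_pos hK (eps_pos j)) (by linarith [hA0 j])
  choose h hh using fun j => hvb.exists_sub_toD (hd j)
  have hAd : ∀ j, A j * (K * eps j / (A j + 1)) ≤ K := fun j => by
    have h2 : A j / (A j + 1) ≤ 1 := div_le_one_of_le₀ (by linarith) (by linarith [hA0 j])
    have h3 : K * eps j ≤ K := mul_le_of_le_one_right hK.le (eps_le_one j)
    calc A j * (K * eps j / (A j + 1)) = (A j / (A j + 1)) * (K * eps j) := by ring
      _ ≤ 1 * K := mul_le_mul h2 h3 (mul_nonneg hK.le (eps_pos j).le) zero_le_one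
      _ = K := one_mul K
  have hle : ∀ j, K * eps j / (A j + 1) ≤ K * eps j := fun j =>
    div_le_self (mul_nonneg hK.le (eps_pos j).le) (by linarith [hA0 j])
  set g : ℕ → Sch n := fun j => SchwartzMap.smulLeftCLM ℂ (dil χ j) (Mu (dil χ j) (h j)) with hg
  have e1 : ∀ j, toD (g j) = reg χ j v + (-1 : ℂ) • reg χ j (v - toD (h j)) := fun j => by
    rw [map_sub, reg_toD]
    module
  have hgw : ∀ j, WordBd 0 r k c (toD (g j)) ((C₂ * C₁ + 1) * K) := fun j w hw => by
    rw [e1, map_add, map_add, map_smul, map_smul]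
    refine ((hC₂ j v _ hvw w hw).add ((hA j _ _ (hh j) w hw).smul (-1))).mono ?_
    rw [norm_neg, norm_one, one_mul]
    linarith [hAd j]
  have hgt : ∀ φ, Filter.Tendsto (fun j => toD (g j) φ) Filter.atTop (nhds (v φ)) := fun φ => by
    have h2 : Filter.Tendsto (fun j => reg χ j (v - toD (h j)) φ) Filter.atTop (nhds 0) := by
      refine squeeze_zero_norm (a := fun j => eps j * (C₄ * K * wn (-r) φ)) (fun j => ?_) ?_
      · refine ((hC₄ j _ _ (hh j)).2 φ).trans ?_
        have := mul_le_mul_of_nonneg_right (mul_le_mul_of_nonneg_left (hle j) h₄) (wn_nonneg (-r) φ)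
        linarith
      · simpa using eps_tendsto.mul_const (C₄ * K * wn (-r) φ)
    have h3 := (tendsto_reg hvb h1 φ).add (h2.const_mul (-1))
    rw [mul_zero, add_zero] at h3
    refine h3.congr fun j => ?_
    rw [e1]
    rfl
  have e2 : ∀ j, toD (Mu (pp (-s / 4)) (g j)) = Ts (-s) (toD (g j)) := fun j => (Ts_toD _ _).symm
  refine ⟨fun j => Mu (pp (-s / 4)) (g j), fun j => ?_, fun φ => ?_⟩
  · rw [e2, mul_assoc]
    simpa using hC₃ _ _ (hgw j)
  · simp only [e2, hu', Ts, mulD]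
    simp only [mult_apply (hasTemperateGrowth_pp _)]
    exact hgt _

/-! ### Distributions that are functions -/

theorem IsFun.locallyIntegrable {u : Dist n} {f : Spacetime n → ℂ} (h : IsFun u f) :
    LocallyIntegrable f volume := by
  rw [locallyIntegrable_iff]
  intro K hK
  obtain ⟨R, hR⟩ := hK.isBounded.subset_closedBall 0
  -- A Schwartz function that is `1` on the compact set.
  let b : ContDiffBump (0 : Spacetime n) :=
    ⟨|R| + 1, |R| + 2, by positivity, by linarith⟩
  have h1 : HasCompactSupport fun x => (b x : ℂ) :=
    b.hasCompactSupport.comp_left Complex.ofReal_zero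
  have h2 : ContDiff ℝ ∞ fun x => (b x : ℂ) := Complex.ofRealCLM.contDiff.comp b.contDiff
  refine (h (h1.toSchwartzMap h2)).1.integrableOn.congr_fun (fun Z hZ => ?_) hK.measurableSet
  change ((b Z : ℝ) : ℂ) * f Z = f Z
  have : Z ∈ Metric.closedBall (0 : Spacetime n) (|R| + 1) :=
    Metric.closedBall_subset_closedBall (by linarith [le_abs_self R]) (hR hZ)
  rw [b.one_of_mem_closedBall this, Complex.ofReal_one, one_mul]

/-- The function of a distribution is determined almost everywhere. -/
theorem IsFun.ae_eq {u : Dist n} {f g : Spacetime n → ℂ} (hf : IsFun u f) (hg : IsFun u g) :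
    f =ᵐ[volume] g := by
  refine ae_eq_of_integral_contDiff_smul_eq hf.locallyIntegrable hg.locallyIntegrable
    fun b hb hb' => ?_
  have h1 : HasCompactSupport fun x => (b x : ℂ) := hb'.comp_left Complex.ofReal_zero
  have h2 : ContDiff ℝ ∞ fun x => (b x : ℂ) := Complex.ofRealCLM.contDiff.comp hb
  have := (hf (h1.toSchwartzMap h2)).2.symm.trans (hg (h1.toSchwartzMap h2)).2
  simp only [Complex.real_smul]
  exact this

/-- Elements of weighted `L²` spaces are functions. -/
theorem Bd.exists_isFun {r K : ℝ} {u : Dist n} (h : Bd r u K) :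
    ∃ f : Spacetime n → ℂ, MemLp (fun Z => bracket r Z * f Z) 2 volume ∧ IsFun u f := by
  obtain ⟨g, -, rfl⟩ := h.exists_Lp
  refine ⟨fun Z => bracket (-r) Z * g Z, (Lp.memLp g).congr_norm ?_ ?_, fun φ => ?_⟩
  · exact ((hasTemperateGrowth_bracket r).1.continuous.aestronglyMeasurable).mul
      (((hasTemperateGrowth_bracket (-r)).1.continuous.aestronglyMeasurable).mul
        (Lp.aestronglyMeasurable g))
  · refine Filter.Eventually.of_forall fun Z => ?_
    rw [← mul_assoc, bracket_mul, add_neg_cancel, bracket_zero, one_mul]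
  · have e : ∀ Z, φ Z * (bracket (-r) Z * g Z) = wt (-r) φ Z * g Z := fun Z => by
      rw [wt_apply]; ring
    simp only [e]
    refine ⟨MemLp.integrable_mul (p := 2) (q := 2) ((wt (-r) φ).memLp 2 volume) (Lp.memLp g), ?_⟩
    rw [smulLeftCLM_apply_apply]
    exact Lp.toTemperedDistribution_apply g (wt (-r) φ)

theorem IsFun.memLp {r K : ℝ} {u : Dist n} {f : Spacetime n → ℂ} (hf : IsFun u f)
    (h : Bd r u K) : MemLp (fun Z => bracket r Z * f Z) 2 volume := by
  obtain ⟨g, hg, hg'⟩ := h.exists_isFun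
  exact (memLp_congr_ae ((hf.ae_eq hg').mono fun Z hZ => by simp only [hZ])).2 hg

theorem memLp_schwartz_mul {r : ℝ} {f : Spacetime n → ℂ}
    (h : MemLp (fun Z => bracket r Z * f Z) 2 volume) (r' : ℝ) (φ : Sch n) :
    MemLp (fun Z => bracket r' Z * (φ Z * f Z)) 2 volume := by
  have e : (fun Z => bracket r' Z * (φ Z * f Z)) =
      fun Z => wt (r' - r) φ Z * (bracket r Z * f Z) := by
    funext Z
    rw [wt_apply, show bracket r' Z = bracket (r' - r) Z * bracket r Z by
      rw [bracket_mul, sub_add_cancel]]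
    ring
  rw [e]
  refine h.of_le_mul (c := SchwartzMap.seminorm ℝ 0 0 (wt (r' - r) φ))
    ((wt (r' - r) φ).continuous.aestronglyMeasurable.mul h.1)
    (Filter.Eventually.of_forall fun Z => ?_)
  rw [norm_mul]
  exact mul_le_mul_of_nonneg_right ((wt (r' - r) φ).norm_le_seminorm ℝ Z) (norm_nonneg _)

/-- The product of two functions in weighted `L²` spaces is a tempered distribution. -/
theorem exists_isFun_mul {r₁ r₂ : ℝ} {f₁ f₂ : Spacetime n → ℂ}
    (h₁ : MemLp (fun Z => bracket r₁ Z * f₁ Z) 2 volume)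
    (h₂ : MemLp (fun Z => bracket r₂ Z * f₂ Z) 2 volume) :
    ∃ w : Dist n, IsFun w fun Z => f₁ Z * f₂ Z := by
  have hP : MemLp (fun Z => (bracket r₁ Z * f₁ Z) * (bracket r₂ Z * f₂ Z)) 1 volume :=
    memLp_one_iff_integrable.2 (MemLp.integrable_mul (p := 2) (q := 2) h₁ h₂)
  refine ⟨smulLeftCLM ℂ (bracket (-(r₁ + r₂))) (hP.toLp _ : Lp ℂ 1 (volume : Measure
    (Spacetime n))), fun φ => ⟨?_, ?_⟩⟩
  · have := MemLp.integrable_mul (p := 2) (q := 2) (memLp_schwartz_mul h₁ (-r₂) φ) h₂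
    refine this.congr (Filter.Eventually.of_forall fun Z => ?_)
    have e : bracket (-r₂) Z * bracket r₂ Z = 1 := by
      rw [bracket_mul, neg_add_cancel, bracket_zero]
    simp only [Pi.mul_apply]
    linear_combination (φ Z * f₁ Z * f₂ Z) * e
  · rw [smulLeftCLM_apply_apply]
    refine (Lp.toTemperedDistribution_apply _ (wt (-(r₁ + r₂)) φ)).trans (integral_congr_ae ?_)
    filter_upwards [hP.coeFn_toLp] with Z hZ
    have e : bracket (-(r₁ + r₂)) Z * (bracket r₁ Z * bracket r₂ Z) = 1 := by
      rw [bracket_mul, bracket_mul, neg_add_cancel, bracket_zero]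
    rw [hZ, wt_apply, smul_eq_mul]
    linear_combination (φ Z * f₁ Z * f₂ Z) * e

/-! ### Products of distributions -/

theorem WordBd.of_tendsto {s r c K : ℝ} {k : ℕ} {u : Dist n} {v : ℕ → Dist n}
    (hv : ∀ j, WordBd s r k c (v j) K)
    (h : ∀ φ, Filter.Tendsto (fun j => v j φ) Filter.atTop (nhds (u φ))) :
    WordBd s r k c u K := fun w hw =>
  Bd.of_tendsto (l := Filter.atTop) (fun j => hv j w hw)
    (PointwiseConvergenceCLM.tendsto_iff_forall_tendsto.1
    (((Ts s ∘L Wd c w).continuous.tendsto u).comp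
      (PointwiseConvergenceCLM.tendsto_iff_forall_tendsto.2 h)))

/-- A bounded sequence that converges weakly against a dense set converges weakly. -/
theorem tendsto_inner_of_dense {H : Type*} [NormedAddCommGroup H] [InnerProductSpace ℂ H]
    {S : Set H} (hS : Dense S) {x : ℕ → H} {y : H} {K : ℝ} (hx : ∀ j, ‖x j‖ ≤ K)
    (h : ∀ b ∈ S, Filter.Tendsto (fun j => inner ℂ b (x j)) Filter.atTop (nhds (inner ℂ b y)))
    (a : H) : Filter.Tendsto (fun j => inner ℂ a (x j)) Filter.atTop (nhds (inner ℂ a y)) := by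
  rw [Metric.tendsto_atTop]
  intro ε hε
  have hK : 0 ≤ K := (norm_nonneg _).trans (hx 0)
  have hp : 0 < K + ‖y‖ + 1 := by positivity
  obtain ⟨b, hb, hbS⟩ := Metric.dense_iff.1 hS a (ε / 2 / (K + ‖y‖ + 1)) (by positivity)
  obtain ⟨J, hJ⟩ := Metric.tendsto_atTop.1 (h b hbS) (ε / 2) (half_pos hε)
  refine ⟨J, fun j hj => ?_⟩
  have h1 := hJ j hj
  rw [dist_eq_norm] at h1 ⊢
  have e : inner ℂ a (x j) - inner ℂ a y =
      inner ℂ (a - b) (x j - y) + (inner ℂ b (x j) - inner ℂ b y) := by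
    simp only [inner_sub_left, inner_sub_right]
    ring
  have h2 : ‖a - b‖ < ε / 2 / (K + ‖y‖ + 1) := by
    rw [← dist_eq_norm, dist_comm]
    exact Metric.mem_ball.1 hb
  rw [lt_div_iff₀ hp] at h2
  have h3 := norm_inner_le_norm (𝕜 := ℂ) (a - b) (x j - y)
  have h4 : ‖x j - y‖ ≤ K + ‖y‖ := (norm_sub_le _ _).trans (by linarith [hx j])
  have h5 := mul_le_mul_of_nonneg_left h4 (norm_nonneg (a - b))
  rw [e]
  have h6 := norm_add_le (inner ℂ (a - b) (x j - y)) (inner ℂ b (x j) - inner ℂ b y)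
  have h7 := norm_nonneg (a - b)
  linarith [mul_add ‖a - b‖ (K + ‖y‖) 1]

/-- A bounded sequence in a weighted `L²` space that converges against Schwartz functions converges
against all functions of the dual space. -/
theorem tendsto_integral_mul {r K : ℝ} {g : ℕ → Sch n} (hg : ∀ j, wn r (g j) ≤ K)
    {f F : Spacetime n → ℂ} (hf : MemLp (fun Z => bracket r Z * f Z) 2 volume)
    (hF : MemLp (fun Z => bracket (-r) Z * F Z) 2 volume)
    (h : ∀ φ : Sch n, Filter.Tendsto (fun j => toD (g j) φ) Filter.atTop
      (nhds (∫ Z, φ Z * f Z))) :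
    Filter.Tendsto (fun j => ∫ Z, F Z * g j Z) Filter.atTop (nhds (∫ Z, F Z * f Z)) := by
  have hF' : MemLp (fun Z => conj (bracket (-r) Z * F Z)) 2 volume := hF.star
  have e1 : ∀ Z : Spacetime n, bracket (-r) Z * bracket r Z = 1 := fun Z => by
    rw [bracket_mul, neg_add_cancel, bracket_zero]
  have hi : ∀ (a : Spacetime n → ℂ) (ha : MemLp (fun Z => bracket r Z * a Z) 2 volume),
      inner ℂ (hF'.toLp _) (ha.toLp _) = ∫ Z, F Z * a Z := fun a ha => by
    rw [L2.inner_def]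
    refine integral_congr_ae ?_
    filter_upwards [hF'.coeFn_toLp, ha.coeFn_toLp] with Z h1 h2
    rw [h1, h2]
    simp only [RCLike.inner_apply, RingHomCompTriple.comp_apply, RingHom.id_apply]
    linear_combination (F Z * a Z) * e1 Z
  have hs : ∀ (η : Sch n) (a : Spacetime n → ℂ) (ha : MemLp (fun Z => bracket r Z * a Z) 2 volume),
      inner ℂ (η.toLp 2 volume) (ha.toLp _) = ∫ Z, wt r (cj η) Z * a Z := fun η a ha => by
    rw [L2.inner_def]
    refine integral_congr_ae ?_
    filter_upwards [η.coeFn_toLp 2 volume, ha.coeFn_toLp] with Z h1 h2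
    rw [h1, h2, wt_apply, cj_apply]
    simp only [RCLike.inner_apply]
    ring
  have hm : ∀ j, MemLp (fun Z => bracket r Z * g j Z) 2 volume := fun j => by
    have := (wt r (g j)).memLp 2 volume
    rwa [show ⇑(wt r (g j)) = fun Z => bracket r Z * g j Z from funext (wt_apply r (g j))] at this
  have key := tendsto_inner_of_dense (K := K) (x := fun j => (hm j).toLp _) (y := hf.toLp _)
    (SchwartzMap.denseRange_toLpCLM (E := Spacetime n) (F := ℂ) (p := 2) (by norm_num))
    (fun j => ?_) ?_ (hF'.toLp _)
  · simpa only [hi] using key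
  · have e2 : (hm j).toLp _ = (wt r (g j)).toLp 2 volume :=
      MemLp.toLp_congr _ _ (Filter.Eventually.of_forall fun Z => (wt_apply r (g j) Z).symm)
    rw [e2]
    exact hg j
  · rintro _ ⟨η, rfl⟩
    have := h (wt r (cj η))
    simp only [toD_apply] at this
    rw [← hs η f hf] at this
    refine this.congr fun j => ?_
    exact (hs η _ (hm j)).symm

/-- Negative powers of `p` are symbols of order zero. -/
theorem pb_pp_neg (hG : ∀ θ, 1 ≤ G θ) {σ : ℝ} (hσ : σ ≤ 0) :
    PB G fun _ => (pp σ : Spacetime n → ℂ) := by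
  refine PB.of_adjoin hG (insert (fun _ => pp σ) {m | PB G m}) ?_ ?_ ?_ _
    (Algebra.subset_adjoin (Set.mem_insert _ _))
  · rintro m (rfl | hm)
    · exact ⟨1, 0, zero_le_one, fun θ ξ => by simpa using norm_pp_neg_le hσ ξ⟩
    · exact PB.bound hm
  · rintro m (rfl | hm) θ
    · exact fun ξ => (fderiv_pp σ ξ).1
    · exact (hm.1 θ).differentiable (by simp)
  · rintro m (rfl | hm) a
    · have : pd a (fun _ : Θ => (pp σ : Spacetime n → ℂ)) =
          (fun _ ξ => (σ : ℂ) * qSym a ξ) * fun _ => pp σ := by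
        funext θ ξ
        exact (fderiv_pp σ ξ).2 a
      rw [this]
      exact mul_mem (Algebra.subset_adjoin (Or.inr ((PB.const _).mul hG (pb_qSym a))))
        (Algebra.subset_adjoin (Set.mem_insert _ _))
    · exact Algebra.subset_adjoin (Or.inr (pb_pd hm a))

/-- Lowering the differential order. -/
theorem wordBd_lower {s s' : ℝ} (h : s' ≤ s) (r c : ℝ) (k : ℕ) : ∃ C : ℝ, 0 ≤ C ∧
    ∀ (u : Dist n) K, WordBd s r k c u K → WordBd s' r k c u (C * K) := by
  obtain ⟨C, N, h0, hC⟩ := (pb_pp_neg (n := n) (G := fun _ : Unit => 1) (fun _ => le_rfl)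
    (σ := (s' - s) / 4) (by linarith)).wordBd (fun _ => le_rfl) s s' r c k
  refine ⟨C, h0, fun u K hu => ?_⟩
  have h1 := hC () u K hu
  have h2 : mulD (pp ((s' - s) / 4)) (Ts (s - s') u) = u :=
    (Ts_Ts (s' - s) (s - s') u).trans (by rw [show s' - s + (s - s') = 0 by ring, Ts_zero])
  simpa [h2] using h1

theorem WordBd.exists_bd {s r c K : ℝ} {k : ℕ} {u : Dist n} (hs : 0 ≤ s)
    (h : WordBd s r k c u K) : ∃ K', Bd r u K' := by
  obtain ⟨C, -, hC⟩ := wordBd_lower (n := n) hs r c k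
  exact ⟨_, by simpa [Ts_zero] using hC u K h [] (by simp)⟩

theorem WordBd.exists_isFun {s r c K : ℝ} {k : ℕ} {u : Dist n} (hs : 0 ≤ s)
    (h : WordBd s r k c u K) : ∃ f, IsFun u f := by
  obtain ⟨K', hK⟩ := h.exists_bd hs
  obtain ⟨f, -, hf⟩ := hK.exists_isFun
  exact ⟨f, hf⟩

/-- The product estimate for functions in the module regularity spaces. -/
theorem exists_wordBd_mul {k : ℕ} (hk : (n : ℝ) / 2 + 2 < k) (hk' : 3 < k) {c₁ c₂ : ℝ}
    (hc₁ : c₁ ≠ 0) (hc₂ : c₂ ≠ 0) (r₁ r₂ : ℝ) {s : ℝ} (hs : 0 ≤ s) :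
    ∃ C : ℝ, 0 ≤ C ∧ ∀ (u₁ u₂ : Dist n) (f₁ f₂ : Spacetime n → ℂ) (K₁ K₂ : ℝ),
      IsFun u₁ f₁ → IsFun u₂ f₂ → WordBd s r₁ k c₁ u₁ K₁ → WordBd s r₂ k c₂ u₂ K₂ →
        ∃ w, IsFun w (fun Z => f₁ Z * f₂ Z) ∧
          WordBd s (r₁ + r₂ + ((n : ℝ) + 1) / 2) k (c₁ + c₂) w (C * (K₁ * K₂)) := by
  obtain ⟨C, h0, hC⟩ := wordBd_mulS (n := n) hk hk' hc₁ hc₂ r₁ r₂ hs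
  obtain ⟨A₁, hA₁, ha₁⟩ := exists_approx (n := n) s r₁ c₁ k
  obtain ⟨A₂, hA₂, ha₂⟩ := exists_approx (n := n) s r₂ c₂ k
  obtain ⟨B, hB, hb⟩ := wordBd_lower (n := n) hs r₂ c₂ k
  refine ⟨C * (A₁ * A₂), by positivity, fun u₁ u₂ f₁ f₂ K₁ K₂ i₁ i₂ h₁ h₂ => ?_⟩
  obtain ⟨K₁', hK₁⟩ := h₁.exists_bd hs
  obtain ⟨K₂', hK₂⟩ := h₂.exists_bd hs
  have m₁ := i₁.memLp hK₁
  have m₂ := i₂.memLp hK₂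
  obtain ⟨w, hw⟩ := exists_isFun_mul m₁ m₂
  refine ⟨w, hw, ?_⟩
  obtain ⟨f, hf, hf'⟩ := ha₁ u₁ K₁ h₁
  obtain ⟨g, hg, hg'⟩ := ha₂ u₂ K₂ h₂
  -- approximate the first factor, with a Schwartz function as the second factor
  have step : ∀ j, WordBd s (r₁ + r₂ + ((n : ℝ) + 1) / 2) k (c₁ + c₂)
      (smulLeftCLM ℂ (g j) u₁) (C * (A₁ * K₁ * (A₂ * K₂))) := fun j => by
    refine WordBd.of_tendsto (fun i => hC (f i) (g j) _ _ (hf i) (hg j)) fun φ => ?_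
    rw [smulLeftCLM_apply_apply]
    refine (hf' _).congr fun i => ?_
    rw [toD_apply, toD_apply]
    congr 1
    ext Z
    rw [SchwartzMap.smulLeftCLM_apply_apply (g j).hasTemperateGrowth, mulS_apply, smul_eq_mul]
    ring
  have e : C * (A₁ * A₂) * (K₁ * K₂) = C * (A₁ * K₁ * (A₂ * K₂)) := by ring
  rw [e]
  -- Approximate the second factor: the first one times a test function lies in the dual of the
  -- weighted `L²` space of the second.
  refine WordBd.of_tendsto step fun φ => ?_
  have key := tendsto_integral_mul (r := r₂) (K := B * (A₂ * K₂)) (g := g) (fun j => ?_) m₂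
    (memLp_schwartz_mul m₁ (-r₂) φ) fun ψ => ?_
  · rw [(hw φ).2]
    simp only [mul_assoc] at key ⊢
    refine key.congr fun j => ?_
    rw [smulLeftCLM_apply_apply, (i₁ _).2]
    congr 1
    ext Z
    rw [SchwartzMap.smulLeftCLM_apply_apply (g j).hasTemperateGrowth, smul_eq_mul]
    ring
  · have := hb _ _ (hg j) [] (by simp)
    rw [Ts_zero] at this
    exact bd_toD_iff.1 this
  · rw [← (i₂ ψ).2]
    exact hg' ψ

/-! ### Complex conjugation -/

/-- The complex conjugate of a distribution. -/
def cjD (u : Dist n) : Dist n :=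
  ContinuousLinearMap.toPointwiseConvergenceCLM ℂ (RingHom.id ℂ) (Sch n) ℂ
    { toFun := fun φ => conj (u (cj φ))
      map_add' := fun φ ψ => by simp
      map_smul' := fun a φ => by
        have : cj (a • φ) = conj a • cj φ := by ext; simp
        simp [this]
      cont := Complex.continuous_conj.comp (u.continuous.comp cj.continuous) }

theorem cjD_apply (u : Dist n) (φ : Sch n) : cjD u φ = conj (u (cj φ)) := rfl

theorem isFun_cjD {u : Dist n} {f : Spacetime n → ℂ} (h : IsFun u f) :
    IsFun (cjD u) fun Z => conj (f Z) := fun φ => by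
  have e : (fun Z => φ Z * conj (f Z)) = fun Z => conj (cj φ Z * f Z) := by
    funext Z
    simp
  rw [e, cjD_apply, (h (cj φ)).2, integral_conj]
  exact ⟨(Complex.conjLIE.toContinuousLinearEquiv.toContinuousLinearMap.integrable_comp
    (h (cj φ)).1), rfl⟩

theorem bd_cjD {r K : ℝ} {u : Dist n} (h : Bd r u K) : Bd r (cjD u) K :=
  ⟨h.1, fun φ => by simpa [cjD_apply, wn_cj] using h.2 (cj φ)⟩

theorem opX_cjD (a : Fin (n + 1)) (u : Dist n) : opX a (cjD u) = cjD (opX a u) := by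
  ext φ
  have : cj (XS a φ) = XS a (cj φ) := by ext; simp [XS_apply]
  rw [opX_apply, cjD_apply, cjD_apply, opX_apply, this]

theorem lineDeriv_cj (v : Spacetime n) (φ : Sch n) : ∂_{v} (cj φ) = cj (∂_{v} φ) := by
  ext x
  have h := (Complex.conjCLE.toContinuousLinearMap.hasFDerivAt.comp x
    (φ.differentiableAt (x := x)).hasFDerivAt).fderiv
  rw [cj_apply, SchwartzMap.lineDerivOp_apply_eq_fderiv, SchwartzMap.lineDerivOp_apply_eq_fderiv]
  exact congrArg (fun L => L v) h

theorem opD_cjD (a : Fin (n + 1)) (u : Dist n) : opD a (cjD u) = -cjD (opD a u) := by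
  ext φ
  change _ = -(cjD (opD a u) φ)
  rw [opD_apply, cjD_apply, cjD_apply, opD_apply, lineDeriv_cj]
  simp

theorem cjD_add (u v : Dist n) : cjD (u + v) = cjD u + cjD v := by
  ext φ
  exact map_add conj _ _

theorem cjD_sub (u v : Dist n) : cjD (u - v) = cjD u - cjD v := by
  ext φ
  exact map_sub conj _ _

theorem cjD_smul (a : ℝ) (u : Dist n) : cjD ((a : ℂ) • u) = (a : ℂ) • cjD u := by
  ext φ
  change conj ((a : ℂ) * _) = (a : ℂ) * conj _
  rw [map_mul, Complex.conj_ofReal]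
  rfl

theorem cjD_sum {ι : Type*} (s : Finset ι) (u : ι → Dist n) :
    cjD (∑ i ∈ s, u i) = ∑ i ∈ s, cjD (u i) :=
  map_sum (AddMonoidHom.mk' cjD cjD_add) u s

/-- Conjugation changes the sign of the parameter `c`. -/
theorem genIn_cjD (c : ℝ) (g : Gen n) (u : Dist n) :
    genIn opD opX (-c) g (cjD u) = -cjD (genIn opD opX c g u) := by
  cases g with
  | Dz j => exact opD_cjD _ u
  | Dt => exact opD_cjD _ u
  | rot i j =>
    change opX _ (opD _ (cjD u)) - opX _ (opD _ (cjD u)) =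
      -cjD (opX _ (opD _ u) - opX _ (opD _ u))
    simp only [opD_cjD, map_neg, opX_cjD, cjD_sub]
    abel
  | gal j =>
    change opX _ (opD _ (cjD u)) - ((-c / 2 : ℝ) : ℂ) • opX _ (cjD u) =
      -cjD (opX _ (opD _ u) - ((c / 2 : ℝ) : ℂ) • opX _ u)
    rw [cjD_sub, cjD_smul, opD_cjD, map_neg, opX_cjD, opX_cjD, neg_div, Complex.ofReal_neg]
    module
  | scal =>
    have e : ∀ (c : ℝ) (u : Dist n), genIn opD opX c .scal u =
        ((2 : ℝ) : ℂ) • opX (Fin.last n) (opD (Fin.last n) u) +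
          ∑ j : Fin n, opX j.castSucc (opD j.castSucc u) := fun c u => by
      simp [genIn]
    rw [e, e, cjD_add, cjD_smul, cjD_sum]
    simp only [opD_cjD, map_neg, opX_cjD, Finset.sum_neg_distrib, smul_neg]
    abel

/-- Conjugation maps words to words with the opposite parameter, up to a sign. -/
theorem Wd_cjD (c : ℝ) (w : List (Gen n)) (u : Dist n) :
    Wd (-c) w (cjD u) = cjD (Wd c w u) ∨ Wd (-c) w (cjD u) = -cjD (Wd c w u) := by
  induction w with
  | nil => exact Or.inl rfl
  | cons g w ih =>
    have e : ∀ (c : ℝ) (u : Dist n), Wd c (g :: w) u = genIn opD opX c g (Wd c w u) :=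
      fun c u => by rw [Wd, wordIn_cons]; rfl
    rw [e, e]
    rcases ih with h | h
    · rw [h, genIn_cjD]
      exact Or.inr rfl
    · rw [h, map_neg, genIn_cjD, neg_neg]
      exact Or.inl rfl

theorem fourier_cj (f : Sch n) (ξ : Spacetime n) :
    (𝓕 (cj f) : Sch n) ξ = conj ((𝓕 f : Sch n) (-ξ)) := by
  rw [SchwartzMap.fourier_coe, SchwartzMap.fourier_coe, Real.fourier_eq', Real.fourier_eq',
    ← integral_conj]
  congr 1
  ext v
  simp [← Complex.exp_conj, Complex.conj_ofNat]

theorem pp_neg (σ : ℝ) (ξ : Spacetime n) : pp σ (-ξ) = pp σ ξ := by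
  simp [pp, parabolicBracket]

theorem Ts_cjD (s : ℝ) (u : Dist n) : Ts s (cjD u) = cjD (Ts s u) := by
  ext φ
  have hp := hasTemperateGrowth_comp_neg (hasTemperateGrowth_pp (n := n) (s / 4))
  have h : cj (Mu (fun ξ => pp (s / 4) (-ξ)) φ) = Mu (fun ξ => pp (s / 4) (-ξ)) (cj φ) := by
    refine sch_ext_fourier fun ξ => ?_
    rw [fourier_cj, fourier_Mu hp, fourier_Mu hp, fourier_cj, map_mul]
    simp only [pp_neg]
    simp [pp]
  rw [Ts, mulD, mult_apply (hasTemperateGrowth_pp _), cjD_apply, cjD_apply,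
    mult_apply (hasTemperateGrowth_pp _), h]

theorem WordBd.cjD {s r c K : ℝ} {k : ℕ} {u : Dist n} (h : WordBd s r k c u K) :
    WordBd s r k (-c) (cjD u) K := fun w hw => by
  rcases Wd_cjD c w u with e | e
  · rw [e, Ts_cjD]
    exact bd_cjD (h w hw)
  · rw [e, map_neg, Ts_cjD, ← neg_one_smul ℂ]
    exact ((bd_cjD (h w hw)).smul (-1)).mono (by simp)

/-! ### The norms of the module regularity spaces -/

theorem parOp_eq (s l : ℝ) (u : Dist n) : parOp s l u = smulLeftCLM ℂ (bracket l) (Ts s u) := rfl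

theorem smulLeft_bracket_cancel (l : ℝ) (u : Dist n) :
    smulLeftCLM ℂ (bracket l) (smulLeftCLM ℂ (bracket (-l)) u) = u := by
  ext φ
  rw [smulLeftCLM_apply_apply, smulLeftCLM_apply_apply]
  congr 1
  change wt (-l) (wt l φ) = φ
  rw [wt_wt, neg_add_cancel, wt_zero]

theorem bd_of_parOp_eq {s l : ℝ} {u : Dist n} {g : Lp ℂ 2 (volume : Measure (Spacetime n))}
    (h : parOp s l u = (g : Dist n)) : Bd l (Ts s u) ‖g‖ := by
  have := bd_smulLeft_Lp l g
  rw [← h, parOp_eq] at this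
  have e := smulLeft_bracket_cancel (-l) (Ts s u)
  rw [neg_neg] at e
  rwa [e] at this

theorem parNorm_eq {s l : ℝ} {u : Dist n} {g : Lp ℂ 2 (volume : Measure (Spacetime n))}
    (h : parOp s l u = (g : Dist n)) : parNorm s l u = ‖g‖ₑ := by
  refine le_antisymm (iInf₂_le g h) (le_iInf₂ fun g' h' => ?_)
  have : Lp.toTemperedDistributionCLM ℂ (volume : Measure (Spacetime n)) 2 g =
    Lp.toTemperedDistributionCLM ℂ volume 2 g' := h.symm.trans h'
  -- The function in `L²` that represents a distribution is unique, so the infimum is over one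
  -- element.
  have hinj := LinearMap.ker_eq_bot.1
    (Lp.ker_toTemperedDistributionCLM_eq_bot (F := ℂ) (μ := (volume : Measure (Spacetime n))) (p := 2))
  rw [hinj this]

theorem Bd.memPar {s l K : ℝ} {u : Dist n} (h : Bd l (Ts s u) K) :
    MemPar s l u ∧ parNorm s l u ≤ ENNReal.ofReal K := by
  obtain ⟨g, hg, hu⟩ := h.exists_Lp
  have e : parOp s l u = (g : Dist n) := by rw [parOp_eq, hu, smulLeft_bracket_cancel]
  refine ⟨⟨g, e⟩, ?_⟩
  rw [parNorm_eq e, ← ofReal_norm]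
  exact ENNReal.ofReal_le_ofReal hg

theorem MemPar.bd {s l : ℝ} {u : Dist n} (h : MemPar s l u) :
    parNorm s l u ≠ ⊤ ∧ Bd l (Ts s u) (parNorm s l u).toReal := by
  obtain ⟨g, hg⟩ := h
  rw [parNorm_eq hg]
  exact ⟨enorm_ne_top, by simpa using bd_of_parOp_eq hg⟩

/-- The ordered monomials are words. -/
theorem monomialOp_eq_word (c : ℝ) (α : MultiIndex n) :
    ∃ w : List (Gen n), wordOrder w = α.order ∧ monomialOp c α = Wd c w := by
  refine ⟨(List.ofFn fun i => List.replicate (α i) ((gens n).get i)).flatten, ?_, ?_⟩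
  · simp [wordOrder, MultiIndex.order, List.map_flatten, List.sum_flatten, List.map_ofFn,
      Function.comp_def, List.sum_ofFn]
  · simp [wordIn, monomialOp, List.map_flatten, List.prod_flatten, List.map_ofFn,
      Function.comp_def, genOp_eq_genIn]

/-- A bound for all words bounds the norm. -/
theorem WordBd.memMod {s r c K : ℝ} {k : ℕ} {u : Dist n} (h : WordBd s r k c u K) :
    MemMod s r k c u ∧ modNorm s r k c u ≤ (admissible n k).card * ENNReal.ofReal K := by
  have key : ∀ α ∈ admissible n k, MemPar s r (monomialOp c α u) ∧
      parNorm s r (monomialOp c α u) ≤ ENNReal.ofReal K := fun α hα => by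
    obtain ⟨w, hw, e⟩ := monomialOp_eq_word c α
    rw [e]
    exact (h w (hw.trans_le ((mem_admissible α).1 hα))).memPar
  refine ⟨fun α hα => (key α hα).1, ?_⟩
  have h1 : ∑ α ∈ admissible n k, parNorm s r (monomialOp c α u) ^ 2 ≤
      ((admissible n k).card * ENNReal.ofReal K) ^ 2 := by
    refine (Finset.sum_le_card_nsmul _ _ (ENNReal.ofReal K ^ 2) fun α hα =>
      pow_le_pow_left' (key α hα).2 2).trans ?_
    rw [nsmul_eq_mul, mul_pow]
    refine mul_le_mul_left ?_ _
    exact_mod_cast Nat.le_self_pow two_ne_zero _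
  refine (ENNReal.rpow_le_rpow h1 (by norm_num)).trans_eq ?_
  rw [← ENNReal.rpow_natCast, ← ENNReal.rpow_mul]
  norm_num

/-- The norm bounds all words. -/
theorem MemMod.wordBd (s r c : ℝ) (k : ℕ) : ∃ C : ℝ, 0 ≤ C ∧ ∀ u : Dist n, MemMod s r k c u →
    modNorm s r k c u ≠ ⊤ ∧ WordBd s r k c u (C * (modNorm s r k c u).toReal) := by
  -- The norm controls the ordered monomials only. They span the words of the same order, by the
  -- Poincaré-Birkhoff-Witt argument in `word_mem_span`.
  have hspan : ∀ A ∈ Submodule.span ℂ {x : Dist n →L[ℂ] Dist n | ∃ α : MultiIndex n,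
      α.order ≤ k ∧ x = monomialOp c α}, ∃ C : ℝ, 0 ≤ C ∧ ∀ u K,
      (∀ α : MultiIndex n, α.order ≤ k → Bd r (Ts s (monomialOp c α u)) K) →
        Bd r (Ts s (A u)) (C * K) := by
    intro A hA
    induction hA using Submodule.span_induction with
    | mem x hx =>
      obtain ⟨α, hα, rfl⟩ := hx
      exact ⟨1, zero_le_one, fun u K hu => by simpa using hu α hα⟩
    | zero => exact ⟨0, le_rfl, fun u K _ => by simpa using Bd.zero r⟩
    | add x y _ _ hx hy =>
      obtain ⟨C, h0, hC⟩ := hx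
      obtain ⟨C', h0', hC'⟩ := hy
      refine ⟨C + C', by positivity, fun u K hu => ?_⟩
      rw [add_mul, add_apply, map_add]
      exact (hC u K hu).add (hC' u K hu)
    | smul a x _ hx =>
      obtain ⟨C, h0, hC⟩ := hx
      refine ⟨‖a‖ * C, by positivity, fun u K hu => ?_⟩
      rw [mul_assoc, smul_apply, map_smul]
      exact (hC u K hu).smul a
  have hw : ∀ w : List (Gen n), ∃ C : ℝ, 0 ≤ C ∧ (wordOrder w ≤ k → ∀ u K,
      (∀ α : MultiIndex n, α.order ≤ k → Bd r (Ts s (monomialOp c α u)) K) →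
        Bd r (Ts s (Wd c w u)) (C * K)) := fun w => by
    by_cases h : wordOrder w ≤ k
    · obtain ⟨C, h0, hC⟩ := hspan _ (Submodule.span_mono
        (fun x (hx : ∃ α : MultiIndex n, _ ∧ _) => hx.imp fun α hα => ⟨hα.1.trans h, hα.2⟩) (word_mem_span weyl_dist c (genOp_eq_genIn c) w))
      exact ⟨C, h0, fun _ => hC⟩
    · exact ⟨0, le_rfl, fun h' => absurd h' h⟩
  choose C h0 hC using hw
  have hf := finite_words (n := n) k
  refine ⟨∑ w ∈ hf.toFinset, C w, Finset.sum_nonneg fun w _ => h0 w, fun u hu => ?_⟩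
  have hle : ∀ α ∈ admissible n k, parNorm s r (monomialOp c α u) ≤ modNorm s r k c u :=
      fun α hα => by
    have h1 : parNorm s r (monomialOp c α u) ^ 2 ≤
        ∑ α ∈ admissible n k, parNorm s r (monomialOp c α u) ^ 2 :=
      Finset.single_le_sum (f := fun α => parNorm s r (monomialOp c α u) ^ 2)
        (fun _ _ => zero_le) hα
    refine le_trans (le_of_eq ?_) (ENNReal.rpow_le_rpow h1 (z := 1 / 2) (by norm_num))
    rw [← ENNReal.rpow_natCast, ← ENNReal.rpow_mul]
    norm_num
  have hfin : modNorm s r k c u ≠ ⊤ := by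
    refine ENNReal.rpow_ne_top_of_nonneg (by norm_num) ?_
    exact (ENNReal.sum_lt_top.2 fun α hα => ENNReal.pow_lt_top (hu α hα).bd.1.lt_top).ne
  refine ⟨hfin, fun w hw => ?_⟩
  refine (hC w hw u (modNorm s r k c u).toReal fun α hα => ?_).mono ?_
  · have hα' := (mem_admissible α).2 hα
    exact (hu α hα').bd.2.mono (ENNReal.toReal_mono hfin (hle α hα'))
  · exact mul_le_mul_of_nonneg_right (Finset.single_le_sum (fun w _ => h0 w) (by simpa using hw))
      ENNReal.toReal_nonneg

/-! ### Functions with module regularity -/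

/-- The function `f` is a distribution whose words of order at most `k` are bounded by `K`. -/
def Rep (s r : ℝ) (k : ℕ) (c : ℝ) (f : Spacetime n → ℂ) (K : ℝ) : Prop :=
  ∃ w : Dist n, IsFun w f ∧ WordBd s r k c w K

variable {s r c : ℝ} {k : ℕ}

theorem Rep.smul {f : Spacetime n → ℂ} {K : ℝ} (h : Rep s r k c f K) (a : ℂ) :
    Rep s r k c (fun Z => a * f Z) (‖a‖ * K) := by
  obtain ⟨w, hw, hb⟩ := h
  refine ⟨a • w, fun φ => ?_, fun v hv => ?_⟩
  · have e : (fun Z => φ Z * (a * f Z)) = fun Z => a * (φ Z * f Z) := by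
      funext Z
      ring
    rw [e, integral_const_mul, ← (hw φ).2]
    exact ⟨(hw φ).1.const_mul a, rfl⟩
  · rw [map_smul, map_smul]
    exact (hb v hv).smul a

theorem Rep.add {f g : Spacetime n → ℂ} {K K' : ℝ} (h : Rep s r k c f K) (h' : Rep s r k c g K') :
    Rep s r k c (fun Z => f Z + g Z) (K + K') := by
  obtain ⟨w, hw, hb⟩ := h
  obtain ⟨w', hw', hb'⟩ := h'
  refine ⟨w + w', fun φ => ?_, fun v hv => ?_⟩
  · simp only [mul_add]
    rw [integral_add (hw φ).1 (hw' φ).1, ← (hw φ).2, ← (hw' φ).2]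
    exact ⟨(hw φ).1.add (hw' φ).1, rfl⟩
  · rw [map_add, map_add]
    exact (hb v hv).add (hb' v hv)

theorem Rep.zero : Rep (n := n) s r k c (fun _ => 0) 0 :=
  ⟨0, fun φ => by simpa using (rfl : (0 : Dist n) φ = 0), fun v hv => by simpa using Bd.zero r⟩

theorem Rep.sum {ι : Type*} (t : Finset ι) {f : ι → Spacetime n → ℂ} {K : ι → ℝ}
    (h : ∀ i ∈ t, Rep s r k c (f i) (K i)) :
    Rep s r k c (fun Z => ∑ i ∈ t, f i Z) (∑ i ∈ t, K i) := by
  classical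
  induction t using Finset.induction_on with
  | empty => simpa using Rep.zero
  | insert i t hi ih =>
    simp only [Finset.sum_insert hi]
    exact (h i (by simp)).add (ih fun j hj => h j (by simp [hj]))

theorem Rep.conj {f : Spacetime n → ℂ} {K : ℝ} (h : Rep s r k c f K) :
    Rep s r k (-c) (fun Z => conj (f Z)) K := by
  obtain ⟨w, hw, hb⟩ := h
  exact ⟨NLSMult.cjD w, isFun_cjD hw, hb.cjD⟩

theorem Rep.mono {f : Spacetime n → ℂ} {K K' : ℝ} (h : Rep s r k c f K) (hK : K ≤ K') :
    Rep s r k c f K' := by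
  obtain ⟨w, hw, hb⟩ := h
  exact ⟨w, hw, hb.mono_bound hK⟩

theorem Rep.weight_mono {f : Spacetime n → ℂ} {K r' : ℝ} (h : Rep s r k c f K) (hr : r' ≤ r) :
    Rep s r' k c f K := by
  obtain ⟨w, hw, hb⟩ := h
  exact ⟨w, hw, fun v hv => (hb v hv).weight_mono hr⟩

/-- Products with several factors that all have the parameter `σ`. The parameters of the partial
products are required not to vanish. -/
theorem rep_mul_prod (hk : (n : ℝ) / 2 + 2 < k) (hk' : 3 < k) (hs : 0 ≤ s) (r : ℝ) {σ : ℝ}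
    (hσ : σ ≠ 0) (b : ℕ) : ∀ (R c₀ : ℝ), (∀ i < b, c₀ + i * σ ≠ 0) → ∃ C : ℝ, 0 ≤ C ∧
      ∀ (F : Spacetime n → ℂ) (K₀ K : ℝ) (L : List (Spacetime n → ℂ)), Rep s R k c₀ F K₀ →
        L.length = b → (∀ f ∈ L, Rep s r k σ f K) →
          Rep s (R + b * (r + ((n : ℝ) + 1) / 2)) k (c₀ + b * σ)
            (fun Z => F Z * (L.map fun f => f Z).prod) (C * (K₀ * K ^ b)) := by
  induction b with
  | zero =>
    intro R c₀ _
    refine ⟨1, zero_le_one, fun F K₀ K L hF hL _ => ?_⟩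
    obtain rfl := List.length_eq_zero_iff.1 hL
    simpa using hF
  | succ b ih =>
    intro R c₀ hc₀
    have h0 : c₀ ≠ 0 := by simpa using hc₀ 0 b.succ_pos
    obtain ⟨C, hC0, hC⟩ := exists_wordBd_mul (n := n) hk hk' h0 hσ R r hs
    obtain ⟨C', hC0', hC'⟩ := ih (R + r + ((n : ℝ) + 1) / 2) (c₀ + σ) fun i hi => by
      have := hc₀ (i + 1) (by omega)
      rwa [show c₀ + σ + i * σ = c₀ + ((i + 1 : ℕ) : ℝ) * σ by push_cast; ring]
    refine ⟨C' * C, mul_nonneg hC0' hC0, fun F K₀ K L hF hL hLb => ?_⟩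
    obtain ⟨g, L, rfl⟩ := List.exists_cons_of_length_eq_add_one hL
    obtain ⟨u, hu, hub⟩ := hF
    obtain ⟨v, hv, hvb⟩ := hLb g (by simp)
    have h1 := hC' (fun Z => F Z * g Z) _ K L (hC u v F g K₀ K hu hv hub hvb) (by simpa using hL)
      fun f hf => hLb f (by simp [hf])
    have e1 : R + r + ((n : ℝ) + 1) / 2 + b * (r + ((n : ℝ) + 1) / 2) =
        R + ((b + 1 : ℕ) : ℝ) * (r + ((n : ℝ) + 1) / 2) := by push_cast; ring
    have e2 : c₀ + σ + b * σ = c₀ + ((b + 1 : ℕ) : ℝ) * σ := by push_cast; ring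
    rw [e1, e2] at h1
    have e3 : C' * (C * (K₀ * K) * K ^ b) = C' * C * (K₀ * K ^ (b + 1)) := by ring
    rw [e3] at h1
    simpa only [List.map_cons, List.prod_cons, mul_assoc] using h1

/-- Products of `b + 1` factors with parameter `1` and `b` factors with parameter `-1`. With the
factors in this order, the parameters of the partial products are positive. -/
theorem rep_charged_prod (hk : (n : ℝ) / 2 + 2 < k) (hk' : 3 < k) (hs : 0 ≤ s) (r : ℝ) (b : ℕ) :
    ∃ C : ℝ, 0 ≤ C ∧ ∀ (K : ℝ) (L L' : List (Spacetime n → ℂ)), L.length = b + 1 →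
      L'.length = b → (∀ f ∈ L, Rep s r k 1 f K) → (∀ f ∈ L', Rep s r k (-1) f K) →
        Rep s (r + 2 * b * (r + ((n : ℝ) + 1) / 2)) k 1
          (fun Z => (L.map fun f => f Z).prod * (L'.map fun f => f Z).prod)
            (C * K ^ (2 * b + 1)) := by
  obtain ⟨C, hC0, hC⟩ := rep_mul_prod (n := n) hk hk' hs r one_ne_zero b r 1 fun i _ => by
    positivity
  obtain ⟨C', hC0', hC'⟩ := rep_mul_prod (n := n) hk hk' hs r (neg_ne_zero.2 one_ne_zero) b
    (r + b * (r + ((n : ℝ) + 1) / 2)) (1 + b * 1) fun i hi => by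
      have : (i : ℝ) < b := by exact_mod_cast hi
      exact ne_of_gt (by linarith)
  refine ⟨C' * C, mul_nonneg hC0' hC0, fun K L L' hL hL' hp hm => ?_⟩
  obtain ⟨F, L, rfl⟩ := List.exists_cons_of_length_eq_add_one hL
  have h1 := hC' _ _ K L' (hC F K K L (hp F (by simp)) (by simpa using hL)
    fun f hf => hp f (by simp [hf])) hL' hm
  have e1 : r + b * (r + ((n : ℝ) + 1) / 2) + b * (r + ((n : ℝ) + 1) / 2) =
      r + 2 * b * (r + ((n : ℝ) + 1) / 2) := by ring
  have e2 : (1 : ℝ) + b * 1 + b * -1 = 1 := by ring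
  have e3 : C' * (C * (K * K ^ b) * K ^ b) = C' * C * K ^ (2 * b + 1) := by ring
  rw [e1, e2, e3] at h1
  simpa only [List.map_cons, List.prod_cons] using h1

/-! ### The estimates in the norms of the module regularity spaces -/

theorem Rep.exists_memMod {f : Spacetime n → ℂ} {K : ℝ} (h : Rep s r k c f K) :
    ∃ w : Dist n, IsFun w f ∧ MemMod s r k c w ∧
      modNorm s r k c w ≤ ENNReal.ofReal ((admissible n k).card * K) := by
  obtain ⟨w, hw, hb⟩ := h
  refine ⟨w, hw, hb.memMod.1, hb.memMod.2.trans_eq ?_⟩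
  rw [ENNReal.ofReal_mul (Nat.cast_nonneg _), ENNReal.ofReal_natCast]

/-- The product estimate in the norms of the module regularity spaces. -/
theorem exists_modNorm_mul_le (hk : (n : ℝ) / 2 + 2 < k) (hk' : 3 < k) (r₁ r₂ : ℝ) {c₁ c₂ : ℝ}
    (hs : 0 ≤ s) (hc₁ : c₁ ≠ 0) (hc₂ : c₂ ≠ 0) : ∃ C : ℝ≥0, ∀ u₁ u₂ : Dist n,
      MemMod s r₁ k c₁ u₁ → MemMod s r₂ k c₂ u₂ → ∃ w : Dist n, IsMul u₁ u₂ w ∧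
        MemMod s (r₁ + r₂ + ((n : ℝ) + 1) / 2) k (c₁ + c₂) w ∧
          modNorm s (r₁ + r₂ + ((n : ℝ) + 1) / 2) k (c₁ + c₂) w ≤
            C * modNorm s r₁ k c₁ u₁ * modNorm s r₂ k c₂ u₂ := by
  obtain ⟨C, h0, hC⟩ := exists_wordBd_mul (n := n) hk hk' hc₁ hc₂ r₁ r₂ hs
  obtain ⟨C₁, h1, hC₁⟩ := MemMod.wordBd (n := n) s r₁ c₁ k
  obtain ⟨C₂, h2, hC₂⟩ := MemMod.wordBd (n := n) s r₂ c₂ k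
  refine ⟨Real.toNNReal ((admissible n k).card * (C * (C₁ * C₂))), fun u₁ u₂ hu₁ hu₂ => ?_⟩
  obtain ⟨n₁, b₁⟩ := hC₁ u₁ hu₁
  obtain ⟨n₂, b₂⟩ := hC₂ u₂ hu₂
  obtain ⟨f₁, hf₁⟩ := b₁.exists_isFun hs
  obtain ⟨f₂, hf₂⟩ := b₂.exists_isFun hs
  obtain ⟨w, hw, hm, hb⟩ := Rep.exists_memMod (hC u₁ u₂ f₁ f₂ _ _ hf₁ hf₂ b₁ b₂)
  refine ⟨w, ⟨f₁, f₂, hf₁, hf₂, hw⟩, hm, hb.trans_eq ?_⟩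
  conv_rhs => rw [← ENNReal.ofReal_toReal n₁, ← ENNReal.ofReal_toReal n₂]
  change _ = ENNReal.ofReal _ * _ * _
  rw [← ENNReal.ofReal_mul (by positivity), ← ENNReal.ofReal_mul (by positivity)]
  congr 1
  ring

/-- The estimate for `|u|^{2b} u`, the product of `b + 1` factors `u` and `b` factors `ū`. -/
theorem exists_modNorm_power_le (hk : (n : ℝ) / 2 + 2 < k) (hk' : 3 < k) (hs : 0 ≤ s) (r : ℝ)
    (b : ℕ) : ∃ C : ℝ≥0, ∀ u : Dist n, MemMod s r k 1 u → ∃ w : Dist n,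
      IsPower (2 * b + 1) u w ∧ MemMod s (r + 2 * b * (r + ((n : ℝ) + 1) / 2)) k 1 w ∧
        modNorm s (r + 2 * b * (r + ((n : ℝ) + 1) / 2)) k 1 w ≤
          C * modNorm s r k 1 u ^ (2 * b + 1) := by
  obtain ⟨C, h0, hC⟩ := rep_charged_prod (n := n) hk hk' hs r b
  obtain ⟨C₁, h1, hC₁⟩ := MemMod.wordBd (n := n) s r 1 k
  refine ⟨Real.toNNReal ((admissible n k).card * (C * C₁ ^ (2 * b + 1))), fun u hu => ?_⟩
  obtain ⟨n₁, b₁⟩ := hC₁ u hu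
  obtain ⟨f, hf⟩ := b₁.exists_isFun hs
  have hR : Rep s r k 1 f _ := ⟨u, hf, b₁⟩
  obtain ⟨w, hw, hm, hb⟩ := (hC _ (List.replicate (b + 1) f)
    (List.replicate b fun Z => conj (f Z)) (by simp) (by simp)
    (fun g hg => by rw [List.eq_of_mem_replicate hg]; exact hR)
    (fun g hg => by rw [List.eq_of_mem_replicate hg]; exact hR.conj)).exists_memMod
  refine ⟨w, ⟨f, hf, ?_⟩, hm, hb.trans_eq ?_⟩
  · convert hw using 2 with Z
    rw [List.map_replicate, List.map_replicate, List.prod_replicate, List.prod_replicate,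
      Nat.add_sub_cancel, pow_mul, ← Complex.normSq_eq_norm_sq, Complex.ofReal_pow,
      Complex.normSq_eq_conj_mul_self, mul_pow]
    ring
  · conv_rhs => rw [← ENNReal.ofReal_toReal n₁]
    change _ = ENNReal.ofReal _ * _
    rw [← ENNReal.ofReal_pow ENNReal.toReal_nonneg, ← ENNReal.ofReal_mul (by positivity)]
    congr 1
    ring

/-! ### Nonlinearities -/

/-- The charge of a monomial: the number of factors without a conjugation, minus the number of
factors with one. -/
def charge (m : Option (Fin n) ⊕ Option (Fin n) →₀ ℕ) : ℤ :=
  (∑ o, m (.inl o) : ℕ) - (∑ o, m (.inr o) : ℕ)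

/-- The value of a monomial. -/
def monVal (m : Option (Fin n) ⊕ Option (Fin n) →₀ ℕ) (a : Option (Fin n) → ℂ) : ℂ :=
  ∏ i, jetVal a i ^ m i

/-- A rotation of the phase multiplies a monomial by the power of the phase given by its charge. -/
theorem monVal_phase (m : Option (Fin n) ⊕ Option (Fin n) →₀ ℕ) (θ : ℝ)
    (a : Option (Fin n) → ℂ) : monVal m (fun o => Complex.exp (θ * Complex.I) * a o) =
      Complex.exp (charge m * (θ * Complex.I)) * monVal m a := by
  have h1 : ∀ o, jetVal (fun o => Complex.exp (θ * Complex.I) * a o) (.inl o) =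
      Complex.exp (θ * Complex.I) * jetVal a (.inl o) := fun o => rfl
  have h2 : ∀ o, jetVal (fun o => Complex.exp (θ * Complex.I) * a o) (.inr o) =
      Complex.exp (-(θ * Complex.I)) * jetVal a (.inr o) := fun o => by
    cases o <;> simp [jetVal, ← Complex.exp_conj]
  have h3 : Complex.exp (charge m * (θ * Complex.I)) =
      Complex.exp (θ * Complex.I) ^ (∑ o, m (.inl o)) *
        Complex.exp (-(θ * Complex.I)) ^ (∑ o, m (.inr o)) := by
    rw [← Complex.exp_nat_mul, ← Complex.exp_nat_mul, ← Complex.exp_add, charge]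
    congr 1
    push_cast
    ring
  simp only [monVal, Fintype.prod_sum_type, h1, h2, mul_pow, Finset.prod_mul_distrib,
    Finset.prod_pow_eq_pow_sum, h3]
  ring

/-- Averaging over the phase: only the monomials of charge one contribute to the values of a phase
invariant nonlinearity. -/
theorem Nonlinearity.PhaseInvariant.val_eq {N : Nonlinearity n} (h : N.PhaseInvariant)
    (a : Option (Fin n) → ℂ) :
    N.val a = ∑ m ∈ N.support with charge m = 1, N.coeff m * monVal m a := by
  have hval : ∀ a, N.val a = ∑ m ∈ N.support, N.coeff m * monVal m a := fun a =>
    MvPolynomial.eval_eq' _ _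
  -- The value is independent of the phase `θ`; its average over a period removes the charges other
  -- than `1`.
  have h1 : ∀ θ : ℝ, N.val a =
      ∑ m ∈ N.support, N.coeff m * monVal m a *
        Complex.exp (((charge m - 1 : ℤ) : ℂ) * Complex.I * θ) := fun θ => by
    have h2 := h θ a
    rw [hval] at h2
    have h3 : N.val a = Complex.exp (-(θ * Complex.I)) * (Complex.exp (θ * Complex.I) * N.val a) := by
      rw [← mul_assoc, ← Complex.exp_add, neg_add_cancel, Complex.exp_zero, one_mul]
    rw [h3, ← h2, Finset.mul_sum]
    refine Finset.sum_congr rfl fun m _ => ?_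
    rw [monVal_phase, show (((charge m - 1 : ℤ) : ℂ) * Complex.I * θ) =
      -(θ * Complex.I) + charge m * (θ * Complex.I) by push_cast; ring, Complex.exp_add]
    ring
  have h2 : ∫ _ in (0 : ℝ)..2 * Real.pi, N.val a = ∑ m ∈ N.support, ∫ θ in (0 : ℝ)..2 * Real.pi,
      N.coeff m * monVal m a * Complex.exp (((charge m - 1 : ℤ) : ℂ) * Complex.I * θ) := by
    rw [← intervalIntegral.integral_finsetSum fun m _ =>
      Continuous.intervalIntegrable (by fun_prop) _ _]
    exact intervalIntegral.integral_congr fun θ _ => h1 θ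
  have h3 : ∀ q : ℤ, ∫ θ in (0 : ℝ)..2 * Real.pi,
      Complex.exp (((q - 1 : ℤ) : ℂ) * Complex.I * θ) =
        if q = 1 then ((2 * Real.pi : ℝ) : ℂ) else 0 := fun q => by
    by_cases hq : q = 1
    · simp [hq]
    · have h4 : ((q - 1 : ℤ) : ℂ) * Complex.I ≠ 0 :=
        mul_ne_zero (by exact_mod_cast sub_ne_zero.2 hq) Complex.I_ne_zero
      rw [integral_exp_mul_complex h4, if_neg hq]
      have h5 : Complex.exp (((q - 1 : ℤ) : ℂ) * Complex.I * ((2 * Real.pi : ℝ) : ℂ)) = 1 := by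
        rw [Complex.exp_eq_one_iff]
        exact ⟨q - 1, by push_cast; ring⟩
      rw [h5]
      simp
  have hpi : ((2 * Real.pi : ℝ) : ℂ) ≠ 0 := by exact_mod_cast Real.two_pi_pos.ne'
  refine mul_left_cancel₀ hpi ?_
  simp only [intervalIntegral.integral_const, intervalIntegral.integral_const_mul, h3, mul_ite,
    mul_zero, sub_zero, Complex.real_smul] at h2
  rw [h2, Finset.mul_sum, Finset.sum_filter]
  exact Finset.sum_congr rfl fun m _ => by split_ifs <;> ring

/-- A monomial as the product of a list of its factors. -/
theorem exists_list_prod {ι : Type*} [Fintype ι] (m : ι → ℕ) (a : ι → Spacetime n → ℂ) :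
    ∃ L : List (Spacetime n → ℂ), L.length = ∑ i, m i ∧ (∀ f ∈ L, ∃ i, f = a i) ∧
      ∀ Z, (L.map fun f => f Z).prod = ∏ i, a i Z ^ m i := by
  refine ⟨Finset.univ.toList.flatMap fun i => List.replicate (m i) (a i), ?_, ?_, fun Z => ?_⟩
  · simp [List.length_flatMap]
  · intro f hf
    obtain ⟨i, -, hi⟩ := List.mem_flatMap.1 hf
    exact ⟨i, List.eq_of_mem_replicate hi⟩
  · simp [List.flatMap_def, List.prod_flatten, Function.comp_def]

theorem opD_eq_mulD (a : Fin (n + 1)) (u : Dist n) :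
    opD a u = mulD (fun ξ => ((2 * Real.pi * ξ a : ℝ) : ℂ)) u := by
  have h : (fun x : Spacetime n => ((inner ℝ x (ev a) : ℝ) : ℂ)).HasTemperateGrowth := by
    fun_prop
  change (-Complex.I) • ∂_{ev a} u = _
  rw [lineDeriv_eq_fourierMultiplierCLM, smul_smul, ← mulD, ← mulD_const_mul h]
  congr 2
  funext ξ
  rw [inner_ev]
  push_cast
  linear_combination (-2 * Real.pi * (ξ a : ℂ)) * Complex.I_mul_I

/-- A spatial derivative costs one parabolic order. -/
theorem wordBd_opDz (s r c : ℝ) (k : ℕ) (j : Fin n) : ∃ C : ℝ, 0 ≤ C ∧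
    ∀ (u : Dist n) K, WordBd (s + 1) r k c u K → WordBd s r k c (opDz j u) (C * K) := by
  obtain ⟨C, N, h0, hC⟩ := ((pb_of_mem_symAlg 0 (uSym_mem 0 j.castSucc)).eval (G' := fun _ : Unit => 1)
    0 (by simp)).wordBd (fun _ => le_rfl) (s + 1) s r c k
  refine ⟨C, h0, fun u K hu => ?_⟩
  have h1 := hC () u K hu
  have h2 : mulD (uSym j.castSucc) (Ts (s + 1 - s) u) = opDz j u := by
    have hp := hasTemperateGrowth_pp (n := n) (1 / 4)
    have hu' := ((pb_of_mem_symAlg 0 (uSym_mem 0 j.castSucc)).temperate 0 :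
      (uSym j.castSucc : Spacetime n → ℂ).HasTemperateGrowth)
    rw [add_sub_cancel_left, Ts, mulD_mulD hu' hp, opDz, opD_eq_mulD]
    congr 2
    funext ξ
    rw [uSym, if_neg (Fin.castSucc_ne_last j), mul_assoc, pp_mul]
    norm_num [pp_zero]
  rw [h2] at h1
  simpa using h1

/-- The value of a phase invariant nonlinearity. Each monomial of charge one is a product as in
`rep_charged_prod`; since `r + (n + 1) / 2` is not negative, the degrees above `p` give at least the
decay of degree `p`. -/
theorem exists_isValue (hk : (n : ℝ) / 2 + 2 < k) (hk' : 3 < k) (hs : 0 ≤ s) {N : Nonlinearity n}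
    (hN : N.PhaseInvariant) {p : ℕ} (hp : ∀ m ∈ N.support, p ≤ m.degree) {r : ℝ}
    (hr : 0 ≤ r + ((n : ℝ) + 1) / 2) {u : Dist n} (hu : MemMod (s + 1) r k 1 u) :
    ∃ w : Dist n, N.IsValue u w ∧
      MemMod s (r + ((p : ℝ) - 1) * (r + ((n : ℝ) + 1) / 2)) k 1 w := by
  obtain ⟨C₁, -, hC₁⟩ := MemMod.wordBd (n := n) (s + 1) r 1 k
  obtain ⟨M, hb⟩ : ∃ M, WordBd (s + 1) r k 1 u M := ⟨_, (hC₁ u hu).2⟩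
  -- the jet of `u` consists of functions of order `s`
  obtain ⟨a, K, ha, haj, haR⟩ : ∃ (a : Option (Fin n) → Spacetime n → ℂ) (K : ℝ),
      IsFun u (a none) ∧ (∀ j, IsFun (opDz j u) (a (some j))) ∧
        ∀ o, Rep s r k 1 (a o) K := by
    obtain ⟨C₀, h0, hC₀⟩ := wordBd_lower (n := n) (show s ≤ s + 1 by linarith) r 1 k
    choose C h hC using wordBd_opDz (n := n) s r 1 k
    obtain ⟨f, hf⟩ := (hC₀ _ _ hb).exists_isFun hs
    choose g hg using fun j => (hC j _ _ hb).exists_isFun hs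
    have hK := hb.nonneg
    refine ⟨fun o => o.elim f g, (C₀ + ∑ j, C j) * M, hf, hg, fun o => ?_⟩
    cases o with
    | none =>
      exact Rep.mono ⟨u, hf, hC₀ _ _ hb⟩ (mul_le_mul_of_nonneg_right
        (le_add_of_nonneg_right (Finset.sum_nonneg fun j _ => h j)) hK)
    | some j =>
      exact Rep.mono ⟨_, hg j, hC j _ _ hb⟩ (mul_le_mul_of_nonneg_right
        ((Finset.single_le_sum (fun j _ => h j) (Finset.mem_univ j)).trans
          (le_add_of_nonneg_left h0)) hK)
  have haR' : ∀ o, Rep s r k (-1) (fun Z => jetVal (fun o => a o Z) (.inr o)) K := fun o => by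
    cases o with
    | none => exact (haR none).conj
    | some j => simpa [jetVal] using (haR (some j)).conj.smul (-1)
  have key : ∀ m ∈ N.support.filter fun m => charge m = 1, ∃ K,
      Rep s (r + ((p : ℝ) - 1) * (r + ((n : ℝ) + 1) / 2)) k 1
        (fun Z => N.coeff m * monVal m fun o => a o Z) K := by
    intro m hm
    obtain ⟨hmN, hmc⟩ := Finset.mem_filter.1 hm
    obtain ⟨L, hL, hLa, hLp⟩ := exists_list_prod (fun o => m (.inl o)) a
    obtain ⟨L', hL', hLa', hLp'⟩ := exists_list_prod (fun o => m (.inr o))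
      fun o Z => jetVal (fun o => a o Z) (.inr o)
    obtain ⟨C, -, hC⟩ := rep_charged_prod (n := n) hk hk' hs r L'.length
    have hlen : L.length = L'.length + 1 := by
      rw [charge, ← hL, ← hL'] at hmc
      omega
    have hdeg : m.degree = L.length + L'.length := by
      rw [Finsupp.degree_eq_sum, Fintype.sum_sum_type, hL, hL']
    have h1 := hC K L L' hlen rfl (fun f hf => by obtain ⟨o, rfl⟩ := hLa f hf; exact haR o)
      fun f hf => by obtain ⟨o, rfl⟩ := hLa' f hf; exact haR' o
    have h2 : ((p : ℝ) - 1) * (r + ((n : ℝ) + 1) / 2) ≤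
        2 * L'.length * (r + ((n : ℝ) + 1) / 2) := by
      refine mul_le_mul_of_nonneg_right ?_ hr
      have h3 : p ≤ 2 * L'.length + 1 := by
        have := hp m hmN
        omega
      have : (p : ℝ) ≤ 2 * L'.length + 1 := by exact_mod_cast h3
      linarith
    have h4 := (h1.weight_mono (r' := r + ((p : ℝ) - 1) * (r + ((n : ℝ) + 1) / 2))
      (by linarith)).smul (N.coeff m)
    simp only [hLp, hLp'] at h4
    refine ⟨_, (congrArg (fun f => Rep s _ k 1 f _) (funext fun Z => ?_)).mpr h4⟩
    rw [monVal, Fintype.prod_sum_type]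
    rfl
  choose! K' hK' using key
  obtain ⟨w, hw, hm, -⟩ := (Rep.sum _ hK').exists_memMod
  refine ⟨w, ⟨a, ha, haj, ?_⟩, hm⟩
  convert hw using 2 with Z
  exact hN.val_eq _

end NLSMult

end

theorem mainTheorem5 (n : ℕ) (hn : 1 ≤ n) (k : ℕ) (hk : max ((n : ℝ) / 2 + 2) 3 < (k : ℝ)) :
    (∀ s r₁ r₂ c₁ c₂ : ℝ, 0 ≤ s → c₁ ≠ 0 → c₂ ≠ 0 →
      ∃ C : ℝ≥0, ∀ u₁ u₂ : NLSMult.Dist n,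
        NLSMult.MemMod s r₁ k c₁ u₁ → NLSMult.MemMod s r₂ k c₂ u₂ →
        ∃ w : NLSMult.Dist n, NLSMult.IsMul u₁ u₂ w ∧
          NLSMult.MemMod s (r₁ + r₂ + ((n : ℝ) + 1) / 2) k (c₁ + c₂) w ∧
          NLSMult.modNorm s (r₁ + r₂ + ((n : ℝ) + 1) / 2) k (c₁ + c₂) w ≤
            C * NLSMult.modNorm s r₁ k c₁ u₁ * NLSMult.modNorm s r₂ k c₂ u₂) ∧
    (∀ p : ℕ, Odd p → ∀ ε : ℝ,
      ∃ C : ℝ≥0, ∀ u : NLSMult.Dist n,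
        NLSMult.MemMod (1 / 2) (-1 / 2 + ε) k 1 u →
        ∃ w : NLSMult.Dist n, NLSMult.IsPower p u w ∧
          NLSMult.MemMod (1 / 2) (-1 / 2 + ((p : ℝ) - 1) * n / 2 + p * ε) k 1 w ∧
          NLSMult.modNorm (1 / 2) (-1 / 2 + ((p : ℝ) - 1) * n / 2 + p * ε) k 1 w ≤
            C * NLSMult.modNorm (1 / 2) (-1 / 2 + ε) k 1 u ^ p) ∧
    (∀ p : ℕ, Odd p → ∀ ε : ℝ, -((n : ℝ) / 2) ≤ ε →
      ∀ N : NLSMult.Nonlinearity n, N.PhaseInvariant →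
        (∀ m ∈ N.support, p ≤ m.degree) →
        ∀ u : NLSMult.Dist n, NLSMult.MemMod (3 / 2) (-1 / 2 + ε) k 1 u →
          ∃ w : NLSMult.Dist n, N.IsValue u w ∧
            NLSMult.MemMod (1 / 2) (-1 / 2 + ((p : ℝ) - 1) * n / 2 + p * ε) k 1 w) := by
  obtain ⟨h1, h2⟩ := max_lt_iff.1 hk
  have h2 : 3 < k := by exact_mod_cast h2
  refine ⟨fun s r₁ r₂ c₁ c₂ hs hc₁ hc₂ => NLSMult.exists_modNorm_mul_le h1 h2 r₁ r₂ hs hc₁ hc₂,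
    fun p hp ε => ?_, fun p _ ε hε N hN hNp u hu => ?_⟩
  · obtain ⟨b, rfl⟩ := hp
    have e : (-1 / 2 + (((2 * b + 1 : ℕ) : ℝ) - 1) * n / 2 + ((2 * b + 1 : ℕ) : ℝ) * ε) =
        -1 / 2 + ε + 2 * b * (-1 / 2 + ε + ((n : ℝ) + 1) / 2) := by
      push_cast
      ring
    rw [e]
    exact NLSMult.exists_modNorm_power_le h1 h2 (by norm_num) (-1 / 2 + ε) b
  · have e : (-1 / 2 + ((p : ℝ) - 1) * n / 2 + p * ε) =
        -1 / 2 + ε + ((p : ℝ) - 1) * (-1 / 2 + ε + ((n : ℝ) + 1) / 2) := by ring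
    rw [e]
    refine NLSMult.exists_isValue h1 h2 (by norm_num) hN hNp (by linarith) ?_
    rwa [show (1 : ℝ) / 2 + 1 = 3 / 2 by norm_num]
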